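/- **Conventions.** Cdga's are $\mathbb Z$-graded, unital and graded-commutative, and $\operatorname{Ho}(\operatorname{cdga}_k)$ is the localization of the category of cdga's over the field $k$ at the quasi-isomorphisms. An $\mathbb R$-cbba is a $\mathbb Z\times\mathbb Z$-graded unital $\mathbb C$-algebra, graded-commutative for the total degree, with anticommuting differentials $\partial,\bar\partial$ of bidegrees $(1,0),(0,1)$ satisfying the graded Leibniz rule, and with a multiplicative antilinear involution $\sigma$ with $\sigma A^{p,q}=A^{q,p}$ and $\sigma d\sigma=d$, $d=\partial+\bar\partial$; morphisms preserve all the structure. Write $\operatorname{to}(A)$ for its total cdga, $H_{dR}(A)=H(\operatorname{to}(A))$, $H_{BC}(A)=(\ker\partial\cap\ker\bar\partial)/\operatorname{im}\partial\bar\partial$ (an $\mathbb R$-cbba with zero differentials) and $H_A(A)=\ker\partial\bar\partial/(\operatorname{im}\partial+\operatorname{im}\bar\partial)$. A morphism is a pluripotential quasi-isomorphism if it induces isomorphisms on $H_{BC}$ and $H_A$. $A$ has the $\partial\bar\partial$-property if the natural map $H_{BC}(A)\to H_{dR}(A)$ is injective (and then it is an isomorphism). $A$ is strongly formal if it is connected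 by a chain of pluripotential quasi-isomorphisms of $\mathbb R$-cbba's to an $\mathbb R$-cbba with zero differentials. A rational cdga is formal if it is connected by a chain of quasi-isomorphisms to its cohomology. A *cbba with rational structure* is a triple $A=(A_{\mathbb Q},A_{\mathbb C},\varphi)$ of a rational cdga $A_{\mathbb Q}$, an $\mathbb R$-cbba $A_{\mathbb C}$ and an isomorphism $\varphi:A_{\mathbb Q}\otimes\mathbb R\cong\operatorname{to}(A_{\mathbb C})^{\sigma=\mathrm{Id}}$ in $\operatorname{Ho}(\operatorname{cdga}_{\mathbb R})$. A morphism is a pair of morphisms $f_{\mathbb Q},f_{\mathbb C}$ compatible with the isomorphisms $\varphi$ in $\operatorname{Ho}(\operatorname{cdga}_{\mathbb R})$; it is a quasi-isomorphism if $f_{\mathbb C}$ is a pluripotential quasi-isomorphism. $A$ is *strongly formal over $\mathbb Q$* if $A_{\mathbb C}$ has the $\partial\bar\partial$-property and $A$ is connected by a chain of quasi-isomorphisms to its cohomology $(H(A_{\mathbb Q}),H_{BC}(A_{\mathbb C}),H(\varphi))$. $A$ is *minimal* if $A_{\mathbb Q}$ is a minimal Sullivan algebra and $A_{\mathbb C}$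 is a minimal $\mathbb R$-cbba. Here a minimal Sullivan algebra is a cdga $\Lambda V$, free on a graded space $V$ of generators of positive degrees, with an exhaustive filtration $0=V_0\subseteq V_1\subseteq\cdots$ of $V$ by graded subspaces such that $d V_{n+1}\subseteq\Lambda V_n$, and with $\operatorname{im}d\subseteq\Lambda^{\ge2}V$. A minimal $\mathbb R$-cbba is an $\mathbb R$-cbba $\Lambda W$, free on a bigraded $\sigma$-stable space $W$ of generators of positive total degrees, with an exhaustive filtration $0=W_0\subseteq W_1\subseteq\cdots$ of $W$ by bigraded $\sigma$-stable subspaces such that $\partial W_{n+1},\bar\partial W_{n+1}\subseteq\Lambda W_n$, and with $\operatorname{im}\partial\bar\partial\subseteq\Lambda^{\ge2}W$. **Proposition.** Let $A=(A_{\mathbb Q},A_{\mathbb C},\varphi)$ be a minimal cbba with rational structure. Then $A_{\mathbb C}$ is strongly formal if and only if there is a pluripotential quasi-isomorphism of $\mathbb R$-cbba's $p:A_{\mathbb C}\to H_{BC}(A_{\mathbb C})$; $A_{\mathbb Q}$ is formal if and only if there is a quasi-isomorphism of cdga's $q:A_{\mathbb Q}\to H(A_{\mathbb Q})$; and $A$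 is strongly formal over $\mathbb Q$ if and only if the following three conditions hold: 1. $A_{\mathbb C}$ is strongly formal; 2. $A_{\mathbb Q}$ is formal; 3. for all pluripotential quasi-isomorphisms $p:A_{\mathbb C}\to H_{BC}(A_{\mathbb C})$ of $\mathbb R$-cbba's and all quasi-isomorphisms $q:A_{\mathbb Q}\to H(A_{\mathbb Q})$ of cdga's such that $H_{dR}(\varphi)\circ H_{dR}(q)=H_{dR}(p)\circ H_{dR}(\varphi)$, there are an automorphism $a$ of the cdga $A_{\mathbb Q}$ and an automorphism $b$ of the $\mathbb R$-cbba $A_{\mathbb C}$ with $H(a)=\mathrm{Id}$ and $H_{dR}(b)=\mathrm{Id}$ such that $$p\circ(b\circ\varphi\circ a)=H(\varphi)\circ q$$ as morphisms $A_{\mathbb Q}\otimes\mathbb R\to H_{dR}(A_{\mathbb C})^{\sigma=\mathrm{Id}}$ in $\operatorname{Ho}(\operatorname{cdga}_{\mathbb R})$, i.e. the square formed by $b\circ\varphi\circ a$, $p$, $q$ and $H(\varphi)$ commutes up to homotopy. Here $p$ is composed with the natural map $H_{BC}(A_{\mathbb C})\to H_{dR}(A_{\mathbb C})$. -/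

import Mathlib

open CategoryTheory
open scoped TensorProduct

universe u

/-! ### Internal gradings -/

namespace Grading

section

variable {ι k M : Type*} [DecidableEq ι] [Ring k] [AddCommGroup M] [Module k M]
  {gr : ι → Submodule k M}

/-- The projection of a graded module onto its homogeneous component of degree `i`. -/
noncomputable def proj (h : DirectSum.IsInternal gr) (i : ι) : M →ₗ[k] M :=
  (gr i).subtype ∘ₗ DirectSum.component k ι (fun i => gr i) i ∘ₗ
    (LinearEquiv.ofBijective (DirectSum.coeLinearMap gr) h).symm.toLinearMap

theorem proj_mem (h : DirectSum.IsInternal gr) (i : ι) (x : M) : proj h i x ∈ gr i := by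
  simp [proj]

theorem proj_same (h : DirectSum.IsInternal gr) {i : ι} {x : M} (hx : x ∈ gr i) :
    proj h i x = x := by
  exact congrArg Subtype.val (h.ofBijective_coeLinearMap_of_mem hx)

theorem proj_ne (h : DirectSum.IsInternal gr) {i j : ι} (hij : i ≠ j) {x : M} (hx : x ∈ gr i) :
    proj h j x = 0 := by
  exact congrArg Subtype.val (h.ofBijective_coeLinearMap_of_mem_ne hij hx)

@[elab_as_elim]
theorem induction [Nonempty ι] (h : DirectSum.IsInternal gr) {P : M → Prop} (x : M)
    (hom : ∀ i, ∀ y ∈ gr i, P y) (add : ∀ y z, P y → P z → P (y + z)) : P x := by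
  have hx : x ∈ iSup gr := by rw [h.submodule_iSup_eq_top]; trivial
  exact Submodule.iSup_induction gr (motive := P) hx hom
    (hom (Classical.arbitrary ι) 0 (Submodule.zero_mem _)) add

/-- A spanning family of submodules with compatible projections is a grading. -/
theorem isInternal_of_proj (π : ι → M → M) (h0 : ∀ i, π i 0 = 0)
    (hadd : ∀ i x y, π i (x + y) = π i x + π i y)
    (h1 : ∀ i, ∀ x ∈ gr i, π i x = x) (h2 : ∀ i j, i ≠ j → ∀ x ∈ gr i, π j x = 0)
    (h3 : ∀ x, x ∈ iSup gr) : DirectSum.IsInternal gr := by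
  classical
  refine DirectSum.isInternal_submodule_of_iSupIndep_of_iSup_eq_top ?_ (eq_top_iff.2 fun x _ => h3 x)
  rw [iSupIndep_def]
  intro i
  rw [Submodule.disjoint_def]
  intro x hx hx'
  rw [← h1 i x hx]
  refine Submodule.iSup_induction (motive := fun y => π i y = 0) _ hx' ?_ (h0 i) ?_
  · intro j y hy
    by_cases hj : j = i
    · subst hj
      simp only [ne_eq, not_true_eq_false, iSup_false, Submodule.mem_bot] at hy
      rw [hy, h0]
    · simp only [ne_eq, hj, not_false_eq_true, iSup_pos] at hy
      exact h2 j i hj y hy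
  · intro y z hy hz
    rw [hadd, hy, hz, add_zero]

theorem sum_proj (h : DirectSum.IsInternal gr) (x : M) :
    ∃ s : Finset ι, x = ∑ i ∈ s, proj h i x := by
  classical
  obtain ⟨y, rfl⟩ := h.surjective x
  refine ⟨DFinsupp.support y, ?_⟩
  have key : ∀ i, proj h i ((DirectSum.coeAddMonoidHom gr) y) = y i := by
    intro i
    have : (LinearEquiv.ofBijective (DirectSum.coeLinearMap gr) h).symm
        ((DirectSum.coeAddMonoidHom gr) y) = y :=
      (LinearEquiv.ofBijective (DirectSum.coeLinearMap gr) h).symm_apply_apply y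
    show (((LinearEquiv.ofBijective (DirectSum.coeLinearMap gr) h).symm
        ((DirectSum.coeAddMonoidHom gr) y)) i : M) = y i
    rw [this]
  rw [Finset.sum_congr rfl fun i _ => key i]
  exact DirectSum.coeAddMonoidHom_eq_dfinsuppSum _ _

/-- A projection-stable submodule is spanned by its homogeneous elements. -/
@[elab_as_elim]
theorem stable_induction {h : DirectSum.IsInternal gr} (Z : Submodule k M)
    (hZ : ∀ i, ∀ x ∈ Z, proj h i x ∈ Z) {P : M → Prop} (x : M) (hx : x ∈ Z)
    (zero : P 0)
    (hom : ∀ i, ∀ y ∈ gr i, y ∈ Z → P y) (add : ∀ y z, P y → P z → P (y + z)) : P x := by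
  obtain ⟨s, hs⟩ := sum_proj h x
  rw [hs]
  exact Finset.sum_induction _ P add zero
    fun i _ => hom i _ (proj_mem h i x) (hZ i x hx)

/-- The grading on a subquotient `Z → Q` (a quotient of a submodule `Z` of `M`). -/
theorem isInternal_subquotient (h : DirectSum.IsInternal gr) (Z : Submodule k M)
    (hZ : ∀ i, ∀ x ∈ Z, proj h i x ∈ Z) {Q : Type*} [AddCommGroup Q] [Module k Q]
    (q : Z →ₗ[k] Q) (hq : Function.Surjective q)
    (hker : ∀ i, ∀ x : Z, q x = 0 → q ⟨proj h i x, hZ i x x.2⟩ = 0) :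
    DirectSum.IsInternal fun i => ((gr i).comap Z.subtype).map q := by
  classical
  let P : ι → (Z →ₗ[k] Z) := fun i => (proj h i).restrict (hZ i)
  have hP : ∀ i z, q z = 0 → q (P i z) = 0 := fun i z hz => hker i z hz
  have wd : ∀ i z z', q z = q z' → q (P i z) = q (P i z') := by
    intro i z z' hzz
    rw [← sub_eq_zero, ← map_sub, ← map_sub]
    exact hP i _ (by rw [map_sub, hzz, sub_self])
  let s : Q → Z := Function.surjInv hq
  have hs : ∀ y, q (s y) = y := Function.surjInv_eq hq
  refine isInternal_of_proj (fun i y => q (P i (s y))) ?_ ?_ ?_ ?_ ?_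
  · intro i
    exact hP i _ (hs 0)
  · intro i x y
    rw [← map_add, ← map_add]
    apply wd
    rw [map_add, hs, hs, hs]
  · rintro i _ ⟨z, hz, rfl⟩
    rw [wd i _ z (hs _)]
    congr 1
    exact Subtype.ext (proj_same h hz)
  · rintro i j hij _ ⟨z, hz, rfl⟩
    show q (P j (s (q z))) = 0
    rw [wd j _ z (hs _)]
    have : P j z = 0 := Subtype.ext (proj_ne h hij hz)
    rw [this, map_zero]
  · intro y
    obtain ⟨⟨z, hz⟩, rfl⟩ := hq y
    obtain ⟨t, ht⟩ := sum_proj h z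
    have : (⟨z, hz⟩ : Z) = ∑ i ∈ t, P i ⟨z, hz⟩ := by
      apply Subtype.ext
      rw [Submodule.coe_sum]
      exact ht
    rw [this, map_sum]
    refine Submodule.sum_mem _ fun i _ => ?_
    exact Submodule.mem_iSup_of_mem i ⟨_, proj_mem h i z, rfl⟩

end

end Grading

/-! ### Commutative differential graded algebras -/

/-- A (`ℤ`-graded, unital) commutative differential graded algebra over a field `k`. -/
structure CDGA (k : Type) [Field k] where
  carrier : Type u
  [ring : Ring carrier]
  [algebra : Algebra k carrier]
  gr : ℤ → Submodule k carrier
  isInternal : DirectSum.IsInternal gr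
  one_mem : (1 : carrier) ∈ gr 0
  mul_mem : ∀ {m n : ℤ} {a b : carrier}, a ∈ gr m → b ∈ gr n → a * b ∈ gr (m + n)
  mul_comm : ∀ {m n : ℤ} {a b : carrier}, a ∈ gr m → b ∈ gr n →
    a * b = ((m * n).negOnePow : ℤ) • (b * a)
  d : carrier →ₗ[k] carrier
  d_mem : ∀ {n : ℤ} {a : carrier}, a ∈ gr n → d a ∈ gr (n + 1)
  d_d : ∀ a, d (d a) = 0
  leibniz : ∀ {n : ℤ} {a : carrier}, a ∈ gr n → ∀ b,
    d (a * b) = d a * b + (n.negOnePow : ℤ) • (a * d b)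

namespace CDGA

attribute [instance] CDGA.ring CDGA.algebra

variable {k : Type} [Field k]

/-- A morphism of cdga's: a unital algebra map preserving degrees and commuting with `d`. -/
@[ext]
structure Hom (A B : CDGA.{u} k) where
  toAlgHom : A.carrier →ₐ[k] B.carrier
  map_gr : ∀ {n : ℤ} {a : A.carrier}, a ∈ A.gr n → toAlgHom a ∈ B.gr n
  map_d : ∀ a, toAlgHom (A.d a) = B.d (toAlgHom a)

instance : Category (CDGA.{u} k) where
  Hom := Hom
  id A := ⟨AlgHom.id k A.carrier, fun h => h, fun _ => rfl⟩
  comp f g := ⟨g.toAlgHom.comp f.toAlgHom, fun h => g.map_gr (f.map_gr h), fun a => by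
    simp [f.map_d, g.map_d]⟩

/-- The underlying map of a morphism of cdga's. -/
def Hom.fn {A B : CDGA.{u} k} (f : A ⟶ B) : A.carrier →ₐ[k] B.carrier := Hom.toAlgHom f

theorem Hom.fn_gr {A B : CDGA.{u} k} (f : A ⟶ B) {n : ℤ} {a : A.carrier} (h : a ∈ A.gr n) :
    Hom.fn f a ∈ B.gr n := Hom.map_gr f h

theorem Hom.fn_d {A B : CDGA.{u} k} (f : A ⟶ B) (a : A.carrier) :
    Hom.fn f (A.d a) = B.d (Hom.fn f a) := Hom.map_d f a

@[simp] theorem fn_id (A : CDGA.{u} k) : Hom.fn (𝟙 A) = AlgHom.id k A.carrier := rfl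

@[simp] theorem fn_comp {A B C : CDGA.{u} k} (f : A ⟶ B) (g : B ⟶ C) :
    Hom.fn (f ≫ g) = (Hom.fn g).comp (Hom.fn f) := rfl

theorem hom_ext {A B : CDGA.{u} k} {f g : A ⟶ B} (h : ∀ a, Hom.fn f a = Hom.fn g a) : f = g :=
  Hom.ext (AlgHom.ext h)

/-- A bijective morphism of cdga's is an isomorphism. -/
theorem isIso_of_bijective {A B : CDGA.{u} k} (f : A ⟶ B)
    (hf : Function.Bijective (Hom.fn f)) : IsIso f := by
  let e := AlgEquiv.ofBijective (Hom.fn f) hf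
  have he : ∀ b, Hom.fn f (e.symm b) = b := fun b => e.apply_symm_apply b
  have he' : ∀ a, e.symm (Hom.fn f a) = a := fun a => e.symm_apply_apply a
  let g : B ⟶ A :=
    { toAlgHom := e.symm.toAlgHom
      map_gr := by
        intro n b hb
        show e.symm b ∈ A.gr n
        have h1 : e.symm b = Grading.proj A.isInternal n (e.symm b) := by
          apply hf.1
          have key : ∀ a, Hom.fn f (Grading.proj A.isInternal n a)
              = Grading.proj B.isInternal n (Hom.fn f a) := by
            intro a
            refine Grading.induction A.isInternal a ?_ ?_
            · intro i y hy
              by_cases hi : i = n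
              · subst hi
                rw [Grading.proj_same _ hy, Grading.proj_same _ (Hom.fn_gr f hy)]
              · rw [Grading.proj_ne _ hi hy, Grading.proj_ne _ hi (Hom.fn_gr f hy), map_zero]
            · intro y z hy hz
              simp only [map_add, hy, hz]
          rw [key, he, Grading.proj_same _ hb]
        rw [h1]
        exact Grading.proj_mem _ _ _
      map_d := by
        intro b
        show e.symm (B.d b) = A.d (e.symm b)
        apply hf.1
        rw [he, Hom.fn_d, he] }
  exact ⟨g, hom_ext he', hom_ext he⟩

theorem d_proj (A : CDGA.{u} k) (n : ℤ) (a : A.carrier) :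
    A.d (Grading.proj A.isInternal n a) = Grading.proj A.isInternal (n + 1) (A.d a) := by
  refine Grading.induction A.isInternal a ?_ ?_
  · intro i y hy
    by_cases hi : i = n
    · subst hi
      rw [Grading.proj_same _ hy, Grading.proj_same _ (A.d_mem hy)]
    · rw [Grading.proj_ne _ hi hy, Grading.proj_ne _ (by omega) (A.d_mem hy), map_zero]
  · intro y z hy hz
    simp only [map_add, hy, hz]

theorem d_mul_of_closed (A : CDGA.{u} k) (a : A.carrier) {b : A.carrier} (hb : A.d b = 0) :
    A.d (a * b) = A.d a * b := by
  refine Grading.induction A.isInternal a ?_ ?_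
  · intro i y hy
    rw [A.leibniz hy, hb]
    simp
  · intro y z hy hz
    simp only [add_mul, map_add, hy, hz]

/-- The algebra of cocycles. -/
def cocycles (A : CDGA.{u} k) : Subalgebra k A.carrier where
  carrier := {a | A.d a = 0}
  mul_mem' := by
    intro a b (ha : A.d a = 0) (hb : A.d b = 0)
    show A.d (a * b) = 0
    rw [A.d_mul_of_closed a hb, ha, zero_mul]
  add_mem' := by
    intro a b (ha : A.d a = 0) (hb : A.d b = 0)
    show A.d (a + b) = 0
    rw [map_add, ha, hb, add_zero]
  algebraMap_mem' := by
    intro r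
    show A.d (algebraMap k A.carrier r) = 0
    have h1 : A.d 1 = 0 := by
      have := A.leibniz A.one_mem 1
      simpa using this
    rw [Algebra.algebraMap_eq_smul_one, map_smul, h1, smul_zero]

theorem mem_cocycles {A : CDGA.{u} k} {a : A.carrier} : a ∈ A.cocycles ↔ A.d a = 0 := Iff.rfl

/-- The two-sided ideal of coboundaries in the algebra of cocycles. -/
def coboundaries (A : CDGA.{u} k) : Ideal A.cocycles where
  carrier := {z | ∃ y, A.d y = z}
  add_mem' := by
    rintro a b ⟨y, hy⟩ ⟨z, hz⟩
    exact ⟨y + z, by rw [map_add, hy, hz]; rfl⟩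
  zero_mem' := ⟨0, by rw [map_zero]; rfl⟩
  smul_mem' := by
    rintro ⟨c, hc⟩ ⟨x, hx⟩ ⟨y, hy⟩
    change A.d y = x at hy
    show ∃ w, A.d w = c * x
    subst hy
    refine Grading.stable_induction (h := A.isInternal) (LinearMap.ker A.d) ?_ c hc ?_ ?_ ?_
    · intro i x hx
      rw [LinearMap.mem_ker] at hx ⊢
      rw [A.d_proj, hx, map_zero]
    · exact ⟨0, by simp⟩
    · intro i z hz hz0
      rw [LinearMap.mem_ker] at hz0
      refine ⟨(i.negOnePow : ℤ) • (z * y), ?_⟩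
      rw [map_zsmul, A.leibniz hz, hz0, zero_mul, zero_add, smul_smul, ← Units.val_mul,
        ← Int.negOnePow_add, Int.negOnePow_even _ ⟨i, rfl⟩, Units.val_one, one_smul]
    · rintro z w ⟨z', hz⟩ ⟨w', hw⟩
      exact ⟨z' + w', by rw [map_add, hz, hw, add_mul]⟩

theorem mem_coboundaries {A : CDGA.{u} k} {z : A.cocycles} :
    z ∈ A.coboundaries ↔ ∃ y, A.d y = z := Iff.rfl

instance (A : CDGA.{u} k) : A.coboundaries.IsTwoSided where
  mul_mem_of_left := by
    rintro ⟨x, hx⟩ ⟨c, hc⟩ ⟨y, hy⟩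
    refine ⟨y * c, ?_⟩
    rw [A.d_mul_of_closed y hc, hy]
    rfl

/-- The class of a cocycle in cohomology. -/
def cls (A : CDGA.{u} k) : A.cocycles →ₐ[k] A.cocycles ⧸ A.coboundaries :=
  Ideal.Quotient.mkₐ k A.coboundaries

theorem cls_surjective (A : CDGA.{u} k) : Function.Surjective A.cls :=
  Ideal.Quotient.mkₐ_surjective k _

theorem cls_eq_zero {A : CDGA.{u} k} {z : A.cocycles} : A.cls z = 0 ↔ ∃ y, A.d y = z :=
  Ideal.Quotient.eq_zero_iff_mem

theorem cls_eq_cls {A : CDGA.{u} k} {z w : A.cocycles} :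
    A.cls z = A.cls w ↔ ∃ y, A.d y = (z : A.carrier) - w := by
  rw [← sub_eq_zero, ← map_sub, cls_eq_zero]
  rfl

/-- The cohomology algebra `ker d / im d`, as a cdga with trivial differential. -/
def cohomology (A : CDGA.{u} k) : CDGA.{u} k where
  carrier := A.cocycles ⧸ A.coboundaries
  gr n := ((A.gr n).comap A.cocycles.val.toLinearMap).map A.cls.toLinearMap
  isInternal := by
    refine Grading.isInternal_subquotient A.isInternal (Subalgebra.toSubmodule A.cocycles) ?_
      (Q := A.cocycles ⧸ A.coboundaries) A.cls.toLinearMap A.cls_surjective ?_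
    · intro i x (hx : A.d x = 0)
      show A.d _ = 0
      rw [A.d_proj, hx, map_zero]
    · intro i x hx
      obtain ⟨y, hy⟩ := cls_eq_zero.1 hx
      refine cls_eq_zero.2 ⟨Grading.proj A.isInternal (i - 1) y, ?_⟩
      rw [A.d_proj, hy, sub_add_cancel]
  one_mem := ⟨1, A.one_mem, map_one A.cls⟩
  mul_mem := by
    rintro m n _ _ ⟨a, ha, rfl⟩ ⟨b, hb, rfl⟩
    exact ⟨a * b, A.mul_mem ha hb, map_mul A.cls a b⟩
  mul_comm := by
    rintro m n _ _ ⟨a, ha, rfl⟩ ⟨b, hb, rfl⟩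
    show A.cls a * A.cls b = _ • (A.cls b * A.cls a)
    rw [← map_mul, ← map_mul, ← map_zsmul]
    congr 1
    exact Subtype.ext (by simpa using A.mul_comm ha hb)
  d := 0
  d_mem := fun _ => Submodule.zero_mem _
  d_d := fun _ => rfl
  leibniz := by intros; simp

/-- The map induced on cocycles. -/
def Hom.onCocycles {A B : CDGA.{u} k} (f : A ⟶ B) : A.cocycles →ₐ[k] B.cocycles :=
  ((Hom.fn f).comp A.cocycles.val).codRestrict B.cocycles fun a => by
    show B.d (Hom.fn f a) = 0
    rw [← Hom.fn_d, show A.d a = 0 from a.2, map_zero]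

/-- The map induced on cohomology. -/
def cohomologyMap {A B : CDGA.{u} k} (f : A ⟶ B) : A.cohomology ⟶ B.cohomology where
  toAlgHom := Ideal.Quotient.liftₐ A.coboundaries (B.cls.comp (Hom.onCocycles f)) (by
    rintro a ⟨y, hy⟩
    refine cls_eq_zero.2 ⟨Hom.fn f y, ?_⟩
    rw [← Hom.fn_d, hy]
    rfl)
  map_gr := by
    rintro n _ ⟨a, ha, rfl⟩
    exact ⟨Hom.onCocycles f a, Hom.fn_gr f ha, rfl⟩
  map_d := fun a => map_zero _

theorem cohomologyMap_cls {A B : CDGA.{u} k} (f : A ⟶ B) (a : A.cocycles) :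
    Hom.fn (cohomologyMap f) (A.cls a) = B.cls (Hom.onCocycles f a) := rfl

/-- The cohomology functor. -/
def H (k : Type) [Field k] : CDGA.{u} k ⥤ CDGA.{u} k where
  obj := cohomology
  map := cohomologyMap
  map_id A := hom_ext fun a => by
    obtain ⟨a, rfl⟩ := A.cls_surjective a
    rfl
  map_comp {A B C} f g := hom_ext fun a => by
    obtain ⟨a, rfl⟩ := A.cls_surjective a
    rfl

/-- Quasi-isomorphisms: morphisms that induce isomorphisms in cohomology. -/
def quasiIso (k : Type) [Field k] : MorphismProperty (CDGA.{u} k) :=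
  fun _ _ f => Function.Bijective (Hom.fn ((H k).map f))

/-- The homotopy category of cdga's: the localization at the quasi-isomorphisms. -/
abbrev Ho (k : Type) [Field k] : Type (u + 1) := (quasiIso.{u} k).Localization

/-- The localization functor from cdga's to the homotopy category. -/
abbrev toHo (k : Type) [Field k] : CDGA.{u} k ⥤ Ho.{u} k := (quasiIso.{u} k).Q

/-- The cohomology functor on the homotopy category. -/
noncomputable def HHo (k : Type) [Field k] : Ho.{u} k ⥤ CDGA.{u} k :=
  Localization.Construction.lift (H k) fun _ _ f hf => isIso_of_bijective ((H k).map f) hf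

/-- A cdga is formal if it is connected by a chain of quasi-isomorphisms to its cohomology. -/
def Formal (A : CDGA.{u} k) : Prop :=
  Relation.EqvGen (fun B C : CDGA.{u} k => ∃ f : B ⟶ C, quasiIso k f) A ((H k).obj A)

end CDGA

namespace CDGA

/-! ### Extension of scalars -/

section BaseChange

variable {k : Type} [Field k] (K : Type) [Field K] [Algebra k K]

@[elab_as_elim]
theorem baseChange_span_induction {A : CDGA.{u} k} {n : ℤ} {P : K ⊗[k] A.carrier → Prop}
    (x : K ⊗[k] A.carrier) (hx : x ∈ (A.gr n).baseChange K)
    (zero : P 0) (tmul : ∀ (r : K) (a : A.carrier), a ∈ A.gr n → P (r ⊗ₜ a))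
    (add : ∀ y z, P y → P z → P (y + z)) : P x := by
  obtain ⟨y, hy⟩ := Submodule.toBaseChange_surjective K (A.gr n) ⟨x, hx⟩
  have hy' : ((Submodule.toBaseChange K (A.gr n) y : (A.gr n).baseChange K) :
      K ⊗[k] A.carrier) = x := by rw [hy]
  rw [← hy']
  clear hy hy'
  induction y using TensorProduct.induction_on with
  | zero => simpa using zero
  | tmul r a => simpa using tmul r a a.2
  | add y z hy hz => simpa using add _ _ hy hz

/-- Extension of scalars `K ⊗ A` of a cdga. -/
noncomputable def baseChangeObj (A : CDGA.{u} k) : CDGA.{u} K :=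
  letI : DirectSum.Decomposition A.gr := A.isInternal.chooseDecomposition
  letI : GradedAlgebra A.gr :=
    { one_mem := A.one_mem
      mul_mem := fun _ _ _ _ ha hb => A.mul_mem ha hb }
  { carrier := K ⊗[k] A.carrier
    gr := fun n => (A.gr n).baseChange K
    isInternal := DirectSum.Decomposition.isInternal _
    one_mem := SetLike.one_mem_graded fun n => (A.gr n).baseChange K
    mul_mem := fun ha hb => SetLike.mul_mem_graded (A := fun n => (A.gr n).baseChange K) ha hb
    mul_comm := by
      intro m n a b ha hb
      refine baseChange_span_induction K a ha (by simp) ?_ ?_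
      · intro r x hx
        refine baseChange_span_induction K b hb (by simp) ?_ ?_
        · intro s y hy
          rw [Algebra.TensorProduct.tmul_mul_tmul, Algebra.TensorProduct.tmul_mul_tmul,
            A.mul_comm hx hy, _root_.mul_comm r s]
          exact (TensorProduct.tmul_smul (R := k) (R' := ℤ) _ _ _)
        · intro y z hy hz
          rw [add_mul, mul_add, smul_add, hy, hz]
      · intro y z hy hz
        rw [add_mul, mul_add, smul_add, hy, hz]
    d := A.d.baseChange K
    d_mem := by
      intro n a ha
      refine baseChange_span_induction K a ha (by simp) ?_ ?_
      · intro r x hx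
        rw [LinearMap.baseChange_tmul]
        exact Submodule.tmul_mem_baseChange_of_mem _ (A.d_mem hx)
      · intro y z hy hz
        rw [map_add]
        exact Submodule.add_mem _ hy hz
    d_d := by
      intro a
      induction a using TensorProduct.induction_on with
      | zero => simp
      | tmul r x => simp [A.d_d]
      | add y z hy hz => rw [map_add, map_add, hy, hz, add_zero]
    leibniz := by
      intro n a ha b
      refine baseChange_span_induction K a ha (by simp) ?_ ?_
      · intro r x hx
        induction b using TensorProduct.induction_on with
        | zero => simp
        | tmul s y =>
          simp only [Algebra.TensorProduct.tmul_mul_tmul, LinearMap.baseChange_tmul, A.leibniz hx,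
            TensorProduct.tmul_add]
          congr 1
          exact (TensorProduct.tmul_smul (R := k) (R' := ℤ) _ _ _)
        | add y z hy hz => simp only [mul_add, map_add, hy, hz, smul_add]; abel
      · intro y z hy hz
        simp only [add_mul, map_add, hy, hz, smul_add]
        abel }

/-- Extension of scalars of a morphism. -/
noncomputable def baseChangeMap {A B : CDGA.{u} k} (f : A ⟶ B) :
    baseChangeObj K A ⟶ baseChangeObj K B where
  toAlgHom := Algebra.TensorProduct.map (AlgHom.id K K) (Hom.fn f)
  map_gr := by
    intro n a ha
    show Algebra.TensorProduct.map (AlgHom.id K K) (Hom.fn f) a ∈ (B.gr n).baseChange K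
    refine baseChange_span_induction K a ha (by simp) ?_ ?_
    · intro r x hx
      exact Submodule.tmul_mem_baseChange_of_mem _ (Hom.fn_gr f hx)
    · intro y z hy hz
      rw [map_add]
      exact Submodule.add_mem _ hy hz
  map_d := by
    intro (a : K ⊗[k] A.carrier)
    show Algebra.TensorProduct.map (AlgHom.id K K) (Hom.fn f) (A.d.baseChange K a) =
      B.d.baseChange K (Algebra.TensorProduct.map (AlgHom.id K K) (Hom.fn f) a)
    induction a using TensorProduct.induction_on with
    | zero => simp
    | tmul r x => simp [Hom.fn_d]
    | add y z hy hz => simp only [map_add, hy, hz]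

/-- Extension of scalars as a functor. -/
noncomputable def baseChange : CDGA.{u} k ⥤ CDGA.{u} K where
  obj A := baseChangeObj K A
  map f := baseChangeMap K f
  map_id A := Hom.ext (Algebra.TensorProduct.map_id ..)
  map_comp f g := hom_ext fun a => by
    show Algebra.TensorProduct.map (AlgHom.id K K) ((Hom.fn g).comp (Hom.fn f)) a =
      Algebra.TensorProduct.map (AlgHom.id K K) (Hom.fn g)
        (Algebra.TensorProduct.map (AlgHom.id K K) (Hom.fn f) a)
    induction a using TensorProduct.induction_on with
    | zero => simp
    | tmul r x => rfl
    | add y z hy hz => simp only [map_add, hy, hz]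

instance (A : CDGA.{u} k) : Algebra k (baseChangeObj K A).carrier :=
  inferInstanceAs (Algebra k (K ⊗[k] A.carrier))

instance (A : CDGA.{u} k) : IsScalarTower k K (baseChangeObj K A).carrier :=
  inferInstanceAs (IsScalarTower k K (K ⊗[k] A.carrier))

/-- The `k`-algebra map `Z(A) → Z(K ⊗ A)`, `a ↦ 1 ⊗ a`. -/
noncomputable def cocyclesToBaseChange (A : CDGA.{u} k) :
    A.cocycles →ₐ[k] (baseChangeObj K A).cocycles :=
  AlgHom.codRestrict ((Algebra.TensorProduct.includeRight :
      A.carrier →ₐ[k] K ⊗[k] A.carrier).comp A.cocycles.val)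
    ((baseChangeObj K A).cocycles.restrictScalars k) fun a => by
      show (A.d.baseChange K) ((1 : K) ⊗ₜ[k] (a : A.carrier)) = 0
      rw [LinearMap.baseChange_tmul, show A.d a = 0 from a.2, TensorProduct.tmul_zero]

/-- The `K`-algebra map `K ⊗ H(A) → H(K ⊗ A)`, `r ⊗ [a] ↦ [r ⊗ a]`. -/
noncomputable def cohomologyBaseChangeAlgHom (A : CDGA.{u} k) :
    K ⊗[k] (A.cocycles ⧸ A.coboundaries) →ₐ[K]
      (baseChangeObj K A).cocycles ⧸ (baseChangeObj K A).coboundaries :=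
  Algebra.TensorProduct.lift (Algebra.ofId K _)
    (Ideal.Quotient.liftₐ A.coboundaries
      (((Ideal.Quotient.mkₐ k (baseChangeObj K A).coboundaries)).comp
        (cocyclesToBaseChange K A)) (by
      rintro a ⟨y, hy⟩
      refine cls_eq_zero.2 ⟨(1 : K) ⊗ₜ[k] y, ?_⟩
      show (A.d.baseChange K) _ = (1 : K) ⊗ₜ[k] (a : A.carrier)
      rw [LinearMap.baseChange_tmul, hy]))
    fun r x => Algebra.commutes _ _

theorem tmul_mem_cocycles (A : CDGA.{u} k) (r : K) (a : A.cocycles) :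
    (r ⊗ₜ[k] (a : A.carrier) : K ⊗[k] A.carrier) ∈ (baseChangeObj K A).cocycles := by
  show (A.d.baseChange K) (r ⊗ₜ[k] (a : A.carrier)) = 0
  rw [LinearMap.baseChange_tmul, show A.d a = 0 from a.2, TensorProduct.tmul_zero]

theorem cohomologyBaseChangeAlgHom_tmul (A : CDGA.{u} k) (r : K) (a : A.cocycles) :
    cohomologyBaseChangeAlgHom K A (r ⊗ₜ A.cls a) =
      (baseChangeObj K A).cls ⟨r ⊗ₜ[k] (a : A.carrier), tmul_mem_cocycles K A r a⟩ := by
  have h1 : cohomologyBaseChangeAlgHom K A (r ⊗ₜ A.cls a) =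
      algebraMap K _ r * (baseChangeObj K A).cls (cocyclesToBaseChange K A a) :=
    Algebra.TensorProduct.lift_tmul ..
  rw [h1, ← Algebra.smul_def, ← map_smul]
  congr 1
  apply Subtype.ext
  show r • ((1 : K) ⊗ₜ[k] (a : A.carrier)) = _
  rw [TensorProduct.smul_tmul', smul_eq_mul, mul_one]

/-- The inclusion `K ⊗ Z(A) → Z(K ⊗ A)`. -/
theorem lTensor_mem_cocycles (A : CDGA.{u} k) (z : K ⊗[k] A.cocycles) :
    (A.cocycles.val.toLinearMap.lTensor K z) ∈ (baseChangeObj K A).cocycles := by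
  induction z using TensorProduct.induction_on with
  | zero => rw [map_zero]; exact (baseChangeObj K A).cocycles.zero_mem
  | tmul r a => exact tmul_mem_cocycles K A r a
  | add y z hy hz => rw [map_add]; exact (baseChangeObj K A).cocycles.add_mem hy hz

theorem cohomologyBaseChangeAlgHom_lTensor (A : CDGA.{u} k) (z : K ⊗[k] A.cocycles) :
    cohomologyBaseChangeAlgHom K A (A.cls.toLinearMap.lTensor K z) =
      (baseChangeObj K A).cls
        ⟨A.cocycles.val.toLinearMap.lTensor K z, lTensor_mem_cocycles K A z⟩ := by
  induction z using TensorProduct.induction_on with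
  | zero =>
    rw [map_zero, map_zero, eq_comm, cls_eq_zero]
    exact ⟨0, by rw [map_zero]; exact (map_zero (A.cocycles.val.toLinearMap.lTensor K)).symm⟩
  | tmul r a => exact cohomologyBaseChangeAlgHom_tmul K A r a
  | add y z hy hz =>
    rw [map_add, map_add, hy, hz, ← map_add]
    congr 1
    exact Subtype.ext (map_add _ _ _).symm

theorem coord_lTensor {ι M N : Type*} [DecidableEq ι] [AddCommGroup M] [Module k M]
    [AddCommGroup N] [Module k N] (b : Module.Basis ι k K) (f : M →ₗ[k] N) (x : K ⊗[k] M) (i : ι) :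
    TensorProduct.equivFinsuppOfBasisLeft b (f.lTensor K x) i =
      f (TensorProduct.equivFinsuppOfBasisLeft b x i) := by
  induction x using TensorProduct.induction_on with
  | zero => simp
  | tmul r a => simp
  | add y z hy hz => simp only [map_add, Finsupp.add_apply, hy, hz]

theorem cohomologyBaseChangeAlgHom_bijective (A : CDGA.{u} k) :
    Function.Bijective (cohomologyBaseChangeAlgHom K A) := by
  classical
  let b := Module.Basis.ofVectorSpace k K
  constructor
  · rw [injective_iff_map_eq_zero]
    intro w hw
    obtain ⟨z, rfl⟩ := LinearMap.lTensor_surjective K (g := A.cls.toLinearMap) A.cls_surjective w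
    rw [cohomologyBaseChangeAlgHom_lTensor] at hw
    have hw' : ∃ n : K ⊗[k] A.carrier,
        A.d.lTensor K n = A.cocycles.val.toLinearMap.lTensor K z := cls_eq_zero.1 hw
    obtain ⟨n, hn⟩ := hw'
    apply (TensorProduct.equivFinsuppOfBasisLeft b).injective
    ext i
    rw [coord_lTensor, map_zero, Finsupp.zero_apply]
    refine cls_eq_zero.2 ⟨TensorProduct.equivFinsuppOfBasisLeft b n i, ?_⟩
    rw [← coord_lTensor K b A.d, hn, coord_lTensor]
    rfl
  · intro y
    obtain ⟨⟨x, hx⟩, rfl⟩ := cls_surjective _ y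
    change K ⊗[k] A.carrier at x
    change A.d.lTensor K x = 0 at hx
    have hz : ∀ i, A.d (TensorProduct.equivFinsuppOfBasisLeft b x i) = 0 := by
      intro i
      rw [← coord_lTensor, hx, map_zero, Finsupp.zero_apply]
    let F := TensorProduct.equivFinsuppOfBasisLeft b x
    let z : K ⊗[k] A.cocycles := (TensorProduct.equivFinsuppOfBasisLeft b).symm
      (Finsupp.onFinset F.support (fun i => (⟨F i, hz i⟩ : A.cocycles)) (by
        intro i hi
        rw [Finsupp.mem_support_iff]
        intro h0
        exact hi (Subtype.ext h0)))
    refine ⟨A.cls.toLinearMap.lTensor K z, ?_⟩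
    rw [cohomologyBaseChangeAlgHom_lTensor]
    congr 1
    apply Subtype.ext
    show A.cocycles.val.toLinearMap.lTensor K z = x
    apply (TensorProduct.equivFinsuppOfBasisLeft b).injective
    ext i
    rw [coord_lTensor, LinearEquiv.apply_symm_apply]
    rfl

/-- The isomorphism of graded algebras `K ⊗ H(A) → H(K ⊗ A)`, `r ⊗ [a] ↦ [r ⊗ a]`. -/
noncomputable def cohomologyBaseChange (A : CDGA.{u} k) :
    (baseChange K).obj ((H k).obj A) ⟶ (H K).obj ((baseChange K).obj A) where
  toAlgHom := cohomologyBaseChangeAlgHom K A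
  map_gr := by
    intro n a ha
    refine baseChange_span_induction (A := (H k).obj A) K a ha ?_ ?_ ?_
    · exact (congrArg (· ∈ (baseChangeObj K A).cohomology.gr n)
        (map_zero (cohomologyBaseChangeAlgHom K A))).mpr (Submodule.zero_mem _)
    · rintro r _ ⟨x, hx, rfl⟩
      exact ⟨⟨r ⊗ₜ[k] (x : A.carrier), tmul_mem_cocycles K A r x⟩,
        Submodule.tmul_mem_baseChange_of_mem _ hx,
        (cohomologyBaseChangeAlgHom_tmul K A r x).symm⟩
    · intro y z hy hz
      exact (congrArg (· ∈ (baseChangeObj K A).cohomology.gr n)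
        (map_add (cohomologyBaseChangeAlgHom K A) y z)).mpr (Submodule.add_mem _ hy hz)
  map_d := by
    intro a
    have h : (((H k).obj A).d.baseChange K) a = 0 := by
      show ((0 : _ →ₗ[k] _).baseChange K) a = 0
      rw [LinearMap.baseChange_zero]
      rfl
    exact (congrArg (cohomologyBaseChangeAlgHom K A) h).trans (map_zero _)

instance (A : CDGA.{u} k) : IsIso (cohomologyBaseChange K A) :=
  isIso_of_bijective _ (cohomologyBaseChangeAlgHom_bijective K A)

end BaseChange

end CDGA

/-! ### Commutative bigraded bidifferential algebras with real structure -/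

namespace Grading

section

variable {ι κ k M : Type*} [Ring k] [AddCommGroup M] [Module k M] {gr : ι → Submodule k M}

/-- The grading obtained from a finer one by merging the degrees with the same image under `f`. -/
def coarsen (gr : ι → Submodule k M) (f : ι → κ) (n : κ) : Submodule k M :=
  ⨆ i : {i // f i = n}, gr i

theorem mem_coarsen {f : ι → κ} {i : ι} {x : M} (hx : x ∈ gr i) : x ∈ coarsen gr f (f i) :=
  Submodule.mem_iSup_of_mem (p := fun j : {j // f j = f i} => gr j) ⟨i, rfl⟩ hx

@[elab_as_elim]
theorem coarsen_induction {f : ι → κ} {n : κ} {P : M → Prop} (x : M) (hx : x ∈ coarsen gr f n)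
    (zero : P 0) (hom : ∀ i, f i = n → ∀ y ∈ gr i, P y) (add : ∀ y z, P y → P z → P (y + z)) :
    P x :=
  Submodule.iSup_induction (fun i : {i // f i = n} => gr i) (motive := P) hx
    (fun i y hy => hom i i.2 y hy) zero add

theorem isInternal_coarsen [DecidableEq ι] [DecidableEq κ] (h : DirectSum.IsInternal gr) (f : ι → κ) :
    DirectSum.IsInternal (coarsen gr f) := by
  let e := LinearEquiv.ofBijective (DirectSum.coeLinearMap gr) h
  let π : κ → M →ₗ[k] M := fun n => e.toLinearMap ∘ₗ
    DFinsupp.filterLinearMap k (fun i => gr i) (fun i => f i = n) ∘ₗ e.symm.toLinearMap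
  have he : ∀ i (y : M) (hy : y ∈ gr i), e.symm y = DirectSum.lof k ι (fun i => gr i) i ⟨y, hy⟩ := by
    intro i y hy
    rw [LinearEquiv.symm_apply_eq]
    exact (DirectSum.coeLinearMap_lof gr i ⟨y, hy⟩).symm
  have h1 : ∀ i (y : M), y ∈ gr i → π (f i) y = y := by
    intro i y hy
    show e (DFinsupp.filter (fun j => f j = f i) (e.symm y)) = y
    rw [he i y hy]
    have : DFinsupp.filter (fun j => f j = f i) (DirectSum.lof k ι (fun i => gr i) i ⟨y, hy⟩) =
        DirectSum.lof k ι (fun i => gr i) i ⟨y, hy⟩ := DFinsupp.filter_single_pos _ _ rfl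
    rw [this, ← he i y hy, e.apply_symm_apply]
  have h2 : ∀ i n (y : M), y ∈ gr i → f i ≠ n → π n y = 0 := by
    intro i n y hy hn
    show e (DFinsupp.filter (fun j => f j = n) (e.symm y)) = 0
    rw [he i y hy]
    have : DFinsupp.filter (fun j => f j = n) (DirectSum.lof k ι (fun i => gr i) i ⟨y, hy⟩) = 0 :=
      DFinsupp.filter_single_neg _ _ hn
    rw [this, map_zero]
  refine isInternal_of_proj (fun n => π n) (fun n => map_zero _) (fun n x y => map_add _ _ _)
    ?_ ?_ ?_
  · intro n x hx
    refine coarsen_induction x hx (map_zero _) ?_ ?_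
    · rintro i rfl y hy
      exact h1 i y hy
    · intro y z hy hz
      rw [map_add, hy, hz]
  · intro m n hmn x hx
    refine coarsen_induction x hx (map_zero _) ?_ ?_
    · rintro i rfl y hy
      exact h2 i n y hy hmn
    · intro y z hy hz
      rw [map_add, hy, hz, add_zero]
  · intro x
    obtain ⟨s, hs⟩ := sum_proj h x
    rw [hs]
    exact Submodule.sum_mem _ fun i _ =>
      Submodule.mem_iSup_of_mem (f i) (mem_coarsen (proj_mem h i x))

end

end Grading

/-- An `ℝ`-cbba: a (`ℤ × ℤ`-graded, unital) commutative bigraded bidifferential algebra over `ℂ`,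
with differentials `del` of bidegree `(1,0)` and `delbar` of bidegree `(0,1)`, graded-commutative
for the total degree, together with a real structure `conj`, an antilinear involution compatible
with the product, exchanging the bidegrees `(p,q)` and `(q,p)`, and exchanging `del` and
`delbar`. -/
structure RCbba where
  carrier : Type u
  [ring : Ring carrier]
  [algebra : Algebra ℂ carrier]
  gr : ℤ × ℤ → Submodule ℂ carrier
  isInternal : DirectSum.IsInternal gr
  one_mem : (1 : carrier) ∈ gr (0, 0)
  mul_mem : ∀ {i j : ℤ × ℤ} {a b : carrier}, a ∈ gr i → b ∈ gr j → a * b ∈ gr (i + j)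
  mul_comm : ∀ {i j : ℤ × ℤ} {a b : carrier}, a ∈ gr i → b ∈ gr j →
    a * b = (((i.1 + i.2) * (j.1 + j.2)).negOnePow : ℤ) • (b * a)
  del : carrier →ₗ[ℂ] carrier
  delbar : carrier →ₗ[ℂ] carrier
  del_mem : ∀ {i : ℤ × ℤ} {a : carrier}, a ∈ gr i → del a ∈ gr (i + (1, 0))
  delbar_mem : ∀ {i : ℤ × ℤ} {a : carrier}, a ∈ gr i → delbar a ∈ gr (i + (0, 1))
  del_del : ∀ a, del (del a) = 0
  delbar_delbar : ∀ a, delbar (delbar a) = 0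
  del_delbar : ∀ a, del (delbar a) + delbar (del a) = 0
  del_leibniz : ∀ {i : ℤ × ℤ} {a : carrier}, a ∈ gr i → ∀ b,
    del (a * b) = del a * b + ((i.1 + i.2).negOnePow : ℤ) • (a * del b)
  delbar_leibniz : ∀ {i : ℤ × ℤ} {a : carrier}, a ∈ gr i → ∀ b,
    delbar (a * b) = delbar a * b + ((i.1 + i.2).negOnePow : ℤ) • (a * delbar b)
  conj : carrier →ₛₗ[starRingEnd ℂ] carrier
  conj_conj : ∀ a, conj (conj a) = a
  conj_one : conj 1 = 1
  conj_mul : ∀ a b, conj (a * b) = conj a * conj b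
  conj_mem : ∀ {i : ℤ × ℤ} {a : carrier}, a ∈ gr i → conj a ∈ gr i.swap
  conj_del : ∀ a, conj (del a) = delbar (conj a)

namespace RCbba

attribute [instance] RCbba.ring RCbba.algebra

/-- A (real) morphism of `ℝ`-cbba's. -/
@[ext]
structure Hom (A B : RCbba.{u}) where
  toAlgHom : A.carrier →ₐ[ℂ] B.carrier
  map_gr : ∀ {i : ℤ × ℤ} {a : A.carrier}, a ∈ A.gr i → toAlgHom a ∈ B.gr i
  map_del : ∀ a, toAlgHom (A.del a) = B.del (toAlgHom a)
  map_delbar : ∀ a, toAlgHom (A.delbar a) = B.delbar (toAlgHom a)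
  map_conj : ∀ a, toAlgHom (A.conj a) = B.conj (toAlgHom a)

instance : Category RCbba.{u} where
  Hom := Hom
  id A := ⟨AlgHom.id ℂ A.carrier, fun h => h, fun _ => rfl, fun _ => rfl, fun _ => rfl⟩
  comp f g := ⟨g.toAlgHom.comp f.toAlgHom, fun h => g.map_gr (f.map_gr h),
    fun a => by simp [f.map_del, g.map_del], fun a => by simp [f.map_delbar, g.map_delbar],
    fun a => by simp [f.map_conj, g.map_conj]⟩

/-- The underlying map of a morphism of `ℝ`-cbba's. -/
def Hom.fn {A B : RCbba.{u}} (f : A ⟶ B) : A.carrier →ₐ[ℂ] B.carrier := Hom.toAlgHom f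

section

variable {A B : RCbba.{u}} (f : A ⟶ B)

theorem Hom.fn_gr {i : ℤ × ℤ} {a : A.carrier} (h : a ∈ A.gr i) : Hom.fn f a ∈ B.gr i :=
  Hom.map_gr f h

theorem Hom.fn_del (a : A.carrier) : Hom.fn f (A.del a) = B.del (Hom.fn f a) := Hom.map_del f a

theorem Hom.fn_delbar (a : A.carrier) : Hom.fn f (A.delbar a) = B.delbar (Hom.fn f a) :=
  Hom.map_delbar f a

theorem Hom.fn_conj (a : A.carrier) : Hom.fn f (A.conj a) = B.conj (Hom.fn f a) :=
  Hom.map_conj f a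

theorem hom_ext {f g : A ⟶ B} (h : ∀ a, Hom.fn f a = Hom.fn g a) : f = g :=
  Hom.ext (AlgHom.ext h)

end

@[simp] theorem fn_id (A : RCbba.{u}) : Hom.fn (𝟙 A) = AlgHom.id ℂ A.carrier := rfl

@[simp] theorem fn_comp {A B C : RCbba.{u}} (f : A ⟶ B) (g : B ⟶ C) :
    Hom.fn (f ≫ g) = (Hom.fn g).comp (Hom.fn f) := rfl

section Basic

variable (A : RCbba.{u})

theorem conj_delbar (a : A.carrier) : A.conj (A.delbar a) = A.del (A.conj a) := by
  rw [← A.conj_conj (A.del (A.conj a)), A.conj_del, A.conj_conj]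

theorem delbar_del (a : A.carrier) : A.delbar (A.del a) = -A.del (A.delbar a) :=
  eq_neg_of_add_eq_zero_right (A.del_delbar a)

theorem del_mul_of_closed (a : A.carrier) {b : A.carrier} (hb : A.del b = 0) :
    A.del (a * b) = A.del a * b := by
  refine Grading.induction A.isInternal a ?_ ?_
  · intro i y hy
    rw [A.del_leibniz hy, hb]
    simp
  · intro y z hy hz
    simp only [add_mul, map_add, hy, hz]

theorem delbar_mul_of_closed (a : A.carrier) {b : A.carrier} (hb : A.delbar b = 0) :
    A.delbar (a * b) = A.delbar a * b := by
  refine Grading.induction A.isInternal a ?_ ?_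
  · intro i y hy
    rw [A.delbar_leibniz hy, hb]
    simp
  · intro y z hy hz
    simp only [add_mul, map_add, hy, hz]

theorem del_proj (i : ℤ × ℤ) (a : A.carrier) :
    A.del (Grading.proj A.isInternal i a) = Grading.proj A.isInternal (i + (1, 0)) (A.del a) := by
  refine Grading.induction A.isInternal a ?_ ?_
  · intro j y hy
    by_cases hj : j = i
    · subst hj
      rw [Grading.proj_same _ hy, Grading.proj_same _ (A.del_mem hy)]
    · rw [Grading.proj_ne _ hj hy, map_zero,
        Grading.proj_ne _ (fun h => hj (add_right_cancel h)) (A.del_mem hy)]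
  · intro y z hy hz
    simp only [map_add, hy, hz]

theorem delbar_proj (i : ℤ × ℤ) (a : A.carrier) :
    A.delbar (Grading.proj A.isInternal i a) =
      Grading.proj A.isInternal (i + (0, 1)) (A.delbar a) := by
  refine Grading.induction A.isInternal a ?_ ?_
  · intro j y hy
    by_cases hj : j = i
    · subst hj
      rw [Grading.proj_same _ hy, Grading.proj_same _ (A.delbar_mem hy)]
    · rw [Grading.proj_ne _ hj hy, map_zero,
        Grading.proj_ne _ (fun h => hj (add_right_cancel h)) (A.delbar_mem hy)]
  · intro y z hy hz
    simp only [map_add, hy, hz]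

theorem del_one : A.del 1 = 0 := by simpa using A.del_leibniz A.one_mem 1

theorem delbar_one : A.delbar 1 = 0 := by simpa using A.delbar_leibniz A.one_mem 1

end Basic

/-! ### Bott-Chern and Aeppli cohomology -/

/-- The algebra `ker ∂ ∩ ker ∂̄`. -/
def bcCocycles (A : RCbba.{u}) : Subalgebra ℂ A.carrier where
  carrier := {a | A.del a = 0 ∧ A.delbar a = 0}
  mul_mem' := by
    rintro a b ⟨ha, ha'⟩ ⟨hb, hb'⟩
    exact ⟨by rw [A.del_mul_of_closed a hb, ha, zero_mul],
      by rw [A.delbar_mul_of_closed a hb', ha', zero_mul]⟩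
  add_mem' := by
    rintro a b ⟨ha, ha'⟩ ⟨hb, hb'⟩
    exact ⟨by rw [map_add, ha, hb, add_zero], by rw [map_add, ha', hb', add_zero]⟩
  algebraMap_mem' := by
    intro r
    refine ⟨?_, ?_⟩
    · rw [Algebra.algebraMap_eq_smul_one, map_smul, A.del_one, smul_zero]
    · rw [Algebra.algebraMap_eq_smul_one, map_smul, A.delbar_one, smul_zero]

/-- The two-sided ideal `im ∂∂̄` of `ker ∂ ∩ ker ∂̄`. -/
def bcCoboundaries (A : RCbba.{u}) : Ideal A.bcCocycles where
  carrier := {z | ∃ y, A.del (A.delbar y) = z}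
  add_mem' := by
    rintro a b ⟨y, hy⟩ ⟨z, hz⟩
    exact ⟨y + z, by rw [map_add, map_add, hy, hz]; rfl⟩
  zero_mem' := ⟨0, by rw [map_zero, map_zero]; rfl⟩
  smul_mem' := by
    rintro ⟨c, hc⟩ ⟨x, hx⟩ ⟨y, hy⟩
    change A.del (A.delbar y) = x at hy
    show ∃ w, A.del (A.delbar w) = c * x
    subst hy
    refine Grading.stable_induction (h := A.isInternal) (Subalgebra.toSubmodule A.bcCocycles)
      ?_ c hc ?_ ?_ ?_
    · rintro i x ⟨hx, hx'⟩
      exact ⟨by rw [A.del_proj, hx, map_zero], by rw [A.delbar_proj, hx', map_zero]⟩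
    · exact ⟨0, by simp⟩
    · rintro i z hz ⟨hz0, hz1⟩
      refine ⟨z * y, ?_⟩
      rw [A.delbar_leibniz hz, hz1, zero_mul, zero_add, map_zsmul, A.del_leibniz hz, hz0, zero_mul,
        zero_add, smul_smul, ← Units.val_mul, ← Int.negOnePow_add,
        Int.negOnePow_even _ ⟨_, rfl⟩, Units.val_one, one_smul]
    · rintro z w ⟨z', hz⟩ ⟨w', hw⟩
      exact ⟨z' + w', by rw [map_add, map_add, hz, hw, add_mul]⟩

instance (A : RCbba.{u}) : A.bcCoboundaries.IsTwoSided where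
  mul_mem_of_left := by
    rintro ⟨x, hx⟩ ⟨c, hc, hc'⟩ ⟨y, hy⟩
    refine ⟨y * c, ?_⟩
    rw [A.delbar_mul_of_closed y hc', A.del_mul_of_closed _ hc, hy]
    rfl

/-- The class of an element of `ker ∂ ∩ ker ∂̄` in Bott-Chern cohomology. -/
def bcCls (A : RCbba.{u}) : A.bcCocycles →ₐ[ℂ] A.bcCocycles ⧸ A.bcCoboundaries :=
  Ideal.Quotient.mkₐ ℂ A.bcCoboundaries

theorem bcCls_surjective (A : RCbba.{u}) : Function.Surjective A.bcCls :=
  Ideal.Quotient.mkₐ_surjective ℂ _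

theorem bcCls_eq_zero {A : RCbba.{u}} {z : A.bcCocycles} :
    A.bcCls z = 0 ↔ ∃ y, A.del (A.delbar y) = z :=
  Ideal.Quotient.eq_zero_iff_mem

/-- The involution on `ker ∂ ∩ ker ∂̄`. -/
def bcConj (A : RCbba.{u}) : A.bcCocycles →+* A.bcCocycles where
  toFun a := ⟨A.conj a, by
    obtain ⟨a, ha, ha'⟩ := a
    exact ⟨by rw [← A.conj_delbar, ha', map_zero], by rw [← A.conj_del, ha, map_zero]⟩⟩
  map_one' := Subtype.ext A.conj_one
  map_mul' a b := Subtype.ext (A.conj_mul a b)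
  map_zero' := Subtype.ext (map_zero A.conj)
  map_add' a b := Subtype.ext (map_add A.conj _ _)

/-- The involution on Bott-Chern cohomology. -/
def bcConjQuot (A : RCbba.{u}) :
    A.bcCocycles ⧸ A.bcCoboundaries →+* A.bcCocycles ⧸ A.bcCoboundaries :=
  Ideal.Quotient.lift A.bcCoboundaries ((A.bcCls : _ →+* _).comp A.bcConj) (by
    rintro a ⟨y, hy⟩
    refine bcCls_eq_zero.2 ⟨-A.conj y, ?_⟩
    show _ = A.conj a
    rw [← hy, A.conj_del, A.conj_delbar, A.delbar_del, map_neg, map_neg])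

theorem bcConjQuot_cls (A : RCbba.{u}) (a : A.bcCocycles) :
    A.bcConjQuot (A.bcCls a) = A.bcCls (A.bcConj a) := rfl

/-- The Bott-Chern cohomology algebra `H_BC(A) = (ker ∂ ∩ ker ∂̄) / im ∂∂̄`, as an `ℝ`-cbba with
trivial differentials. -/
def bottChern (A : RCbba.{u}) : RCbba.{u} where
  carrier := A.bcCocycles ⧸ A.bcCoboundaries
  gr i := ((A.gr i).comap A.bcCocycles.val.toLinearMap).map A.bcCls.toLinearMap
  isInternal := by
    refine Grading.isInternal_subquotient A.isInternal (Subalgebra.toSubmodule A.bcCocycles) ?_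
      (Q := A.bcCocycles ⧸ A.bcCoboundaries) A.bcCls.toLinearMap A.bcCls_surjective ?_
    · rintro i x ⟨hx, hx'⟩
      exact ⟨by rw [A.del_proj, hx, map_zero], by rw [A.delbar_proj, hx', map_zero]⟩
    · intro i x hx
      obtain ⟨y, hy⟩ := bcCls_eq_zero.1 hx
      refine bcCls_eq_zero.2 ⟨Grading.proj A.isInternal (i - (1, 1)) y, ?_⟩
      rw [A.delbar_proj, A.del_proj, hy]
      congr 2
      ext <;> simp
  one_mem := ⟨1, A.one_mem, map_one A.bcCls⟩
  mul_mem := by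
    rintro m n _ _ ⟨a, ha, rfl⟩ ⟨b, hb, rfl⟩
    exact ⟨a * b, A.mul_mem ha hb, map_mul A.bcCls a b⟩
  mul_comm := by
    rintro m n _ _ ⟨a, ha, rfl⟩ ⟨b, hb, rfl⟩
    show A.bcCls a * A.bcCls b = _ • (A.bcCls b * A.bcCls a)
    rw [← map_mul, ← map_mul, ← map_zsmul]
    congr 1
    exact Subtype.ext (by simpa using A.mul_comm ha hb)
  del := 0
  delbar := 0
  del_mem := fun _ => Submodule.zero_mem _
  delbar_mem := fun _ => Submodule.zero_mem _
  del_del := fun _ => rfl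
  delbar_delbar := fun _ => rfl
  del_delbar := fun _ => add_zero _
  del_leibniz := by intros; simp
  delbar_leibniz := by intros; simp
  conj :=
    { toFun := A.bcConjQuot
      map_add' := map_add _
      map_smul' := by
        intro r x
        obtain ⟨a, rfl⟩ := A.bcCls_surjective x
        rw [← map_smul, bcConjQuot_cls, bcConjQuot_cls, ← map_smul]
        congr 1
        exact Subtype.ext (A.conj.map_smulₛₗ r (a : A.carrier)) }
  conj_conj := by
    intro x
    obtain ⟨a, rfl⟩ := A.bcCls_surjective x
    show A.bcConjQuot (A.bcConjQuot (A.bcCls a)) = _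
    rw [bcConjQuot_cls, bcConjQuot_cls]
    congr 1
    exact Subtype.ext (A.conj_conj a)
  conj_one := map_one A.bcConjQuot
  conj_mul := map_mul A.bcConjQuot
  conj_mem := by
    rintro i _ ⟨a, ha, rfl⟩
    exact ⟨A.bcConj a, A.conj_mem ha, rfl⟩
  conj_del := fun a => map_zero A.bcConjQuot

/-- The map induced on `ker ∂ ∩ ker ∂̄`. -/
def Hom.onBcCocycles {A B : RCbba.{u}} (f : A ⟶ B) : A.bcCocycles →ₐ[ℂ] B.bcCocycles :=
  ((Hom.fn f).comp A.bcCocycles.val).codRestrict B.bcCocycles fun a =>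
    ⟨show B.del (Hom.fn f a) = 0 by rw [← Hom.fn_del, a.2.1, map_zero],
      show B.delbar (Hom.fn f a) = 0 by rw [← Hom.fn_delbar, a.2.2, map_zero]⟩

/-- The map induced on Bott-Chern cohomology. -/
def bottChernMap {A B : RCbba.{u}} (f : A ⟶ B) : A.bottChern ⟶ B.bottChern where
  toAlgHom := Ideal.Quotient.liftₐ A.bcCoboundaries (B.bcCls.comp (Hom.onBcCocycles f)) (by
    rintro a ⟨y, hy⟩
    refine bcCls_eq_zero.2 ⟨Hom.fn f y, ?_⟩
    rw [← Hom.fn_delbar, ← Hom.fn_del, hy]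
    rfl)
  map_gr := by
    rintro n _ ⟨a, ha, rfl⟩
    exact ⟨Hom.onBcCocycles f a, Hom.fn_gr f ha, rfl⟩
  map_del := fun a => map_zero _
  map_delbar := fun a => map_zero _
  map_conj := by
    intro x
    obtain ⟨a, rfl⟩ := A.bcCls_surjective x
    show B.bcCls _ = B.bcCls _
    congr 1
    exact Subtype.ext (Hom.fn_conj f a)

/-- Bott-Chern cohomology as a functor. -/
def HBC : RCbba.{u} ⥤ RCbba.{u} where
  obj := bottChern
  map := bottChernMap
  map_id A := hom_ext fun a => by
    obtain ⟨a, rfl⟩ := A.bcCls_surjective a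
    rfl
  map_comp {A B C} f g := hom_ext fun a => by
    obtain ⟨a, rfl⟩ := A.bcCls_surjective a
    rfl

/-- `ker ∂∂̄`. -/
def aeppliCocycles (A : RCbba.{u}) : Submodule ℂ A.carrier := LinearMap.ker (A.del ∘ₗ A.delbar)

/-- `im ∂ + im ∂̄`, as a subspace of `ker ∂∂̄`. -/
def aeppliCoboundaries (A : RCbba.{u}) : Submodule ℂ A.aeppliCocycles :=
  (LinearMap.range A.del ⊔ LinearMap.range A.delbar).comap A.aeppliCocycles.subtype

/-- The Aeppli cohomology `H_A(A) = ker ∂∂̄ / (im ∂ + im ∂̄)`. -/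
abbrev Aeppli (A : RCbba.{u}) : Type u := A.aeppliCocycles ⧸ A.aeppliCoboundaries

/-- The map induced on `ker ∂∂̄`. -/
def Hom.onAeppliCocycles {A B : RCbba.{u}} (f : A ⟶ B) : A.aeppliCocycles →ₗ[ℂ] B.aeppliCocycles :=
  (Hom.fn f).toLinearMap.restrict fun a (ha : A.del (A.delbar a) = 0) => by
    show B.del (B.delbar (Hom.fn f a)) = 0
    rw [← Hom.fn_delbar, ← Hom.fn_del, ha, map_zero]

/-- The map induced on Aeppli cohomology. -/
def aeppliMap {A B : RCbba.{u}} (f : A ⟶ B) : A.Aeppli →ₗ[ℂ] B.Aeppli :=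
  Submodule.mapQ A.aeppliCoboundaries B.aeppliCoboundaries (Hom.onAeppliCocycles f) (by
    intro x hx
    obtain ⟨_, ⟨y, rfl⟩, _, ⟨z, rfl⟩, h⟩ := Submodule.mem_sup.1 hx
    refine Submodule.mem_sup.2 ⟨_, ⟨Hom.fn f y, rfl⟩, _, ⟨Hom.fn f z, rfl⟩, ?_⟩
    rw [← Hom.fn_del, ← Hom.fn_delbar, ← map_add, h]
    rfl)

/-- Pluripotential quasi-isomorphisms: morphisms that induce isomorphisms in Bott-Chern and Aeppli
cohomology. -/
def PluriQuasiIso {A B : RCbba.{u}} (f : A ⟶ B) : Prop :=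
  Function.Bijective (Hom.fn (HBC.map f)) ∧ Function.Bijective (aeppliMap f)

/-- An `ℝ`-cbba is strongly formal if it is connected by a chain of pluripotential
quasi-isomorphisms to one with trivial differentials. -/
def StronglyFormal (A : RCbba.{u}) : Prop :=
  ∃ B : RCbba.{u}, B.del = 0 ∧ B.delbar = 0 ∧
    Relation.EqvGen (fun C D : RCbba.{u} => ∃ f : C ⟶ D, PluriQuasiIso f) A B

/-! ### Total complexes -/

/-- The total degree. -/
def totalDegree (i : ℤ × ℤ) : ℤ := i.1 + i.2

theorem totalDegree_add (i j : ℤ × ℤ) : totalDegree (i + j) = totalDegree i + totalDegree j := by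
  simp only [totalDegree, Prod.fst_add, Prod.snd_add]
  ring

/-- The component of total degree `n`. -/
def totGr (A : RCbba.{u}) : ℤ → Submodule ℂ A.carrier := Grading.coarsen A.gr totalDegree

theorem mem_totGr {A : RCbba.{u}} {i : ℤ × ℤ} {n : ℤ} (hi : totalDegree i = n) {x : A.carrier}
    (hx : x ∈ A.gr i) : x ∈ A.totGr n := by
  subst hi
  exact Grading.mem_coarsen hx

theorem totGr_isInternal (A : RCbba.{u}) : DirectSum.IsInternal A.totGr :=
  Grading.isInternal_coarsen A.isInternal _

theorem one_mem_totGr (A : RCbba.{u}) : (1 : A.carrier) ∈ A.totGr 0 :=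
  mem_totGr (i := (0, 0)) rfl A.one_mem

theorem mul_mem_totGr (A : RCbba.{u}) {m n : ℤ} {a b : A.carrier} (ha : a ∈ A.totGr m)
    (hb : b ∈ A.totGr n) : a * b ∈ A.totGr (m + n) := by
  refine Grading.coarsen_induction a ha (by simp) ?_ ?_
  · rintro i rfl x hx
    refine Grading.coarsen_induction b hb (by simp) ?_ ?_
    · rintro j rfl y hy
      exact mem_totGr (totalDegree_add i j) (A.mul_mem hx hy)
    · intro y z hy hz
      rw [mul_add]
      exact Submodule.add_mem _ hy hz
  · intro y z hy hz
    rw [add_mul]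
    exact Submodule.add_mem _ hy hz

theorem mul_comm_totGr (A : RCbba.{u}) {m n : ℤ} {a b : A.carrier} (ha : a ∈ A.totGr m)
    (hb : b ∈ A.totGr n) : a * b = ((m * n).negOnePow : ℤ) • (b * a) := by
  refine Grading.coarsen_induction a ha (by simp) ?_ ?_
  · rintro i rfl x hx
    refine Grading.coarsen_induction b hb (by simp) ?_ ?_
    · rintro j rfl y hy
      exact A.mul_comm hx hy
    · intro y z hy hz
      rw [mul_add, add_mul, smul_add, hy, hz]
  · intro y z hy hz
    rw [mul_add, add_mul, smul_add, hy, hz]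

/-- The total differential `d = ∂ + ∂̄`. -/
def d (A : RCbba.{u}) : A.carrier →ₗ[ℂ] A.carrier := A.del + A.delbar

theorem d_apply (A : RCbba.{u}) (a : A.carrier) : A.d a = A.del a + A.delbar a := rfl

theorem d_mem_totGr (A : RCbba.{u}) {n : ℤ} {a : A.carrier} (ha : a ∈ A.totGr n) :
    A.d a ∈ A.totGr (n + 1) := by
  refine Grading.coarsen_induction a ha (by simp) ?_ ?_
  · rintro i rfl x hx
    exact Submodule.add_mem _ (mem_totGr (by rw [totalDegree_add]; rfl) (A.del_mem hx))
      (mem_totGr (by rw [totalDegree_add]; rfl) (A.delbar_mem hx))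
  · intro y z hy hz
    rw [map_add]
    exact Submodule.add_mem _ hy hz

theorem d_d (A : RCbba.{u}) (a : A.carrier) : A.d (A.d a) = 0 := by
  simp only [d_apply, map_add, A.del_del, A.delbar_delbar, A.delbar_del]
  abel

theorem d_leibniz (A : RCbba.{u}) {n : ℤ} {a : A.carrier} (ha : a ∈ A.totGr n) (b : A.carrier) :
    A.d (a * b) = A.d a * b + (n.negOnePow : ℤ) • (a * A.d b) := by
  refine Grading.coarsen_induction a ha (by simp) ?_ ?_
  · rintro i rfl x hx
    simp only [d_apply, A.del_leibniz hx, A.delbar_leibniz hx, add_mul, mul_add, smul_add,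
      totalDegree]
    abel
  · intro y z hy hz
    simp only [add_mul, map_add, hy, hz, smul_add]
    abel

theorem conj_d (A : RCbba.{u}) (a : A.carrier) : A.conj (A.d a) = A.d (A.conj a) := by
  rw [d_apply, d_apply, map_add, A.conj_del, A.conj_delbar, add_comm]

theorem conj_mem_totGr (A : RCbba.{u}) {n : ℤ} {a : A.carrier} (ha : a ∈ A.totGr n) :
    A.conj a ∈ A.totGr n := by
  refine Grading.coarsen_induction a ha (by simp) ?_ ?_
  · rintro i rfl x hx
    exact mem_totGr (by simp [totalDegree, add_comm]) (A.conj_mem hx)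
  · intro y z hy hz
    rw [map_add]
    exact Submodule.add_mem _ hy hz

theorem Hom.fn_d {A B : RCbba.{u}} (f : A ⟶ B) (a : A.carrier) :
    Hom.fn f (A.d a) = B.d (Hom.fn f a) := by
  rw [d_apply, d_apply, map_add, Hom.fn_del, Hom.fn_delbar]

theorem Hom.fn_totGr {A B : RCbba.{u}} (f : A ⟶ B) {n : ℤ} {a : A.carrier} (ha : a ∈ A.totGr n) :
    Hom.fn f a ∈ B.totGr n := by
  refine Grading.coarsen_induction a ha (by simp) ?_ ?_
  · rintro i rfl x hx
    exact mem_totGr rfl (Hom.fn_gr f hx)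
  · intro y z hy hz
    rw [map_add]
    exact Submodule.add_mem _ hy hz

/-- The total cdga `to(A)`, over `ℂ`. -/
def tot : RCbba.{u} ⥤ CDGA.{u} ℂ where
  obj A :=
    { carrier := A.carrier
      gr := A.totGr
      isInternal := A.totGr_isInternal
      one_mem := A.one_mem_totGr
      mul_mem := A.mul_mem_totGr
      mul_comm := A.mul_comm_totGr
      d := A.d
      d_mem := A.d_mem_totGr
      d_d := A.d_d
      leibniz := A.d_leibniz }
  map f :=
    { toAlgHom := Hom.fn f
      map_gr := Hom.fn_totGr f
      map_d := Hom.fn_d f }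

/-- The real subalgebra of elements fixed by the real structure. -/
noncomputable def fixed (A : RCbba.{u}) : Subalgebra ℝ A.carrier where
  carrier := {a | A.conj a = a}
  mul_mem' := by
    intro a b (ha : A.conj a = a) (hb : A.conj b = b)
    show A.conj (a * b) = a * b
    rw [A.conj_mul, ha, hb]
  add_mem' := by
    intro a b (ha : A.conj a = a) (hb : A.conj b = b)
    show A.conj (a + b) = a + b
    rw [map_add, ha, hb]
  algebraMap_mem' := by
    intro r
    show A.conj (algebraMap ℝ A.carrier r) = algebraMap ℝ A.carrier r
    rw [IsScalarTower.algebraMap_apply ℝ ℂ A.carrier, Algebra.algebraMap_eq_smul_one,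
      A.conj.map_smulₛₗ, A.conj_one]
    simp

theorem mem_fixed {A : RCbba.{u}} {a : A.carrier} : a ∈ A.fixed ↔ A.conj a = a := Iff.rfl

theorem conj_proj (A : RCbba.{u}) (n : ℤ) (a : A.carrier) :
    A.conj (Grading.proj A.totGr_isInternal n a) =
      Grading.proj A.totGr_isInternal n (A.conj a) := by
  refine Grading.induction A.totGr_isInternal a ?_ ?_
  · intro j y hy
    by_cases hj : j = n
    · subst hj
      rw [Grading.proj_same _ hy, Grading.proj_same _ (A.conj_mem_totGr hy)]
    · rw [Grading.proj_ne _ hj hy, Grading.proj_ne _ hj (A.conj_mem_totGr hy), map_zero]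
  · intro y z hy hz
    simp only [map_add, hy, hz]

/-- The component of degree `n` of the fixed points. -/
noncomputable def fixedGr (A : RCbba.{u}) (n : ℤ) : Submodule ℝ A.fixed :=
  ((A.totGr n).restrictScalars ℝ).comap A.fixed.val.toLinearMap

theorem fixedGr_isInternal (A : RCbba.{u}) : DirectSum.IsInternal A.fixedGr := by
  let π : ℤ → A.fixed → A.fixed := fun n a => ⟨Grading.proj A.totGr_isInternal n a, by
    show A.conj _ = _
    rw [conj_proj, show A.conj a = a from a.2]⟩
  refine Grading.isInternal_of_proj π (fun n => Subtype.ext (map_zero _))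
    (fun n x y => Subtype.ext (map_add _ _ _))
    (fun n x hx => Subtype.ext (Grading.proj_same _ hx))
    (fun m n hmn x hx => Subtype.ext (Grading.proj_ne _ hmn hx)) ?_
  intro x
  obtain ⟨s, hs⟩ := Grading.sum_proj A.totGr_isInternal (x : A.carrier)
  have : x = ∑ n ∈ s, π n x := by
    apply Subtype.ext
    rw [AddSubmonoidClass.coe_finsetSum]
    exact hs
  rw [this]
  exact Submodule.sum_mem _ fun i _ =>
    Submodule.mem_iSup_of_mem i (Grading.proj_mem A.totGr_isInternal i (x : A.carrier))

/-- The differential on the fixed points. -/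
noncomputable def fixedD (A : RCbba.{u}) : A.fixed →ₗ[ℝ] A.fixed where
  toFun a := ⟨A.d a, by
    show A.conj _ = _
    rw [conj_d, show A.conj a = a from a.2]⟩
  map_add' a b := Subtype.ext (map_add A.d _ _)
  map_smul' r a := Subtype.ext ((A.d.restrictScalars ℝ).map_smul r a)

/-- The real cdga `to(A)^{σ = Id}` of fixed points of the real structure in the total cdga. -/
noncomputable def totReal : RCbba.{u} ⥤ CDGA.{u} ℝ where
  obj A :=
    { carrier := A.fixed
      gr := A.fixedGr
      isInternal := A.fixedGr_isInternal
      one_mem := A.one_mem_totGr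
      mul_mem := fun ha hb => A.mul_mem_totGr ha hb
      mul_comm := fun ha hb => Subtype.ext (by simpa using A.mul_comm_totGr ha hb)
      d := A.fixedD
      d_mem := fun ha => A.d_mem_totGr ha
      d_d := fun a => Subtype.ext (A.d_d a)
      leibniz := fun ha b => Subtype.ext (A.d_leibniz ha b) }
  map {A B} f :=
    { toAlgHom := (((Hom.fn f).restrictScalars ℝ).comp A.fixed.val).codRestrict B.fixed
        fun a => by
          show B.conj (Hom.fn f a) = Hom.fn f a
          rw [← Hom.fn_conj, show A.conj a = a from a.2]
      map_gr := fun ha => Hom.fn_totGr f ha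
      map_d := fun a => Subtype.ext (Hom.fn_d f a) }

/-! ### The `∂∂̄`-property -/

/-- The natural map `H_BC(A) → H_dR(A)` induced by the identity. -/
noncomputable def bcToDR (A : RCbba.{u}) :
    A.bottChern.carrier →ₐ[ℂ] ((CDGA.H ℂ).obj (tot.obj A)).carrier :=
  Ideal.Quotient.liftₐ A.bcCoboundaries
    ((tot.obj A).cls.comp (Subalgebra.inclusion (fun a ha => by
      show A.d a = 0
      rw [d_apply, ha.1, ha.2, add_zero] : A.bcCocycles ≤ (tot.obj A).cocycles))) (by
    rintro a ⟨y, hy⟩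
    refine CDGA.cls_eq_zero.2 ⟨A.delbar y, ?_⟩
    show A.d (A.delbar y) = a
    rw [d_apply, A.delbar_delbar, add_zero, hy])

/-- The `∂∂̄`-property: the natural map `H_BC(A) → H_dR(A)` is injective. -/
def DDbar (A : RCbba.{u}) : Prop := Function.Injective A.bcToDR

theorem DDbar.exists_eq {A : RCbba.{u}} (h : A.DDbar) {a b : A.carrier} (h1 : A.del a = 0)
    (h2 : A.delbar a = 0) (hb : A.d b = a) : ∃ y, A.del (A.delbar y) = a := by
  have h0 : A.bcToDR (A.bcCls ⟨a, h1, h2⟩) = 0 := CDGA.cls_eq_zero.2 ⟨b, hb⟩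
  exact bcCls_eq_zero.1 (h (h0.trans (map_zero A.bcToDR).symm))

/-- Under the `∂∂̄`-property every class in `H_dR(A)` has a representative in `ker ∂ ∩ ker ∂̄`. -/
theorem DDbar.exists_representative {A : RCbba.{u}} (h : A.DDbar) {a : A.carrier}
    (ha : A.d a = 0) : ∃ c, A.del (a + A.d c) = 0 ∧ A.delbar (a + A.d c) = 0 := by
  let N : A.carrier →ₗ[ℂ] A.carrier :=
    DirectSum.toModule ℂ (ℤ × ℤ) A.carrier (fun i => (i.1 : ℂ) • (A.gr i).subtype) ∘ₗ
      (LinearEquiv.ofBijective (DirectSum.coeLinearMap A.gr) A.isInternal).symm.toLinearMap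
  have hN : ∀ i, ∀ x ∈ A.gr i, N x = (i.1 : ℂ) • x := by
    intro i x hx
    have he : (LinearEquiv.ofBijective (DirectSum.coeLinearMap A.gr) A.isInternal).symm x =
        DirectSum.lof ℂ (ℤ × ℤ) (fun i => A.gr i) i ⟨x, hx⟩ := by
      rw [LinearEquiv.symm_apply_eq]
      exact (DirectSum.coeLinearMap_lof A.gr i ⟨x, hx⟩).symm
    show DirectSum.toModule ℂ (ℤ × ℤ) A.carrier (fun i => (i.1 : ℂ) • (A.gr i).subtype)
      ((LinearEquiv.ofBijective (DirectSum.coeLinearMap A.gr) A.isInternal).symm x) = _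
    rw [he, DirectSum.toModule_lof]
    rfl
  have hdN : ∀ x, A.d (N x) = N (A.d x) - A.del x := by
    intro x
    refine Grading.induction A.isInternal x ?_ ?_
    · intro i y hy
      rw [hN i y hy, map_smul, d_apply, map_add, hN _ _ (A.del_mem hy), hN _ _ (A.delbar_mem hy)]
      simp only [Prod.fst_add, add_zero, Int.cast_add, Int.cast_one, add_smul, smul_add, one_smul]
      abel
    · intro y z hy hz
      simp only [map_add, hy, hz]
      abel
  have h1 : A.del (A.delbar a) = 0 := by
    have : A.delbar a = -A.del a := eq_neg_of_add_eq_zero_right ha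
    rw [this, map_neg, A.del_del, neg_zero]
  obtain ⟨c, hc⟩ := h.exists_eq (a := A.del a) (b := -N a) (A.del_del a)
    (by rw [A.delbar_del, h1, neg_zero])
    (by rw [map_neg, hdN, ha, map_zero, zero_sub, neg_neg])
  refine ⟨-c, ?_, ?_⟩
  · simp only [d_apply, map_add, map_neg, A.del_del, hc]
    abel
  · have : A.delbar a = -A.del a := eq_neg_of_add_eq_zero_right ha
    simp only [d_apply, map_add, map_neg, A.delbar_delbar, A.delbar_del, hc, this]
    abel

/-- Real elements of `ker ∂ ∩ ker ∂̄` are cocycles of `to(A)^{σ = Id}`. -/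
theorem mem_cocycles_totReal {A : RCbba.{u}} {a : A.carrier} (h : a ∈ A.bcCocycles)
    (hσ : A.conj a = a) : (⟨a, hσ⟩ : A.fixed) ∈ (totReal.obj A).cocycles :=
  Subtype.ext (show A.d a = 0 by rw [d_apply, h.1, h.2, add_zero])

theorem conj_half : starRingEnd ℂ (2⁻¹ : ℂ) = 2⁻¹ := by
  rw [map_inv₀, Complex.conj_ofNat]

/-- A real `d`-exact element is `d` of a real element. -/
theorem exists_real_primitive {A : RCbba.{u}} {a b : A.carrier} (hσ : A.conj a = a)
    (h : A.d b = a) : ∃ c : A.fixed, A.d c = a := by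
  refine ⟨⟨(2⁻¹ : ℂ) • (b + A.conj b), ?_⟩, ?_⟩
  · show A.conj _ = _
    rw [A.conj.map_smulₛₗ, map_add, A.conj_conj, add_comm b, conj_half]
  · show A.d ((2⁻¹ : ℂ) • (b + A.conj b)) = a
    rw [map_smul, map_add, ← conj_d, h, hσ, ← two_smul ℂ a, smul_smul]
    norm_num

theorem conj_average (A : RCbba.{u}) (a : A.bcCocycles) :
    A.conj ((2⁻¹ : ℂ) • (a + A.bcConj a) : A.bcCocycles) =
      ((2⁻¹ : ℂ) • (a + A.bcConj a) : A.bcCocycles) := by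
  show A.conj ((2⁻¹ : ℂ) • ((a : A.carrier) + A.conj a)) =
    (2⁻¹ : ℂ) • ((a : A.carrier) + A.conj a)
  rw [A.conj.map_smulₛₗ, map_add, A.conj_conj, add_comm (a : A.carrier), conj_half]

theorem bcCls_average (A : RCbba.{u}) (a : A.bcCocycles)
    (h : A.bottChern.conj (A.bcCls a) = A.bcCls a) :
    A.bcCls ((2⁻¹ : ℂ) • (a + A.bcConj a)) = A.bcCls a := by
  change A.bcCls (A.bcConj a) = A.bcCls a at h
  rw [map_smul, map_add, h, ← two_smul ℂ, smul_smul]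
  norm_num

/-- Every conjugation-invariant Bott-Chern class has a real representative. -/
theorem exists_real_representative (A : RCbba.{u}) (x : A.bottChern.fixed) :
    ∃ a : A.bcCocycles, A.conj a = a ∧ A.bcCls a = (x : A.bottChern.carrier) := by
  obtain ⟨x, hx⟩ := x
  obtain ⟨a, rfl⟩ := A.bcCls_surjective x
  exact ⟨_, A.conj_average a, A.bcCls_average a hx⟩

/-- A chosen real representative of a conjugation-invariant Bott-Chern class. -/
noncomputable def realRep (A : RCbba.{u}) (x : A.bottChern.fixed) : A.bcCocycles :=
  (A.exists_real_representative x).choose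

theorem conj_realRep (A : RCbba.{u}) (x : A.bottChern.fixed) :
    A.conj (A.realRep x) = A.realRep x := (A.exists_real_representative x).choose_spec.1

theorem bcCls_realRep (A : RCbba.{u}) (x : A.bottChern.fixed) :
    A.bcCls (A.realRep x) = (x : A.bottChern.carrier) :=
  (A.exists_real_representative x).choose_spec.2

/-- The class in `H(to(A)^{σ = Id})` of a real element of `ker ∂ ∩ ker ∂̄`. -/
noncomputable def realCls (A : RCbba.{u}) (a : A.bcCocycles) (h : A.conj a = a) :
    (totReal.obj A).cocycles ⧸ (totReal.obj A).coboundaries :=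
  (totReal.obj A).cls ⟨⟨a, h⟩, mem_cocycles_totReal a.2 h⟩

theorem realCls_eq (A : RCbba.{u}) {a b : A.bcCocycles} (ha : A.conj a = a) (hb : A.conj b = b)
    (h : A.bcCls a = A.bcCls b) : A.realCls a ha = A.realCls b hb := by
  rw [← sub_eq_zero, ← map_sub] at h
  obtain ⟨y, hy⟩ := bcCls_eq_zero.1 h
  obtain ⟨c, hc⟩ := exists_real_primitive (A := A) (a := (a : A.carrier) - b) (b := A.delbar y)
    (by rw [map_sub, ha, hb]) (by rw [d_apply, A.delbar_delbar, add_zero, hy]; rfl)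
  exact CDGA.cls_eq_cls.2 ⟨c, Subtype.ext hc⟩

/-- The algebra map `H_BC(A)^{σ = Id} → H(to(A)^{σ = Id})`, `[a] ↦ [a]` for `a` real. -/
noncomputable def bcToDRRealAlgHom (A : RCbba.{u}) : A.bottChern.fixed →ₐ[ℝ]
    (totReal.obj A).cocycles ⧸ (totReal.obj A).coboundaries where
  toFun x := A.realCls (A.realRep x) (A.conj_realRep x)
  map_one' := A.realCls_eq (b := 1) _ A.conj_one (by rw [bcCls_realRep]; rfl)
  map_mul' x y := by
    refine (A.realCls_eq (b := A.realRep x * A.realRep y) _ ?_ ?_).trans ?_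
    · show A.conj ((A.realRep x : A.carrier) * A.realRep y) = _
      rw [A.conj_mul, conj_realRep, conj_realRep]
      rfl
    · rw [map_mul, bcCls_realRep, bcCls_realRep, bcCls_realRep]
      rfl
    · exact map_mul (totReal.obj A).cls ⟨⟨_, A.conj_realRep x⟩, mem_cocycles_totReal (A.realRep x).2 _⟩
        ⟨⟨_, A.conj_realRep y⟩, mem_cocycles_totReal (A.realRep y).2 _⟩
  map_zero' := by
    refine (A.realCls_eq (b := 0) _ (map_zero A.conj) (by rw [bcCls_realRep, map_zero]; rfl)).trans ?_
    exact map_zero (totReal.obj A).cls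
  map_add' x y := by
    refine (A.realCls_eq (b := A.realRep x + A.realRep y) _ ?_ ?_).trans ?_
    · show A.conj ((A.realRep x : A.carrier) + A.realRep y) = _
      rw [map_add, conj_realRep, conj_realRep]
      rfl
    · rw [map_add, bcCls_realRep, bcCls_realRep, bcCls_realRep]
      rfl
    · exact map_add (totReal.obj A).cls ⟨⟨_, A.conj_realRep x⟩, mem_cocycles_totReal (A.realRep x).2 _⟩
        ⟨⟨_, A.conj_realRep y⟩, mem_cocycles_totReal (A.realRep y).2 _⟩
  commutes' r := by
    refine (A.realCls_eq (b := algebraMap ℝ A.bcCocycles r) _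
      (A.fixed.algebraMap_mem r) ?_).trans ?_
    · rw [bcCls_realRep]
      rfl
    · rfl

theorem bcToDRRealAlgHom_apply (A : RCbba.{u}) (x : A.bottChern.fixed) (a : A.bcCocycles)
    (h : A.conj a = a) (hx : A.bcCls a = (x : A.bottChern.carrier)) :
    A.bcToDRRealAlgHom x = A.realCls a h :=
  A.realCls_eq _ h (by rw [bcCls_realRep, hx])

/-- Any conjugation-invariant Bott-Chern class of total degree `n` has a real representative of
total degree `n`. -/
theorem exists_real_representative_gr (A : RCbba.{u}) {n : ℤ} (x : A.bottChern.fixed)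
    (hx : (x : A.bottChern.carrier) ∈ A.bottChern.totGr n) :
    ∃ a : A.bcCocycles, A.conj a = a ∧ A.bcCls a = (x : A.bottChern.carrier) ∧
      (a : A.carrier) ∈ A.totGr n := by
  obtain ⟨x, hσ⟩ := x
  have h : ∃ a : A.bcCocycles, A.bcCls a = x ∧ (a : A.carrier) ∈ A.totGr n := by
    refine Grading.coarsen_induction x hx ⟨0, map_zero _, Submodule.zero_mem _⟩ ?_ ?_
    · rintro i rfl _ ⟨a, ha, rfl⟩
      exact ⟨a, rfl, mem_totGr rfl ha⟩
    · rintro y z ⟨a, ha, ha'⟩ ⟨b, hb, hb'⟩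
      exact ⟨a + b, by rw [map_add, ha, hb]; rfl, Submodule.add_mem _ ha' hb'⟩
  obtain ⟨a, rfl, ha⟩ := h
  exact ⟨_, A.conj_average a, A.bcCls_average a hσ,
    Submodule.smul_mem _ _ (Submodule.add_mem _ ha (A.conj_mem_totGr ha))⟩

/-- The natural map `H_BC(A)^{σ = Id} → H_dR(A)^{σ = Id}` induced by the identity, where the
target is realized as the cohomology of `to(A)^{σ = Id}`. -/
noncomputable def bcToDRReal (A : RCbba.{u}) :
    totReal.obj (HBC.obj A) ⟶ (CDGA.H ℝ).obj (totReal.obj A) where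
  toAlgHom := A.bcToDRRealAlgHom
  map_gr := by
    intro n x hx
    obtain ⟨a, ha, hax, han⟩ := A.exists_real_representative_gr x hx
    exact ⟨⟨⟨a, ha⟩, mem_cocycles_totReal a.2 ha⟩, han,
      (A.bcToDRRealAlgHom_apply x a ha hax).symm⟩
  map_d := by
    intro x
    have h : A.bottChern.fixedD x = 0 :=
      Subtype.ext (add_zero (0 : A.bottChern.carrier))
    exact (congrArg A.bcToDRRealAlgHom h).trans (map_zero _)

theorem bcToDRReal_bijective {A : RCbba.{u}} (h : A.DDbar) :
    Function.Bijective A.bcToDRRealAlgHom := by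
  constructor
  · rw [injective_iff_map_eq_zero]
    intro x hx
    obtain ⟨c, hc⟩ := CDGA.cls_eq_zero.1 hx
    obtain ⟨y, hy⟩ := h.exists_eq (A.realRep x).2.1 (A.realRep x).2.2 (congrArg Subtype.val hc)
    apply Subtype.ext
    rw [← bcCls_realRep]
    exact bcCls_eq_zero.2 ⟨y, hy⟩
  · intro y
    obtain ⟨⟨⟨a, hσ⟩, ha⟩, rfl⟩ := CDGA.cls_surjective _ y
    have hσ' : A.conj a = a := hσ
    obtain ⟨c, hc1, hc2⟩ := h.exists_representative (a := a) (congrArg Subtype.val ha)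
    let b : A.bcCocycles := ⟨a + A.d c, hc1, hc2⟩
    refine ⟨⟨A.bcCls ((2⁻¹ : ℂ) • (b + A.bcConj b)), ?_⟩, ?_⟩
    · show A.bcCls (A.bcConj _) = _
      congr 1
      exact Subtype.ext (A.conj_average b)
    · refine (A.bcToDRRealAlgHom_apply _ _ (A.conj_average b) rfl).trans ?_
      refine CDGA.cls_eq_cls.2 ?_
      obtain ⟨e, he⟩ := exists_real_primitive (A := A)
        (a := (2⁻¹ : ℂ) • ((a + A.d c) + A.conj (a + A.d c)) - a)
        (b := (2⁻¹ : ℂ) • (c + A.conj c)) (by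
          rw [map_sub, hσ', A.conj.map_smulₛₗ, map_add, A.conj_conj, conj_half,
            add_comm (A.conj _)]) (by
          rw [map_smul, map_add, map_add, ← conj_d, hσ', eq_sub_iff_add_eq]
          have h2 : a = (2⁻¹ : ℂ) • (a + a) := by
            rw [← two_smul ℂ a, smul_smul]
            norm_num
          nth_rewrite 1 [h2]
          rw [← smul_add]
          congr 1
          abel)
      exact ⟨e, Subtype.ext he⟩

theorem isIso_bcToDRReal {A : RCbba.{u}} (h : A.DDbar) : IsIso A.bcToDRReal :=
  CDGA.isIso_of_bijective _ (bcToDRReal_bijective h)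

end RCbba

/-! ### Minimal algebras -/

namespace Grading

section

variable {ι k A : Type*} [CommRing k] [Ring A] [Algebra k A]

/-- A submodule is graded if it is spanned by its homogeneous elements. -/
def IsGradedSubmodule (gr : ι → Submodule k A) (W : Submodule k A) : Prop :=
  W ≤ ⨆ i, W ⊓ gr i

/-- The relations `x y = (-1)^{|x||y|} y x`, for homogeneous `x, y ∈ W`, in the tensor algebra on a
subspace `W` of a graded algebra; the degree of an element of `gr i` is `deg i`. -/
inductive CommRel (gr : ι → Submodule k A) (deg : ι → ℤ) (W : Submodule k A) :
    TensorAlgebra k W → TensorAlgebra k W → Prop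
  | comm {i j : ι} (x y : W) (hx : (x : A) ∈ gr i) (hy : (y : A) ∈ gr j) :
    CommRel gr deg W (TensorAlgebra.ι k x * TensorAlgebra.ι k y)
      (((deg i * deg j).negOnePow : ℤ) • (TensorAlgebra.ι k y * TensorAlgebra.ι k x))

/-- The free graded-commutative algebra `ΛW` on a graded subspace `W` of a graded algebra, over a
ring in which `2` is invertible. -/
abbrev FreeGradedComm (gr : ι → Submodule k A) (deg : ι → ℤ) (W : Submodule k A) : Type _ :=
  RingQuot (CommRel gr deg W)

/-- `A = ΛW`: the inclusion of `W` extends to an isomorphism of algebras `ΛW ≅ A`. -/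
def IsFreeOn (gr : ι → Submodule k A) (deg : ι → ℤ) (W : Submodule k A) : Prop :=
  ∃ e : FreeGradedComm gr deg W ≃ₐ[k] A, ∀ w : W,
    e (RingQuot.mkAlgHom k (CommRel gr deg W) (TensorAlgebra.ι k w)) = w

end

end Grading

/-- `A = ΛW` is a minimal (Sullivan) algebra: it is free on a graded space `W` of generators of
positive degrees, `W` has an exhaustive filtration by graded subspaces `F n`, starting from zero,
such that `d` maps `F (n + 1)` to `Λ(F n)`, and `d` has decomposable image, i.e. image in
`Λ^{≥ 2} W = W · W · A`. -/
structure CDGA.IsMinimalOn {k : Type} [Field k] (A : CDGA.{u} k) (W : Submodule k A.carrier)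
    (F : ℕ → Submodule k A.carrier) : Prop where
  graded : Grading.IsGradedSubmodule A.gr W
  pos : ∀ n ≤ 0, W ⊓ A.gr n = ⊥
  free : Grading.IsFreeOn A.gr id W
  filtration_zero : F 0 = ⊥
  filtration_mono : Monotone F
  filtration_iSup : ⨆ n, F n = W
  filtration_graded : ∀ n, Grading.IsGradedSubmodule A.gr (F n)
  d_mem_adjoin : ∀ n, ∀ x ∈ F (n + 1), A.d x ∈ Algebra.adjoin k (F n : Set A.carrier)
  d_decomposable : ∀ a, A.d a ∈ W * W * (⊤ : Submodule k A.carrier)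

/-- Minimal cdga's. -/
def CDGA.IsMinimal {k : Type} [Field k] (A : CDGA.{u} k) : Prop := ∃ W F, A.IsMinimalOn W F

/-- `A = ΛW` is a minimal `ℝ`-cbba: it is free on a bigraded, conjugation-invariant space `W` of
generators of positive total degrees, `W` has an exhaustive filtration by bigraded,
conjugation-invariant subspaces `F n`, starting from zero, such that `∂` and `∂̄` map `F (n + 1)` to
`Λ(F n)`, and `∂∂̄` has decomposable image, i.e. image in `Λ^{≥ 2} W = W · W · A`. -/
structure RCbba.IsMinimalOn (A : RCbba.{u}) (W : Submodule ℂ A.carrier)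
    (F : ℕ → Submodule ℂ A.carrier) : Prop where
  graded : Grading.IsGradedSubmodule A.gr W
  conj_mem : ∀ x ∈ W, A.conj x ∈ W
  pos : ∀ i, RCbba.totalDegree i ≤ 0 → W ⊓ A.gr i = ⊥
  free : Grading.IsFreeOn A.gr RCbba.totalDegree W
  filtration_zero : F 0 = ⊥
  filtration_mono : Monotone F
  filtration_iSup : ⨆ n, F n = W
  filtration_graded : ∀ n, Grading.IsGradedSubmodule A.gr (F n)
  filtration_conj : ∀ n, ∀ x ∈ F n, A.conj x ∈ F n
  del_mem_adjoin : ∀ n, ∀ x ∈ F (n + 1), A.del x ∈ Algebra.adjoin ℂ (F n : Set A.carrier)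
  delbar_mem_adjoin : ∀ n, ∀ x ∈ F (n + 1), A.delbar x ∈ Algebra.adjoin ℂ (F n : Set A.carrier)
  del_delbar_decomposable : ∀ a, A.del (A.delbar a) ∈ W * W * (⊤ : Submodule ℂ A.carrier)

/-- Minimal `ℝ`-cbba's. -/
def RCbba.IsMinimal (A : RCbba.{u}) : Prop := ∃ W F, A.IsMinimalOn W F

/-! ### Rational structures -/

/-- A cbba with rational structure `(A_ℚ, A_ℂ, φ)`: a rational cdga, an `ℝ`-cbba, and an
isomorphism `A_ℚ ⊗ ℝ ≅ to(A_ℂ)^{σ = Id}` in the homotopy category of real cdga's. -/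
structure RatCbba where
  Q : CDGA.{u} ℚ
  C : RCbba.{u}
  φ : (CDGA.toHo ℝ).obj ((CDGA.baseChange ℝ).obj Q) ≅ (CDGA.toHo ℝ).obj (RCbba.totReal.obj C)

namespace RatCbba

/-- A morphism of cbba's with rational structure. -/
structure Hom (A B : RatCbba.{u}) where
  fQ : A.Q ⟶ B.Q
  fC : A.C ⟶ B.C
  comm : A.φ.hom ≫ (CDGA.toHo ℝ).map (RCbba.totReal.map fC) =
    (CDGA.toHo ℝ).map ((CDGA.baseChange ℝ).map fQ) ≫ B.φ.hom

/-- Quasi-isomorphisms of cbba's with rational structure. -/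
def Hom.IsQuasiIso {A B : RatCbba.{u}} (f : Hom A B) : Prop := RCbba.PluriQuasiIso f.fC

/-- A cbba with rational structure is minimal if both underlying algebras are. -/
def IsMinimal (A : RatCbba.{u}) : Prop := A.Q.IsMinimal ∧ A.C.IsMinimal

/-- The map `H(A_ℚ ⊗ ℝ) → H(to(A_ℂ)^{σ = Id})` induced by `φ`. -/
noncomputable def Hφ (A : RatCbba.{u}) :
    (CDGA.H ℝ).obj ((CDGA.baseChange ℝ).obj A.Q) ⟶ (CDGA.H ℝ).obj (RCbba.totReal.obj A.C) :=
  (CDGA.HHo ℝ).map A.φ.hom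

instance (A : RatCbba.{u}) : IsIso A.Hφ := inferInstanceAs (IsIso ((CDGA.HHo ℝ).map A.φ.hom))

/-- The map `H(φ) : H(A_ℚ) ⊗ ℝ → H(A_ℂ)^{σ = Id}`, where the target is realized as
`H(to(A_ℂ)^{σ = Id})`. -/
noncomputable def cohomologyφ (A : RatCbba.{u}) :
    (CDGA.baseChange ℝ).obj ((CDGA.H ℚ).obj A.Q) ⟶ (CDGA.H ℝ).obj (RCbba.totReal.obj A.C) :=
  CDGA.cohomologyBaseChange ℝ A.Q ≫ A.Hφ

instance (A : RatCbba.{u}) : IsIso A.cohomologyφ :=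
  inferInstanceAs (IsIso (CDGA.cohomologyBaseChange ℝ A.Q ≫ A.Hφ))

/-- The cohomology `(H(A_ℚ), H_BC(A_ℂ), H(φ))` of a cbba with rational structure such that `A_ℂ` has
the `∂∂̄`-property; here `H_BC(A_ℂ)^{σ = Id}` is identified with `H(to(A_ℂ)^{σ = Id})` through the
natural isomorphism. -/
noncomputable def cohomology (A : RatCbba.{u}) (h : A.C.DDbar) : RatCbba.{u} where
  Q := (CDGA.H ℚ).obj A.Q
  C := RCbba.HBC.obj A.C
  φ :=
    haveI := RCbba.isIso_bcToDRReal h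
    (CDGA.toHo ℝ).mapIso (asIso A.cohomologyφ ≪≫ (asIso A.C.bcToDRReal).symm)

/-- Strong formality over `ℚ`: `A_ℂ` has the `∂∂̄`-property and `A` is connected by a chain of
quasi-isomorphisms to its cohomology. -/
def StronglyFormalOverQ (A : RatCbba.{u}) : Prop :=
  ∃ h : A.C.DDbar,
    Relation.EqvGen (fun B C : RatCbba.{u} => ∃ f : Hom B C, f.IsQuasiIso) A (A.cohomology h)

/-- For `p : A_ℂ → H_BC(A_ℂ)`, the composite
`to(A_ℂ)^{σ = Id} → H_BC(A_ℂ)^{σ = Id} → H(to(A_ℂ)^{σ = Id})`. -/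
noncomputable def realMap (A : RatCbba.{u}) (p : A.C ⟶ RCbba.HBC.obj A.C) :
    RCbba.totReal.obj A.C ⟶ (CDGA.H ℝ).obj (RCbba.totReal.obj A.C) :=
  RCbba.totReal.map p ≫ A.C.bcToDRReal

/-- `p` and `q` are compatible: `H(φ) ∘ H(q) = H(p) ∘ H(φ)`. -/
def Compatible (A : RatCbba.{u}) (p : A.C ⟶ RCbba.HBC.obj A.C) (q : A.Q ⟶ (CDGA.H ℚ).obj A.Q) :
    Prop :=
  (CDGA.H ℝ).map ((CDGA.baseChange ℝ).map q) ≫ (CDGA.H ℝ).map A.cohomologyφ =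
    A.Hφ ≫ (CDGA.H ℝ).map (A.realMap p)

/-- The square with sides `b ∘ φ ∘ a`, `p`, `q` and `H(φ)` commutes in the homotopy category of real
cdga's. -/
def SquareCommutes (A : RatCbba.{u}) (p : A.C ⟶ RCbba.HBC.obj A.C) (q : A.Q ⟶ (CDGA.H ℚ).obj A.Q)
    (a : A.Q ⟶ A.Q) (b : A.C ⟶ A.C) : Prop :=
  ((CDGA.toHo ℝ).map ((CDGA.baseChange ℝ).map a) ≫ A.φ.hom ≫
      (CDGA.toHo ℝ).map (RCbba.totReal.map b)) ≫ (CDGA.toHo ℝ).map (A.realMap p) =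
    (CDGA.toHo ℝ).map ((CDGA.baseChange ℝ).map q) ≫ (CDGA.toHo ℝ).map A.cohomologyφ

end RatCbba

/-! ### More on internal gradings -/

namespace Grading

section Internal

variable {ι k M : Type*} [DecidableEq ι] [Ring k] [AddCommGroup M] [Module k M]
  {gr : ι → Submodule k M}

/-! A minimal algebra behaves like a cofibrant object: it maps strictly through every surjection
with acyclic kernel (`CDGA.IsMinimal.exists_lift`, `RCbba.IsMinimal.exists_lift`). The lift grows
along the filtration of the generators. At each stage the failure to commute with the differentials
is closed and lies in the kernel, and a primitive of it in the kernel corrects the lift. For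
`ℝ`-cbba's, acyclic means that the Bott-Chern cohomology of the kernel vanishes; this already forces
its Dolbeault, Aeppli and total cohomology to vanish, and a surjection is a pluripotential
quasi-isomorphism exactly when its kernel is acyclic in this sense.

A general quasi-isomorphism is not surjective, but a path object factors it as a section of an
acyclic surjection followed by a surjection (`exists_factorization`). For cdga's the path object is
`Y ⊗ Λ(t, dt)`. For `ℝ`-cbba's it adjoins to `Y` a real variable t together with ∂t, ∂̄t and ∂∂̄t,
where all products of these three generators are zero; a closed path that starts at zero is ∂∂̄ of
the integral of its ∂∂̄t-coefficient. Consequently a chain of quasi-isomorphisms out of a minimal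
algebra collapses to one arrow, which gives the first two equivalences. For triples the chain
collapses as well: in the homotopy category the section is inverse to the acyclic surjection, so
compatibility with φ survives the lifting.

The second ingredient is rigidity. Let e be an endomorphism of a minimal algebra over a
quasi-isomorphism p to an algebra with zero differentials. Then e is homotopic to the identity
through paths that are constant after p (`exists_homotopy`). Differentiating the homotopy in t shows
for cdga's that e is the identity modulo decomposables. For `ℝ`-cbba's only ∂∂̄ is decomposable, so
e is the identity modulo decomposables, ∂-images and ∂̄-images, and one further application of ∂ or
∂̄ disposes of these. Hence e is onto by induction on the degree (`surjective_of_comp_eq`), and maps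
between two quasi-isomorphisms onto an algebra with zero differentials are automorphisms
(`isIso_of_comp_eq`). It follows that two such quasi-isomorphisms p and f differ by an automorphism
of the minimal algebra that is trivial in cohomology and an automorphism of the target
(`exists_iso_comp_eq`).

For the third equivalence, strong formality over ℚ provides one morphism (g, r) from A to its
cohomology whose square with φ and H(φ) commutes in the homotopy category. A compatible pair (q, p)
differs from (g, r) by cohomologically trivial automorphisms of A and by automorphisms of the two
cohomology algebras. The latter match under H(φ): this is an identity between maps of algebras with
zero differential, so it can be tested in cohomology, where it is the compatibility of p and q
(`RatCbba.exists_squareCommutes`). Conversely, p and q can be normalized to induce the canonical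
maps in cohomology, which makes them compatible. The automorphisms a and b of condition 3 then turn
(q a⁻¹, p b) into a morphism from A to its cohomology. -/

theorem finite_proj (h : DirectSum.IsInternal gr) (x : M) :
    {i | proj h i x ≠ 0}.Finite := by
  obtain ⟨s, hs⟩ := sum_proj h x
  refine s.finite_toSet.subset fun i hi => ?_
  by_contra his
  apply hi
  rw [hs, map_sum]
  refine Finset.sum_eq_zero fun j hj => ?_
  exact proj_ne h (fun hji => his (by rwa [← hji])) (proj_mem h j x)

theorem eq_zero_of_proj (h : DirectSum.IsInternal gr) {x : M} (hx : ∀ i, proj h i x = 0) :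
    x = 0 := by
  obtain ⟨s, hs⟩ := sum_proj h x
  rw [hs]
  exact Finset.sum_eq_zero fun i _ => hx i

theorem eq_of_proj (h : DirectSum.IsInternal gr) {x y : M} (hx : ∀ i, proj h i x = proj h i y) :
    x = y := by
  rw [← sub_eq_zero]
  exact eq_zero_of_proj h fun i => by rw [map_sub, hx, sub_self]

/-- An additive map preserving the gradings commutes with the projections. -/
theorem map_proj {k' N : Type*} [Ring k'] [AddCommGroup N] [Module k' N] {gr' : ι → Submodule k' N}
    (h : DirectSum.IsInternal gr) (h' : DirectSum.IsInternal gr') [Nonempty ι]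
    (f : M →+ N) (e : ι → ι) (he : Function.Injective e)
    (hf : ∀ i, ∀ x ∈ gr i, f x ∈ gr' (e i)) (i : ι) (x : M) :
    f (proj h i x) = proj h' (e i) (f x) := by
  refine induction h x ?_ ?_
  · intro j y hy
    by_cases hj : j = i
    · subst hj
      rw [proj_same _ hy, proj_same _ (hf _ _ hy)]
    · rw [proj_ne _ hj hy, proj_ne _ (fun h => hj (he h)) (hf _ _ hy), map_zero]
  · intro y z hy hz
    simp only [map_add, hy, hz]

/-- Submodules with separating, locally finite, compatible projections form a grading. -/
theorem isInternal_of_separating (π : ι → M →+ M) (h0 : ∀ i x, π i x ∈ gr i)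
    (h1 : ∀ i, ∀ x ∈ gr i, π i x = x) (h2 : ∀ i j, i ≠ j → ∀ x ∈ gr i, π j x = 0)
    (h3 : ∀ x, (∀ i, π i x = 0) → x = 0) (h4 : ∀ x, {i | π i x ≠ 0}.Finite) :
    DirectSum.IsInternal gr := by
  classical
  refine isInternal_of_proj (fun i x => π i x) (fun i => map_zero _) (fun i => map_add _) h1 h2 ?_
  intro x
  have : x = ∑ i ∈ (h4 x).toFinset, π i x := by
    rw [← sub_eq_zero]
    refine h3 _ fun j => ?_
    rw [map_sub, map_sum, sub_eq_zero]
    by_cases hj : π j x = 0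
    · rw [hj, eq_comm]
      refine Finset.sum_eq_zero fun i _ => ?_
      by_cases hij : i = j
      · subst hij
        rw [hj, map_zero]
      · exact h2 i j hij _ (h0 i x)
    · rw [Finset.sum_eq_single j (fun i _ hij => h2 i j hij _ (h0 i x)),
        h1 j _ (h0 j x)]
      intro hj'
      exact absurd ((h4 x).mem_toFinset.2 hj) hj'
  rw [this]
  exact Submodule.sum_mem _ fun i _ => Submodule.mem_iSup_of_mem i (h0 i x)

/-- Linear maps given on the homogeneous components glue. -/
theorem exists_linearMap {k M N : Type*} [CommRing k] [AddCommGroup M] [Module k M]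
    [AddCommGroup N] [Module k N] {gr : ι → Submodule k M} (h : DirectSum.IsInternal gr)
    (κ : ι → M →ₗ[k] N) : ∃ f : M →ₗ[k] N, ∀ i, ∀ x ∈ gr i, f x = κ i x := by
  refine ⟨DirectSum.toModule k ι N (fun i => κ i ∘ₗ (gr i).subtype) ∘ₗ
      (LinearEquiv.ofBijective (DirectSum.coeLinearMap gr) h).symm.toLinearMap, ?_⟩
  intro i x hx
  have he : (LinearEquiv.ofBijective (DirectSum.coeLinearMap gr) h).symm x =
      DirectSum.lof k ι (fun i => gr i) i ⟨x, hx⟩ := by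
    rw [LinearEquiv.symm_apply_eq]
    exact (DirectSum.coeLinearMap_lof gr i ⟨x, hx⟩).symm
  show DirectSum.toModule k ι N _
    ((LinearEquiv.ofBijective (DirectSum.coeLinearMap gr) h).symm x) = _
  rw [he, DirectSum.toModule_lof]
  rfl

end Internal

section Choice

variable {ι k M N : Type*} [DecidableEq ι] [Field k] [AddCommGroup M] [Module k M]
  [AddCommGroup N] [Module k N] {gr : ι → Submodule k M}

/-- A linear relation `R` that is total on `U₁` and contains `U₀ × 0` can be chosen linearly. -/
theorem exists_linear_choice {U₀ U₁ : Submodule k M} (R : Submodule k (M × N)) (h01 : U₀ ≤ U₁)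
    (h0 : ∀ w ∈ U₀, (w, 0) ∈ R) (h1 : ∀ w ∈ U₁, ∃ x, (w, x) ∈ R) :
    ∃ f : M →ₗ[k] N, (∀ w ∈ U₁, (w, f w) ∈ R) ∧ (∀ w ∈ U₀, f w = 0) ∧
      ∀ w, ∃ w' ∈ U₁, (w', f w) ∈ R := by
  obtain ⟨r₁, hr₁⟩ := LinearMap.exists_leftInverse_of_injective U₁.subtype
    (by rw [Submodule.ker_subtype])
  obtain ⟨r₀, hr₀⟩ := LinearMap.exists_leftInverse_of_injective U₀.subtype
    (by rw [Submodule.ker_subtype])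
  let R₁ : Submodule k (M × N) := R ⊓ U₁.comap (LinearMap.fst k M N)
  let q : R₁ →ₗ[k] U₁ := (LinearMap.fst k M N).restrict fun x hx => hx.2
  have hq : Function.Surjective q := by
    rintro ⟨w, hw⟩
    obtain ⟨x, hx⟩ := h1 w hw
    exact ⟨⟨(w, x), hx, hw⟩, rfl⟩
  obtain ⟨s, hs⟩ := LinearMap.exists_rightInverse_of_surjective q (LinearMap.range_eq_top.2 hq)
  -- On `U₁` this is `w ↦ w - r₀ w`, so it kills `U₀`. Adding the related pair `(r₀ w, 0)`
  -- afterwards recovers `w` itself without changing the value.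
  let c : M →ₗ[k] U₁ := r₁ - Submodule.inclusion h01 ∘ₗ r₀ ∘ₗ U₁.subtype ∘ₗ r₁
  have hsw : ∀ w : U₁, ((w : M), ((s w : M × N)).2) ∈ R := by
    intro w
    have h2 : ((s w : M × N)).1 = w := congrArg Subtype.val (LinearMap.congr_fun hs w)
    have h3 := (s w).2.1
    rw [← h2]
    exact h3
  refine ⟨LinearMap.snd k M N ∘ₗ R₁.subtype ∘ₗ s ∘ₗ c, ?_, ?_, ?_⟩
  · intro w hw
    have h2 : r₁ w = ⟨w, hw⟩ := LinearMap.congr_fun hr₁ ⟨w, hw⟩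
    have h3 : (c w : M) = w - r₀ w := by
      show ((r₁ w : M) - (r₀ (r₁ w : M) : M)) = _
      rw [h2]
    have h4 := R.add_mem (hsw (c w)) (h0 (r₀ w) (r₀ w).2)
    rw [h3] at h4
    simpa using h4
  · intro w hw
    have h2 : r₁ w = ⟨w, h01 hw⟩ := LinearMap.congr_fun hr₁ ⟨w, h01 hw⟩
    have h3 : r₀ w = ⟨w, hw⟩ := LinearMap.congr_fun hr₀ ⟨w, hw⟩
    have h4 : c w = 0 := by
      apply Subtype.ext
      show ((r₁ w : M) - (r₀ (r₁ w : M) : M)) = 0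
      rw [h2, h3, sub_self]
    show ((s (c w) : M × N)).2 = 0
    rw [h4, map_zero]
    rfl
  -- Also outside `U₁` the value is one that the relation allows, for the element `c w`. Conditions
  -- on values alone, such as a degree or membership in a kernel, therefore hold on the whole
  -- module.
  · intro w
    exact ⟨c w, (c w).2, hsw (c w)⟩

/-- The graded version of `exists_linear_choice`. -/
theorem exists_graded_choice (h : DirectSum.IsInternal gr) {U₀ U₁ : Submodule k M}
    (R : ι → Submodule k (M × N)) (h01 : U₀ ≤ U₁)
    (h0 : ∀ i, ∀ w ∈ U₀, w ∈ gr i → (w, 0) ∈ R i)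
    (h1 : ∀ i, ∀ w ∈ U₁, w ∈ gr i → ∃ x, (w, x) ∈ R i) :
    ∃ f : M →ₗ[k] N, (∀ i, ∀ w ∈ U₁, w ∈ gr i → (w, f w) ∈ R i) ∧
      (∀ i, ∀ w ∈ U₀, w ∈ gr i → f w = 0) ∧
      ∀ i, ∀ w ∈ gr i, ∃ w' ∈ U₁, (w', f w) ∈ R i := by
  choose κ hκ using fun i => exists_linear_choice (U₀ := U₀ ⊓ gr i) (U₁ := U₁ ⊓ gr i) (R i)
    (inf_le_inf_right _ h01) (fun w hw => h0 i w hw.1 hw.2) (fun w hw => h1 i w hw.1 hw.2)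
  obtain ⟨f, hf⟩ := exists_linearMap h κ
  refine ⟨f, ?_, ?_, ?_⟩
  · intro i w hw hwi
    rw [hf i w hwi]
    exact (hκ i).1 w ⟨hw, hwi⟩
  · intro i w hw hwi
    rw [hf i w hwi]
    exact (hκ i).2.1 w ⟨hw, hwi⟩
  · intro i w hwi
    rw [hf i w hwi]
    obtain ⟨w', hw', h2⟩ := (hκ i).2.2 w
    exact ⟨w', hw'.1, h2⟩

end Choice

/-! ### Graded-commutative algebras -/

/-- Algebra maps out of a free graded-commutative algebra. -/
theorem IsFreeOn.exists_lift {ι k A B : Type*} [AddCommGroup ι] [CommRing k] [Ring A]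
    [Algebra k A] [Ring B] [Algebra k B] {gr : ι → Submodule k A} {D : ι →+ ℤ} {W : Submodule k A}
    (hW : IsFreeOn gr D W) (ℓ : A →ₗ[k] B)
    (hℓ : ∀ i j, ∀ x ∈ W, ∀ y ∈ W, x ∈ gr i → y ∈ gr j →
      ℓ x * ℓ y = ((D i * D j).negOnePow : ℤ) • (ℓ y * ℓ x)) :
    ∃ f : A →ₐ[k] B, ∀ w ∈ W, f w = ℓ w := by
  obtain ⟨e, he⟩ := hW
  let g : FreeGradedComm gr D W →ₐ[k] B := RingQuot.liftAlgHom k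
    ⟨TensorAlgebra.lift k (ℓ ∘ₗ W.subtype), by
      rintro _ _ ⟨x, y, hx, hy⟩
      rw [map_mul, map_zsmul, map_mul, TensorAlgebra.lift_ι_apply, TensorAlgebra.lift_ι_apply]
      exact hℓ _ _ x x.2 y y.2 hx hy⟩
  refine ⟨g.comp e.symm.toAlgHom, fun w hw => ?_⟩
  have h1 : e.symm w = RingQuot.mkAlgHom k (CommRel gr D W) (TensorAlgebra.ι k ⟨w, hw⟩) := by
    rw [AlgEquiv.symm_apply_eq]
    exact (he ⟨w, hw⟩).symm
  show g (e.symm w) = ℓ w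
  rw [h1, RingQuot.liftAlgHom_mkAlgHom_apply, TensorAlgebra.lift_ι_apply]
  rfl

theorem IsFreeOn.adjoin_eq_top {ι k A : Type*} [CommRing k] [Ring A] [Algebra k A]
    {gr : ι → Submodule k A} {D : ι → ℤ} {W : Submodule k A}
    (hW : IsFreeOn gr D W) : Algebra.adjoin k (W : Set A) = ⊤ := by
  obtain ⟨e, he⟩ := hW
  rw [eq_top_iff]
  rintro x -
  obtain ⟨y, rfl⟩ := e.surjective x
  obtain ⟨z, rfl⟩ := RingQuot.mkAlgHom_surjective k (CommRel gr D W) y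
  induction z using TensorAlgebra.induction with
  | algebraMap r =>
    simp only [AlgHom.commutes, AlgEquiv.commutes]
    exact Subalgebra.algebraMap_mem _ r
  | ι w => rw [he]; exact Algebra.subset_adjoin w.2
  | mul a b ha hb => rw [map_mul, map_mul]; exact mul_mem ha hb
  | add a b ha hb => rw [map_add, map_add]; exact add_mem ha hb

section Algebra

variable {ι k A : Type*} [DecidableEq ι] [AddCommGroup ι] [CommRing k] [Ring A] [Algebra k A]

/-- The family `gr` is an algebra grading which is graded-commutative for the degree `D`. -/
structure IsGradedComm (D : ι →+ ℤ) (gr : ι → Submodule k A) : Prop where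
  isInternal : DirectSum.IsInternal gr
  one_mem : (1 : A) ∈ gr 0
  mul_mem : ∀ {i j : ι} {a b : A}, a ∈ gr i → b ∈ gr j → a * b ∈ gr (i + j)
  mul_comm : ∀ {i j : ι} {a b : A}, a ∈ gr i → b ∈ gr j →
    a * b = ((D i * D j).negOnePow : ℤ) • (b * a)

theorem neg_one_pow_smul_smul {M : Type*} [AddCommGroup M] (n : ℤ) (x : M) :
    ((n.negOnePow : ℤˣ) : ℤ) • ((n.negOnePow : ℤˣ) : ℤ) • x = x := by
  rw [smul_smul, ← Units.val_mul, ← Int.negOnePow_add, Int.negOnePow_even _ ⟨n, rfl⟩,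
    Units.val_one, one_smul]

namespace IsGradedComm

variable {D : ι →+ ℤ} {gr : ι → Submodule k A} (h : IsGradedComm D gr)

/-- The linear map underlying the sign automorphism. -/
noncomputable def signLin : A →ₗ[k] A :=
  (exists_linearMap h.isInternal
    fun i => ((D i).negOnePow : ℤ) • (LinearMap.id : A →ₗ[k] A)).choose

theorem signLin_apply {i : ι} {x : A} (hx : x ∈ gr i) :
    h.signLin x = ((D i).negOnePow : ℤ) • x :=
  (exists_linearMap h.isInternal
    fun i => ((D i).negOnePow : ℤ) • (LinearMap.id : A →ₗ[k] A)).choose_spec i x hx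

/-- The sign automorphism, `x ↦ (-1)^{|x|} x`. -/
noncomputable def sign : A →ₐ[k] A :=
  AlgHom.ofLinearMap h.signLin (by rw [h.signLin_apply h.one_mem]; simp) (by
    intro x y
    refine induction h.isInternal x ?_ ?_
    · intro i x hx
      refine induction h.isInternal y ?_ ?_
      · intro j y hy
        rw [h.signLin_apply hx, h.signLin_apply hy, h.signLin_apply (h.mul_mem hx hy), map_add,
          Int.negOnePow_add, Units.val_mul, smul_mul_smul_comm]
      · intro y z hy hz
        rw [mul_add, map_add, map_add, mul_add, hy, hz]
    · intro y z hy hz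
      rw [add_mul, map_add, map_add, add_mul, hy, hz])

theorem sign_apply {i : ι} {x : A} (hx : x ∈ gr i) : h.sign x = ((D i).negOnePow : ℤ) • x :=
  h.signLin_apply hx

theorem sign_mem {i : ι} {x : A} (hx : x ∈ gr i) : h.sign x ∈ gr i := by
  rw [h.sign_apply hx]
  exact zsmul_mem hx _

theorem sign_sign (x : A) : h.sign (h.sign x) = x := by
  refine induction h.isInternal x ?_ ?_
  · intro i x hx
    rw [h.sign_apply (h.sign_mem hx), h.sign_apply hx, neg_one_pow_smul_smul]
  · intro y z hy hz
    rw [map_add, map_add, hy, hz]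

/-- A map of odd degree anticommutes with the sign automorphism. -/
theorem sign_odd (f : A →+ A) (e : ι) (he : D e = 1) (hf : ∀ i, ∀ x ∈ gr i, f x ∈ gr (i + e))
    (x : A) : h.sign (f x) = -f (h.sign x) := by
  refine induction h.isInternal x ?_ ?_
  · intro i x hx
    rw [h.sign_apply (hf i x hx), h.sign_apply hx, map_zsmul, map_add, he, Int.negOnePow_succ,
      Units.val_neg, neg_smul]
  · intro y z hy hz
    rw [map_add, map_add, hy, hz, map_add, map_add, neg_add]

/-- A map preserving degrees commutes with the sign automorphisms. -/
theorem map_sign {k' B : Type*} [CommRing k'] [Ring B] [Algebra k' B] {gr' : ι → Submodule k' B}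
    (h' : IsGradedComm D gr') (f : A →+ B) (e : ι → ι) (he : ∀ i, D (e i) = D i)
    (hf : ∀ i, ∀ x ∈ gr i, f x ∈ gr' (e i)) (x : A) : f (h.sign x) = h'.sign (f x) := by
  refine induction h.isInternal x ?_ ?_
  · intro i x hx
    rw [h.sign_apply hx, h'.sign_apply (hf i x hx), map_zsmul, he]
  · intro y z hy hz
    simp only [map_add, hy, hz]

/-- The Leibniz rule, in terms of the sign automorphism. -/
theorem leibniz_sign (d : A →+ A) (hd : ∀ i, ∀ a ∈ gr i, ∀ b,
    d (a * b) = d a * b + ((D i).negOnePow : ℤ) • (a * d b)) (a b : A) :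
    d (a * b) = d a * b + h.sign a * d b := by
  refine induction h.isInternal a ?_ ?_
  · intro i x hx
    rw [hd i x hx, h.sign_apply hx, smul_mul_assoc]
  · intro y z hy hz
    simp only [add_mul, map_add, hy, hz]
    abel

end IsGradedComm

/-- Homogeneous elements of the subalgebra generated by a graded submodule can be treated by
multiplicative induction. -/
theorem adjoin_induction {gr : ι → Submodule k A} (h : DirectSum.IsInternal gr)
    {F : Submodule k A} (hF : IsGradedSubmodule gr F) (T : ι → Submodule k A)
    (hT : ∀ i, T i ≤ gr i) (hone : 1 ∈ T 0) (hgen : ∀ i, F ⊓ gr i ≤ T i)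
    (hmul : ∀ i j, ∀ a ∈ T i, ∀ b ∈ T j, a * b ∈ T (i + j)) {x : A}
    (hx : x ∈ Algebra.adjoin k (F : Set A)) {i : ι} (hxi : x ∈ gr i) : x ∈ T i := by
  have hmul' : ∀ a b, a ∈ iSup T → b ∈ iSup T → a * b ∈ iSup T := by
    intro a b ha hb
    refine Submodule.iSup_induction T (motive := fun a => a * b ∈ iSup T) ha ?_ (by simp) ?_
    · intro i a ha
      refine Submodule.iSup_induction T (motive := fun b => a * b ∈ iSup T) hb ?_ (by simp) ?_
      · intro j b hb
        exact Submodule.mem_iSup_of_mem _ (hmul i j a ha b hb)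
      · intro b c hb hc
        rw [mul_add]
        exact Submodule.add_mem _ hb hc
    · intro a c ha hc
      rw [add_mul]
      exact Submodule.add_mem _ ha hc
  -- The sum of the `T i` is a subalgebra containing the generators. As `T i` lies in `gr i`,
  -- projecting to degree `i` returns from the sum to `T i`.
  let S : Subalgebra k A := (iSup T).toSubalgebra (Submodule.mem_iSup_of_mem 0 hone) hmul'
  have hFS : Algebra.adjoin k (F : Set A) ≤ S := by
    refine Algebra.adjoin_le fun y hy => ?_
    have h1 : (⨆ i, F ⊓ gr i) ≤ iSup T := iSup_mono hgen
    exact h1 (hF hy)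
  have hxT : x ∈ iSup T := hFS hx
  have key : ∀ y ∈ iSup T, ∀ j, proj h j y ∈ T j := by
    intro y hy j
    refine Submodule.iSup_induction T (motive := fun y => proj h j y ∈ T j) hy ?_ (by simp) ?_
    · intro l z hz
      by_cases hl : l = j
      · subst hl
        rwa [proj_same h (hT _ hz)]
      · rw [proj_ne h hl (hT _ hz)]
        exact Submodule.zero_mem _
    · intro y z hy hz
      rw [map_add]
      exact Submodule.add_mem _ hy hz
  have := key x hxT i
  rwa [proj_same h hxi] at this

/-- An algebra map is graded if it is on a graded space of generators. -/
theorem map_mem_of_generators {B : Type*} [Ring B] [Algebra k B] {gr : ι → Submodule k A}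
    {gr' : ι → Submodule k B} {D D' : ι →+ ℤ}
    (h : IsGradedComm D gr) (h' : IsGradedComm D' gr') {W : Submodule k A}
    (hW : IsGradedSubmodule gr W) (htop : Algebra.adjoin k (W : Set A) = ⊤) (f : A →ₐ[k] B)
    (hf : ∀ i, ∀ w ∈ W, w ∈ gr i → f w ∈ gr' i) {i : ι} {x : A} (hx : x ∈ gr i) :
    f x ∈ gr' i := by
  refine (adjoin_induction h.isInternal hW
    (fun i => gr i ⊓ (gr' i).comap f.toLinearMap) (fun i => inf_le_left) ⟨h.one_mem, ?_⟩ ?_ ?_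
    (htop ▸ Algebra.mem_top : x ∈ Algebra.adjoin k (W : Set A)) hx).2
  · show f 1 ∈ gr' 0
    rw [map_one]
    exact h'.one_mem
  · rintro i w ⟨hw, hwi⟩
    exact ⟨hwi, hf i w hw hwi⟩
  · rintro i j a ⟨ha, ha'⟩ b ⟨hb, hb'⟩
    refine ⟨h.mul_mem ha hb, ?_⟩
    show f (a * b) ∈ gr' (i + j)
    rw [map_mul]
    exact h'.mul_mem ha' hb'

end Algebra

end Grading

/-! ### Sign automorphisms of cdga's and of `ℝ`-cbba's -/

namespace CDGA

variable {k : Type} [Field k]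

theorem isGradedComm (A : CDGA.{u} k) : Grading.IsGradedComm (AddMonoidHom.id ℤ) A.gr where
  isInternal := A.isInternal
  one_mem := A.one_mem
  mul_mem := A.mul_mem
  mul_comm := A.mul_comm

/-- The sign automorphism. -/
noncomputable def sign (A : CDGA.{u} k) : A.carrier →ₐ[k] A.carrier := A.isGradedComm.sign

theorem leibniz_sign (A : CDGA.{u} k) (a b : A.carrier) :
    A.d (a * b) = A.d a * b + A.sign a * A.d b :=
  A.isGradedComm.leibniz_sign A.d.toAddMonoidHom (fun _ _ ha b => A.leibniz ha b) a b

theorem sign_d (A : CDGA.{u} k) (a : A.carrier) : A.sign (A.d a) = -A.d (A.sign a) :=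
  A.isGradedComm.sign_odd A.d.toAddMonoidHom 1 rfl (fun _ _ ha => A.d_mem ha) a

theorem sign_sign (A : CDGA.{u} k) (a : A.carrier) : A.sign (A.sign a) = a :=
  A.isGradedComm.sign_sign a

theorem Hom.fn_sign {A B : CDGA.{u} k} (f : A ⟶ B) (a : A.carrier) :
    Hom.fn f (A.sign a) = B.sign (Hom.fn f a) :=
  A.isGradedComm.map_sign B.isGradedComm (Hom.fn f).toLinearMap.toAddMonoidHom id (fun _ => rfl)
    (fun _ _ ha => Hom.fn_gr f ha) a

theorem Hom.fn_proj {A B : CDGA.{u} k} (f : A ⟶ B) (n : ℤ) (a : A.carrier) :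
    Hom.fn f (Grading.proj A.isInternal n a) = Grading.proj B.isInternal n (Hom.fn f a) :=
  Grading.map_proj A.isInternal B.isInternal (Hom.fn f).toLinearMap.toAddMonoidHom id
    Function.injective_id (fun _ _ ha => Hom.fn_gr f ha) n a

end CDGA

namespace RCbba

/-- The total degree, as a homomorphism. -/
def degHom : ℤ × ℤ →+ ℤ where
  toFun := totalDegree
  map_zero' := rfl
  map_add' := totalDegree_add

theorem isGradedComm (A : RCbba.{u}) : Grading.IsGradedComm degHom A.gr where
  isInternal := A.isInternal
  one_mem := A.one_mem
  mul_mem := A.mul_mem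
  mul_comm := A.mul_comm

/-- The sign automorphism. -/
noncomputable def sign (A : RCbba.{u}) : A.carrier →ₐ[ℂ] A.carrier := A.isGradedComm.sign

theorem del_leibniz_sign (A : RCbba.{u}) (a b : A.carrier) :
    A.del (a * b) = A.del a * b + A.sign a * A.del b :=
  A.isGradedComm.leibniz_sign A.del.toAddMonoidHom (fun _ _ ha b => A.del_leibniz ha b) a b

theorem delbar_leibniz_sign (A : RCbba.{u}) (a b : A.carrier) :
    A.delbar (a * b) = A.delbar a * b + A.sign a * A.delbar b :=
  A.isGradedComm.leibniz_sign A.delbar.toAddMonoidHom (fun _ _ ha b => A.delbar_leibniz ha b) a b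

theorem sign_del (A : RCbba.{u}) (a : A.carrier) : A.sign (A.del a) = -A.del (A.sign a) :=
  A.isGradedComm.sign_odd A.del.toAddMonoidHom (1, 0) rfl (fun _ _ ha => A.del_mem ha) a

theorem sign_delbar (A : RCbba.{u}) (a : A.carrier) :
    A.sign (A.delbar a) = -A.delbar (A.sign a) :=
  A.isGradedComm.sign_odd A.delbar.toAddMonoidHom (0, 1) rfl (fun _ _ ha => A.delbar_mem ha) a

theorem sign_sign (A : RCbba.{u}) (a : A.carrier) : A.sign (A.sign a) = a :=
  A.isGradedComm.sign_sign a

theorem conj_sign (A : RCbba.{u}) (a : A.carrier) : A.conj (A.sign a) = A.sign (A.conj a) :=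
  A.isGradedComm.map_sign A.isGradedComm A.conj.toAddMonoidHom Prod.swap
    (fun i => add_comm i.2 i.1) (fun _ _ ha => A.conj_mem ha) a

theorem Hom.fn_sign {A B : RCbba.{u}} (f : A ⟶ B) (a : A.carrier) :
    Hom.fn f (A.sign a) = B.sign (Hom.fn f a) :=
  A.isGradedComm.map_sign B.isGradedComm (Hom.fn f).toLinearMap.toAddMonoidHom id (fun _ => rfl)
    (fun _ _ ha => Hom.fn_gr f ha) a

theorem Hom.fn_proj {A B : RCbba.{u}} (f : A ⟶ B) (i : ℤ × ℤ) (a : A.carrier) :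
    Hom.fn f (Grading.proj A.isInternal i a) = Grading.proj B.isInternal i (Hom.fn f a) :=
  Grading.map_proj A.isInternal B.isInternal (Hom.fn f).toLinearMap.toAddMonoidHom id
    Function.injective_id (fun _ _ ha => Hom.fn_gr f ha) i a

end RCbba

/-! ### Lifting maps out of minimal algebras -/

namespace Grading

@[elab_as_elim]
theorem IsGradedSubmodule.induction {ι k A : Type*} [CommRing k] [Ring A] [Algebra k A]
    {gr : ι → Submodule k A} {W : Submodule k A} (hW : IsGradedSubmodule gr W) {P : A → Prop}
    (x : A) (hx : x ∈ W) (zero : P 0) (hom : ∀ i, ∀ y ∈ W, y ∈ gr i → P y)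
    (add : ∀ y z, P y → P z → P (y + z)) : P x :=
  Submodule.iSup_induction (fun i => W ⊓ gr i) (motive := P) (hW hx)
    (fun i y hy => hom i y hy.1 hy.2) zero add

/-- Successive extension of linear maps along an increasing sequence of subspaces. -/
theorem exists_limit {k M N : Type*} [Field k] [AddCommGroup M] [Module k M] [AddCommGroup N]
    [Module k N] {F : ℕ → Submodule k M} (hF : Monotone F) (P : ℕ → (M →ₗ[k] N) → Prop)
    (base : ∃ ℓ, P 0 ℓ)
    (step : ∀ n ℓ, P n ℓ → ∃ ℓ', P (n + 1) ℓ' ∧ ∀ w ∈ F n, ℓ' w = ℓ w) :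
    ∃ (ℓ : ℕ → M →ₗ[k] N) (ℓ' : M →ₗ[k] N), (∀ n, P n (ℓ n)) ∧ ∀ n, ∀ w ∈ F n, ℓ' w = ℓ n w := by
  let s : (n : ℕ) → {ℓ // P n ℓ} := fun n => Nat.rec ⟨base.choose, base.choose_spec⟩
    (fun n ℓ => ⟨(step n ℓ.1 ℓ.2).choose, (step n ℓ.1 ℓ.2).choose_spec.1⟩) n
  have hs : ∀ n, ∀ w ∈ F n, (s (n + 1)).1 w = (s n).1 w :=
    fun n => (step n (s n).1 (s n).2).choose_spec.2
  have hs' : ∀ n m, n ≤ m → ∀ w ∈ F n, (s m).1 w = (s n).1 w := by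
    intro n m hnm
    induction m, hnm using Nat.le_induction with
    | base => exact fun _ _ => rfl
    | succ m hnm ih => exact fun w hw => (hs m w (hF hnm hw)).trans (ih w hw)
  have hmem : ∀ w : (⨆ n, F n : Submodule k M), ∃ n, (w : M) ∈ F n := fun w =>
    (Submodule.mem_iSup_of_directed F hF.directed_le).1 w.2
  choose n hn using hmem
  have key : ∀ (w : (⨆ n, F n : Submodule k M)) m, (w : M) ∈ F m →
      (s (n w)).1 w = (s m).1 w := by
    intro w m hm
    rw [← hs' _ _ (le_max_left (n w) m) w (hn w), ← hs' _ _ (le_max_right (n w) m) w hm]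
  let g : (⨆ n, F n : Submodule k M) →ₗ[k] N :=
    { toFun := fun w => (s (n w)).1 w
      map_add' := by
        intro v w
        have hv := hF (le_max_left (n v) (n w)) (hn v)
        have hw := hF (le_max_right (n v) (n w)) (hn w)
        rw [key v _ hv, key w _ hw, key (v + w) _ (Submodule.add_mem _ hv hw)]
        exact map_add _ _ _
      map_smul' := by
        intro c w
        rw [key (c • w) _ (Submodule.smul_mem _ c (hn w))]
        exact map_smul _ _ _ }
  -- Off the union of the filtration the values are arbitrary.
  obtain ⟨ℓ', hℓ'⟩ := LinearMap.exists_extend g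
  refine ⟨fun n => (s n).1, ℓ', fun n => (s n).2, fun m w hw => ?_⟩
  have h1 : w ∈ (⨆ n, F n : Submodule k M) := Submodule.mem_iSup_of_mem m hw
  exact (LinearMap.congr_fun hℓ' ⟨w, h1⟩).trans (key ⟨w, h1⟩ m hw)

/-- Twisted derivations agree on a subalgebra if they agree on generators. -/
theorem map_deriv_of_generators {k A B : Type*} [CommRing k] [Ring A] [Algebra k A] [Ring B]
    [Algebra k B] (h : A →ₐ[k] B) {d s : A →ₗ[k] A} {d' s' : B →ₗ[k] B}
    (hd : ∀ a b, d (a * b) = d a * b + s a * d b) (hd' : ∀ a b, d' (a * b) = d' a * b + s' a * d' b)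
    (hs : ∀ a, h (s a) = s' (h a)) (hd1 : d 1 = 0) (hd1' : d' 1 = 0) {F : Submodule k A}
    (hF : ∀ w ∈ F, h (d w) = d' (h w)) {x : A} (hx : x ∈ Algebra.adjoin k (F : Set A)) :
    h (d x) = d' (h x) := by
  induction hx using Algebra.adjoin_induction with
  | mem w hw => exact hF w hw
  | algebraMap r =>
    rw [Algebra.algebraMap_eq_smul_one, map_smul, hd1, map_smul, map_smul, map_smul, map_one, hd1',
      map_zero, smul_zero]
  | add a b _ _ ha hb => simp only [map_add, ha, hb]
  | mul a b _ _ ha hb => simp only [map_add, map_mul, hd, hd', ha, hb, hs]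

theorem algHom_eqOn_adjoin {k A B : Type*} [CommRing k] [Ring A] [Algebra k A] [Ring B]
    [Algebra k B] {f g : A →ₐ[k] B} {F : Submodule k A} (h : ∀ w ∈ F, f w = g w) {x : A}
    (hx : x ∈ Algebra.adjoin k (F : Set A)) : f x = g x :=
  (AlgHom.eqOn_adjoin_iff.2 fun w hw => h w hw) hx

end Grading

namespace CDGA

variable {k : Type} [Field k]

theorem d_one (A : CDGA.{u} k) : A.d 1 = 0 := by simpa using A.leibniz A.one_mem 1

/-- The kernel of a morphism is acyclic. -/
def AcyclicKer {A B : CDGA.{u} k} (f : A ⟶ B) : Prop :=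
  ∀ x, Hom.fn f x = 0 → A.d x = 0 → ∃ y, Hom.fn f y = 0 ∧ A.d y = x

/-- Minimal algebras lift strictly against surjections with acyclic kernel. -/
theorem IsMinimal.exists_lift {A X Y : CDGA.{u} k} (hA : A.IsMinimal) (f : X ⟶ Y)
    (hf : Function.Surjective (Hom.fn f)) (hK : AcyclicKer f) (g : A ⟶ Y) :
    ∃ h : A ⟶ X, h ≫ f = g := by
  obtain ⟨W, F, hW⟩ := hA
  have htop := hW.free.adjoin_eq_top
  have hFW : ∀ n, F n ≤ W := fun n => hW.filtration_iSup ▸ le_iSup F n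
  have hext : ∀ ℓ : A.carrier →ₗ[k] X.carrier, (∀ i, ∀ w ∈ W, w ∈ A.gr i → ℓ w ∈ X.gr i) →
      ∃ h : A.carrier →ₐ[k] X.carrier, ∀ w ∈ W, h w = ℓ w := fun ℓ hℓ =>
    Grading.IsFreeOn.exists_lift (D := AddMonoidHom.id ℤ) hW.free ℓ fun i j x hx y hy hxi hyj =>
      X.mul_comm (hℓ i x hx hxi) (hℓ j y hy hyj)
  have hgr : ∀ (ℓ : A.carrier →ₗ[k] X.carrier) (h : A.carrier →ₐ[k] X.carrier),
      (∀ i, ∀ w ∈ W, w ∈ A.gr i → ℓ w ∈ X.gr i) → (∀ w ∈ W, h w = ℓ w) →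
      ∀ i, ∀ x ∈ A.gr i, h x ∈ X.gr i := fun ℓ h hℓ hh i x hx =>
    Grading.map_mem_of_generators A.isGradedComm X.isGradedComm hW.graded htop h
      (fun i w hw hwi => by rw [hh w hw]; exact hℓ i w hw hwi) hx
  have hder : ∀ (h : A.carrier →ₐ[k] X.carrier), (∀ i, ∀ x ∈ A.gr i, h x ∈ X.gr i) →
      ∀ U : Submodule k A.carrier, (∀ w ∈ U, h (A.d w) = X.d (h w)) →
      ∀ x ∈ Algebra.adjoin k (U : Set A.carrier), h (A.d x) = X.d (h x) := fun h hh U hU x hx =>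
    Grading.map_deriv_of_generators (s := A.sign.toLinearMap) (s' := X.sign.toLinearMap) h
      A.leibniz_sign X.leibniz_sign
      (A.isGradedComm.map_sign X.isGradedComm h.toLinearMap.toAddMonoidHom id (fun _ => rfl) hh)
      A.d_one X.d_one hU hx
  -- The linear map prescribes the lift on the generators. The last clause says that the algebra map
  -- it generates commutes with `d` on `F n`; since it speaks of every `h` that agrees with `ℓ` on
  -- `W`, it depends on `ℓ` alone and no choice of `h` is carried along.
  let P : ℕ → (A.carrier →ₗ[k] X.carrier) → Prop := fun n ℓ =>
    (∀ i, ∀ w ∈ W, w ∈ A.gr i → ℓ w ∈ X.gr i) ∧ (∀ w ∈ W, Hom.fn f (ℓ w) = Hom.fn g w) ∧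
    ∀ h : A.carrier →ₐ[k] X.carrier, (∀ w ∈ W, h w = ℓ w) → ∀ w ∈ F n, h (A.d w) = X.d (ℓ w)
  have base : ∃ ℓ, P 0 ℓ := by
    obtain ⟨ℓ, h1, -, -⟩ := Grading.exists_graded_choice (N := X.carrier) A.isInternal
      (U₀ := ⊥) (U₁ := W)
      (fun i => (X.gr i).comap (LinearMap.snd k A.carrier X.carrier) ⊓
        LinearMap.eqLocus ((Hom.fn f).toLinearMap ∘ₗ LinearMap.snd k _ _)
          ((Hom.fn g).toLinearMap ∘ₗ LinearMap.fst k _ _))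
      bot_le (by
        rintro i w (rfl : w = 0) -
        exact Submodule.zero_mem _) (by
        intro i w _ hwi
        obtain ⟨x, hx⟩ := hf (Hom.fn g w)
        refine ⟨Grading.proj X.isInternal i x, Grading.proj_mem _ _ _, ?_⟩
        show Hom.fn f (Grading.proj X.isInternal i x) = Hom.fn g w
        rw [Hom.fn_proj, hx, Grading.proj_same _ (Hom.fn_gr g hwi)])
    refine ⟨ℓ, fun i w hw hwi => (h1 i w hw hwi).1, ?_, ?_⟩
    · intro w hw
      refine hW.graded.induction w hw (by simp) (fun i w hw hwi => (h1 i w hw hwi).2) ?_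
      intro y z hy hz
      simp only [map_add, hy, hz]
    · intro h _ w hw
      rw [hW.filtration_zero] at hw
      rw [(Submodule.mem_bot k).1 hw]
      simp
  have step : ∀ n ℓ, P n ℓ → ∃ ℓ', P (n + 1) ℓ' ∧ ∀ w ∈ F n, ℓ' w = ℓ w := by
    rintro n ℓ ⟨h1, h2, h3⟩
    obtain ⟨h, hh⟩ := hext ℓ h1
    have hgrh := hgr ℓ h h1 hh
    have hdh : ∀ x ∈ Algebra.adjoin k (F n : Set A.carrier), h (A.d x) = X.d (h x) :=
      hder h hgrh (F n) fun w hw => by rw [h3 h hh w hw, hh w (hFW n hw)]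
    have hfh : ∀ x, Hom.fn f (h x) = Hom.fn g x := fun x =>
      Grading.algHom_eqOn_adjoin (f := (Hom.fn f).comp h) (F := W)
        (fun w hw => by rw [← h2 w hw, ← hh w hw]; rfl) (htop ▸ Algebra.mem_top)
    -- The correction: `κ w` is a primitive, within the kernel of `f`, of the obstruction `h (d w) -
    -- d (ℓ w)`. On `F n` the obstruction is zero and `κ` is chosen zero.
    obtain ⟨κ, k1, k2, k3⟩ := Grading.exists_graded_choice (N := X.carrier) A.isInternal
      (U₀ := F n) (U₁ := F (n + 1))
      (fun i => (X.gr i).comap (LinearMap.snd k A.carrier X.carrier) ⊓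
        (LinearMap.ker ((Hom.fn f).toLinearMap ∘ₗ LinearMap.snd k _ _) ⊓
        LinearMap.eqLocus (X.d ∘ₗ LinearMap.snd k _ _)
          ((h.toLinearMap ∘ₗ A.d - X.d ∘ₗ ℓ) ∘ₗ LinearMap.fst k _ _)))
      (hW.filtration_mono n.le_succ) (by
        intro i w hw hwi
        refine ⟨Submodule.zero_mem _, map_zero (Hom.fn f), ?_⟩
        show X.d 0 = h (A.d w) - X.d (ℓ w)
        rw [h3 h hh w hw, map_zero, sub_self]) (by
        intro i w hw hwi
        have hadj := hW.d_mem_adjoin n w hw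
        have ha : h (A.d w) - X.d (ℓ w) ∈ X.gr (i + 1) :=
          sub_mem (hgrh _ _ (A.d_mem hwi)) (X.d_mem (h1 i w (hFW _ hw) hwi))
        -- The obstruction is in the kernel because `ℓ` lifts `g`, and it is closed because `d w`
        -- lies in Λ(F n), where `h` already commutes with `d`.
        obtain ⟨y, hy, hy'⟩ := hK (h (A.d w) - X.d (ℓ w))
          (by rw [map_sub, hfh, Hom.fn_d, Hom.fn_d, h2 w (hFW _ hw), sub_self])
          (by rw [map_sub, X.d_d, ← hdh _ hadj, A.d_d, map_zero, sub_zero])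
        refine ⟨Grading.proj X.isInternal i y, Grading.proj_mem _ _ _, ?_, ?_⟩
        · show Hom.fn f (Grading.proj X.isInternal i y) = 0
          rw [Hom.fn_proj, hy, map_zero]
        · show X.d (Grading.proj X.isInternal i y) = h (A.d w) - X.d (ℓ w)
          rw [X.d_proj, hy', Grading.proj_same _ ha])
    have k4 : ∀ x, Hom.fn f (κ x) = 0 := by
      intro x
      refine Grading.induction A.isInternal x ?_ ?_
      · intro i w hwi
        obtain ⟨w', -, -, h5, -⟩ := k3 i w hwi
        exact h5
      · intro y z hy hz
        rw [map_add, map_add, hy, hz, add_zero]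
    have k5 : ∀ w ∈ F n, κ w = 0 := by
      intro w hw
      refine (hW.filtration_graded n).induction w hw (map_zero κ) (fun i w hw hwi => k2 i w hw hwi)
        ?_
      intro y z hy hz
      rw [map_add, hy, hz, add_zero]
    have k6 : ∀ w ∈ F (n + 1), X.d (κ w) = h (A.d w) - X.d (ℓ w) := by
      intro w hw
      refine (hW.filtration_graded (n + 1)).induction w hw (by simp)
        (fun i w hw hwi => (k1 i w hw hwi).2.2) ?_
      intro y z hy hz
      simp only [map_add, hy, hz]
      abel
    have k7 : ∀ w ∈ F n, (ℓ + κ) w = ℓ w := fun w hw => by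
      rw [LinearMap.add_apply, k5 w hw, add_zero]
    refine ⟨ℓ + κ, ⟨?_, ?_, ?_⟩, k7⟩
    · intro i w hw hwi
      obtain ⟨w', -, h5, -⟩ := k3 i w hwi
      exact add_mem (h1 i w hw hwi) h5
    · intro w hw
      rw [LinearMap.add_apply, map_add, k4, add_zero, h2 w hw]
    · intro h' hh' w hw
      -- `d w` is a polynomial in elements of `F n`, where `κ` vanishes, so the correction of `ℓ`
      -- does not move its image.
      have h8 : h' (A.d w) = h (A.d w) := Grading.algHom_eqOn_adjoin (F := F n)
        (fun v hv => by rw [hh' v (hFW n hv), hh v (hFW n hv), k7 v hv]) (hW.d_mem_adjoin n w hw)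
      rw [h8, LinearMap.add_apply, map_add, k6 w hw]
      abel
  obtain ⟨ℓ, ℓ', hℓ, hℓ'⟩ := Grading.exists_limit hW.filtration_mono P base step
  have hmem : ∀ w ∈ W, ∃ n, w ∈ F n := fun w hw => by
    rw [← hW.filtration_iSup] at hw
    exact (Submodule.mem_iSup_of_directed F hW.filtration_mono.directed_le).1 hw
  have g1 : ∀ i, ∀ w ∈ W, w ∈ A.gr i → ℓ' w ∈ X.gr i := by
    intro i w hw hwi
    obtain ⟨n, hn⟩ := hmem w hw
    rw [hℓ' n w hn]
    exact (hℓ n).1 i w hw hwi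
  obtain ⟨h, hh⟩ := hext ℓ' g1
  have hgrh := hgr ℓ' h g1 hh
  refine ⟨⟨h, fun {i} {x} hx => hgrh i x hx, fun x => hder h hgrh W ?_ x
    (htop ▸ Algebra.mem_top)⟩, hom_ext fun x => ?_⟩
  · intro w hw
    obtain ⟨n, hn⟩ := hmem w hw
    -- The element is viewed one stage higher, since the filtration condition puts `d w` in Λ(F n)
    -- for `w` in `F (n + 1)`.
    have hn1 := hW.filtration_mono n.le_succ hn
    obtain ⟨h', hh'⟩ := hext (ℓ (n + 1)) (hℓ (n + 1)).1
    have h8 : h (A.d w) = h' (A.d w) := Grading.algHom_eqOn_adjoin (F := F n)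
      (fun v hv => by
        rw [hh v (hFW n hv), hh' v (hFW n hv), hℓ' (n + 1) v (hW.filtration_mono n.le_succ hv)])
      (hW.d_mem_adjoin n w hn1)
    rw [h8, (hℓ (n + 1)).2.2 h' hh' w hn1, hh w hw, hℓ' (n + 1) w hn1]
  · refine Grading.algHom_eqOn_adjoin (f := (Hom.fn f).comp h) (g := Hom.fn g) (F := W) ?_
      (htop ▸ Algebra.mem_top)
    intro w hw
    obtain ⟨n, hn⟩ := hmem w hw
    show Hom.fn f (h w) = Hom.fn g w
    rw [hh w hw, hℓ' n w hn, (hℓ n).2.1 w hw]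

end CDGA

/-! ### Acyclic kernels and lifting for `ℝ`-cbba's -/

namespace RCbba

/-- The kernel of a morphism has vanishing Bott-Chern cohomology. -/
def AcyclicKer {A B : RCbba.{u}} (f : A ⟶ B) : Prop :=
  ∀ x, Hom.fn f x = 0 → A.del x = 0 → A.delbar x = 0 →
    ∃ y, Hom.fn f y = 0 ∧ A.del (A.delbar y) = x

section Acyclic

variable {A B : RCbba.{u}} {f : A ⟶ B}

/-- The element ∂b is closed for both differentials, hence of the form ∂∂̄y. Now b − ∂̄y is closed
for both, hence ∂∂̄z = −∂̄∂z, which is also a ∂̄-boundary. -/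
theorem AcyclicKer.exists_delbar_primitive (hf : AcyclicKer f) {b : A.carrier}
    (hb : Hom.fn f b = 0) (hb' : A.delbar b = 0) : ∃ y, Hom.fn f y = 0 ∧ A.delbar y = b := by
  obtain ⟨y, hy, hy'⟩ := hf (A.del b) (by rw [Hom.fn_del, hb, map_zero]) (A.del_del b)
    (by rw [A.delbar_del, hb', map_zero, neg_zero])
  obtain ⟨z, hz, hz'⟩ := hf (b - A.delbar y)
    (by rw [map_sub, Hom.fn_delbar, hb, hy, map_zero, sub_zero])
    (by rw [map_sub, hy', sub_self]) (by rw [map_sub, hb', A.delbar_delbar, sub_zero])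
  refine ⟨y - A.del z, by rw [map_sub, Hom.fn_del, hy, hz, map_zero, sub_zero], ?_⟩
  rw [map_sub, A.delbar_del, hz']
  abel

/-- The common primitives with respect to both differentials in an acyclic kernel. -/
theorem AcyclicKer.exists_common_primitive (hf : AcyclicKer f) {a b : A.carrier}
    (ha : Hom.fn f a = 0) (hb : Hom.fn f b = 0) (ha' : A.del a = 0) (hb' : A.delbar b = 0)
    (hab : A.delbar a + A.del b = 0) :
    ∃ y, Hom.fn f y = 0 ∧ A.del y = a ∧ A.delbar y = b := by
  obtain ⟨y, hy, hy'⟩ := hf.exists_delbar_primitive hb hb'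
  -- With y a ∂̄-primitive of b, the error a − ∂y is closed for both differentials, so it is ∂∂̄z.
  -- Adding ∂̄z to y repairs ∂ and leaves ∂̄ unchanged.
  obtain ⟨z, hz, hz'⟩ := hf (a - A.del y)
    (by rw [map_sub, Hom.fn_del, ha, hy, map_zero, sub_zero])
    (by rw [map_sub, ha', A.del_del, sub_zero])
    (by
      rw [map_sub, A.delbar_del, hy', sub_neg_eq_add, hab])
  refine ⟨y + A.delbar z, by rw [map_add, Hom.fn_delbar, hy, hz, map_zero, add_zero], ?_, ?_⟩
  · rw [map_add, hz']
    abel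
  · rw [map_add, A.delbar_delbar, hy', add_zero]

/-- The Aeppli cohomology of an acyclic kernel vanishes. -/
theorem AcyclicKer.aeppli (hf : AcyclicKer f) {x : A.carrier} (hx : Hom.fn f x = 0)
    (hx' : A.del (A.delbar x) = 0) :
    ∃ y z, Hom.fn f y = 0 ∧ Hom.fn f z = 0 ∧ A.del y + A.delbar z = x := by
  -- From ∂̄x = ∂∂̄y = −∂̄∂y it follows that x + ∂y is ∂̄-closed.
  obtain ⟨y, hy, hy'⟩ := hf (A.delbar x) (by rw [Hom.fn_delbar, hx, map_zero]) hx'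
    (A.delbar_delbar x)
  obtain ⟨z, hz, hz'⟩ := hf.exists_delbar_primitive (b := x + A.del y)
    (by rw [map_add, Hom.fn_del, hx, hy, map_zero, add_zero])
    (by rw [map_add, A.delbar_del, hy']; abel)
  refine ⟨-y, z, by rw [map_neg, hy, neg_zero], hz, ?_⟩
  rw [hz', map_neg]
  abel

/-- The total complex of an acyclic kernel is acyclic. -/
theorem AcyclicKer.exists_d_primitive (hf : AcyclicKer f) {x : A.carrier} (hx : Hom.fn f x = 0)
    (hx' : A.d x = 0) : ∃ y, Hom.fn f y = 0 ∧ A.d y = x := by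
  have h1 : A.delbar x = -A.del x := eq_neg_of_add_eq_zero_right hx'
  -- As ∂̄x = −∂x, the element ∂x is closed for both differentials, say ∂∂̄c. Subtracting dc from x
  -- leaves an element closed for both, to which acyclicity applies again.
  obtain ⟨c, hc, hc'⟩ := hf (A.del x) (by rw [Hom.fn_del, hx, map_zero]) (A.del_del x)
    (by rw [A.delbar_del, h1, map_neg, A.del_del, neg_zero, neg_zero])
  obtain ⟨w, hw, hw'⟩ := hf (x - A.d c) (by rw [map_sub, Hom.fn_d, hx, hc, map_zero, sub_zero])
    (by rw [map_sub, d_apply, map_add, A.del_del, hc', zero_add, sub_self])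
    (by
      rw [map_sub, d_apply, map_add, A.delbar_delbar, A.delbar_del, hc', h1]
      abel)
  refine ⟨c + A.delbar w, by rw [map_add, Hom.fn_delbar, hc, hw, map_zero, add_zero], ?_⟩
  rw [map_add, d_apply A (A.delbar w), A.delbar_delbar, hw']
  abel

end Acyclic

/-- Averaging a linear map over the real structures. -/
noncomputable def average {A X : RCbba.{u}} (κ : A.carrier →ₗ[ℂ] X.carrier) :
    A.carrier →ₗ[ℂ] X.carrier where
  toFun w := (2⁻¹ : ℂ) • (κ w + X.conj (κ (A.conj w)))
  map_add' v w := by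
    simp only [map_add, smul_add]
    abel
  map_smul' c w := by
    simp only [map_smul, LinearMap.map_smulₛₗ, RingHom.id_apply, Complex.conj_conj, ← smul_add]
    rw [smul_comm]

theorem average_apply {A X : RCbba.{u}} (κ : A.carrier →ₗ[ℂ] X.carrier) (w : A.carrier) :
    average κ w = (2⁻¹ : ℂ) • (κ w + X.conj (κ (A.conj w))) := rfl

theorem average_conj {A X : RCbba.{u}} (κ : A.carrier →ₗ[ℂ] X.carrier) (w : A.carrier) :
    average κ (A.conj w) = X.conj (average κ w) := by
  rw [average_apply, average_apply, A.conj_conj, X.conj.map_smulₛₗ, map_add, X.conj_conj, conj_half,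
    add_comm]

theorem half_add_self {M : Type*} [AddCommGroup M] [Module ℂ M] (x : M) :
    (2⁻¹ : ℂ) • (x + x) = x := by
  rw [← two_smul ℂ x, smul_smul]
  norm_num

/-- Minimal algebras lift strictly against surjections with acyclic kernel. -/
theorem IsMinimal.exists_lift {A X Y : RCbba.{u}} (hA : A.IsMinimal) (f : X ⟶ Y)
    (hf : Function.Surjective (Hom.fn f)) (hK : AcyclicKer f) (g : A ⟶ Y) :
    ∃ h : A ⟶ X, h ≫ f = g := by
  obtain ⟨W, F, hW⟩ := hA
  have htop := hW.free.adjoin_eq_top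
  have hFW : ∀ n, F n ≤ W := fun n => hW.filtration_iSup ▸ le_iSup F n
  have hext : ∀ ℓ : A.carrier →ₗ[ℂ] X.carrier, (∀ i, ∀ w ∈ W, w ∈ A.gr i → ℓ w ∈ X.gr i) →
      ∃ h : A.carrier →ₐ[ℂ] X.carrier, ∀ w ∈ W, h w = ℓ w := fun ℓ hℓ =>
    Grading.IsFreeOn.exists_lift (D := degHom) hW.free ℓ fun i j x hx y hy hxi hyj =>
      X.mul_comm (hℓ i x hx hxi) (hℓ j y hy hyj)
  have hgr : ∀ (ℓ : A.carrier →ₗ[ℂ] X.carrier) (h : A.carrier →ₐ[ℂ] X.carrier),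
      (∀ i, ∀ w ∈ W, w ∈ A.gr i → ℓ w ∈ X.gr i) → (∀ w ∈ W, h w = ℓ w) →
      ∀ i, ∀ x ∈ A.gr i, h x ∈ X.gr i := fun ℓ h hℓ hh i x hx =>
    Grading.map_mem_of_generators A.isGradedComm X.isGradedComm hW.graded htop h
      (fun i w hw hwi => by rw [hh w hw]; exact hℓ i w hw hwi) hx
  have hsgn : ∀ (h : A.carrier →ₐ[ℂ] X.carrier), (∀ i, ∀ x ∈ A.gr i, h x ∈ X.gr i) →
      ∀ x, h (A.sign x) = X.sign (h x) := fun h hh =>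
    A.isGradedComm.map_sign X.isGradedComm h.toLinearMap.toAddMonoidHom id (fun _ => rfl) hh
  have hdel : ∀ (h : A.carrier →ₐ[ℂ] X.carrier), (∀ i, ∀ x ∈ A.gr i, h x ∈ X.gr i) →
      ∀ U : Submodule ℂ A.carrier, (∀ w ∈ U, h (A.del w) = X.del (h w)) →
      ∀ x ∈ Algebra.adjoin ℂ (U : Set A.carrier), h (A.del x) = X.del (h x) := fun h hh U hU x hx =>
    Grading.map_deriv_of_generators (s := A.sign.toLinearMap) (s' := X.sign.toLinearMap) h
      A.del_leibniz_sign X.del_leibniz_sign (hsgn h hh) A.del_one X.del_one hU hx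
  have hdelbar : ∀ (h : A.carrier →ₐ[ℂ] X.carrier), (∀ i, ∀ x ∈ A.gr i, h x ∈ X.gr i) →
      ∀ U : Submodule ℂ A.carrier, (∀ w ∈ U, h (A.delbar w) = X.delbar (h w)) →
      ∀ x ∈ Algebra.adjoin ℂ (U : Set A.carrier), h (A.delbar x) = X.delbar (h x) :=
    fun h hh U hU x hx =>
    Grading.map_deriv_of_generators (s := A.sign.toLinearMap) (s' := X.sign.toLinearMap) h
      A.delbar_leibniz_sign X.delbar_leibniz_sign (hsgn h hh) A.delbar_one X.delbar_one hU hx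
  have hconj : ∀ (ℓ : A.carrier →ₗ[ℂ] X.carrier) (h : A.carrier →ₐ[ℂ] X.carrier),
      (∀ w ∈ W, ℓ (A.conj w) = X.conj (ℓ w)) → (∀ w ∈ W, h w = ℓ w) →
      ∀ x, h (A.conj x) = X.conj (h x) := by
    intro ℓ h hℓ hh x
    have hx : x ∈ Algebra.adjoin ℂ (W : Set A.carrier) := htop ▸ Algebra.mem_top
    induction hx using Algebra.adjoin_induction with
    | mem w hw => rw [hh w hw, hh _ (hW.conj_mem w hw), hℓ w hw]
    | algebraMap r =>
      rw [Algebra.algebraMap_eq_smul_one, A.conj.map_smulₛₗ, map_smul, map_smul, X.conj.map_smulₛₗ,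
        A.conj_one, map_one, X.conj_one]
    | add a b _ _ ha hb => simp only [map_add, ha, hb]
    | mul a b _ _ ha hb => simp only [A.conj_mul, X.conj_mul, map_mul, ha, hb]
  -- As for cdga's, with both differentials and with `ℓ` real on the generators.
  let P : ℕ → (A.carrier →ₗ[ℂ] X.carrier) → Prop := fun n ℓ =>
    ((∀ i, ∀ w ∈ W, w ∈ A.gr i → ℓ w ∈ X.gr i) ∧ (∀ w ∈ W, Hom.fn f (ℓ w) = Hom.fn g w) ∧
      ∀ w ∈ W, ℓ (A.conj w) = X.conj (ℓ w)) ∧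
    ∀ h : A.carrier →ₐ[ℂ] X.carrier, (∀ w ∈ W, h w = ℓ w) → ∀ w ∈ F n,
      h (A.del w) = X.del (ℓ w) ∧ h (A.delbar w) = X.delbar (ℓ w)
  have base : ∃ ℓ, P 0 ℓ := by
    obtain ⟨ℓ, h1, -, -⟩ := Grading.exists_graded_choice (N := X.carrier) A.isInternal
      (U₀ := ⊥) (U₁ := W)
      (fun i => (X.gr i).comap (LinearMap.snd ℂ A.carrier X.carrier) ⊓
        LinearMap.eqLocus ((Hom.fn f).toLinearMap ∘ₗ LinearMap.snd ℂ _ _)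
          ((Hom.fn g).toLinearMap ∘ₗ LinearMap.fst ℂ _ _))
      bot_le (by
        rintro i w (rfl : w = 0) -
        exact Submodule.zero_mem _) (by
        intro i w _ hwi
        obtain ⟨x, hx⟩ := hf (Hom.fn g w)
        refine ⟨Grading.proj X.isInternal i x, Grading.proj_mem _ _ _, ?_⟩
        show Hom.fn f (Grading.proj X.isInternal i x) = Hom.fn g w
        rw [Hom.fn_proj, hx, Grading.proj_same _ (Hom.fn_gr g hwi)])
    have h2 : ∀ w ∈ W, Hom.fn f (ℓ w) = Hom.fn g w := by
      intro w hw
      refine hW.graded.induction w hw (by simp) (fun i w hw hwi => (h1 i w hw hwi).2) ?_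
      intro y z hy hz
      simp only [map_add, hy, hz]
    -- Averaging with the conjugate preserves bidegrees, as conjugation swaps them twice, and
    -- preserves the lifting property, as `f` and `g` are real.
    refine ⟨average ℓ, ⟨?_, ?_, fun w _ => average_conj ℓ w⟩, ?_⟩
    · intro i w hw hwi
      refine Submodule.smul_mem _ _ (add_mem (h1 i w hw hwi).1 ?_)
      exact X.conj_mem (h1 i.swap _ (hW.conj_mem w hw) (A.conj_mem hwi)).1
    · intro w hw
      rw [average_apply, map_smul, map_add, Hom.fn_conj, h2 w hw, h2 _ (hW.conj_mem w hw),
        Hom.fn_conj, Y.conj_conj, half_add_self]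
    · intro h _ w hw
      rw [hW.filtration_zero] at hw
      rw [(Submodule.mem_bot ℂ).1 hw]
      simp
  have step : ∀ n ℓ, P n ℓ → ∃ ℓ', P (n + 1) ℓ' ∧ ∀ w ∈ F n, ℓ' w = ℓ w := by
    rintro n ℓ ⟨⟨h1, h2, hc⟩, h3⟩
    obtain ⟨h, hh⟩ := hext ℓ h1
    have hgrh := hgr ℓ h h1 hh
    have hch := hconj ℓ h hc hh
    have hdh : ∀ x ∈ Algebra.adjoin ℂ (F n : Set A.carrier), h (A.del x) = X.del (h x) :=
      hdel h hgrh (F n) fun w hw => by rw [(h3 h hh w hw).1, hh w (hFW n hw)]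
    have hdbh : ∀ x ∈ Algebra.adjoin ℂ (F n : Set A.carrier), h (A.delbar x) = X.delbar (h x) :=
      hdelbar h hgrh (F n) fun w hw => by rw [(h3 h hh w hw).2, hh w (hFW n hw)]
    have hfh : ∀ x, Hom.fn f (h x) = Hom.fn g x := fun x =>
      Grading.algHom_eqOn_adjoin (f := (Hom.fn f).comp h) (F := W)
        (fun w hw => by rw [← h2 w hw, ← hh w hw]; rfl) (htop ▸ Algebra.mem_top)
    -- A single correction must remove the obstructions for ∂ and for ∂̄ at once, which requires a
    -- common primitive.
    obtain ⟨κ, k1, k2, k3⟩ := Grading.exists_graded_choice (N := X.carrier) A.isInternal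
      (U₀ := F n) (U₁ := F (n + 1))
      (fun i => (X.gr i).comap (LinearMap.snd ℂ A.carrier X.carrier) ⊓
        (LinearMap.ker ((Hom.fn f).toLinearMap ∘ₗ LinearMap.snd ℂ _ _) ⊓
        (LinearMap.eqLocus (X.del ∘ₗ LinearMap.snd ℂ _ _)
          ((h.toLinearMap ∘ₗ A.del - X.del ∘ₗ ℓ) ∘ₗ LinearMap.fst ℂ _ _) ⊓
        LinearMap.eqLocus (X.delbar ∘ₗ LinearMap.snd ℂ _ _)
          ((h.toLinearMap ∘ₗ A.delbar - X.delbar ∘ₗ ℓ) ∘ₗ LinearMap.fst ℂ _ _))))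
      (hW.filtration_mono n.le_succ) (by
        intro i w hw hwi
        refine ⟨Submodule.zero_mem _, map_zero (Hom.fn f), ?_, ?_⟩
        · show X.del 0 = h (A.del w) - X.del (ℓ w)
          rw [(h3 h hh w hw).1, map_zero, sub_self]
        · show X.delbar 0 = h (A.delbar w) - X.delbar (ℓ w)
          rw [(h3 h hh w hw).2, map_zero, sub_self]) (by
        intro i w hw hwi
        have hadj := hW.del_mem_adjoin n w hw
        have hadj' := hW.delbar_mem_adjoin n w hw
        have ha : h (A.del w) - X.del (ℓ w) ∈ X.gr (i + (1, 0)) :=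
          sub_mem (hgrh _ _ (A.del_mem hwi)) (X.del_mem (h1 i w (hFW _ hw) hwi))
        have hb : h (A.delbar w) - X.delbar (ℓ w) ∈ X.gr (i + (0, 1)) :=
          sub_mem (hgrh _ _ (A.delbar_mem hwi)) (X.delbar_mem (h1 i w (hFW _ hw) hwi))
        -- The three closedness conditions are ∂² = 0, ∂̄² = 0 and ∂∂̄ + ∂̄∂ = 0, transported
        -- through `h`, which commutes with both differentials on Λ(F n).
        obtain ⟨y, hy, hy', hy''⟩ := hK.exists_common_primitive
          (a := h (A.del w) - X.del (ℓ w)) (b := h (A.delbar w) - X.delbar (ℓ w))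
          (by rw [map_sub, hfh, Hom.fn_del, Hom.fn_del, h2 w (hFW _ hw), sub_self])
          (by rw [map_sub, hfh, Hom.fn_delbar, Hom.fn_delbar, h2 w (hFW _ hw), sub_self])
          (by rw [map_sub, X.del_del, ← hdh _ hadj, A.del_del, map_zero, sub_zero])
          (by rw [map_sub, X.delbar_delbar, ← hdbh _ hadj', A.delbar_delbar, map_zero, sub_zero])
          (by
            rw [map_sub, map_sub, ← hdh _ hadj', ← hdbh _ hadj, A.delbar_del, X.delbar_del, map_neg]
            abel)
        refine ⟨Grading.proj X.isInternal i y, Grading.proj_mem _ _ _, ?_, ?_, ?_⟩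
        · show Hom.fn f (Grading.proj X.isInternal i y) = 0
          rw [Hom.fn_proj, hy, map_zero]
        · show X.del (Grading.proj X.isInternal i y) = h (A.del w) - X.del (ℓ w)
          rw [X.del_proj, hy', Grading.proj_same _ ha]
        · show X.delbar (Grading.proj X.isInternal i y) = h (A.delbar w) - X.delbar (ℓ w)
          rw [X.delbar_proj, hy'', Grading.proj_same _ hb])
    have k4 : ∀ x, Hom.fn f (κ x) = 0 := by
      intro x
      refine Grading.induction A.isInternal x ?_ ?_
      · intro i w hwi
        obtain ⟨w', -, -, h5, -⟩ := k3 i w hwi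
        exact h5
      · intro y z hy hz
        rw [map_add, map_add, hy, hz, add_zero]
    have k5 : ∀ w ∈ F n, κ w = 0 := by
      intro w hw
      refine (hW.filtration_graded n).induction w hw (map_zero κ) (fun i w hw hwi => k2 i w hw hwi)
        ?_
      intro y z hy hz
      rw [map_add, hy, hz, add_zero]
    have k6 : ∀ w ∈ F (n + 1), X.del (κ w) = h (A.del w) - X.del (ℓ w) := by
      intro w hw
      refine (hW.filtration_graded (n + 1)).induction w hw (by simp)
        (fun i w hw hwi => (k1 i w hw hwi).2.2.1) ?_
      intro y z hy hz
      simp only [map_add, hy, hz]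
      abel
    have k6' : ∀ w ∈ F (n + 1), X.delbar (κ w) = h (A.delbar w) - X.delbar (ℓ w) := by
      intro w hw
      refine (hW.filtration_graded (n + 1)).induction w hw (by simp)
        (fun i w hw hwi => (k1 i w hw hwi).2.2.2) ?_
      intro y z hy hz
      simp only [map_add, hy, hz]
      abel
    have k7 : ∀ w ∈ F n, (ℓ + average κ) w = ℓ w := fun w hw => by
      rw [LinearMap.add_apply, average_apply, k5 w hw, k5 _ (hW.filtration_conj n w hw), map_zero,
        add_zero, smul_zero, add_zero]
    -- `κ` need not be real, so its average is added. It still vanishes on `F n` because the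
    -- filtration is stable under conjugation.
    refine ⟨ℓ + average κ, ⟨⟨?_, ?_, ?_⟩, ?_⟩, k7⟩
    · intro i w hw hwi
      refine add_mem (h1 i w hw hwi) (Submodule.smul_mem _ _ (add_mem ?_ ?_))
      · obtain ⟨w', -, h5, -⟩ := k3 i w hwi
        exact h5
      · obtain ⟨w', -, h5, -⟩ := k3 i.swap _ (A.conj_mem hwi)
        exact X.conj_mem h5
    · intro w hw
      rw [LinearMap.add_apply, map_add, average_apply, map_smul, map_add, Hom.fn_conj, k4, k4,
        map_zero, add_zero, smul_zero, add_zero, h2 w hw]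
    · intro w hw
      rw [LinearMap.add_apply, LinearMap.add_apply, map_add, average_conj, hc w hw]
    · intro h' hh' w hw
      have h8 : ∀ x ∈ Algebra.adjoin ℂ (F n : Set A.carrier), h' x = h x := fun x hx =>
        Grading.algHom_eqOn_adjoin (F := F n)
          (fun v hv => by rw [hh' v (hFW n hv), hh v (hFW n hv), k7 v hv]) hx
      have hwW := hFW _ hw
      have hw' := hW.filtration_conj _ w hw
      rw [h8 _ (hW.del_mem_adjoin n w hw), h8 _ (hW.delbar_mem_adjoin n w hw), LinearMap.add_apply,
        map_add, map_add, average_apply, map_smul, map_smul, map_add, map_add, k6 w hw, k6' w hw]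
      constructor
      -- The conjugate half of the average solves the same equation: its ∂ is the conjugate of the
      -- ∂̄-equation at the conjugate of `w`.
      · rw [← X.conj_delbar, k6' _ hw', map_sub, X.conj_delbar, ← hch, A.conj_delbar, A.conj_conj,
          hc w hwW, X.conj_conj, half_add_self]
        abel
      · rw [← X.conj_del, k6 _ hw', map_sub, X.conj_del, ← hch, A.conj_del, A.conj_conj,
          hc w hwW, X.conj_conj, half_add_self]
        abel
  obtain ⟨ℓ, ℓ', hℓ, hℓ'⟩ := Grading.exists_limit hW.filtration_mono P base step
  have hmem : ∀ w ∈ W, ∃ n, w ∈ F n := fun w hw => by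
    rw [← hW.filtration_iSup] at hw
    exact (Submodule.mem_iSup_of_directed F hW.filtration_mono.directed_le).1 hw
  have g1 : ∀ i, ∀ w ∈ W, w ∈ A.gr i → ℓ' w ∈ X.gr i := by
    intro i w hw hwi
    obtain ⟨n, hn⟩ := hmem w hw
    rw [hℓ' n w hn]
    exact (hℓ n).1.1 i w hw hwi
  have g2 : ∀ w ∈ W, ℓ' (A.conj w) = X.conj (ℓ' w) := by
    intro w hw
    obtain ⟨n, hn⟩ := hmem w hw
    rw [hℓ' n w hn, hℓ' n _ (hW.filtration_conj n w hn), (hℓ n).1.2.2 w hw]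
  obtain ⟨h, hh⟩ := hext ℓ' g1
  have hgrh := hgr ℓ' h g1 hh
  have g3 : ∀ w ∈ W, h (A.del w) = X.del (h w) ∧ h (A.delbar w) = X.delbar (h w) := by
    intro w hw
    obtain ⟨n, hn⟩ := hmem w hw
    have hn1 := hW.filtration_mono n.le_succ hn
    obtain ⟨h', hh'⟩ := hext (ℓ (n + 1)) (hℓ (n + 1)).1.1
    have h8 : ∀ x ∈ Algebra.adjoin ℂ (F n : Set A.carrier), h x = h' x := fun x hx =>
      Grading.algHom_eqOn_adjoin (F := F n)
        (fun v hv => by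
          rw [hh v (hFW n hv), hh' v (hFW n hv),
            hℓ' (n + 1) v (hW.filtration_mono n.le_succ hv)]) hx
    obtain ⟨h9, h9'⟩ := (hℓ (n + 1)).2 h' hh' w hn1
    rw [h8 _ (hW.del_mem_adjoin n w hn1), h8 _ (hW.delbar_mem_adjoin n w hn1), h9, h9', hh w hw,
      hℓ' (n + 1) w hn1]
    exact ⟨rfl, rfl⟩
  refine ⟨⟨h, fun {i} {x} hx => hgrh i x hx,
    fun x => hdel h hgrh W (fun w hw => (g3 w hw).1) x (htop ▸ Algebra.mem_top),
    fun x => hdelbar h hgrh W (fun w hw => (g3 w hw).2) x (htop ▸ Algebra.mem_top),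
    hconj ℓ' h g2 hh⟩, hom_ext fun x => ?_⟩
  refine Grading.algHom_eqOn_adjoin (f := (Hom.fn f).comp h) (g := Hom.fn g) (F := W) ?_
    (htop ▸ Algebra.mem_top)
  intro w hw
  obtain ⟨n, hn⟩ := hmem w hw
  show Hom.fn f (h w) = Hom.fn g w
  rw [hh w hw, hℓ' n w hn, (hℓ n).1.2.1 w hw]

end RCbba

/-! ### Quasi-isomorphisms -/

namespace CDGA

variable {k : Type} [Field k]

/-- This and its analogues allow diagram chases with elements in place of classes. -/
theorem injective_cohomologyMap_iff {A B : CDGA.{u} k} (f : A ⟶ B) :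
    Function.Injective (Hom.fn ((H k).map f)) ↔
      ∀ x, A.d x = 0 → (∃ y, B.d y = Hom.fn f x) → ∃ y, A.d y = x := by
  rw [injective_iff_map_eq_zero]
  constructor
  · rintro h x hx ⟨y, hy⟩
    exact cls_eq_zero.1 (h (A.cls ⟨x, hx⟩) (cls_eq_zero.2 ⟨y, hy⟩))
  · intro h c hc
    obtain ⟨⟨x, hx⟩, rfl⟩ := A.cls_surjective c
    exact cls_eq_zero.2 (h x hx (cls_eq_zero.1 hc))

theorem surjective_cohomologyMap_iff {A B : CDGA.{u} k} (f : A ⟶ B) :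
    Function.Surjective (Hom.fn ((H k).map f)) ↔
      ∀ y, B.d y = 0 → ∃ x, A.d x = 0 ∧ ∃ z, B.d z = Hom.fn f x - y := by
  constructor
  · intro h y hy
    obtain ⟨c, hc⟩ := h (B.cls ⟨y, hy⟩)
    obtain ⟨⟨x, hx⟩, rfl⟩ := A.cls_surjective c
    exact ⟨x, hx, cls_eq_cls.1 hc⟩
  · intro h c
    obtain ⟨⟨y, hy⟩, rfl⟩ := B.cls_surjective c
    obtain ⟨x, hx, hz⟩ := h y hy
    exact ⟨A.cls ⟨x, hx⟩, cls_eq_cls.2 hz⟩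

/-- The kernel of a surjective quasi-isomorphism is acyclic. -/
theorem acyclicKer_of_quasiIso {A B : CDGA.{u} k} {f : A ⟶ B}
    (hs : Function.Surjective (Hom.fn f)) (hf : quasiIso k f) : AcyclicKer f := by
  intro x hx hx'
  obtain ⟨y, hy⟩ := (injective_cohomologyMap_iff f).1 hf.1 x hx' ⟨0, by rw [hx, map_zero]⟩
  -- The primitive `y` need not lie in the kernel, but its image is a cocycle. Surjectivity in
  -- cohomology and surjectivity of `f` supply a cocycle and a coboundary whose subtraction moves
  -- `y` into the kernel.
  obtain ⟨w, hw, v, hv⟩ := (surjective_cohomologyMap_iff f).1 hf.2 (Hom.fn f y)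
    (by rw [← Hom.fn_d, hy, hx])
  obtain ⟨v, rfl⟩ := hs v
  refine ⟨y - w + A.d v, ?_, ?_⟩
  · rw [map_add, map_sub, Hom.fn_d, hv]
    abel
  · rw [map_add, map_sub, A.d_d, hw, hy, sub_zero, add_zero]

/-- A surjection with acyclic kernel is a quasi-isomorphism. -/
theorem quasiIso_of_acyclicKer {A B : CDGA.{u} k} {f : A ⟶ B}
    (hs : Function.Surjective (Hom.fn f)) (hf : AcyclicKer f) : quasiIso k f := by
  refine ⟨(injective_cohomologyMap_iff f).2 ?_, (surjective_cohomologyMap_iff f).2 ?_⟩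
  · rintro x hx ⟨y, hy⟩
    obtain ⟨z, rfl⟩ := hs y
    obtain ⟨w, -, hw⟩ := hf (x - A.d z) (by rw [map_sub, Hom.fn_d, hy, sub_self])
      (by rw [map_sub, hx, A.d_d, sub_zero])
    exact ⟨w + z, by rw [map_add, hw]; abel⟩
  · intro y hy
    obtain ⟨x, rfl⟩ := hs y
    -- Any preimage of a cocycle has differential in the kernel; a primitive of that differential in
    -- the kernel turns the preimage into a cocycle.
    obtain ⟨w, hw, hw'⟩ := hf (A.d x) (by rw [Hom.fn_d, hy]) (A.d_d x)
    refine ⟨x - w, by rw [map_sub, hw', sub_self], 0, ?_⟩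
    rw [map_zero, map_sub, hw, sub_zero, sub_self]

section TwoOutOfThree

variable {A B C : CDGA.{u} k} {f : A ⟶ B} {g : B ⟶ C}

theorem fn_H_comp (f : A ⟶ B) (g : B ⟶ C) : (Hom.fn ((H k).map (f ≫ g)) : _ → _) =
    Hom.fn ((H k).map g) ∘ Hom.fn ((H k).map f) := by
  rw [Functor.map_comp]
  rfl

theorem quasiIso.comp (hf : quasiIso k f) (hg : quasiIso k g) : quasiIso k (f ≫ g) := by
  show Function.Bijective (Hom.fn ((H k).map (f ≫ g)) : _ → _)
  rw [fn_H_comp]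
  exact Function.Bijective.comp hg hf

theorem quasiIso.of_comp_right (hg : quasiIso k g) (hfg : quasiIso k (f ≫ g)) : quasiIso k f := by
  change Function.Bijective (Hom.fn ((H k).map (f ≫ g)) : _ → _) at hfg
  rw [fn_H_comp] at hfg
  exact (Function.Bijective.of_comp_iff' hg _).1 hfg

theorem quasiIso.of_comp_left (hf : quasiIso k f) (hfg : quasiIso k (f ≫ g)) : quasiIso k g := by
  change Function.Bijective (Hom.fn ((H k).map (f ≫ g)) : _ → _) at hfg
  rw [fn_H_comp] at hfg
  exact (Function.Bijective.of_comp_iff _ hf).1 hfg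

theorem bijective_of_isIso (f : A ⟶ B) [IsIso f] : Function.Bijective (Hom.fn f) := by
  refine Function.bijective_iff_has_inverse.2 ⟨Hom.fn (inv f), fun x => ?_, fun x => ?_⟩
  · show Hom.fn (f ≫ inv f) x = x
    rw [IsIso.hom_inv_id]
    rfl
  · show Hom.fn (inv f ≫ f) x = x
    rw [IsIso.inv_hom_id]
    rfl

theorem quasiIso_of_isIso (f : A ⟶ B) [IsIso f] : quasiIso k f :=
  bijective_of_isIso ((H k).map f)

end TwoOutOfThree

end CDGA

namespace RCbba

/-- A bijective morphism of `ℝ`-cbba's is an isomorphism. -/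
theorem isIso_of_bijective {A B : RCbba.{u}} (f : A ⟶ B)
    (hf : Function.Bijective (Hom.fn f)) : IsIso f := by
  let e := AlgEquiv.ofBijective (Hom.fn f) hf
  have he : ∀ b, Hom.fn f (e.symm b) = b := fun b => e.apply_symm_apply b
  have he' : ∀ a, e.symm (Hom.fn f a) = a := fun a => e.symm_apply_apply a
  let g : B ⟶ A :=
    { toAlgHom := e.symm.toAlgHom
      map_gr := by
        intro n b hb
        show e.symm b ∈ A.gr n
        have h1 : e.symm b = Grading.proj A.isInternal n (e.symm b) := by
          apply hf.1
          rw [Hom.fn_proj, he, Grading.proj_same _ hb]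
        rw [h1]
        exact Grading.proj_mem _ _ _
      map_del := fun b => hf.1 (by
        show Hom.fn f (e.symm _) = Hom.fn f (A.del (e.symm b))
        rw [he, Hom.fn_del, he])
      map_delbar := fun b => hf.1 (by
        show Hom.fn f (e.symm _) = Hom.fn f (A.delbar (e.symm b))
        rw [he, Hom.fn_delbar, he])
      map_conj := fun b => hf.1 (by
        show Hom.fn f (e.symm _) = Hom.fn f (A.conj (e.symm b))
        rw [he, Hom.fn_conj, he]) }
  exact ⟨g, hom_ext he', hom_ext he⟩

theorem bijective_of_isIso {A B : RCbba.{u}} (f : A ⟶ B) [IsIso f] :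
    Function.Bijective (Hom.fn f) := by
  refine Function.bijective_iff_has_inverse.2 ⟨Hom.fn (inv f), fun x => ?_, fun x => ?_⟩
  · show Hom.fn (f ≫ inv f) x = x
    rw [IsIso.hom_inv_id]
    rfl
  · show Hom.fn (inv f ≫ f) x = x
    rw [IsIso.inv_hom_id]
    rfl

theorem aeppliMap_id (A : RCbba.{u}) : (aeppliMap (𝟙 A) : A.Aeppli → A.Aeppli) = id := by
  funext x
  obtain ⟨x, rfl⟩ := Submodule.Quotient.mk_surjective _ x
  rfl

theorem aeppliMap_comp {A B C : RCbba.{u}} (f : A ⟶ B) (g : B ⟶ C) :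
    (aeppliMap (f ≫ g) : A.Aeppli → C.Aeppli) = aeppliMap g ∘ aeppliMap f := by
  funext x
  obtain ⟨x, rfl⟩ := Submodule.Quotient.mk_surjective _ x
  rfl

theorem fn_HBC_comp {A B C : RCbba.{u}} (f : A ⟶ B) (g : B ⟶ C) :
    (Hom.fn (HBC.map (f ≫ g)) : _ → _) = Hom.fn (HBC.map g) ∘ Hom.fn (HBC.map f) := by
  rw [Functor.map_comp]
  rfl

section TwoOutOfThree

variable {A B C : RCbba.{u}} {f : A ⟶ B} {g : B ⟶ C}

theorem PluriQuasiIso.comp (hf : PluriQuasiIso f) (hg : PluriQuasiIso g) :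
    PluriQuasiIso (f ≫ g) := by
  constructor
  · rw [fn_HBC_comp]
    exact hg.1.comp hf.1
  · rw [aeppliMap_comp]
    exact hg.2.comp hf.2

theorem PluriQuasiIso.of_comp_right (hg : PluriQuasiIso g) (hfg : PluriQuasiIso (f ≫ g)) :
    PluriQuasiIso f := by
  obtain ⟨h1, h2⟩ := hfg
  rw [fn_HBC_comp] at h1
  rw [aeppliMap_comp] at h2
  exact ⟨(Function.Bijective.of_comp_iff' hg.1 _).1 h1,
    (Function.Bijective.of_comp_iff' hg.2 _).1 h2⟩

theorem PluriQuasiIso.of_comp_left (hf : PluriQuasiIso f) (hfg : PluriQuasiIso (f ≫ g)) :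
    PluriQuasiIso g := by
  obtain ⟨h1, h2⟩ := hfg
  rw [fn_HBC_comp] at h1
  rw [aeppliMap_comp] at h2
  exact ⟨(Function.Bijective.of_comp_iff _ hf.1).1 h1, (Function.Bijective.of_comp_iff _ hf.2).1 h2⟩

theorem pluriQuasiIso_id (A : RCbba.{u}) : PluriQuasiIso (𝟙 A) := by
  constructor
  · rw [CategoryTheory.Functor.map_id]
    exact Function.bijective_id
  · rw [aeppliMap_id]
    exact Function.bijective_id

theorem pluriQuasiIso_of_isIso (f : A ⟶ B) [IsIso f] : PluriQuasiIso f := by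
  refine ⟨bijective_of_isIso (HBC.map f), ?_⟩
  refine Function.bijective_iff_has_inverse.2 ⟨aeppliMap (inv f), fun x => ?_, fun x => ?_⟩
  · rw [← Function.comp_apply (f := aeppliMap (inv f)), ← aeppliMap_comp, IsIso.hom_inv_id,
      aeppliMap_id, id]
  · rw [← Function.comp_apply (f := aeppliMap f), ← aeppliMap_comp, IsIso.inv_hom_id,
      aeppliMap_id, id]

end TwoOutOfThree

section Elements

variable {A B : RCbba.{u}} (f : A ⟶ B)

theorem injective_bottChernMap_iff : Function.Injective (Hom.fn (HBC.map f)) ↔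
    ∀ x, A.del x = 0 → A.delbar x = 0 → (∃ y, B.del (B.delbar y) = Hom.fn f x) →
      ∃ y, A.del (A.delbar y) = x := by
  rw [injective_iff_map_eq_zero]
  constructor
  · rintro h x hx hx' ⟨y, hy⟩
    exact bcCls_eq_zero.1 (h (A.bcCls ⟨x, hx, hx'⟩) (bcCls_eq_zero.2 ⟨y, hy⟩))
  · intro h c hc
    obtain ⟨⟨x, hx, hx'⟩, rfl⟩ := A.bcCls_surjective c
    exact bcCls_eq_zero.2 (h x hx hx' (bcCls_eq_zero.1 hc))

theorem bcCls_eq_bcCls {A : RCbba.{u}} {z w : A.bcCocycles} :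
    A.bcCls z = A.bcCls w ↔ ∃ y, A.del (A.delbar y) = (z : A.carrier) - w := by
  rw [← sub_eq_zero, ← map_sub, bcCls_eq_zero]
  rfl

theorem surjective_bottChernMap_iff : Function.Surjective (Hom.fn (HBC.map f)) ↔
    ∀ y, B.del y = 0 → B.delbar y = 0 → ∃ x, A.del x = 0 ∧ A.delbar x = 0 ∧
      ∃ z, B.del (B.delbar z) = Hom.fn f x - y := by
  constructor
  · intro h y hy hy'
    obtain ⟨c, hc⟩ := h (B.bcCls ⟨y, hy, hy'⟩)
    obtain ⟨⟨x, hx, hx'⟩, rfl⟩ := A.bcCls_surjective c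
    exact ⟨x, hx, hx', bcCls_eq_bcCls.1 hc⟩
  · intro h c
    obtain ⟨⟨y, hy, hy'⟩, rfl⟩ := B.bcCls_surjective c
    obtain ⟨x, hx, hx', hz⟩ := h y hy hy'
    exact ⟨A.bcCls ⟨x, hx, hx'⟩, bcCls_eq_bcCls.2 hz⟩

theorem injective_aeppliMap_iff : Function.Injective (aeppliMap f) ↔
    ∀ x, A.del (A.delbar x) = 0 → (∃ y z, B.del y + B.delbar z = Hom.fn f x) →
      ∃ y z, A.del y + A.delbar z = x := by
  rw [injective_iff_map_eq_zero]
  have key : ∀ {C : RCbba.{u}} (x : C.aeppliCocycles),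
      (Submodule.Quotient.mk x : C.Aeppli) = 0 ↔ ∃ y z, C.del y + C.delbar z = x := by
    intro C x
    rw [Submodule.Quotient.mk_eq_zero]
    show (x : C.carrier) ∈ LinearMap.range C.del ⊔ LinearMap.range C.delbar ↔ _
    rw [Submodule.mem_sup]
    simp
  constructor
  · rintro h x hx hy
    exact (key (⟨x, hx⟩ : A.aeppliCocycles)).1 (h _ ((key (Hom.onAeppliCocycles f ⟨x, hx⟩)).2 hy))
  · intro h c hc
    obtain ⟨x, rfl⟩ := Submodule.Quotient.mk_surjective _ c
    exact (key x).2 (h x x.2 ((key (Hom.onAeppliCocycles f x)).1 hc))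

theorem surjective_aeppliMap_iff : Function.Surjective (aeppliMap f) ↔
    ∀ y, B.del (B.delbar y) = 0 → ∃ x, A.del (A.delbar x) = 0 ∧
      ∃ v w, B.del v + B.delbar w = Hom.fn f x - y := by
  have key : ∀ (x y : B.aeppliCocycles),
      (Submodule.Quotient.mk x : B.Aeppli) = Submodule.Quotient.mk y ↔
        ∃ v w, B.del v + B.delbar w = (x : B.carrier) - y := by
    intro x y
    rw [Submodule.Quotient.eq]
    show (x : B.carrier) - y ∈ LinearMap.range B.del ⊔ LinearMap.range B.delbar ↔ _
    rw [Submodule.mem_sup]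
    simp
  constructor
  · intro h y hy
    obtain ⟨c, hc⟩ := h (Submodule.Quotient.mk ⟨y, hy⟩)
    obtain ⟨x, rfl⟩ := Submodule.Quotient.mk_surjective _ c
    exact ⟨x, x.2, (key (Hom.onAeppliCocycles f x) ⟨y, hy⟩).1 hc⟩
  · intro h c
    obtain ⟨⟨y, hy⟩, rfl⟩ := Submodule.Quotient.mk_surjective _ c
    obtain ⟨x, hx, hz⟩ := h y hy
    exact ⟨Submodule.Quotient.mk ⟨x, hx⟩, (key (Hom.onAeppliCocycles f ⟨x, hx⟩) ⟨y, hy⟩).2 hz⟩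

variable {f}

/-- The kernel of a surjective pluripotential quasi-isomorphism is acyclic. -/
theorem acyclicKer_of_pluriQuasiIso (hs : Function.Surjective (Hom.fn f)) (hf : PluriQuasiIso f) :
    AcyclicKer f := by
  intro x hx hx1 hx2
  obtain ⟨y, hy⟩ := (injective_bottChernMap_iff f).1 hf.1.1 x hx1 hx2
    ⟨0, by rw [hx, map_zero, map_zero]⟩
  -- The image of `y` is ∂∂̄-closed, hence an Aeppli cocycle. Injectivity in Bott-Chern cohomology
  -- produces `y`, and surjectivity in Aeppli cohomology moves it into the kernel.
  obtain ⟨w, hw, u, v, huv⟩ := (surjective_aeppliMap_iff f).1 hf.2.2 (Hom.fn f y)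
    (by rw [← Hom.fn_delbar, ← Hom.fn_del, hy, hx])
  obtain ⟨u, rfl⟩ := hs u
  obtain ⟨v, rfl⟩ := hs v
  refine ⟨y - w + (A.del u + A.delbar v), ?_, ?_⟩
  · rw [map_add, map_sub, map_add, Hom.fn_del, Hom.fn_delbar, huv]
    abel
  · simp only [map_add, map_sub, A.delbar_delbar, A.delbar_del, map_neg, A.del_del, hw, hy]
    simp

/-- A surjection with acyclic kernel is a pluripotential quasi-isomorphism. -/
theorem pluriQuasiIso_of_acyclicKer (hs : Function.Surjective (Hom.fn f)) (hf : AcyclicKer f) :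
    PluriQuasiIso f := by
  refine ⟨⟨(injective_bottChernMap_iff f).2 ?_, (surjective_bottChernMap_iff f).2 ?_⟩,
    ⟨(injective_aeppliMap_iff f).2 ?_, (surjective_aeppliMap_iff f).2 ?_⟩⟩
  · rintro x hx hx' ⟨y, hy⟩
    obtain ⟨z, rfl⟩ := hs y
    obtain ⟨w, -, hw⟩ := hf (x - A.del (A.delbar z))
      (by rw [map_sub, Hom.fn_del, Hom.fn_delbar, hy, sub_self])
      (by rw [map_sub, hx, A.del_del, sub_zero])
      (by rw [map_sub, hx', A.delbar_del, A.delbar_delbar, map_zero, neg_zero, sub_zero])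
    exact ⟨w + z, by rw [map_add, map_add, hw]; abel⟩
  · intro y hy hy'
    obtain ⟨x, rfl⟩ := hs y
    -- ∂x and ∂̄x lie in the kernel; subtracting a common primitive makes the preimage closed for
    -- both differentials.
    obtain ⟨w, hw, hw1, hw2⟩ := hf.exists_common_primitive (a := A.del x) (b := A.delbar x)
      (by rw [Hom.fn_del, hy]) (by rw [Hom.fn_delbar, hy']) (A.del_del x) (A.delbar_delbar x)
      (by rw [add_comm, A.del_delbar])
    refine ⟨x - w, by rw [map_sub, hw1, sub_self], by rw [map_sub, hw2, sub_self], 0, ?_⟩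
    rw [map_zero, map_zero, map_sub, hw, sub_zero, sub_self]
  · rintro x hx ⟨y, z, hyz⟩
    obtain ⟨y, rfl⟩ := hs y
    obtain ⟨z, rfl⟩ := hs z
    obtain ⟨v, w, -, -, hvw⟩ := hf.aeppli (x := x - (A.del y + A.delbar z))
      (by rw [map_sub, map_add, Hom.fn_del, Hom.fn_delbar, hyz, sub_self])
      (by simp [A.delbar_delbar, A.delbar_del, A.del_del, hx])
    refine ⟨v + y, w + z, ?_⟩
    rw [map_add, map_add, add_add_add_comm, hvw]
    abel
  · intro y hy
    obtain ⟨x, rfl⟩ := hs y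
    obtain ⟨w, hw, hw'⟩ := hf (A.del (A.delbar x)) (by rw [Hom.fn_del, Hom.fn_delbar, hy])
      (A.del_del _) (by rw [A.delbar_del, A.delbar_delbar, map_zero, neg_zero])
    refine ⟨x - w, by rw [map_sub, map_sub, hw', sub_self], 0, 0, ?_⟩
    rw [map_zero, map_zero, map_sub, hw, sub_zero, sub_self, add_zero]

/-- A surjection with acyclic kernel is a quasi-isomorphism on real total complexes. -/
theorem quasiIso_totReal_of_acyclicKer (hs : Function.Surjective (Hom.fn f)) (hf : AcyclicKer f) :
    CDGA.quasiIso ℝ (totReal.map f) := by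
  -- Preimages and primitives exist over ℂ; averaging them with their conjugates makes them real.
  apply CDGA.quasiIso_of_acyclicKer
  · rintro ⟨y, hy⟩
    obtain ⟨x, rfl⟩ := hs y
    have hy' : B.conj (Hom.fn f x) = Hom.fn f x := hy
    refine ⟨⟨(2⁻¹ : ℂ) • (x + A.conj x), ?_⟩, Subtype.ext ?_⟩
    · show A.conj _ = _
      rw [A.conj.map_smulₛₗ, map_add, A.conj_conj, conj_half, add_comm]
    · show Hom.fn f ((2⁻¹ : ℂ) • (x + A.conj x)) = _
      rw [map_smul, map_add, Hom.fn_conj, hy', half_add_self]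
  · rintro ⟨x, hx⟩ hfx hdx
    have hx' : A.conj x = x := hx
    obtain ⟨y, hy, hy'⟩ := hf.exists_d_primitive (x := x) (congrArg Subtype.val hfx)
      (congrArg Subtype.val hdx)
    refine ⟨⟨(2⁻¹ : ℂ) • (y + A.conj y), ?_⟩, Subtype.ext ?_, Subtype.ext ?_⟩
    · show A.conj _ = _
      rw [A.conj.map_smulₛₗ, map_add, A.conj_conj, conj_half, add_comm]
    · show Hom.fn f ((2⁻¹ : ℂ) • (y + A.conj y)) = 0
      rw [map_smul, map_add, Hom.fn_conj, hy, map_zero, add_zero, smul_zero]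
    · show A.d ((2⁻¹ : ℂ) • (y + A.conj y)) = x
      rw [map_smul, map_add, ← conj_d, hy', hx', half_add_self]

end Elements

end RCbba

/-! ### Polynomials with coefficients in an algebra -/

namespace Polynomial

section

variable {A B : Type*} [Ring A] [Ring B]

/-- Apply an additive map to the coefficients of a polynomial. -/
noncomputable def coeffMap (F : A →+ B) : A[X] →+ B[X] where
  toFun p := p.sum fun n a => monomial n (F a)
  map_zero' := by simp
  map_add' p q := by
    rw [sum_add_index]
    · intro i; simp
    · intro n a b; simp

@[simp] theorem coeff_coeffMap (F : A →+ B) (p : A[X]) (n : ℕ) :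
    (coeffMap F p).coeff n = F (p.coeff n) := by
  show (p.sum fun n a => monomial n (F a)).coeff n = _
  rw [sum_def, finsetSum_coeff, Finset.sum_eq_single n]
  · simp
  · intro m _ hm
    rw [coeff_monomial, if_neg hm]
  · intro hn
    rw [notMem_support_iff.1 hn]
    simp

theorem coeffMap_C (F : A →+ B) (a : A) : coeffMap F (C a) = C (F a) := by
  ext n
  rw [coeff_coeffMap, coeff_C, coeff_C]
  split_ifs <;> simp

theorem derivative_coeffMap (F : A →+ B) (p : A[X]) :
    derivative (coeffMap F p) = coeffMap F (derivative p) := by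
  ext n
  have h1 : ((n : A) + 1) = ((n + 1 : ℕ) : A) := (Nat.cast_succ n).symm
  have h2 : ((n : B) + 1) = ((n + 1 : ℕ) : B) := (Nat.cast_succ n).symm
  rw [coeff_coeffMap, coeff_derivative, coeff_derivative, coeff_coeffMap, h1, h2,
    ← nsmul_eq_mul', ← nsmul_eq_mul', map_nsmul]

/-- Powers of 1 drop out, so additivity is enough. At a general point `F` would also have to respect
multiplication by that point. -/
theorem eval_one_coeffMap (F : A →+ B) (p : A[X]) : (coeffMap F p).eval 1 = F (p.eval 1) := by
  induction p using Polynomial.induction_on' with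
  | add p q hp hq => rw [map_add, eval_add, eval_add, hp, hq, map_add]
  | monomial n a =>
    have : coeffMap F (monomial n a) = monomial n (F a) := by
      ext m
      rw [coeff_coeffMap, coeff_monomial, coeff_monomial]
      split_ifs <;> simp
    rw [this, eval_monomial, eval_monomial, one_pow, one_pow, mul_one, mul_one]

/-- The variable is constant for `d` and has degree zero, so the rule holds coefficient by
coefficient. -/
theorem coeffMap_leibniz (d s : A →+ A) (hd : ∀ a b, d (a * b) = d a * b + s a * d b)
    (p q : A[X]) : coeffMap d (p * q) = coeffMap d p * q + coeffMap s p * coeffMap d q := by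
  ext n
  simp only [coeff_coeffMap, coeff_add, coeff_mul, map_sum, hd, Finset.sum_add_distrib]

theorem coeffMap_mul (F : A →+ B) (hF : ∀ a b, F (a * b) = F a * F b) (p q : A[X]) :
    coeffMap F (p * q) = coeffMap F p * coeffMap F q := by
  ext n
  simp only [coeff_coeffMap, coeff_mul, map_sum, hF]

/-- One sign `c` serves all pairs of coefficients because the variable is central. -/
theorem mul_eq_zsmul_mul {p q : A[X]} (c : ℤ)
    (h : ∀ m n, p.coeff m * q.coeff n = c • (q.coeff n * p.coeff m)) : p * q = c • (q * p) := by
  ext n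
  rw [coeff_smul, coeff_mul, coeff_mul, ← Finset.Nat.sum_antidiagonal_swap, Finset.smul_sum]
  exact Finset.sum_congr rfl fun x _ => h _ _

end

section Integral

variable (k : Type*) {A : Type*} [Field k] [Ring A] [Algebra k A]

/-- The primitive without constant term of a polynomial. -/
noncomputable def integral (p : A[X]) : A[X] :=
  p.sum fun n a => monomial (n + 1) (((n + 1 : ℕ) : k)⁻¹ • a)

theorem coeff_integral_zero (p : A[X]) : (integral k p).coeff 0 = 0 := by
  rw [integral, sum_def, finsetSum_coeff]
  exact Finset.sum_eq_zero fun n _ => by rw [coeff_monomial, if_neg n.succ_ne_zero]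

theorem coeff_integral_succ (p : A[X]) (n : ℕ) :
    (integral k p).coeff (n + 1) = ((n + 1 : ℕ) : k)⁻¹ • p.coeff n := by
  rw [integral, sum_def, finsetSum_coeff, Finset.sum_eq_single n]
  · rw [coeff_monomial, if_pos rfl]
  · intro m _ hm
    rw [coeff_monomial, if_neg (by omega)]
  · intro hn
    rw [notMem_support_iff.1 hn, smul_zero, monomial_zero_right, coeff_zero]

theorem natCast_inv_smul_mul [CharZero k] (n : ℕ) (a : A) :
    (((n + 1 : ℕ) : k)⁻¹ • a) * ((n : A) + 1) = a := by
  have h : ((n : A) + 1) = algebraMap k A ((n + 1 : ℕ) : k) := by simp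
  rw [h, ← Algebra.commutes, ← Algebra.smul_def, smul_smul, mul_inv_cancel₀, one_smul]
  exact Nat.cast_ne_zero.2 n.succ_ne_zero

theorem derivative_integral [CharZero k] (p : A[X]) : derivative (integral k p) = p := by
  ext n
  rw [coeff_derivative, coeff_integral_succ, natCast_inv_smul_mul]

/-- Polynomials with the same derivative and the same constant term agree. -/
theorem eq_of_derivative_eq [CharZero k] {p q : A[X]} (h : derivative p = derivative q)
    (h0 : p.coeff 0 = q.coeff 0) : p = q := by
  ext n
  cases n with
  | zero => exact h0
  | succ n =>
    have h1 := congrArg (fun r => ((n + 1 : ℕ) : k)⁻¹ • r.coeff n) h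
    simp only [coeff_derivative, ← smul_mul_assoc, natCast_inv_smul_mul] at h1
    exact h1

end Integral

end Polynomial

/-! ### Square-zero extensions by twisted bimodules -/

/-- The square-zero extension `R ⊕ R^J`, where `R` acts on the right of the component `j` through
the endomorphism `s j`. -/
def TwistedExt {k R J : Type*} [CommRing k] [Ring R] [Algebra k R] (_ : J → R →ₐ[k] R) : Type _ :=
  R × (J → R)

namespace TwistedExt

variable {k R J : Type*} [CommRing k] [Ring R] [Algebra k R] {s : J → R →ₐ[k] R}

instance : AddCommGroup (TwistedExt s) := inferInstanceAs (AddCommGroup (R × (J → R)))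

instance : Module k (TwistedExt s) := inferInstanceAs (Module k (R × (J → R)))

instance : Mul (TwistedExt s) := ⟨fun x y => (x.1 * y.1, fun j => x.1 * y.2 j + x.2 j * s j y.1)⟩

instance : One (TwistedExt s) := ⟨((1 : R), fun _ => (0 : R))⟩

/-- The element with the given components. -/
def mk (s : J → R →ₐ[k] R) (a : R) (b : J → R) : TwistedExt s := (a, b)

theorem mk_fst (a : R) (b : J → R) : (mk s a b).1 = a := rfl

theorem mk_snd (a : R) (b : J → R) (j : J) : (mk s a b).2 j = b j := rfl

theorem ext' {x y : TwistedExt s} (h1 : x.1 = y.1) (h2 : ∀ j, x.2 j = y.2 j) : x = y :=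
  Prod.ext h1 (funext h2)

theorem mul_fst (x y : TwistedExt s) : (x * y).1 = x.1 * y.1 := rfl

theorem mul_snd (x y : TwistedExt s) (j : J) : (x * y).2 j = x.1 * y.2 j + x.2 j * s j y.1 := rfl

theorem one_fst : (1 : TwistedExt s).1 = 1 := rfl

theorem one_snd (j : J) : (1 : TwistedExt s).2 j = 0 := rfl

theorem add_fst (x y : TwistedExt s) : (x + y).1 = x.1 + y.1 := rfl

theorem add_snd (x y : TwistedExt s) (j : J) : (x + y).2 j = x.2 j + y.2 j := rfl

theorem zero_fst : (0 : TwistedExt s).1 = 0 := rfl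

theorem zero_snd (j : J) : (0 : TwistedExt s).2 j = 0 := rfl

theorem smul_fst (c : k) (x : TwistedExt s) : (c • x).1 = c • x.1 := rfl

theorem smul_snd (c : k) (x : TwistedExt s) (j : J) : (c • x).2 j = c • x.2 j := rfl

theorem zsmul_fst (c : ℤ) (x : TwistedExt s) : (c • x).1 = c • x.1 := rfl

theorem zsmul_snd (c : ℤ) (x : TwistedExt s) (j : J) : (c • x).2 j = c • x.2 j := rfl

/-- Associativity in the component `j` amounts to the multiplicativity of `s j`. -/
instance : Ring (TwistedExt s) :=
  { (inferInstance : AddCommGroup (TwistedExt s)), (inferInstance : Mul (TwistedExt s)),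
    (inferInstance : One (TwistedExt s)) with
    left_distrib := fun x y z => ext' (by simp only [mul_fst, add_fst, mul_add]) fun j => by
      simp only [mul_snd, add_fst, add_snd, mul_add, map_add]; abel
    right_distrib := fun x y z => ext' (by simp only [mul_fst, add_fst, add_mul]) fun j => by
      simp only [mul_snd, add_fst, add_snd, add_mul]; abel
    zero_mul := fun x => ext' (by simp only [mul_fst, zero_fst, zero_mul]) fun j => by
      simp only [mul_snd, zero_fst, zero_snd, zero_mul, add_zero]
    mul_zero := fun x => ext' (by simp only [mul_fst, zero_fst, mul_zero]) fun j => by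
      simp only [mul_snd, zero_fst, zero_snd, mul_zero, map_zero, add_zero]
    mul_assoc := fun x y z => ext' (by simp only [mul_fst, mul_assoc]) fun j => by
      simp only [mul_snd, mul_fst, map_mul, mul_add, add_mul, mul_assoc, add_assoc]
    one_mul := fun x => ext' (by simp only [mul_fst, one_fst, one_mul]) fun j => by
      simp only [mul_snd, one_fst, one_snd, one_mul, zero_mul, add_zero]
    mul_one := fun x => ext' (by simp only [mul_fst, one_fst, mul_one]) fun j => by
      simp only [mul_snd, one_fst, one_snd, mul_zero, map_one, mul_one, zero_add] }

instance : Algebra k (TwistedExt s) := Algebra.ofModule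
  (fun c x y => ext' (by simp only [mul_fst, smul_fst, smul_mul_assoc]) fun j => by
    simp only [mul_snd, smul_fst, smul_snd, smul_mul_assoc, smul_add])
  (fun c x y => ext' (by simp only [mul_fst, smul_fst, mul_smul_comm]) fun j => by
    simp only [mul_snd, smul_fst, smul_snd, mul_smul_comm, smul_add, map_smul])

end TwistedExt

/-! ### Gradings on path algebras -/

namespace Grading

section Path

open Polynomial

variable {ι k A J : Type*} [DecidableEq ι] [AddCommGroup ι] [CommRing k] [Ring A] [Algebra k A]

/-- The underlying algebra of a path object: polynomials in a variable of degree zero, and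
square-zero generators indexed by `J`. -/
abbrev PathAlg (σ : J → A →ₐ[k] A) : Type _ := TwistedExt fun j => mapAlgHom (σ j)

/-- The grading on `PathAlg`, where the generator `j` has degree `deg j`. -/
noncomputable def pathGr (gr : ι → Submodule k A) (σ : J → A →ₐ[k] A) (deg : J → ι) (i : ι) :
    Submodule k (PathAlg σ) where
  carrier := {x | (∀ n, coeff x.1 n ∈ gr i) ∧ ∀ j n, coeff (x.2 j) n ∈ gr (i - deg j)}
  zero_mem' := ⟨fun n => by rw [TwistedExt.zero_fst, coeff_zero]; exact Submodule.zero_mem _,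
    fun j n => by rw [TwistedExt.zero_snd, coeff_zero]; exact Submodule.zero_mem _⟩
  add_mem' := fun hx hy =>
    ⟨fun n => by rw [TwistedExt.add_fst, coeff_add]; exact add_mem (hx.1 n) (hy.1 n),
      fun j n => by rw [TwistedExt.add_snd, coeff_add]; exact add_mem (hx.2 j n) (hy.2 j n)⟩
  smul_mem' := fun c _ hx =>
    ⟨fun n => by rw [TwistedExt.smul_fst, coeff_smul]; exact Submodule.smul_mem _ c (hx.1 n),
      fun j n => by rw [TwistedExt.smul_snd, coeff_smul]; exact Submodule.smul_mem _ c (hx.2 j n)⟩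

theorem coeff_derivative_mem {k A : Type*} [CommRing k] [Ring A] [Algebra k A]
    {S : Submodule k A} {p : A[X]} (h : ∀ n, p.coeff n ∈ S) (n : ℕ) :
    (derivative p).coeff n ∈ S := by
  rw [coeff_derivative, ← Nat.cast_succ, ← nsmul_eq_mul']
  exact nsmul_mem (h _) _

theorem finite_coeffMap_proj {ι k A : Type*} [DecidableEq ι] [CommRing k] [Ring A] [Algebra k A]
    {gr : ι → Submodule k A} (h : DirectSum.IsInternal gr) (p : A[X]) :
    {i | coeffMap (proj h i).toAddMonoidHom p ≠ 0}.Finite := by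
  refine Set.Finite.subset (p.support.finite_toSet.biUnion fun n _ => finite_proj h (p.coeff n)) ?_
  intro i hi
  simp only [Set.mem_iUnion]
  by_contra hc
  apply hi
  ext n
  rw [coeff_coeffMap, coeff_zero]
  by_contra hn
  refine hc ⟨n, ?_, hn⟩
  rw [Finset.mem_coe, mem_support_iff]
  intro h0
  apply hn
  rw [h0, map_zero]

/-- The hypothesis `hσ` is the Koszul sign for moving the generator `j` past a coefficient. Since
products of generators vanish, graded commutativity only involves two coefficients, or two
coefficients and one generator. -/
theorem IsGradedComm.path [Finite J] {D : ι →+ ℤ} {gr : ι → Submodule k A}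
    (h : IsGradedComm D gr) {σ : J → A →ₐ[k] A} {deg : J → ι}
    (hσ : ∀ j i, ∀ a ∈ gr i, σ j a = ((D (deg j) * D i).negOnePow : ℤ) • a) :
    IsGradedComm D (pathGr gr σ deg) where
  isInternal := by
    let π : ι → PathAlg σ →+ PathAlg σ := fun i =>
      AddMonoidHom.mk' (fun x => ((coeffMap (proj h.isInternal i).toAddMonoidHom x.1,
        fun j => coeffMap (proj h.isInternal (i - deg j)).toAddMonoidHom (x.2 j)) :
          A[X] × (J → A[X])))
      fun x y => TwistedExt.ext' (map_add _ x.1 y.1) fun j => map_add _ (x.2 j) (y.2 j)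
    have π1 : ∀ i x, (π i x).1 = coeffMap (proj h.isInternal i).toAddMonoidHom x.1 :=
      fun _ _ => rfl
    have π2 : ∀ i x j, (π i x).2 j =
      coeffMap (proj h.isInternal (i - deg j)).toAddMonoidHom (x.2 j) := fun _ _ _ => rfl
    refine isInternal_of_separating π ?_ ?_ ?_ ?_ ?_
    · intro i x
      refine ⟨fun n => ?_, fun j n => ?_⟩
      · rw [π1, coeff_coeffMap]
        exact proj_mem _ _ _
      · rw [π2, coeff_coeffMap]
        exact proj_mem _ _ _
    · intro i x hx
      refine TwistedExt.ext' ?_ fun j => ?_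
      · ext n
        rw [π1, coeff_coeffMap]
        exact proj_same _ (hx.1 n)
      · ext n
        rw [π2, coeff_coeffMap]
        exact proj_same _ (hx.2 j n)
    · intro i l hil x hx
      refine TwistedExt.ext' ?_ fun j => ?_
      · ext n
        rw [π1, coeff_coeffMap]
        exact proj_ne _ hil (hx.1 n)
      · ext n
        rw [π2, coeff_coeffMap]
        exact proj_ne _ (fun h => hil (sub_left_injective h)) (hx.2 j n)
    · intro x hx
      refine TwistedExt.ext' ?_ fun j => ?_
      · ext n
        refine eq_of_proj h.isInternal fun i => ?_
        have := congrArg (fun y : PathAlg σ => coeff y.1 n) (hx i)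
        simp only [π1, coeff_coeffMap] at this
        rw [TwistedExt.zero_fst, coeff_zero, map_zero]
        exact this
      · ext n
        refine eq_of_proj h.isInternal fun i => ?_
        have := congrArg (fun y : PathAlg σ => coeff (y.2 j) n) (hx (i + deg j))
        simp only [π2, coeff_coeffMap, add_sub_cancel_right] at this
        rw [TwistedExt.zero_snd, coeff_zero, map_zero]
        exact this
    · intro x
      refine Set.Finite.subset ((finite_coeffMap_proj h.isInternal x.1).union
        (Set.finite_iUnion fun j => (finite_coeffMap_proj h.isInternal (x.2 j)).preimage
          (sub_left_injective (b := deg j)).injOn)) ?_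
      intro i hi
      by_contra hc
      simp only [Set.mem_union, Set.mem_ofPred_eq, Set.mem_iUnion, Set.mem_preimage, not_or,
        not_exists, not_not] at hc
      exact hi (TwistedExt.ext' hc.1 hc.2)
  one_mem := by
    refine ⟨fun n => ?_, fun j n => ?_⟩
    · rw [TwistedExt.one_fst, coeff_one]
      split_ifs
      · exact h.one_mem
      · exact Submodule.zero_mem _
    · rw [TwistedExt.one_snd, coeff_zero]
      exact Submodule.zero_mem _
  mul_mem := by
    intro i l x y hx hy
    have hs : ∀ j n, coeff (mapAlgHom (σ j) y.1) n ∈ gr l := by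
      intro j n
      rw [coe_mapAlgHom, coeff_map]
      show σ j _ ∈ _
      rw [hσ j l _ (hy.1 n)]
      exact zsmul_mem (hy.1 n) _
    refine ⟨fun n => ?_, fun j n => ?_⟩
    · rw [TwistedExt.mul_fst, coeff_mul]
      exact Submodule.sum_mem _ fun m _ => h.mul_mem (hx.1 _) (hy.1 _)
    · rw [TwistedExt.mul_snd, coeff_add, coeff_mul, coeff_mul]
      refine add_mem (Submodule.sum_mem _ fun m _ => ?_) (Submodule.sum_mem _ fun m _ => ?_)
      · rw [add_sub_assoc]
        exact h.mul_mem (hx.1 _) (hy.2 j _)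
      · rw [add_sub_right_comm]
        exact h.mul_mem (hx.2 j _) (hs j _)
  mul_comm := by
    intro i l x y hx hy
    have hs : ∀ (z : PathAlg σ) i, z ∈ pathGr gr σ deg i → ∀ j,
        mapAlgHom (σ j) z.1 = ((D (deg j) * D i).negOnePow : ℤ) • z.1 := by
      intro z i hz j
      ext n
      rw [coe_mapAlgHom, coeff_map, coeff_smul]
      exact hσ j i _ (hz.1 n)
    refine TwistedExt.ext' ?_ fun j => ?_
    · rw [TwistedExt.zsmul_fst]
      exact mul_eq_zsmul_mul _ fun m n => h.mul_comm (hx.1 m) (hy.1 n)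
    · rw [TwistedExt.zsmul_snd, TwistedExt.mul_snd, TwistedExt.mul_snd, hs x i hx, hs y l hy,
        mul_eq_zsmul_mul _ fun m n => h.mul_comm (hx.1 m) (hy.2 j n), mul_smul_comm, mul_smul_comm,
        mul_eq_zsmul_mul _ fun m n => h.mul_comm (hx.2 j m) (hy.1 n), smul_add, smul_smul,
        smul_smul, add_comm, ← Units.val_mul, ← Units.val_mul, ← Int.negOnePow_add,
        ← Int.negOnePow_add, map_sub, map_sub]
      -- The coefficient at generator `j` has degree lowered by `deg j`, and the twist by `σ j`
      -- compensates. The first identity of exponents holds only modulo 2, the second as integers.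
      have e1 : (D i * (D l - D (deg j))).negOnePow = (D i * D l + D (deg j) * D i).negOnePow := by
        rw [Int.negOnePow_eq_iff]
        exact ⟨-(D (deg j) * D i), by ring⟩
      have e2 : D (deg j) * D l + (D i - D (deg j)) * D l = D i * D l := by ring
      rw [e1, e2]

end Path

end Grading

/-! ### Pullbacks -/

namespace Grading

section Pullback

variable {ι k A B Z : Type*} [DecidableEq ι] [AddCommGroup ι] [CommRing k] [Ring A] [Algebra k A]
  [Ring B] [Algebra k B] [Ring Z] [Algebra k Z]

/-- The underlying algebra of a pullback. -/
abbrev pullbackAlg (f : A →ₐ[k] Z) (g : B →ₐ[k] Z) : Subalgebra k (A × B) :=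
  AlgHom.equalizer (f.comp (AlgHom.fst k A B)) (g.comp (AlgHom.snd k A B))

/-- The grading on a pullback. -/
def pullbackGr (f : A →ₐ[k] Z) (g : B →ₐ[k] Z) (gr : ι → Submodule k A) (gr' : ι → Submodule k B)
    (i : ι) : Submodule k (pullbackAlg f g) :=
  ((gr i).prod (gr' i)).comap (pullbackAlg f g).val.toLinearMap

/-- Graded maps commute with projections, so projecting both entries of a pair keeps it in the
pullback. -/
theorem IsGradedComm.pullback {D : ι →+ ℤ} {gr : ι → Submodule k A} {gr' : ι → Submodule k B}
    {gr'' : ι → Submodule k Z} (h : IsGradedComm D gr) (h' : IsGradedComm D gr')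
    (h'' : IsGradedComm D gr'') {f : A →ₐ[k] Z} {g : B →ₐ[k] Z}
    (hf : ∀ i, ∀ x ∈ gr i, f x ∈ gr'' i) (hg : ∀ i, ∀ x ∈ gr' i, g x ∈ gr'' i) :
    IsGradedComm D (pullbackGr f g gr gr') where
  isInternal := by
    let π : ι → pullbackAlg f g →+ pullbackAlg f g := fun i => AddMonoidHom.mk'
      (fun x => ⟨(proj h.isInternal i x.1.1, proj h'.isInternal i x.1.2), by
        show f _ = g _
        have h1 := map_proj h.isInternal h''.isInternal f.toLinearMap.toAddMonoidHom id
          Function.injective_id hf i x.1.1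
        have h2 := map_proj h'.isInternal h''.isInternal g.toLinearMap.toAddMonoidHom id
          Function.injective_id hg i x.1.2
        refine h1.trans (Eq.trans ?_ h2.symm)
        exact congrArg _ x.2⟩)
      fun x y => Subtype.ext (Prod.ext (map_add _ x.1.1 y.1.1) (map_add _ x.1.2 y.1.2))
    refine isInternal_of_separating π (fun i x => ⟨proj_mem _ _ _, proj_mem _ _ _⟩)
      (fun i x hx => Subtype.ext (Prod.ext (proj_same _ hx.1) (proj_same _ hx.2)))
      (fun i j hij x hx => Subtype.ext (Prod.ext (proj_ne _ hij hx.1) (proj_ne _ hij hx.2))) ?_ ?_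
    · intro x hx
      refine Subtype.ext (Prod.ext (eq_zero_of_proj h.isInternal fun i => ?_)
        (eq_zero_of_proj h'.isInternal fun i => ?_))
      · exact congrArg (fun y : pullbackAlg f g => y.1.1) (hx i)
      · exact congrArg (fun y : pullbackAlg f g => y.1.2) (hx i)
    · intro x
      refine ((finite_proj h.isInternal x.1.1).union (finite_proj h'.isInternal x.1.2)).subset ?_
      intro i hi
      by_contra hc
      simp only [Set.mem_union, Set.mem_ofPred_eq, not_or, not_not] at hc
      exact hi (Subtype.ext (Prod.ext hc.1 hc.2))
  one_mem := ⟨h.one_mem, h'.one_mem⟩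
  mul_mem := fun ha hb => ⟨h.mul_mem ha.1 hb.1, h'.mul_mem ha.2 hb.2⟩
  mul_comm := fun ha hb =>
    Subtype.ext (Prod.ext (h.mul_comm ha.1 hb.1) (h'.mul_comm ha.2 hb.2))

end Pullback

end Grading

namespace CDGA

variable {k : Type} [Field k]

/-- The pullback of cdga's. -/
def pullback {A B Z : CDGA.{u} k} (f : A ⟶ Z) (g : B ⟶ Z) : CDGA.{u} k where
  carrier := Grading.pullbackAlg (Hom.fn f) (Hom.fn g)
  gr := Grading.pullbackGr (Hom.fn f) (Hom.fn g) A.gr B.gr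
  isInternal := (A.isGradedComm.pullback B.isGradedComm Z.isGradedComm
    (fun _ _ hx => Hom.fn_gr f hx) (fun _ _ hx => Hom.fn_gr g hx)).isInternal
  one_mem := ⟨A.one_mem, B.one_mem⟩
  mul_mem := fun ha hb => ⟨A.mul_mem ha.1 hb.1, B.mul_mem ha.2 hb.2⟩
  mul_comm := fun ha hb => Subtype.ext (Prod.ext (A.mul_comm ha.1 hb.1) (B.mul_comm ha.2 hb.2))
  d := (A.d.prodMap B.d).restrict (p := Subalgebra.toSubmodule (Grading.pullbackAlg _ _))
    (q := Subalgebra.toSubmodule (Grading.pullbackAlg _ _)) fun x hx => by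
      show Hom.fn f (A.d x.1) = Hom.fn g (B.d x.2)
      rw [Hom.fn_d, Hom.fn_d]
      exact congrArg Z.d hx
  d_mem := fun ha => ⟨A.d_mem ha.1, B.d_mem ha.2⟩
  d_d := fun x => Subtype.ext (Prod.ext (A.d_d _) (B.d_d _))
  leibniz := fun ha b => Subtype.ext (Prod.ext (A.leibniz ha.1 _) (B.leibniz ha.2 _))

section

variable {A B Z : CDGA.{u} k} (f : A ⟶ Z) (g : B ⟶ Z)

/-- The first projection. -/
def pullbackFst : pullback f g ⟶ A where
  toAlgHom := (AlgHom.fst k A.carrier B.carrier).comp (Grading.pullbackAlg _ _).val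
  map_gr := fun h => h.1
  map_d := fun _ => rfl

/-- The second projection. -/
def pullbackSnd : pullback f g ⟶ B where
  toAlgHom := (AlgHom.snd k A.carrier B.carrier).comp (Grading.pullbackAlg _ _).val
  map_gr := fun h => h.2
  map_d := fun _ => rfl

/-- The map to a pullback. -/
def pullbackLift {X : CDGA.{u} k} (a : X ⟶ A) (b : X ⟶ B) (h : a ≫ f = b ≫ g) :
    X ⟶ pullback f g where
  toAlgHom := ((Hom.fn a).prod (Hom.fn b)).codRestrict (Grading.pullbackAlg _ _) fun x =>
    congrArg (fun c : X ⟶ Z => Hom.fn c x) h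
  map_gr := fun hx => ⟨Hom.fn_gr a hx, Hom.fn_gr b hx⟩
  map_d := fun x => Subtype.ext (Prod.ext (Hom.fn_d a x) (Hom.fn_d b x))

end

end CDGA

namespace RCbba

/-- The pullback of `ℝ`-cbba's. -/
def pullback {A B Z : RCbba.{u}} (f : A ⟶ Z) (g : B ⟶ Z) : RCbba.{u} where
  carrier := Grading.pullbackAlg (Hom.fn f) (Hom.fn g)
  gr := Grading.pullbackGr (Hom.fn f) (Hom.fn g) A.gr B.gr
  isInternal := (A.isGradedComm.pullback B.isGradedComm Z.isGradedComm
    (fun _ _ hx => Hom.fn_gr f hx) (fun _ _ hx => Hom.fn_gr g hx)).isInternal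
  one_mem := ⟨A.one_mem, B.one_mem⟩
  mul_mem := fun ha hb => ⟨A.mul_mem ha.1 hb.1, B.mul_mem ha.2 hb.2⟩
  mul_comm := fun ha hb => Subtype.ext (Prod.ext (A.mul_comm ha.1 hb.1) (B.mul_comm ha.2 hb.2))
  del := (A.del.prodMap B.del).restrict (p := Subalgebra.toSubmodule (Grading.pullbackAlg _ _))
    (q := Subalgebra.toSubmodule (Grading.pullbackAlg _ _)) fun x hx => by
      show Hom.fn f (A.del x.1) = Hom.fn g (B.del x.2)
      rw [Hom.fn_del, Hom.fn_del]
      exact congrArg Z.del hx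
  delbar := (A.delbar.prodMap B.delbar).restrict
    (p := Subalgebra.toSubmodule (Grading.pullbackAlg _ _))
    (q := Subalgebra.toSubmodule (Grading.pullbackAlg _ _)) fun x hx => by
      show Hom.fn f (A.delbar x.1) = Hom.fn g (B.delbar x.2)
      rw [Hom.fn_delbar, Hom.fn_delbar]
      exact congrArg Z.delbar hx
  del_mem := fun ha => ⟨A.del_mem ha.1, B.del_mem ha.2⟩
  delbar_mem := fun ha => ⟨A.delbar_mem ha.1, B.delbar_mem ha.2⟩
  del_del := fun x => Subtype.ext (Prod.ext (A.del_del _) (B.del_del _))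
  delbar_delbar := fun x => Subtype.ext (Prod.ext (A.delbar_delbar _) (B.delbar_delbar _))
  del_delbar := fun x => Subtype.ext (Prod.ext (A.del_delbar _) (B.del_delbar _))
  del_leibniz := fun ha b => Subtype.ext (Prod.ext (A.del_leibniz ha.1 _) (B.del_leibniz ha.2 _))
  delbar_leibniz := fun ha b =>
    Subtype.ext (Prod.ext (A.delbar_leibniz ha.1 _) (B.delbar_leibniz ha.2 _))
  conj :=
    { toFun := fun x => ⟨(A.conj x.1.1, B.conj x.1.2), by
        show Hom.fn f (A.conj x.1.1) = Hom.fn g (B.conj x.1.2)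
        rw [Hom.fn_conj, Hom.fn_conj]
        exact congrArg Z.conj x.2⟩
      map_add' := fun x y => Subtype.ext (Prod.ext (map_add A.conj _ _) (map_add B.conj _ _))
      map_smul' := fun c x => Subtype.ext
        (Prod.ext (A.conj.map_smulₛₗ c x.1.1) (B.conj.map_smulₛₗ c x.1.2)) }
  conj_conj := fun x => Subtype.ext (Prod.ext (A.conj_conj _) (B.conj_conj _))
  conj_one := Subtype.ext (Prod.ext A.conj_one B.conj_one)
  conj_mul := fun x y => Subtype.ext (Prod.ext (A.conj_mul _ _) (B.conj_mul _ _))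
  conj_mem := fun h => ⟨A.conj_mem h.1, B.conj_mem h.2⟩
  conj_del := fun x => Subtype.ext (Prod.ext (A.conj_del _) (B.conj_del _))

section

variable {A B Z : RCbba.{u}} (f : A ⟶ Z) (g : B ⟶ Z)

/-- The first projection. -/
def pullbackFst : pullback f g ⟶ A where
  toAlgHom := (AlgHom.fst ℂ A.carrier B.carrier).comp (Grading.pullbackAlg _ _).val
  map_gr := fun h => h.1
  map_del := fun _ => rfl
  map_delbar := fun _ => rfl
  map_conj := fun _ => rfl

/-- The second projection. -/
def pullbackSnd : pullback f g ⟶ B where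
  toAlgHom := (AlgHom.snd ℂ A.carrier B.carrier).comp (Grading.pullbackAlg _ _).val
  map_gr := fun h => h.2
  map_del := fun _ => rfl
  map_delbar := fun _ => rfl
  map_conj := fun _ => rfl

/-- The map to a pullback. -/
def pullbackLift {X : RCbba.{u}} (a : X ⟶ A) (b : X ⟶ B) (h : a ≫ f = b ≫ g) :
    X ⟶ pullback f g where
  toAlgHom := ((Hom.fn a).prod (Hom.fn b)).codRestrict (Grading.pullbackAlg _ _) fun x =>
    congrArg (fun c : X ⟶ Z => Hom.fn c x) h
  map_gr := fun hx => ⟨Hom.fn_gr a hx, Hom.fn_gr b hx⟩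
  map_del := fun x => Subtype.ext (Prod.ext (Hom.fn_del a x) (Hom.fn_del b x))
  map_delbar := fun x => Subtype.ext (Prod.ext (Hom.fn_delbar a x) (Hom.fn_delbar b x))
  map_conj := fun x => Subtype.ext (Prod.ext (Hom.fn_conj a x) (Hom.fn_conj b x))

end

end RCbba

/-! ### Path objects -/

namespace CDGA

open Polynomial

variable {k : Type} [Field k]

section

variable (Y : CDGA.{u} k)

/-- The differential on polynomials, with the variable treated as a constant. -/
noncomputable abbrev polyD : Y.carrier[X] →+ Y.carrier[X] := coeffMap Y.d.toAddMonoidHom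

/-- The sign automorphism on polynomials. -/
noncomputable abbrev polySign : Y.carrier[X] →+ Y.carrier[X] :=
  coeffMap Y.sign.toLinearMap.toAddMonoidHom

theorem mapAlgHom_sign (p : Y.carrier[X]) : mapAlgHom Y.sign p = Y.polySign p := by
  ext n
  rw [coe_mapAlgHom, coeff_map, coeff_coeffMap]
  rfl

theorem polyD_mul (p q : Y.carrier[X]) :
    Y.polyD (p * q) = Y.polyD p * q + Y.polySign p * Y.polyD q :=
  coeffMap_leibniz _ _ Y.leibniz_sign p q

theorem polySign_mul (p q : Y.carrier[X]) :
    Y.polySign (p * q) = Y.polySign p * Y.polySign q :=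
  coeffMap_mul _ (map_mul Y.sign) p q

theorem polySign_polyD (p : Y.carrier[X]) :
    Y.polySign (Y.polyD p) = -Y.polyD (Y.polySign p) := by
  ext n
  rw [coeff_neg, coeff_coeffMap, coeff_coeffMap, coeff_coeffMap, coeff_coeffMap]
  exact Y.sign_d _

theorem polySign_polySign (p : Y.carrier[X]) : Y.polySign (Y.polySign p) = p := by
  ext n
  rw [coeff_coeffMap, coeff_coeffMap]
  exact Y.sign_sign _

theorem polyD_polyD (p : Y.carrier[X]) : Y.polyD (Y.polyD p) = 0 := by
  ext n
  rw [coeff_coeffMap, coeff_coeffMap]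
  exact Y.d_d _

theorem polySign_of_mem {n : ℤ} {p : Y.carrier[X]} (hp : ∀ m, p.coeff m ∈ Y.gr n) :
    Y.polySign p = (n.negOnePow : ℤ) • p := by
  ext m
  rw [coeff_coeffMap, coeff_smul]
  exact Y.isGradedComm.sign_apply (hp m)

/-- The generator dt has degree 1, so it passes coefficients through the sign automorphism. -/
theorem isGradedComm_path : Grading.IsGradedComm (AddMonoidHom.id ℤ)
    (Grading.pathGr Y.gr (fun _ : Unit => Y.sign) fun _ => 1) :=
  Y.isGradedComm.path fun _ i a ha => (Y.isGradedComm.sign_apply ha).trans (by simp)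

/-- The path object `Y ⊗ Λ(t, dt)`; the generator `dt` is written on the right. -/
noncomputable def path : CDGA.{u} k where
  carrier := Grading.PathAlg fun _ : Unit => Y.sign
  gr := Grading.pathGr Y.gr (fun _ : Unit => Y.sign) fun _ => 1
  isInternal := Y.isGradedComm_path.isInternal
  one_mem := Y.isGradedComm_path.one_mem
  mul_mem := Y.isGradedComm_path.mul_mem
  mul_comm := Y.isGradedComm_path.mul_comm
  -- With dt on the right, d(p + q dt) = d_Y p + (d_Y q + sign(p′)) dt, where d_Y acts on
  -- coefficients; the sign arises from moving d past the coefficients of p.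
  d :=
    { toFun := fun x => TwistedExt.mk _ (Y.polyD x.1)
        fun _ => Y.polyD (x.2 ()) + Y.polySign (derivative x.1)
      map_add' := fun x y => TwistedExt.ext'
        (by simp only [TwistedExt.mk_fst, TwistedExt.add_fst, map_add])
        fun _ => by
          simp only [TwistedExt.mk_snd, TwistedExt.add_fst, TwistedExt.add_snd, map_add]; abel
      map_smul' := fun c x => TwistedExt.ext'
        (by ext n; simp [TwistedExt.mk_fst, TwistedExt.smul_fst])
        fun _ => by
          ext n
          simp [TwistedExt.mk_snd, TwistedExt.smul_fst, TwistedExt.smul_snd, coeff_derivative] }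
  d_mem := by
    intro i x hx
    refine ⟨fun n => ?_, fun j n => ?_⟩
    · show (Y.polyD x.1).coeff n ∈ _
      rw [coeff_coeffMap]
      exact Y.d_mem (hx.1 n)
    · show (Y.polyD (x.2 ()) + Y.polySign (derivative x.1)).coeff n ∈ _
      rw [coeff_add, coeff_coeffMap, coeff_coeffMap, add_sub_cancel_right]
      refine add_mem ?_ (Y.isGradedComm.sign_mem (Grading.coeff_derivative_mem hx.1 n))
      have := Y.d_mem (hx.2 () n)
      rwa [sub_add_cancel] at this
  d_d := by
    intro x
    refine TwistedExt.ext' (Y.polyD_polyD x.1) fun _ => ?_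
    show Y.polyD (Y.polyD (x.2 ()) + Y.polySign (derivative x.1)) +
      Y.polySign (derivative (Y.polyD x.1)) = 0
    rw [map_add, polyD_polyD, derivative_coeffMap, polySign_polyD]
    abel
  leibniz := by
    intro i x hx y
    have h1 := Y.polySign_of_mem hx.1
    have h2 := Y.polySign_of_mem (hx.2 ())
    rw [Int.negOnePow_sub, Int.negOnePow_one, mul_neg_one, Units.val_neg, neg_smul] at h2
    refine TwistedExt.ext' ?_ fun _ => ?_
    · show Y.polyD (x.1 * y.1) = Y.polyD x.1 * y.1 + (i.negOnePow : ℤ) • (x.1 * Y.polyD y.1)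
      rw [polyD_mul, h1, smul_mul_assoc]
    · show Y.polyD (x.1 * y.2 () + x.2 () * mapAlgHom Y.sign y.1) +
          Y.polySign (derivative (x.1 * y.1)) =
        Y.polyD x.1 * y.2 () + (Y.polyD (x.2 ()) + Y.polySign (derivative x.1)) *
          mapAlgHom Y.sign y.1 +
        (i.negOnePow : ℤ) • (x.1 * (Y.polyD (y.2 ()) + Y.polySign (derivative y.1)) +
          x.2 () * mapAlgHom Y.sign (Y.polyD y.1))
      rw [mapAlgHom_sign, mapAlgHom_sign, smul_add, ← smul_mul_assoc, ← smul_mul_assoc, ← h1,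
        ← neg_neg ((i.negOnePow : ℤ) • x.2 ()), ← h2, polySign_polyD, derivative_mul]
      simp only [map_add, polyD_mul, polySign_mul, mul_add, add_mul, neg_mul, mul_neg, neg_neg]
      abel

/-- Evaluation at `t = 0`. -/
noncomputable def pathZero : Y.path ⟶ Y where
  toAlgHom := AlgHom.ofLinearMap
    { toFun := fun x : Grading.PathAlg (fun _ : Unit => Y.sign) => coeff x.1 0
      map_add' := fun _ _ => coeff_add _ _ _
      map_smul' := fun _ _ => coeff_smul _ _ _ } coeff_one_zero fun _ _ => mul_coeff_zero _ _
  map_gr := fun hx => hx.1 0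
  map_d := fun _ => coeff_coeffMap _ _ _

/-- Evaluation at `t = 1`. -/
noncomputable def pathOne : Y.path ⟶ Y where
  toAlgHom := AlgHom.ofLinearMap
    { toFun := fun x : Grading.PathAlg (fun _ : Unit => Y.sign) => eval 1 x.1
      map_add' := fun x y => eval_add
      map_smul' := fun c x => eval_smul _ _ _ } eval_one fun x y =>
        -- Evaluation at 1 is multiplicative over a noncommutative ring because 1 commutes with all
        -- coefficients.
        eval₂_mul_noncomm _ _ fun _ => Commute.one_right _
  map_gr := fun {n x} hx => by
    show eval 1 x.1 ∈ Y.gr n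
    rw [eval_eq_sum, sum_def]
    exact Submodule.sum_mem _ fun m _ => by
      rw [one_pow, mul_one]
      exact hx.1 m
  map_d := fun x => eval_one_coeffMap _ _

/-- Constant paths. -/
noncomputable def pathConst : Y ⟶ Y.path where
  toAlgHom := AlgHom.ofLinearMap
    { toFun := fun y => TwistedExt.mk (fun _ : Unit => mapAlgHom Y.sign) (C y) fun _ => 0
      map_add' := fun x y => TwistedExt.ext' (s := fun _ : Unit => mapAlgHom Y.sign) (map_add C x y)
        fun _ => (add_zero _).symm
      map_smul' := fun c x => TwistedExt.ext' (s := fun _ : Unit => mapAlgHom Y.sign)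
        (smul_C c x).symm fun _ => (smul_zero c).symm }
    (TwistedExt.ext' (s := fun _ : Unit => mapAlgHom Y.sign) (map_one C) fun _ => rfl) fun x y =>
      TwistedExt.ext' (s := fun _ : Unit => mapAlgHom Y.sign) (map_mul C x y) fun _ => by
        show 0 = C x * 0 + 0 * mapAlgHom Y.sign (C y)
        rw [mul_zero, zero_mul, add_zero]
  map_gr := fun {n x} hx => by
    refine ⟨fun m => ?_, fun _ m => ?_⟩
    · show (C x).coeff m ∈ Y.gr n
      rw [coeff_C]
      split_ifs
      exacts [hx, Submodule.zero_mem _]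
    · show (0 : Y.carrier[X]).coeff m ∈ _
      exact Submodule.zero_mem _
  map_d := fun x => TwistedExt.ext' (s := fun _ : Unit => mapAlgHom Y.sign)
    (coeffMap_C Y.d.toAddMonoidHom x).symm fun _ => by
    show 0 = Y.polyD 0 + Y.polySign (derivative (C x))
    rw [derivative_C, map_zero, map_zero, add_zero]

theorem pathConst_zero : Y.pathConst ≫ Y.pathZero = 𝟙 Y := hom_ext fun x => coeff_C_zero (a := x)

theorem pathConst_one : Y.pathConst ≫ Y.pathOne = 𝟙 Y := hom_ext fun x => eval_C (a := x) (x := 1)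

/-- Closed paths starting at zero have a primitive starting at zero. -/
theorem acyclicKer_pathZero [CharZero k] : AcyclicKer Y.pathZero := by
  intro x hx hdx
  have h0 : coeff x.1 0 = 0 := hx
  have h1 : Y.polyD (x.2 ()) + Y.polySign (derivative x.1) = 0 :=
    congrArg (fun z : Grading.PathAlg (fun _ : Unit => Y.sign) => z.2 ()) hdx
  -- The primitive is the integral from 0 to t of the dt-coefficient, corrected by the sign. The
  -- dt-coefficient of its differential is right by construction; the polynomial part is right
  -- because the derivatives agree by closedness and both sides vanish at t = 0.
  refine ⟨TwistedExt.mk (fun _ : Unit => mapAlgHom Y.sign) (integral k (Y.polySign (x.2 ())))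
    fun _ => 0, coeff_integral_zero k _,
    TwistedExt.ext' (s := fun _ : Unit => mapAlgHom Y.sign) ?_ fun _ => ?_⟩
  · show Y.polyD (integral k (Y.polySign (x.2 ()))) = x.1
    refine eq_of_derivative_eq k ?_ ?_
    · rw [derivative_coeffMap, derivative_integral, ← neg_eq_iff_eq_neg.2 (Y.polySign_polyD _),
        eq_neg_of_add_eq_zero_left h1, map_neg, neg_neg, polySign_polySign]
    · rw [coeff_coeffMap, coeff_integral_zero, h0, map_zero]
  · show Y.polyD 0 + Y.polySign (derivative (integral k (Y.polySign (x.2 ())))) = x.2 ()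
    rw [derivative_integral, polySign_polySign, map_zero, zero_add]

end

/-- Every morphism of cdga's factors as a section of a quasi-isomorphism followed by a
surjection. -/
theorem exists_factorization [CharZero k] {X Y : CDGA.{u} k} (f : X ⟶ Y) :
    ∃ (P : CDGA.{u} k) (s : X ⟶ P) (r : P ⟶ X) (f' : P ⟶ Y), s ≫ r = 𝟙 X ∧ s ≫ f' = f ∧
      quasiIso k r ∧ Function.Surjective (Hom.fn f') := by
  -- The mapping path object: pairs (x, γ) with γ(0) = f x. The section pairs x with a constant
  -- path, and the surjection is (x, γ) ↦ γ(1).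
  refine ⟨pullback f Y.pathZero, pullbackLift f Y.pathZero (𝟙 X) (f ≫ Y.pathConst) ?_,
    pullbackFst f Y.pathZero, pullbackSnd f Y.pathZero ≫ Y.pathOne, rfl, ?_, ?_, ?_⟩
  · rw [Category.assoc, pathConst_zero, Category.comp_id, Category.id_comp]
  · show f ≫ Y.pathConst ≫ Y.pathOne = f
    rw [pathConst_one, Category.comp_id]
  · refine quasiIso_of_acyclicKer ?_ ?_
    · intro x
      exact ⟨⟨(x, Hom.fn Y.pathConst (Hom.fn f x)), (coeff_C_zero (a := Hom.fn f x)).symm⟩, rfl⟩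
    · rintro ⟨⟨x, γ⟩, h⟩ (rfl : x = 0) hd
      have h0 : Hom.fn Y.pathZero γ = 0 := Eq.trans (Eq.symm h) (map_zero (Hom.fn f))
      obtain ⟨η, hη, hη'⟩ := Y.acyclicKer_pathZero γ h0
        (congrArg (fun z : (pullback f Y.pathZero).carrier => z.1.2) hd)
      refine ⟨⟨(0, η), (map_zero (Hom.fn f)).trans hη.symm⟩, rfl,
        Subtype.ext (Prod.ext (map_zero X.d) hη')⟩
  · intro y
    -- The path y·t runs from 0 to y, so it lies over x = 0.
    refine ⟨⟨(0, TwistedExt.mk (fun _ : Unit => mapAlgHom Y.sign) (C y * Polynomial.X)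
      fun _ => 0), ?_⟩, ?_⟩
    · exact (map_zero (Hom.fn f)).trans (coeff_mul_X_zero _).symm
    · show eval 1 (C y * Polynomial.X) = y
      rw [eval_C_mul, eval_X, mul_one]

end CDGA

/-! ### The path object of an `ℝ`-cbba -/

namespace RCbba

open Polynomial

section

variable (Y : RCbba.{u})

/-- The differential `∂` on polynomials, with the variable treated as a constant. -/
noncomputable abbrev polyDel : Y.carrier[X] →+ Y.carrier[X] := coeffMap Y.del.toAddMonoidHom

/-- The differential `∂̄` on polynomials, with the variable treated as a constant. -/
noncomputable abbrev polyDelbar : Y.carrier[X] →+ Y.carrier[X] := coeffMap Y.delbar.toAddMonoidHom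

/-- The sign automorphism on polynomials. -/
noncomputable abbrev polySign : Y.carrier[X] →+ Y.carrier[X] :=
  coeffMap Y.sign.toLinearMap.toAddMonoidHom

/-- The real structure on polynomials. -/
noncomputable abbrev polyConj : Y.carrier[X] →+ Y.carrier[X] := coeffMap Y.conj.toAddMonoidHom

theorem mapAlgHom_sign (p : Y.carrier[X]) : mapAlgHom Y.sign p = Y.polySign p := by
  ext n
  rw [coe_mapAlgHom, coeff_map, coeff_coeffMap]
  rfl

theorem polyDel_mul (p q : Y.carrier[X]) :
    Y.polyDel (p * q) = Y.polyDel p * q + Y.polySign p * Y.polyDel q :=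
  coeffMap_leibniz _ _ Y.del_leibniz_sign p q

theorem polySign_mul (p q : Y.carrier[X]) :
    Y.polySign (p * q) = Y.polySign p * Y.polySign q :=
  coeffMap_mul _ (map_mul Y.sign) p q

theorem polyConj_mul (p q : Y.carrier[X]) :
    Y.polyConj (p * q) = Y.polyConj p * Y.polyConj q :=
  coeffMap_mul _ Y.conj_mul p q

theorem polySign_polyDel (p : Y.carrier[X]) :
    Y.polySign (Y.polyDel p) = -Y.polyDel (Y.polySign p) := by
  ext n
  rw [coeff_neg, coeff_coeffMap, coeff_coeffMap, coeff_coeffMap, coeff_coeffMap]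
  exact Y.sign_del _

theorem polySign_polyDelbar (p : Y.carrier[X]) :
    Y.polySign (Y.polyDelbar p) = -Y.polyDelbar (Y.polySign p) := by
  ext n
  rw [coeff_neg, coeff_coeffMap, coeff_coeffMap, coeff_coeffMap, coeff_coeffMap]
  exact Y.sign_delbar _

theorem polySign_polySign (p : Y.carrier[X]) : Y.polySign (Y.polySign p) = p := by
  ext n
  rw [coeff_coeffMap, coeff_coeffMap]
  exact Y.sign_sign _

theorem polyConj_polySign (p : Y.carrier[X]) :
    Y.polyConj (Y.polySign p) = Y.polySign (Y.polyConj p) := by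
  ext n
  rw [coeff_coeffMap, coeff_coeffMap, coeff_coeffMap, coeff_coeffMap]
  exact Y.conj_sign _

theorem polyConj_polyConj (p : Y.carrier[X]) : Y.polyConj (Y.polyConj p) = p := by
  ext n
  rw [coeff_coeffMap, coeff_coeffMap]
  exact Y.conj_conj _

theorem polyConj_polyDel (p : Y.carrier[X]) :
    Y.polyConj (Y.polyDel p) = Y.polyDelbar (Y.polyConj p) := by
  ext n
  rw [coeff_coeffMap, coeff_coeffMap, coeff_coeffMap, coeff_coeffMap]
  exact Y.conj_del _

theorem polyDel_polyDel (p : Y.carrier[X]) : Y.polyDel (Y.polyDel p) = 0 := by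
  ext n
  rw [coeff_coeffMap, coeff_coeffMap]
  exact Y.del_del _

theorem polyDelbar_polyDelbar (p : Y.carrier[X]) : Y.polyDelbar (Y.polyDelbar p) = 0 := by
  ext n
  rw [coeff_coeffMap, coeff_coeffMap]
  exact Y.delbar_delbar _

theorem polyDelbar_polyDel (p : Y.carrier[X]) :
    Y.polyDelbar (Y.polyDel p) = -Y.polyDel (Y.polyDelbar p) := by
  ext n
  rw [coeff_neg, coeff_coeffMap, coeff_coeffMap, coeff_coeffMap, coeff_coeffMap]
  exact Y.delbar_del _

theorem polySign_of_mem {i : ℤ × ℤ} {p : Y.carrier[X]} (hp : ∀ m, p.coeff m ∈ Y.gr i) :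
    Y.polySign p = ((i.1 + i.2).negOnePow : ℤ) • p := by
  ext m
  rw [coeff_coeffMap, coeff_smul]
  exact Y.isGradedComm.sign_apply (hp m)

/-- The automorphisms through which the square-zero generators of bidegrees `(1, 0)`, `(0, 1)` and
`(1, 1)` of the path object commute with the coefficients. -/
noncomputable def pathTwist : Fin 3 → Y.carrier →ₐ[ℂ] Y.carrier
  | 0 => Y.sign
  | 1 => Y.sign
  | 2 => AlgHom.id ℂ Y.carrier

/-- The bidegrees of the square-zero generators of the path object. -/
def pathDeg : Fin 3 → ℤ × ℤ
  | 0 => (1, 0)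
  | 1 => (0, 1)
  | 2 => (1, 1)

/-- The underlying algebra of the path object. -/
abbrev PathCarrier : Type u := Grading.PathAlg Y.pathTwist

/-- The element of the path object with the given components. -/
noncomputable def pathMk (a b c e : Y.carrier[X]) : Y.PathCarrier :=
  TwistedExt.mk (fun j => mapAlgHom (Y.pathTwist j)) a fun
    | 0 => b
    | 1 => c
    | 2 => e

variable {Y} in
theorem path_ext {x y : Y.PathCarrier} (h : x.1 = y.1) (h0 : x.2 0 = y.2 0) (h1 : x.2 1 = y.2 1)
    (h2 : x.2 2 = y.2 2) : x = y :=
  TwistedExt.ext' h fun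
    | 0 => h0
    | 1 => h1
    | 2 => h2

/-- The generators ∂t and ∂̄t are odd and bring in the sign automorphism; ∂∂̄t is even and commutes
with the coefficients. -/
theorem path_mul (x y : Y.PathCarrier) : x * y = Y.pathMk (x.1 * y.1)
    (x.1 * y.2 0 + x.2 0 * Y.polySign y.1) (x.1 * y.2 1 + x.2 1 * Y.polySign y.1)
    (x.1 * y.2 2 + x.2 2 * y.1) := by
  refine path_ext rfl ?_ ?_ ?_
  · show x.1 * y.2 0 + x.2 0 * mapAlgHom Y.sign y.1 = _
    rw [mapAlgHom_sign]
    rfl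
  · show x.1 * y.2 1 + x.2 1 * mapAlgHom Y.sign y.1 = _
    rw [mapAlgHom_sign]
    rfl
  · show x.1 * y.2 2 + x.2 2 * mapAlgHom (AlgHom.id ℂ Y.carrier) y.1 = _
    rw [mapAlgHom_id]
    rfl

theorem isGradedComm_path :
    Grading.IsGradedComm degHom (Grading.pathGr Y.gr Y.pathTwist pathDeg) :=
  Y.isGradedComm.path fun j i a ha => by
    match j with
    | 0 =>
      have h1 : degHom (pathDeg 0) = 1 := rfl
      rw [h1, one_mul]
      exact Y.isGradedComm.sign_apply ha
    | 1 =>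
      have h1 : degHom (pathDeg 1) = 1 := rfl
      rw [h1, one_mul]
      exact Y.isGradedComm.sign_apply ha
    | 2 =>
      have : degHom (pathDeg 2) * degHom i = degHom i + degHom i := two_mul (degHom i)
      rw [this, Int.negOnePow_even _ ⟨_, rfl⟩, Units.val_one, one_smul]
      rfl

variable {Y} in
theorem mem_pathGr {i : ℤ × ℤ} {x : Y.PathCarrier} :
    x ∈ Grading.pathGr Y.gr Y.pathTwist pathDeg i ↔ (∀ n, x.1.coeff n ∈ Y.gr i) ∧
      (∀ n, (x.2 0).coeff n ∈ Y.gr (i - (1, 0))) ∧ (∀ n, (x.2 1).coeff n ∈ Y.gr (i - (0, 1))) ∧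
      ∀ n, (x.2 2).coeff n ∈ Y.gr (i - (1, 1)) := by
  refine ⟨fun h => ⟨h.1, h.2 0, h.2 1, h.2 2⟩, fun h => ⟨h.1, fun j => ?_⟩⟩
  match j with
  | 0 => exact h.2.1
  | 1 => exact h.2.2.1
  | 2 => exact h.2.2.2

/-- The differential `∂` of the path object. -/
noncomputable def pathDel : Y.PathCarrier →ₗ[ℂ] Y.PathCarrier where
  -- Elements are read as a + b·∂t + c·∂̄t + e·∂∂̄t. Applying ∂ to a gives a′ at ∂t, and applying it
  -- to c·∂̄t gives c at ∂∂̄t, each up to the sign automorphism.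
  toFun x := Y.pathMk (Y.polyDel x.1) (Y.polyDel (x.2 0) + Y.polySign (derivative x.1))
    (Y.polyDel (x.2 1)) (Y.polyDel (x.2 2) + Y.polySign (x.2 1))
  map_add' x y := by
    refine path_ext (map_add Y.polyDel _ _) ?_ (map_add Y.polyDel _ _) ?_
    · show Y.polyDel (x.2 0 + y.2 0) + Y.polySign (derivative (x.1 + y.1)) =
        (Y.polyDel (x.2 0) + Y.polySign (derivative x.1)) +
          (Y.polyDel (y.2 0) + Y.polySign (derivative y.1))
      simp only [map_add]
      abel
    · show Y.polyDel (x.2 2 + y.2 2) + Y.polySign (x.2 1 + y.2 1) =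
        (Y.polyDel (x.2 2) + Y.polySign (x.2 1)) + (Y.polyDel (y.2 2) + Y.polySign (y.2 1))
      simp only [map_add]
      abel
  map_smul' r x := by
    refine path_ext ?_ ?_ ?_ ?_
    · show Y.polyDel (r • x.1) = r • Y.polyDel x.1
      ext n
      simp
    · show Y.polyDel (r • x.2 0) + Y.polySign (derivative (r • x.1)) =
        r • (Y.polyDel (x.2 0) + Y.polySign (derivative x.1))
      ext n
      simp [coeff_derivative]
    · show Y.polyDel (r • x.2 1) = r • Y.polyDel (x.2 1)
      ext n
      simp
    · show Y.polyDel (r • x.2 2) + Y.polySign (r • x.2 1) =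
        r • (Y.polyDel (x.2 2) + Y.polySign (x.2 1))
      ext n
      simp

/-- The differential `∂̄` of the path object. -/
noncomputable def pathDelbar : Y.PathCarrier →ₗ[ℂ] Y.PathCarrier where
  -- The minus sign in the last component is ∂̄∂t = −∂∂̄t.
  toFun x := Y.pathMk (Y.polyDelbar x.1) (Y.polyDelbar (x.2 0))
    (Y.polyDelbar (x.2 1) + Y.polySign (derivative x.1))
    (Y.polyDelbar (x.2 2) - Y.polySign (x.2 0))
  map_add' x y := by
    refine path_ext (map_add Y.polyDelbar _ _) (map_add Y.polyDelbar _ _) ?_ ?_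
    · show Y.polyDelbar (x.2 1 + y.2 1) + Y.polySign (derivative (x.1 + y.1)) =
        (Y.polyDelbar (x.2 1) + Y.polySign (derivative x.1)) +
          (Y.polyDelbar (y.2 1) + Y.polySign (derivative y.1))
      simp only [map_add]
      abel
    · show Y.polyDelbar (x.2 2 + y.2 2) - Y.polySign (x.2 0 + y.2 0) =
        (Y.polyDelbar (x.2 2) - Y.polySign (x.2 0)) + (Y.polyDelbar (y.2 2) - Y.polySign (y.2 0))
      simp only [map_add]
      abel
  map_smul' r x := by
    refine path_ext ?_ ?_ ?_ ?_
    · show Y.polyDelbar (r • x.1) = r • Y.polyDelbar x.1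
      ext n
      simp
    · show Y.polyDelbar (r • x.2 0) = r • Y.polyDelbar (x.2 0)
      ext n
      simp
    · show Y.polyDelbar (r • x.2 1) + Y.polySign (derivative (r • x.1)) =
        r • (Y.polyDelbar (x.2 1) + Y.polySign (derivative x.1))
      ext n
      simp [coeff_derivative]
    · show Y.polyDelbar (r • x.2 2) - Y.polySign (r • x.2 0) =
        r • (Y.polyDelbar (x.2 2) - Y.polySign (x.2 0))
      ext n
      simp [smul_sub]

/-- The real structure of the path object. -/
noncomputable def pathConj : Y.PathCarrier →ₛₗ[starRingEnd ℂ] Y.PathCarrier where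
  -- The variable t is real, so conjugation exchanges ∂t and ∂̄t and sends ∂∂̄t to ∂̄∂t = −∂∂̄t.
  toFun x := Y.pathMk (Y.polyConj x.1) (Y.polyConj (x.2 1)) (Y.polyConj (x.2 0))
    (-Y.polyConj (x.2 2))
  map_add' x y := path_ext (map_add Y.polyConj _ _) (map_add Y.polyConj _ _)
    (map_add Y.polyConj _ _) ((congrArg _ (map_add Y.polyConj _ _)).trans (neg_add _ _))
  map_smul' r x := by
    have h : ∀ p : Y.carrier[X], Y.polyConj (r • p) = starRingEnd ℂ r • Y.polyConj p := fun p => by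
      ext n
      rw [coeff_coeffMap, coeff_smul, coeff_smul, coeff_coeffMap]
      exact Y.conj.map_smulₛₗ r _
    exact path_ext (h _) (h _) (h _) ((congrArg _ (h _)).trans (smul_neg _ _).symm)

theorem pathDel_mem {i : ℤ × ℤ} {x : Y.PathCarrier}
    (hx : x ∈ Grading.pathGr Y.gr Y.pathTwist pathDeg i) :
    Y.pathDel x ∈ Grading.pathGr Y.gr Y.pathTwist pathDeg (i + (1, 0)) := by
  obtain ⟨h, h0, h1, h2⟩ := mem_pathGr.1 hx
  refine mem_pathGr.2 ⟨fun n => ?_, fun n => ?_, fun n => ?_, fun n => ?_⟩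
  · show (Y.polyDel x.1).coeff n ∈ _
    rw [coeff_coeffMap]
    exact Y.del_mem (h n)
  · show (Y.polyDel (x.2 0) + Y.polySign (derivative x.1)).coeff n ∈ _
    rw [coeff_add, coeff_coeffMap, coeff_coeffMap, add_sub_cancel_right]
    refine add_mem ?_ (Y.isGradedComm.sign_mem (Grading.coeff_derivative_mem h n))
    have := Y.del_mem (h0 n)
    rwa [sub_add_cancel] at this
  · show (Y.polyDel (x.2 1)).coeff n ∈ _
    rw [coeff_coeffMap, add_sub_right_comm]
    exact Y.del_mem (h1 n)
  · show (Y.polyDel (x.2 2) + Y.polySign (x.2 1)).coeff n ∈ _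
    rw [coeff_add, coeff_coeffMap, coeff_coeffMap]
    refine add_mem ?_ (Y.isGradedComm.sign_mem ?_)
    · rw [add_sub_right_comm]
      exact Y.del_mem (h2 n)
    · have := h1 n
      rwa [show i - (0, 1) = i + (1, 0) - (1, 1) by ext <;> simp] at this

theorem pathConj_mem {i : ℤ × ℤ} {x : Y.PathCarrier}
    (hx : x ∈ Grading.pathGr Y.gr Y.pathTwist pathDeg i) :
    Y.pathConj x ∈ Grading.pathGr Y.gr Y.pathTwist pathDeg i.swap := by
  obtain ⟨h, h0, h1, h2⟩ := mem_pathGr.1 hx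
  refine mem_pathGr.2 ⟨fun n => ?_, fun n => ?_, fun n => ?_, fun n => ?_⟩
  · show (Y.polyConj x.1).coeff n ∈ _
    rw [coeff_coeffMap]
    exact Y.conj_mem (h n)
  · show (Y.polyConj (x.2 1)).coeff n ∈ _
    rw [coeff_coeffMap]
    exact Y.conj_mem (h1 n)
  · show (Y.polyConj (x.2 0)).coeff n ∈ _
    rw [coeff_coeffMap]
    exact Y.conj_mem (h0 n)
  · show (-Y.polyConj (x.2 2)).coeff n ∈ _
    rw [coeff_neg, coeff_coeffMap]
    exact neg_mem (Y.conj_mem (h2 n))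

theorem pathConj_pathConj (x : Y.PathCarrier) : Y.pathConj (Y.pathConj x) = x := by
  refine path_ext (Y.polyConj_polyConj _) (Y.polyConj_polyConj _) (Y.polyConj_polyConj _) ?_
  show -Y.polyConj (-Y.polyConj (x.2 2)) = x.2 2
  rw [map_neg, neg_neg, polyConj_polyConj]

theorem pathConj_pathDel (x : Y.PathCarrier) :
    Y.pathConj (Y.pathDel x) = Y.pathDelbar (Y.pathConj x) := by
  refine path_ext (Y.polyConj_polyDel _) (Y.polyConj_polyDel _) ?_ ?_
  · show Y.polyConj (Y.polyDel (x.2 0) + Y.polySign (derivative x.1)) =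
      Y.polyDelbar (Y.polyConj (x.2 0)) + Y.polySign (derivative (Y.polyConj x.1))
    rw [map_add, polyConj_polyDel, polyConj_polySign, derivative_coeffMap]
  · show -Y.polyConj (Y.polyDel (x.2 2) + Y.polySign (x.2 1)) =
      Y.polyDelbar (-Y.polyConj (x.2 2)) - Y.polySign (Y.polyConj (x.2 1))
    rw [map_add, polyConj_polyDel, polyConj_polySign, map_neg]
    abel

theorem pathConj_pathDelbar (x : Y.PathCarrier) :
    Y.pathConj (Y.pathDelbar x) = Y.pathDel (Y.pathConj x) := by
  rw [← Y.pathConj_pathConj (Y.pathDel _), pathConj_pathDel, pathConj_pathConj]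

theorem pathConj_mul (x y : Y.PathCarrier) :
    Y.pathConj (x * y) = Y.pathConj x * Y.pathConj y := by
  rw [path_mul, path_mul]
  refine path_ext (Y.polyConj_mul _ _) ?_ ?_ ?_
  · show Y.polyConj (x.1 * y.2 1 + x.2 1 * Y.polySign y.1) =
      Y.polyConj x.1 * Y.polyConj (y.2 1) + Y.polyConj (x.2 1) * Y.polySign (Y.polyConj y.1)
    rw [map_add, polyConj_mul, polyConj_mul, polyConj_polySign]
  · show Y.polyConj (x.1 * y.2 0 + x.2 0 * Y.polySign y.1) =
      Y.polyConj x.1 * Y.polyConj (y.2 0) + Y.polyConj (x.2 0) * Y.polySign (Y.polyConj y.1)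
    rw [map_add, polyConj_mul, polyConj_mul, polyConj_polySign]
  · show -Y.polyConj (x.1 * y.2 2 + x.2 2 * y.1) =
      Y.polyConj x.1 * -Y.polyConj (y.2 2) + -Y.polyConj (x.2 2) * Y.polyConj y.1
    rw [map_add, polyConj_mul, polyConj_mul]
    simp only [neg_mul, mul_neg]
    abel

/-- A comparison of the four components. The coefficients at ∂t, ∂̄t and ∂∂̄t have total degree
lower by 1, 1 and 2 than the element, so the sign automorphism acts on them by −ε, −ε and ε. -/
theorem pathDel_leibniz {i : ℤ × ℤ} {x : Y.PathCarrier}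
    (hx : x ∈ Grading.pathGr Y.gr Y.pathTwist pathDeg i) (y : Y.PathCarrier) :
    Y.pathDel (x * y) = Y.pathDel x * y + ((i.1 + i.2).negOnePow : ℤ) • (x * Y.pathDel y) := by
  obtain ⟨h, h0, h1, h2⟩ := mem_pathGr.1 hx
  replace h := Y.polySign_of_mem h
  replace h0 := Y.polySign_of_mem h0
  replace h1 := Y.polySign_of_mem h1
  replace h2 := Y.polySign_of_mem h2
  set ε : ℤ := ((i.1 + i.2).negOnePow : ℤ) with hε
  have hi : ∀ j : ℤ × ℤ, (i - j).1 + (i - j).2 = i.1 + i.2 - (j.1 + j.2) := fun j => by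
    rw [Prod.fst_sub, Prod.snd_sub]
    ring
  have hε' : ((i.1 + i.2 - 1).negOnePow : ℤ) = -ε := by
    rw [hε, Int.negOnePow_sub, Int.negOnePow_one, mul_neg_one, Units.val_neg]
  have e0 : (((i - (1, 0)).1 + (i - (1, 0)).2).negOnePow : ℤ) = -ε := by
    rw [hi]
    exact hε'
  have e1 : (((i - (0, 1)).1 + (i - (0, 1)).2).negOnePow : ℤ) = -ε := by
    rw [hi]
    exact hε'
  have e2 : (((i - (1, 1)).1 + (i - (1, 1)).2).negOnePow : ℤ) = ε := by
    rw [hi]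
    show ((i.1 + i.2 - 2).negOnePow : ℤ) = ε
    rw [hε, Int.negOnePow_sub, Int.negOnePow_even 2 even_two, mul_one]
  rw [e0, neg_smul, eq_neg_iff_add_eq_zero, ← eq_neg_iff_add_eq_zero] at h0
  rw [e1, neg_smul, eq_neg_iff_add_eq_zero, ← eq_neg_iff_add_eq_zero] at h1
  rw [e2] at h2
  have k0 : ε • x.2 0 = -Y.polySign (x.2 0) := by rw [h0, neg_neg]
  have k1 : ε • x.2 1 = -Y.polySign (x.2 1) := by rw [h1, neg_neg]
  rw [path_mul, path_mul, path_mul]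
  refine path_ext ?_ ?_ ?_ ?_
  · show Y.polyDel (x.1 * y.1) = Y.polyDel x.1 * y.1 + ε • (x.1 * Y.polyDel y.1)
    rw [← smul_mul_assoc, ← h, polyDel_mul]
  · show Y.polyDel (x.1 * y.2 0 + x.2 0 * Y.polySign y.1) + Y.polySign (derivative (x.1 * y.1)) =
      (Y.polyDel x.1 * y.2 0 + (Y.polyDel (x.2 0) + Y.polySign (derivative x.1)) *
        Y.polySign y.1) +
      ε • (x.1 * (Y.polyDel (y.2 0) + Y.polySign (derivative y.1)) +
        x.2 0 * Y.polySign (Y.polyDel y.1))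
    rw [smul_add, ← smul_mul_assoc, ← smul_mul_assoc, ← h, k0, polySign_polyDel, derivative_mul]
    simp only [map_add, polyDel_mul, polySign_mul, mul_add, add_mul, neg_mul, mul_neg, neg_neg]
    abel
  · show Y.polyDel (x.1 * y.2 1 + x.2 1 * Y.polySign y.1) =
      (Y.polyDel x.1 * y.2 1 + Y.polyDel (x.2 1) * Y.polySign y.1) +
      ε • (x.1 * Y.polyDel (y.2 1) + x.2 1 * Y.polySign (Y.polyDel y.1))
    rw [smul_add, ← smul_mul_assoc, ← smul_mul_assoc, ← h, k1, polySign_polyDel]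
    simp only [map_add, polyDel_mul, neg_mul, mul_neg, neg_neg]
    abel
  · show Y.polyDel (x.1 * y.2 2 + x.2 2 * y.1) +
        Y.polySign (x.1 * y.2 1 + x.2 1 * Y.polySign y.1) =
      (Y.polyDel x.1 * y.2 2 + (Y.polyDel (x.2 2) + Y.polySign (x.2 1)) * y.1) +
      ε • (x.1 * (Y.polyDel (y.2 2) + Y.polySign (y.2 1)) + x.2 2 * Y.polyDel y.1)
    rw [smul_add, ← smul_mul_assoc, ← smul_mul_assoc, ← h, ← h2]
    simp only [map_add, polyDel_mul, polySign_mul, polySign_polySign, mul_add, add_mul]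
    abel

/-- The path object of an `ℝ`-cbba. -/
noncomputable def path : RCbba.{u} where
  carrier := Y.PathCarrier
  gr := Grading.pathGr Y.gr Y.pathTwist pathDeg
  isInternal := Y.isGradedComm_path.isInternal
  one_mem := Y.isGradedComm_path.one_mem
  mul_mem := Y.isGradedComm_path.mul_mem
  mul_comm := Y.isGradedComm_path.mul_comm
  del := Y.pathDel
  delbar := Y.pathDelbar
  del_mem := Y.pathDel_mem
  -- Degrees and the Leibniz rule for ∂̄ follow from those for ∂ by conjugation.
  delbar_mem := fun {i a} ha => by
    rw [← Y.pathConj_pathConj (Y.pathDelbar a), pathConj_pathDelbar]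
    exact Y.pathConj_mem (Y.pathDel_mem (Y.pathConj_mem ha))
  del_del := fun x => by
    refine path_ext (Y.polyDel_polyDel _) ?_ (Y.polyDel_polyDel _) ?_
    · show Y.polyDel (Y.polyDel (x.2 0) + Y.polySign (derivative x.1)) +
        Y.polySign (derivative (Y.polyDel x.1)) = 0
      rw [map_add, polyDel_polyDel, derivative_coeffMap, polySign_polyDel]
      abel
    · show Y.polyDel (Y.polyDel (x.2 2) + Y.polySign (x.2 1)) + Y.polySign (Y.polyDel (x.2 1)) = 0
      rw [map_add, polyDel_polyDel, polySign_polyDel]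
      abel
  delbar_delbar := fun x => by
    refine path_ext (Y.polyDelbar_polyDelbar _) (Y.polyDelbar_polyDelbar _) ?_ ?_
    · show Y.polyDelbar (Y.polyDelbar (x.2 1) + Y.polySign (derivative x.1)) +
        Y.polySign (derivative (Y.polyDelbar x.1)) = 0
      rw [map_add, polyDelbar_polyDelbar, derivative_coeffMap, polySign_polyDelbar]
      abel
    · show Y.polyDelbar (Y.polyDelbar (x.2 2) - Y.polySign (x.2 0)) -
        Y.polySign (Y.polyDelbar (x.2 0)) = 0
      rw [map_sub, polyDelbar_polyDelbar, polySign_polyDelbar]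
      abel
  del_delbar := fun x => by
    refine path_ext ?_ ?_ ?_ ?_
    · show Y.polyDel (Y.polyDelbar x.1) + Y.polyDelbar (Y.polyDel x.1) = 0
      rw [polyDelbar_polyDel, add_neg_cancel]
    · show Y.polyDel (Y.polyDelbar (x.2 0)) + Y.polySign (derivative (Y.polyDelbar x.1)) +
        Y.polyDelbar (Y.polyDel (x.2 0) + Y.polySign (derivative x.1)) = 0
      rw [map_add, polyDelbar_polyDel, derivative_coeffMap, polySign_polyDelbar]
      abel
    · show Y.polyDel (Y.polyDelbar (x.2 1) + Y.polySign (derivative x.1)) +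
        (Y.polyDelbar (Y.polyDel (x.2 1)) + Y.polySign (derivative (Y.polyDel x.1))) = 0
      rw [map_add, polyDelbar_polyDel, derivative_coeffMap, polySign_polyDel]
      abel
    · show Y.polyDel (Y.polyDelbar (x.2 2) - Y.polySign (x.2 0)) +
          Y.polySign (Y.polyDelbar (x.2 1) + Y.polySign (derivative x.1)) +
        (Y.polyDelbar (Y.polyDel (x.2 2) + Y.polySign (x.2 1)) -
          Y.polySign (Y.polyDel (x.2 0) + Y.polySign (derivative x.1))) = 0
      simp only [map_add, map_sub, polyDelbar_polyDel, polySign_polyDel, polySign_polyDelbar,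
        polySign_polySign]
      abel
  del_leibniz := Y.pathDel_leibniz
  delbar_leibniz := fun {i a} ha b => by
    have h := congrArg Y.pathConj (Y.pathDel_leibniz (Y.pathConj_mem ha) (Y.pathConj b))
    rw [← pathConj_mul, ← pathConj_pathDelbar, ← pathConj_pathDelbar, ← pathConj_pathDelbar,
      ← pathConj_mul, ← pathConj_mul, map_add, map_zsmul, pathConj_pathConj, pathConj_pathConj,
      pathConj_pathConj, Prod.fst_swap, Prod.snd_swap, add_comm i.2] at h
    exact h
  conj := Y.pathConj
  conj_conj := Y.pathConj_pathConj
  conj_one := path_ext (show Y.polyConj (C 1) = C 1 by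
    rw [coeffMap_C]
    exact congrArg C Y.conj_one) (map_zero Y.polyConj) (map_zero Y.polyConj)
    ((congrArg _ (map_zero Y.polyConj)).trans neg_zero)
  conj_mul := Y.pathConj_mul
  conj_mem := Y.pathConj_mem
  conj_del := Y.pathConj_pathDel

/-- Evaluation at `t = 0`. -/
noncomputable def pathZero : Y.path ⟶ Y where
  toAlgHom := AlgHom.ofLinearMap
    { toFun := fun x : Y.PathCarrier => coeff x.1 0
      map_add' := fun _ _ => coeff_add _ _ _
      map_smul' := fun _ _ => coeff_smul _ _ _ } coeff_one_zero fun _ _ => mul_coeff_zero _ _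
  map_gr := fun hx => hx.1 0
  map_del := fun _ => coeff_coeffMap _ _ _
  map_delbar := fun _ => coeff_coeffMap _ _ _
  map_conj := fun _ => coeff_coeffMap _ _ _

/-- Evaluation at `t = 1`. -/
noncomputable def pathOne : Y.path ⟶ Y where
  toAlgHom := AlgHom.ofLinearMap
    { toFun := fun x : Y.PathCarrier => eval 1 x.1
      map_add' := fun _ _ => eval_add
      map_smul' := fun _ _ => eval_smul _ _ _ } eval_one fun _ _ =>
        eval₂_mul_noncomm _ _ fun _ => Commute.one_right _
  map_gr := fun {n x} hx => by
    show eval 1 x.1 ∈ Y.gr n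
    rw [eval_eq_sum, sum_def]
    exact Submodule.sum_mem _ fun m _ => by
      rw [one_pow, mul_one]
      exact hx.1 m
  map_del := fun _ => eval_one_coeffMap _ _
  map_delbar := fun _ => eval_one_coeffMap _ _
  map_conj := fun _ => eval_one_coeffMap _ _

/-- Constant paths. -/
noncomputable def pathConst : Y ⟶ Y.path where
  toAlgHom := AlgHom.ofLinearMap
    { toFun := fun y => Y.pathMk (C y) 0 0 0
      map_add' := fun x y => path_ext (map_add C x y) (add_zero _).symm (add_zero _).symm
        (add_zero _).symm
      map_smul' := fun c x => path_ext (smul_C c x).symm (smul_zero c).symm (smul_zero c).symm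
        (smul_zero c).symm }
    (path_ext (map_one C) rfl rfl rfl) fun x y => by
      refine Eq.trans ?_ (Y.path_mul (Y.pathMk (C x) 0 0 0) (Y.pathMk (C y) 0 0 0)).symm
      refine path_ext (map_mul C x y) ?_ ?_ ?_
      · show 0 = C x * 0 + 0 * Y.polySign (C y)
        rw [mul_zero, zero_mul, add_zero]
      · show 0 = C x * 0 + 0 * Y.polySign (C y)
        rw [mul_zero, zero_mul, add_zero]
      · show 0 = C x * 0 + 0 * C y
        rw [mul_zero, zero_mul, add_zero]
  map_gr := fun {n x} hx => by
    refine mem_pathGr.2 ⟨fun m => ?_, fun _ => Submodule.zero_mem _, fun _ => Submodule.zero_mem _,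
      fun _ => Submodule.zero_mem _⟩
    show (C x).coeff m ∈ Y.gr n
    rw [coeff_C]
    split_ifs
    exacts [hx, Submodule.zero_mem _]
  map_del := fun x => by
    refine path_ext (coeffMap_C Y.del.toAddMonoidHom x).symm ?_ (map_zero Y.polyDel).symm ?_
    · show 0 = Y.polyDel 0 + Y.polySign (derivative (C x))
      rw [derivative_C, map_zero, map_zero, add_zero]
    · show 0 = Y.polyDel 0 + Y.polySign 0
      rw [map_zero, map_zero, add_zero]
  map_delbar := fun x => by
    refine path_ext (coeffMap_C Y.delbar.toAddMonoidHom x).symm (map_zero Y.polyDelbar).symm ?_ ?_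
    · show 0 = Y.polyDelbar 0 + Y.polySign (derivative (C x))
      rw [derivative_C, map_zero, map_zero, add_zero]
    · show 0 = Y.polyDelbar 0 - Y.polySign 0
      rw [map_zero, map_zero, sub_zero]
  map_conj := fun x => path_ext (coeffMap_C Y.conj.toAddMonoidHom x).symm
    (map_zero Y.polyConj).symm (map_zero Y.polyConj).symm
    (neg_zero.symm.trans (congrArg _ (map_zero Y.polyConj).symm))

theorem pathConst_zero : Y.pathConst ≫ Y.pathZero = 𝟙 Y := hom_ext fun x => coeff_C_zero (a := x)

theorem pathConst_one : Y.pathConst ≫ Y.pathOne = 𝟙 Y :=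
  hom_ext fun x => eval_C (a := x) (x := 1)

variable {Y} in
/-- The map of path objects induced by a morphism. -/
noncomputable def pathMap {Z : RCbba.{u}} (f : Y ⟶ Z) : Y.path ⟶ Z.path :=
  let F : Y.carrier[X] →+ Z.carrier[X] := coeffMap (Hom.fn f).toLinearMap.toAddMonoidHom
  have hF : ∀ (S : Y.carrier →+ Y.carrier) (T : Z.carrier →+ Z.carrier),
      (∀ a, Hom.fn f (S a) = T (Hom.fn f a)) → ∀ p, F (coeffMap S p) = coeffMap T (F p) :=
    fun S T h p => by
      ext n
      rw [coeff_coeffMap, coeff_coeffMap, coeff_coeffMap, coeff_coeffMap]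
      exact h _
  have hdel : ∀ p, F (Y.polyDel p) = Z.polyDel (F p) := hF _ _ (Hom.fn_del f)
  have hdelbar : ∀ p, F (Y.polyDelbar p) = Z.polyDelbar (F p) := hF _ _ (Hom.fn_delbar f)
  have hconj : ∀ p, F (Y.polyConj p) = Z.polyConj (F p) := hF _ _ (Hom.fn_conj f)
  have hsign : ∀ p, F (Y.polySign p) = Z.polySign (F p) := hF _ _ (Hom.fn_sign f)
  have hder : ∀ p, F (derivative p) = derivative (F p) := fun p => (derivative_coeffMap _ p).symm
  have hmul : ∀ p q, F (p * q) = F p * F q := coeffMap_mul _ (map_mul (Hom.fn f))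
  have hsmul : ∀ (c : ℂ) p, F (c • p) = c • F p := fun c p => by
    ext n
    rw [coeff_coeffMap, coeff_smul, coeff_smul, coeff_coeffMap]
    exact map_smul (Hom.fn f) c _
  { toAlgHom := AlgHom.ofLinearMap
      { toFun := fun x : Y.PathCarrier => Z.pathMk (F x.1) (F (x.2 0)) (F (x.2 1)) (F (x.2 2))
        map_add' := fun x y => path_ext (map_add F _ _) (map_add F _ _) (map_add F _ _)
          (map_add F _ _)
        map_smul' := fun c x => path_ext (hsmul _ _) (hsmul _ _) (hsmul _ _) (hsmul _ _) }
      (path_ext (show F (C 1) = C 1 by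
        rw [coeffMap_C]
        exact congrArg C (map_one (Hom.fn f))) (map_zero F) (map_zero F) (map_zero F))
      fun x y => by
        refine (congrArg (fun z : Y.PathCarrier =>
          Z.pathMk (F z.1) (F (z.2 0)) (F (z.2 1)) (F (z.2 2))) (Y.path_mul x y)).trans
            (Eq.trans ?_ (Z.path_mul _ _).symm)
        refine path_ext (hmul _ _) ?_ ?_ ?_
        · show F (x.1 * y.2 0 + x.2 0 * Y.polySign y.1) =
            F x.1 * F (y.2 0) + F (x.2 0) * Z.polySign (F y.1)
          rw [map_add, hmul, hmul, hsign]
        · show F (x.1 * y.2 1 + x.2 1 * Y.polySign y.1) =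
            F x.1 * F (y.2 1) + F (x.2 1) * Z.polySign (F y.1)
          rw [map_add, hmul, hmul, hsign]
        · show F (x.1 * y.2 2 + x.2 2 * y.1) = F x.1 * F (y.2 2) + F (x.2 2) * F y.1
          rw [map_add, hmul, hmul]
    map_gr := fun {i x} hx => by
      obtain ⟨h, h0, h1, h2⟩ := mem_pathGr.1 hx
      have key : ∀ {p : Y.carrier[X]} {i}, (∀ n, p.coeff n ∈ Y.gr i) →
          ∀ n, (F p).coeff n ∈ Z.gr i := fun hp n => by
        rw [coeff_coeffMap]
        exact Hom.fn_gr f (hp n)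
      exact mem_pathGr.2 ⟨key h, key h0, key h1, key h2⟩
    map_del := fun x => by
      refine path_ext (hdel _) ?_ (hdel _) ?_
      · show F (Y.polyDel (x.2 0) + Y.polySign (derivative x.1)) =
          Z.polyDel (F (x.2 0)) + Z.polySign (derivative (F x.1))
        rw [map_add, hdel, hsign, hder]
      · show F (Y.polyDel (x.2 2) + Y.polySign (x.2 1)) =
          Z.polyDel (F (x.2 2)) + Z.polySign (F (x.2 1))
        rw [map_add, hdel, hsign]
    map_delbar := fun x => by
      refine path_ext (hdelbar _) (hdelbar _) ?_ ?_
      · show F (Y.polyDelbar (x.2 1) + Y.polySign (derivative x.1)) =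
          Z.polyDelbar (F (x.2 1)) + Z.polySign (derivative (F x.1))
        rw [map_add, hdelbar, hsign, hder]
      · show F (Y.polyDelbar (x.2 2) - Y.polySign (x.2 0)) =
          Z.polyDelbar (F (x.2 2)) - Z.polySign (F (x.2 0))
        rw [map_sub, hdelbar, hsign]
    map_conj := fun x => path_ext (hconj _) (hconj _) (hconj _)
      ((map_neg F _).trans (congrArg _ (hconj _))) }

variable {Y} in
/-- A closed path starting at zero is in the image of `∂∂̄`. -/
theorem del_delbar_integral {x : Y.PathCarrier} (h0 : coeff x.1 0 = 0) (hdel : Y.pathDel x = 0)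
    (hdelbar : Y.pathDelbar x = 0) :
    Y.pathDel (Y.pathDelbar (Y.pathMk (integral ℂ (x.2 2)) 0 0 0)) = x := by
  -- ∂∂̄ of a polynomial P has the coefficient P′ at ∂∂̄t, so P must be the integral of that
  -- coefficient of `x`. Closedness expresses the coefficients at ∂t and ∂̄t, and the derivative of
  -- the polynomial part, through the coefficient at ∂∂̄t; the constant term is zero because the
  -- path starts at zero.
  have d0 : Y.polyDel (x.2 0) + Y.polySign (derivative x.1) = 0 :=
    congrArg (fun z : Y.PathCarrier => z.2 0) hdel
  have d2 : Y.polyDel (x.2 2) + Y.polySign (x.2 1) = 0 :=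
    congrArg (fun z : Y.PathCarrier => z.2 2) hdel
  have e2 : Y.polyDelbar (x.2 2) - Y.polySign (x.2 0) = 0 :=
    congrArg (fun z : Y.PathCarrier => z.2 2) hdelbar
  have k1 : -Y.polyDel (Y.polySign (x.2 0)) = -derivative x.1 := by
    rw [← polySign_polyDel, eq_neg_of_add_eq_zero_left d0, map_neg, polySign_polySign]
  refine path_ext ?_ ?_ ?_ ?_
  · show Y.polyDel (Y.polyDelbar (integral ℂ (x.2 2))) = x.1
    refine eq_of_derivative_eq ℂ ?_ ?_
    · rw [derivative_coeffMap, derivative_coeffMap, derivative_integral, sub_eq_zero.1 e2]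
      exact neg_injective k1
    · rw [coeff_coeffMap, coeff_coeffMap, coeff_integral_zero, h0, map_zero, map_zero]
  · show Y.polyDel (Y.polyDelbar 0) + Y.polySign (derivative (Y.polyDelbar (integral ℂ (x.2 2)))) =
      x.2 0
    rw [derivative_coeffMap, derivative_integral, sub_eq_zero.1 e2, polySign_polySign, map_zero,
      map_zero, zero_add]
  · show Y.polyDel (Y.polyDelbar 0 + Y.polySign (derivative (integral ℂ (x.2 2)))) = x.2 1
    rw [derivative_integral, map_zero, zero_add, ← neg_eq_iff_eq_neg.2 (Y.polySign_polyDel _),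
      eq_neg_of_add_eq_zero_left d2, map_neg, neg_neg, polySign_polySign]
  · show Y.polyDel (Y.polyDelbar 0 - Y.polySign 0) +
      Y.polySign (Y.polyDelbar 0 + Y.polySign (derivative (integral ℂ (x.2 2)))) = x.2 2
    simp only [derivative_integral, map_zero, sub_zero, zero_add, polySign_polySign]

theorem acyclicKer_pathZero : AcyclicKer Y.pathZero := fun _ hx hdel hdelbar =>
  ⟨_, coeff_integral_zero ℂ _, del_delbar_integral hx hdel hdelbar⟩

end

/-- Every morphism of `ℝ`-cbba's factors as a section of a surjective pluripotential
quasi-isomorphism followed by a surjection. -/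
theorem exists_factorization {A B : RCbba.{u}} (f : A ⟶ B) :
    ∃ (P : RCbba.{u}) (s : A ⟶ P) (r : P ⟶ A) (f' : P ⟶ B), s ≫ r = 𝟙 A ∧ s ≫ f' = f ∧
      Function.Surjective (Hom.fn r) ∧ AcyclicKer r ∧ Function.Surjective (Hom.fn f') := by
  -- The mapping path object again: pairs (x, γ) with γ(0) = f x, evaluated at γ(1).
  refine ⟨pullback f B.pathZero, pullbackLift f B.pathZero (𝟙 A) (f ≫ B.pathConst) ?_,
    pullbackFst f B.pathZero, pullbackSnd f B.pathZero ≫ B.pathOne, rfl, ?_, ?_, ?_, ?_⟩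
  · rw [Category.assoc, pathConst_zero, Category.comp_id, Category.id_comp]
  · show f ≫ B.pathConst ≫ B.pathOne = f
    rw [pathConst_one, Category.comp_id]
  · intro x
    exact ⟨⟨(x, Hom.fn B.pathConst (Hom.fn f x)), (coeff_C_zero (a := Hom.fn f x)).symm⟩, rfl⟩
  · rintro ⟨⟨x, γ⟩, h⟩ (rfl : x = 0) hd hd'
    have h0 : Hom.fn B.pathZero γ = 0 := Eq.trans (Eq.symm h) (map_zero (Hom.fn f))
    obtain ⟨η, hη, hη'⟩ := B.acyclicKer_pathZero γ h0
      (congrArg (fun z : (pullback f B.pathZero).carrier => z.1.2) hd)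
      (congrArg (fun z : (pullback f B.pathZero).carrier => z.1.2) hd')
    exact ⟨⟨(0, η), (map_zero (Hom.fn f)).trans hη.symm⟩, rfl,
      Subtype.ext (Prod.ext ((congrArg _ (map_zero A.delbar)).trans (map_zero A.del)) hη')⟩
  · intro y
    refine ⟨⟨(0, B.pathMk (C y * X) 0 0 0), ?_⟩, ?_⟩
    · exact (map_zero (Hom.fn f)).trans (coeff_mul_X_zero _).symm
    · show eval 1 (C y * X) = y
      rw [eval_C_mul, eval_X, mul_one]

/-- Pluripotential quasi-isomorphisms induce quasi-isomorphisms of the real total cdga's. -/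
theorem PluriQuasiIso.totReal {A B : RCbba.{u}} {f : A ⟶ B} (hf : PluriQuasiIso f) :
    CDGA.quasiIso ℝ (totReal.map f) := by
  -- For surjections the claim follows from the acyclic kernel. The factorization writes `f` as a
  -- section of one such surjection followed by another, so two-out-of-three on both sides gives the
  -- general case.
  obtain ⟨P, s, r, f', hsr, rfl, hr, hr', hf'⟩ := exists_factorization f
  have hrq := quasiIso_totReal_of_acyclicKer hr hr'
  have hs : CDGA.quasiIso ℝ (RCbba.totReal.map s) := by
    refine CDGA.quasiIso.of_comp_right hrq ?_
    rw [← Functor.map_comp, hsr, CategoryTheory.Functor.map_id]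
    exact CDGA.quasiIso_of_isIso _
  have hs' : PluriQuasiIso s := by
    refine PluriQuasiIso.of_comp_right (pluriQuasiIso_of_acyclicKer hr hr') ?_
    rw [hsr]
    exact pluriQuasiIso_id A
  rw [Functor.map_comp]
  exact hs.comp (quasiIso_totReal_of_acyclicKer hf'
    (acyclicKer_of_pluriQuasiIso hf' (PluriQuasiIso.of_comp_left hs' hf)))

end RCbba

/-! ### Connected gradings -/

namespace Grading

section Connected

variable {ι k A : Type*} [AddCommGroup ι] [CommRing k] [Ring A] [Algebra k A]

/-- The part of positive degree of a graded algebra. -/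
def positivePart (D : ι →+ ℤ) (gr : ι → Submodule k A) : Submodule k A :=
  ⨆ i : {i // 0 < D i}, gr i

variable {D : ι →+ ℤ} {gr : ι → Submodule k A}

theorem mem_positivePart {i : ι} (hi : 0 < D i) {x : A} (hx : x ∈ gr i) :
    x ∈ positivePart D gr :=
  Submodule.mem_iSup_of_mem (p := fun j : {j // 0 < D j} => gr j) ⟨i, hi⟩ hx

@[elab_as_elim]
theorem positivePart_induction {P : A → Prop} (x : A) (hx : x ∈ positivePart D gr) (zero : P 0)
    (hom : ∀ i, 0 < D i → ∀ y ∈ gr i, P y) (add : ∀ y z, P y → P z → P (y + z)) : P x :=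
  Submodule.iSup_induction (fun i : {i // 0 < D i} => gr i) (motive := P) hx
    (fun i y hy => hom i i.2 y hy) zero add

variable [DecidableEq ι]

theorem proj_of_mem_positivePart (h : DirectSum.IsInternal gr) {i : ι} (hi : D i ≤ 0) {x : A}
    (hx : x ∈ positivePart D gr) : proj h i x = 0 := by
  refine positivePart_induction x hx (map_zero _) ?_ ?_
  · intro j hj y hy
    exact proj_ne h (fun hij => by rw [hij] at hj; omega) hy
  · intro y z hy hz
    rw [map_add, hy, hz, add_zero]

theorem map_positivePart_le {k' B : Type*} [CommRing k'] [Ring B] [Algebra k' B]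
    {gr' : ι → Submodule k' B} (f : A →+ B) (e : ι → ι) (he : ∀ i, D i ≤ D (e i))
    (hf : ∀ i, ∀ x ∈ gr i, f x ∈ gr' (e i)) {x : A} (hx : x ∈ positivePart D gr) :
    f x ∈ positivePart D gr' := by
  refine positivePart_induction x hx ?_ ?_ ?_
  · rw [map_zero]
    exact Submodule.zero_mem _
  · intro i hi y hy
    exact mem_positivePart (hi.trans_le (he i)) (hf i y hy)
  · intro y z hy hz
    rw [map_add]
    exact Submodule.add_mem _ hy hz

/-- A connected grading: apart from the scalars all degrees are positive. -/
structure IsConnected (D : ι →+ ℤ) (gr : ι → Submodule k A) : Prop where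
  scalar : gr 0 ≤ 1
  eq_bot : ∀ i, D i ≤ 0 → i ≠ 0 → gr i = ⊥

/-- Generators have positive degree, hence so do all their products of positive length; only scalars
remain in nonpositive degrees, and they sit at index 0. The family `T` records this upper bound for
the components. -/
theorem IsConnected.of_generators (h : IsGradedComm D gr) {W : Submodule k A}
    (hW : IsGradedSubmodule gr W) (htop : Algebra.adjoin k (W : Set A) = ⊤)
    (hpos : ∀ i, D i ≤ 0 → W ⊓ gr i = ⊥) : IsConnected D gr := by
  let T : ι → Submodule k A := fun i => if 0 < D i then gr i else if i = 0 then 1 else ⊥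
  have T1 : ∀ i, 0 < D i → T i = gr i := fun i hi => if_pos hi
  have T2 : T 0 = 1 := (if_neg (by simp)).trans (if_pos rfl)
  have T3 : ∀ i, D i ≤ 0 → i ≠ 0 → T i = ⊥ := fun i hi hi' =>
    (if_neg (not_lt.2 hi)).trans (if_neg hi')
  have hT : ∀ i, T i ≤ gr i := by
    intro i
    by_cases hi : 0 < D i
    · rw [T1 i hi]
    by_cases hi' : i = 0
    · rw [hi', T2, Submodule.one_le]
      exact h.one_mem
    · rw [T3 i (not_lt.1 hi) hi']
      exact bot_le
  have key : ∀ i, gr i ≤ T i := fun i x hx => adjoin_induction h.isInternal hW T hT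
    (by rw [T2]; exact Submodule.one_le.1 le_rfl) (by
      intro i
      by_cases hi : 0 < D i
      · rw [T1 i hi]
        exact inf_le_right
      · rw [hpos i (not_lt.1 hi)]
        exact bot_le) (by
      intro i j a ha b hb
      by_cases hi' : i = 0
      · subst hi'
        rw [T2, Submodule.mem_one] at ha
        obtain ⟨c, rfl⟩ := ha
        rw [zero_add, ← Algebra.smul_def]
        exact Submodule.smul_mem _ c hb
      by_cases hj' : j = 0
      · subst hj'
        rw [T2, Submodule.mem_one] at hb
        obtain ⟨c, rfl⟩ := hb
        rw [add_zero, ← Algebra.commutes, ← Algebra.smul_def]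
        exact Submodule.smul_mem _ c ha
      by_cases hi : 0 < D i
      · by_cases hj : 0 < D j
        · rw [T1 _ (by rw [map_add]; omega)]
          exact h.mul_mem (hT i ha) (hT j hb)
        · rw [T3 j (not_lt.1 hj) hj', Submodule.mem_bot] at hb
          rw [hb, mul_zero]
          exact Submodule.zero_mem _
      · rw [T3 i (not_lt.1 hi) hi', Submodule.mem_bot] at ha
        rw [ha, zero_mul]
        exact Submodule.zero_mem _) (htop ▸ Algebra.mem_top : x ∈ Algebra.adjoin k (W : Set A)) hx
  exact ⟨T2 ▸ key 0, fun i hi hi' => le_bot_iff.1 (T3 i hi hi' ▸ key i)⟩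

theorem le_positivePart {W : Submodule k A} (hW : IsGradedSubmodule gr W)
    (hpos : ∀ i, D i ≤ 0 → W ⊓ gr i = ⊥) : W ≤ positivePart D gr := by
  refine hW.trans (iSup_le fun i => ?_)
  by_cases hi : 0 < D i
  · exact fun x hx => mem_positivePart hi hx.2
  · rw [hpos i (not_lt.1 hi)]
    exact bot_le

namespace IsConnected

variable (hc : IsConnected D gr) (h : IsGradedComm D gr)
include hc h

theorem exists_scalar_add (x : A) : ∃ c : k, ∃ y ∈ positivePart D gr, x = algebraMap k A c + y := by
  refine induction h.isInternal x ?_ ?_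
  · intro i y hy
    by_cases hi : 0 < D i
    · exact ⟨0, y, mem_positivePart hi hy, by rw [map_zero, zero_add]⟩
    by_cases hi' : i = 0
    · subst hi'
      obtain ⟨c, rfl⟩ := Submodule.mem_one.1 (hc.scalar hy)
      exact ⟨c, 0, Submodule.zero_mem _, (add_zero _).symm⟩
    · rw [hc.eq_bot i (not_lt.1 hi) hi', Submodule.mem_bot] at hy
      exact ⟨0, 0, Submodule.zero_mem _, by rw [hy, map_zero, zero_add]⟩
  · rintro y z ⟨c, v, hv, rfl⟩ ⟨c', w, hw, rfl⟩
    exact ⟨c + c', v + w, Submodule.add_mem _ hv hw, by rw [map_add]; abel⟩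

theorem mul_mem_positivePart {x : A} (hx : x ∈ positivePart D gr) (y : A) :
    x * y ∈ positivePart D gr := by
  obtain ⟨c, y, hy, rfl⟩ := hc.exists_scalar_add h y
  rw [mul_add, ← Algebra.commutes, ← Algebra.smul_def]
  refine Submodule.add_mem _ (Submodule.smul_mem _ c hx) ?_
  refine positivePart_induction x hx ?_ ?_ ?_
  · rw [zero_mul]
    exact Submodule.zero_mem _
  · intro i hi x hx
    refine positivePart_induction y hy ?_ ?_ ?_
    · rw [mul_zero]
      exact Submodule.zero_mem _
    · intro j hj y hy
      exact mem_positivePart (by rw [map_add]; omega) (h.mul_mem hx hy)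
    · intro y z hy hz
      rw [mul_add]
      exact Submodule.add_mem _ hy hz
  · intro y z hy hz
    rw [add_mul]
    exact Submodule.add_mem _ hy hz

theorem positivePart_mul_top_le : positivePart D gr * ⊤ ≤ positivePart D gr :=
  Submodule.mul_le.2 fun _ hx y _ => hc.mul_mem_positivePart h hx y

theorem positivePart_sq_le : positivePart D gr * positivePart D gr ≤ positivePart D gr :=
  Submodule.mul_le.2 fun _ hx y _ => hc.mul_mem_positivePart h hx y

/-- The positive part is an ideal, so decomposability can be expressed by its square, without
reference to a choice of generators. -/
theorem decomposable_le {W : Submodule k A} (hW : W ≤ positivePart D gr) :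
    W * W * ⊤ ≤ positivePart D gr * positivePart D gr := by
  rw [mul_assoc]
  exact mul_le_mul' hW ((mul_le_mul' hW le_rfl).trans (hc.positivePart_mul_top_le h))

/-- A graded subalgebra that contains the positive part up to decomposable elements is
everything. -/
theorem eq_top_of_le_sup (S : Subalgebra k A)
    (hS : ∀ i, ∀ x ∈ S, proj h.isInternal i x ∈ S)
    (hle : ∀ x ∈ positivePart D gr, ∃ s ∈ S, x - s ∈ positivePart D gr * positivePart D gr) :
    S = ⊤ := by
  -- Induction on the degree: a homogeneous element is, up to an element of `S`, a sum of products
  -- of two factors of positive degree. After projection to its index both factors have smaller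
  -- degree and so lie in `S`.
  have key : ∀ n : ℕ, ∀ i, 0 < D i → D i ≤ n → ∀ x ∈ gr i, x ∈ S := by
    intro n
    induction n with
    | zero =>
      intro i hi hi'
      push_cast at hi'
      omega
    | succ n ih =>
      intro i hi hin x hx
      obtain ⟨s, hs, hxs⟩ := hle x (mem_positivePart hi hx)
      have h1 : ∀ y ∈ positivePart D gr * positivePart D gr, proj h.isInternal i y ∈ S := by
        intro y hy
        refine Submodule.mul_induction_on hy ?_ ?_
        · intro a ha b hb
          refine positivePart_induction a ha ?_ ?_ ?_
          · rw [zero_mul, map_zero]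
            exact S.zero_mem
          · intro j hj a ha
            refine positivePart_induction b hb ?_ ?_ ?_
            · rw [mul_zero, map_zero]
              exact S.zero_mem
            · intro l hl b hb
              by_cases hjl : j + l = i
              · subst hjl
                rw [map_add] at hin
                push_cast at hin
                rw [proj_same _ (h.mul_mem ha hb)]
                exact S.mul_mem (ih j hj (by omega) a ha) (ih l hl (by omega) b hb)
              · rw [proj_ne _ hjl (h.mul_mem ha hb)]
                exact S.zero_mem
            · intro y z hy hz
              rw [mul_add, map_add]
              exact S.add_mem hy hz
          · intro y z hy hz
            rw [add_mul, map_add]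
            exact S.add_mem hy hz
        · intro y z hy hz
          rw [map_add]
          exact S.add_mem hy hz
      have h2 := S.add_mem (h1 _ hxs) (hS i s hs)
      rwa [← map_add, sub_add_cancel, proj_same _ hx] at h2
  rw [eq_top_iff]
  rintro x -
  obtain ⟨c, y, hy, rfl⟩ := hc.exists_scalar_add h x
  refine S.add_mem (S.algebraMap_mem c) ?_
  refine positivePart_induction y hy S.zero_mem ?_ fun _ _ => S.add_mem
  intro i hi y hy
  exact key (D i).toNat i hi (by omega) y hy

/-- A subspace stable under projections that does not contain the unit lies in the positive part. -/
theorem mem_positivePart_of_map_eq_zero {B : Type*} [Ring B] [Algebra k B] {gr' : ι → Submodule k B}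
    (h' : DirectSum.IsInternal gr') (f : A →ₐ[k] B) (hf : ∀ i, ∀ x ∈ gr i, f x ∈ gr' i)
    (hone : ∀ c : k, f (algebraMap k A c) = 0 → algebraMap k A c = 0) {x : A} (hx : f x = 0) :
    x ∈ positivePart D gr := by
  obtain ⟨c, y, hy, rfl⟩ := hc.exists_scalar_add h x
  -- The scalar part is the component at index 0, and the kernel of a graded map contains the
  -- components of its elements.
  have h1 : proj h.isInternal 0 (algebraMap k A c + y) = algebraMap k A c := by
    rw [map_add, proj_of_mem_positivePart h.isInternal (map_zero D).le hy, add_zero, proj_same]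
    rw [Algebra.algebraMap_eq_smul_one]
    exact Submodule.smul_mem _ c h.one_mem
  have h2 : f (algebraMap k A c) = 0 := by
    rw [← h1]
    refine (map_proj h.isInternal h' f.toLinearMap.toAddMonoidHom id
      Function.injective_id hf 0 _).trans ?_
    exact (congrArg _ hx).trans (map_zero _)
  rwa [hone c h2, zero_add]

end IsConnected

end Connected

end Grading

/-! ### Polynomials with coefficients in a subspace -/

namespace Polynomial

variable {k A : Type*} [Field k] [Ring A] [Algebra k A]

theorem coeff_mul_mem {M N : Submodule k A} {p q : A[X]} (hp : ∀ n, p.coeff n ∈ M)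
    (hq : ∀ n, q.coeff n ∈ N) (n : ℕ) : (p * q).coeff n ∈ M * N := by
  rw [coeff_mul]
  exact Submodule.sum_mem _ fun x _ => Submodule.mul_mem_mul (hp _) (hq _)

theorem coeff_integral_mem {M : Submodule k A} {p : A[X]} (hp : ∀ n, p.coeff n ∈ M) (n : ℕ) :
    (integral k p).coeff n ∈ M := by
  cases n with
  | zero =>
    rw [coeff_integral_zero]
    exact M.zero_mem
  | succ n =>
    rw [coeff_integral_succ]
    exact M.smul_mem _ (hp n)

theorem eval_one_mem {M : Submodule k A} {p : A[X]} (hp : ∀ n, p.coeff n ∈ M) : p.eval 1 ∈ M := by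
  rw [eval_eq_sum, sum_def]
  exact Submodule.sum_mem _ fun m _ => by
    rw [one_pow, mul_one]
    exact hp m

/-- p(1) − p(0) is the integral of p′ from 0 to 1, and integration only rescales coefficients by
elements of the field. -/
theorem eval_one_sub_coeff_zero_mem [CharZero k] {M : Submodule k A} {p : A[X]}
    (hp : ∀ n, (derivative p).coeff n ∈ M) : p.eval 1 - p.coeff 0 ∈ M := by
  have h : p = C (p.coeff 0) + integral k (derivative p) := by
    refine eq_of_derivative_eq k ?_ ?_
    · rw [map_add, derivative_C, zero_add, derivative_integral]
    · rw [coeff_add, coeff_C_zero, coeff_integral_zero, add_zero]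
  have h1 : p.eval 1 - p.coeff 0 = (integral k (derivative p)).eval 1 := by
    nth_rewrite 1 [h]
    rw [eval_add, eval_C, add_sub_cancel_left]
  rw [h1]
  exact eval_one_mem (coeff_integral_mem hp)

end Polynomial

/-! ### Homotopies between morphisms over a cdga with trivial differential -/

namespace CDGA

open Polynomial

variable {k : Type} [Field k]

/-- The map of path objects induced by a morphism. -/
noncomputable def pathMap {Y Z : CDGA.{u} k} (f : Y ⟶ Z) : Y.path ⟶ Z.path :=
  let F : Y.carrier[X] →+ Z.carrier[X] := coeffMap (Hom.fn f).toLinearMap.toAddMonoidHom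
  have hF : ∀ (S : Y.carrier →+ Y.carrier) (T : Z.carrier →+ Z.carrier),
      (∀ a, Hom.fn f (S a) = T (Hom.fn f a)) → ∀ p, F (coeffMap S p) = coeffMap T (F p) :=
    fun S T h p => by
      ext n
      rw [coeff_coeffMap, coeff_coeffMap, coeff_coeffMap, coeff_coeffMap]
      exact h _
  have hd : ∀ p, F (Y.polyD p) = Z.polyD (F p) := hF _ _ (Hom.fn_d f)
  have hsign : ∀ p, F (Y.polySign p) = Z.polySign (F p) := hF _ _ (Hom.fn_sign f)
  have hder : ∀ p, F (derivative p) = derivative (F p) := fun p => (derivative_coeffMap _ p).symm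
  have hmul : ∀ p q, F (p * q) = F p * F q := coeffMap_mul _ (map_mul (Hom.fn f))
  have hsmul : ∀ (c : k) p, F (c • p) = c • F p := fun c p => by
    ext n
    rw [coeff_coeffMap, coeff_smul, coeff_smul, coeff_coeffMap]
    exact map_smul (Hom.fn f) c _
  { toAlgHom := AlgHom.ofLinearMap
      { toFun := fun x : Grading.PathAlg (fun _ : Unit => Y.sign) =>
          TwistedExt.mk (fun _ : Unit => mapAlgHom Z.sign) (F x.1) fun _ => F (x.2 ())
        map_add' := fun x y => TwistedExt.ext' (s := fun _ : Unit => mapAlgHom Z.sign)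
          (map_add F _ _) fun _ => map_add F _ _
        map_smul' := fun c x => TwistedExt.ext' (s := fun _ : Unit => mapAlgHom Z.sign)
          (hsmul _ _) fun _ => hsmul _ _ }
      (TwistedExt.ext' (s := fun _ : Unit => mapAlgHom Z.sign) (show F (C 1) = C 1 by
        rw [coeffMap_C]
        exact congrArg C (map_one (Hom.fn f))) fun _ => map_zero F)
      fun x y => TwistedExt.ext' (s := fun _ : Unit => mapAlgHom Z.sign) (hmul _ _) fun _ => by
        show F (x.1 * y.2 () + x.2 () * mapAlgHom Y.sign y.1) =
          F x.1 * F (y.2 ()) + F (x.2 ()) * mapAlgHom Z.sign (F y.1)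
        rw [map_add, hmul, hmul, mapAlgHom_sign, mapAlgHom_sign, hsign]
    map_gr := fun {i x} hx => by
      have key : ∀ {p : Y.carrier[X]} {i}, (∀ n, p.coeff n ∈ Y.gr i) →
          ∀ n, (F p).coeff n ∈ Z.gr i := fun hp n => by
        rw [coeff_coeffMap]
        exact Hom.fn_gr f (hp n)
      exact ⟨key hx.1, fun _ => key (hx.2 ())⟩
    map_d := fun x => TwistedExt.ext' (s := fun _ : Unit => mapAlgHom Z.sign) (hd _) fun _ => by
      show F (Y.polyD (x.2 ()) + Y.polySign (derivative x.1)) =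
        Z.polyD (F (x.2 ())) + Z.polySign (derivative (F x.1))
      rw [map_add, hd, hsign, hder] }

/-- Two lifts of the same morphism from a minimal cdga through a morphism with acyclic kernel are
homotopic, through a homotopy over the target. -/
theorem IsMinimal.exists_homotopy [CharZero k] {A B H : CDGA.{u} k} (hA : A.IsMinimal) {p : B ⟶ H}
    (hp : AcyclicKer p) {f g : A ⟶ B} (hfg : f ≫ p = g ≫ p) :
    ∃ h : A ⟶ B.path, h ≫ B.pathZero = f ∧ h ≫ B.pathOne = g ∧
      h ≫ pathMap p = f ≫ p ≫ H.pathConst := by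
  -- G consists of pairs of points with the same image in H, and T of paths whose image in H is
  -- constant. The map `r` below takes endpoints; lifting (f, g) through it produces the homotopy.
  let G := pullback p p
  let T := pullback (pathMap p) H.pathConst
  have hT : ∀ z : T.carrier, (∀ n, Hom.fn p (coeff z.1.1.1 n) = coeff (C z.1.2) n) ∧
      ∀ n, Hom.fn p (coeff (z.1.1.2 ()) n) = 0 := by
    intro z
    have h : Hom.fn (pathMap p) z.1.1 = Hom.fn H.pathConst z.1.2 := z.2
    refine ⟨fun n => ?_, fun n => ?_⟩
    · have := congrArg (fun w : Grading.PathAlg (fun _ : Unit => H.sign) => coeff w.1 n) h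
      exact (coeff_coeffMap (Hom.fn p).toLinearMap.toAddMonoidHom z.1.1.1 n).symm.trans this
    · have := congrArg (fun w : Grading.PathAlg (fun _ : Unit => H.sign) => coeff (w.2 ()) n) h
      exact (coeff_coeffMap (Hom.fn p).toLinearMap.toAddMonoidHom (z.1.1.2 ()) n).symm.trans this
  have hT0 : pullbackFst (pathMap p) H.pathConst ≫ B.pathZero ≫ p = pullbackSnd _ _ :=
    hom_ext fun z => ((hT z).1 0).trans coeff_C_zero
  have hT1 : pullbackFst (pathMap p) H.pathConst ≫ B.pathOne ≫ p = pullbackSnd _ _ :=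
    hom_ext fun z => by
      have h : coeffMap (Hom.fn p).toLinearMap.toAddMonoidHom z.1.1.1 = C z.1.2 := by
        ext n
        rw [coeff_coeffMap]
        exact (hT z).1 n
      have h' := eval_one_coeffMap (Hom.fn p).toLinearMap.toAddMonoidHom z.1.1.1
      rw [h, eval_C] at h'
      exact h'.symm
  let r : T ⟶ G := pullbackLift p p (pullbackFst _ _ ≫ B.pathZero) (pullbackFst _ _ ≫ B.pathOne)
    (by rw [Category.assoc, Category.assoc, hT0, hT1])
  have memT : ∀ w : Grading.PathAlg (fun _ : Unit => B.sign), ∀ c : H.carrier,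
      (∀ n, Hom.fn p (coeff w.1 n) = coeff (C c) n) → (∀ n, Hom.fn p (coeff (w.2 ()) n) = 0) →
      ∃ z : T.carrier, z.1.1 = w ∧ z.1.2 = c := by
    intro w c h1 h2
    refine ⟨⟨(w, c), ?_⟩, rfl, rfl⟩
    refine TwistedExt.ext' (s := fun _ : Unit => mapAlgHom H.sign) ?_ fun _ => ?_
    · ext n
      exact (coeff_coeffMap (Hom.fn p).toLinearMap.toAddMonoidHom w.1 n).trans (h1 n)
    · ext n
      exact (coeff_coeffMap (Hom.fn p).toLinearMap.toAddMonoidHom (w.2 ()) n).trans (h2 n)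
  have hr : Function.Surjective (Hom.fn r) := by
    rintro ⟨⟨x, y⟩, hxy⟩
    have hxy' : Hom.fn p x = Hom.fn p y := hxy
    -- The straight path x + (y − x)t; its image in H is constant because x and y have the same
    -- image.
    obtain ⟨z, hz, -⟩ := memT (TwistedExt.mk (fun _ : Unit => mapAlgHom B.sign)
      (C x + C (y - x) * X) fun _ => 0) (Hom.fn p x) (fun n => by
        rw [TwistedExt.mk_fst, coeff_add, map_add, coeff_C]
        have h0 : Hom.fn p (coeff (C (y - x) * X) n) = 0 := by
          rw [coeff_C_mul, map_mul, map_sub, hxy', sub_self, zero_mul]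
        rw [h0, add_zero, coeff_C]
        split_ifs
        exacts [rfl, map_zero _]) (fun n => by rw [TwistedExt.mk_snd, coeff_zero, map_zero])
    refine ⟨z, Subtype.ext (Prod.ext ?_ ?_)⟩
    · show coeff z.1.1.1 0 = x
      rw [hz, TwistedExt.mk_fst, coeff_add, coeff_C_zero, coeff_mul_X_zero, add_zero]
    · show eval 1 z.1.1.1 = y
      rw [hz, TwistedExt.mk_fst, eval_add, eval_C, eval_C_mul, eval_X, mul_one, add_sub_cancel]
  have hr' : AcyclicKer r := by
    intro z hz hdz
    have z0 : coeff z.1.1.1 0 = 0 := congrArg (fun w : G.carrier => w.1.1) hz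
    have z1 : eval 1 z.1.1.1 = 0 := congrArg (fun w : G.carrier => w.1.2) hz
    have hz2 : z.1.2 = 0 := by
      have := (hT z).1 0
      rw [z0, map_zero, coeff_C_zero] at this
      exact this.symm
    have hd : B.path.d z.1.1 = 0 := congrArg (fun w : T.carrier => w.1.1) hdz
    have d1 : B.polyD (z.1.1.2 ()) + B.polySign (derivative z.1.1.1) = 0 :=
      congrArg (fun w : Grading.PathAlg (fun _ : Unit => B.sign) => w.2 ()) hd
    let E : B.carrier[X] := integral k (B.polySign (z.1.1.2 ()))
    have hE0 : E.coeff 0 = 0 := coeff_integral_zero k _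
    have hEd : B.polyD E = z.1.1.1 := by
      refine eq_of_derivative_eq k ?_ ?_
      · rw [derivative_coeffMap, derivative_integral, ← neg_eq_iff_eq_neg.2 (B.polySign_polyD _),
          eq_neg_of_add_eq_zero_left d1, map_neg, neg_neg, polySign_polySign]
      · rw [coeff_coeffMap, hE0, z0, map_zero]
    have hEp : ∀ n, E.coeff n ∈ LinearMap.ker (Hom.fn p).toLinearMap := by
      refine coeff_integral_mem fun n => ?_
      rw [coeff_coeffMap]
      show Hom.fn p (B.sign _) = 0
      rw [Hom.fn_sign, (hT z).2, map_zero]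
    -- E is a primitive that vanishes at t = 0, but perhaps not at t = 1. Its end value is closed
    -- and lies in the kernel of `p`, hence equals dκ. Subtracting d(κt), whose value at 1 is dκ and
    -- at 0 is zero, makes both ends vanish.
    obtain ⟨κ, hκ, hκ'⟩ := hp (E.eval 1) (eval_one_mem hEp) (by
      refine (eval_one_coeffMap B.d.toAddMonoidHom E).symm.trans ?_
      exact (congrArg _ hEd).trans z1)
    obtain ⟨w, hw, hw'⟩ := memT (TwistedExt.mk (fun _ : Unit => mapAlgHom B.sign)
      (E - B.polyD (C κ * X)) fun _ => -B.polySign (C κ)) 0 (fun n => by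
        rw [TwistedExt.mk_fst, coeff_sub, map_sub, coeff_coeffMap, C_0, coeff_zero, sub_eq_zero]
        refine (hEp n).trans ?_
        show 0 = Hom.fn p (B.d _)
        rw [Hom.fn_d, coeff_C_mul, map_mul, hκ, zero_mul, map_zero]) (fun n => by
        rw [TwistedExt.mk_snd, coeff_neg, map_neg, coeff_coeffMap, neg_eq_zero]
        show Hom.fn p (B.sign _) = 0
        rw [Hom.fn_sign, coeff_C]
        split_ifs
        · rw [hκ, map_zero]
        · rw [map_zero, map_zero])
    have hX : B.polyD (C κ * X) = C (E.eval 1) * X := by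
      ext n
      rw [coeff_coeffMap, ← hκ']
      cases n with
      | zero =>
        rw [coeff_mul_X_zero, coeff_mul_X_zero]
        exact map_zero B.d
      | succ n =>
        rw [coeff_mul_X, coeff_mul_X, coeff_C, coeff_C]
        split_ifs
        exacts [rfl, map_zero B.d]
    refine ⟨w, Subtype.ext (Prod.ext ?_ ?_), Subtype.ext (Prod.ext ?_ ?_)⟩
    · show coeff w.1.1.1 0 = 0
      rw [hw, TwistedExt.mk_fst, hX, coeff_sub, hE0, coeff_mul_X_zero, sub_zero]
    · show eval 1 w.1.1.1 = 0
      rw [hw, TwistedExt.mk_fst, hX, eval_sub, eval_C_mul, eval_X, mul_one, sub_self]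
    · show B.path.d w.1.1 = z.1.1
      rw [hw]
      refine TwistedExt.ext' (s := fun _ : Unit => mapAlgHom B.sign) ?_ fun _ => ?_
      · show B.polyD (E - B.polyD (C κ * X)) = z.1.1.1
        rw [map_sub, polyD_polyD, sub_zero, hEd]
      · show B.polyD (-B.polySign (C κ)) + B.polySign (derivative (E - B.polyD (C κ * X))) =
          z.1.1.2 ()
        have h1 : derivative (B.polyD (C κ * X)) = B.polyD (C κ) := by
          rw [derivative_coeffMap, derivative_C_mul, derivative_X, mul_one]
        rw [map_sub, h1, derivative_integral, map_sub, polySign_polySign, polySign_polyD, map_neg]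
        abel
    · show H.d w.1.2 = z.1.2
      rw [hw', hz2, map_zero]
  obtain ⟨h, hh⟩ := hA.exists_lift r hr hr' (pullbackLift p p f g hfg)
  have h0 : (h ≫ pullbackFst (pathMap p) H.pathConst) ≫ B.pathZero = f :=
    congrArg (fun c : A ⟶ G => c ≫ pullbackFst p p) hh
  refine ⟨h ≫ pullbackFst _ _, h0, congrArg (fun c : A ⟶ G => c ≫ pullbackSnd p p) hh, ?_⟩
  have h2 : pullbackFst (pathMap p) H.pathConst ≫ pathMap p =
      pullbackSnd (pathMap p) H.pathConst ≫ H.pathConst := hom_ext fun z => z.2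
  rw [Category.assoc, h2, ← hT0, ← h0]
  rfl

end CDGA

/-! ### Rigidity of minimal cdga's over their cohomology -/

namespace CDGA

open Polynomial

variable {k : Type} [Field k]

/-- The part of positive degree. -/
abbrev positivePart (A : CDGA.{u} k) : Submodule k A.carrier :=
  Grading.positivePart (AddMonoidHom.id ℤ) A.gr

theorem IsMinimalOn.isConnected {A : CDGA.{u} k} {W F} (h : A.IsMinimalOn W F) :
    Grading.IsConnected (AddMonoidHom.id ℤ) A.gr :=
  Grading.IsConnected.of_generators A.isGradedComm h.graded h.free.adjoin_eq_top h.pos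

theorem IsMinimalOn.d_mem {A : CDGA.{u} k} {W F} (h : A.IsMinimalOn W F) (a : A.carrier) :
    A.d a ∈ A.positivePart * A.positivePart :=
  h.isConnected.decomposable_le A.isGradedComm (Grading.le_positivePart h.graded h.pos)
    (h.d_decomposable a)

/-- If `p` killed 1, acyclicity would make 1 a coboundary. Coboundaries are decomposable, hence have
no component of degree zero, so 1 would vanish. Thus elements of the kernel have no scalar part. -/
theorem IsMinimalOn.mem_positivePart {A H : CDGA.{u} k} {W F} (h : A.IsMinimalOn W F) {p : A ⟶ H}
    (hp : AcyclicKer p) {x : A.carrier} (hx : Hom.fn p x = 0) : x ∈ A.positivePart := by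
  refine h.isConnected.mem_positivePart_of_map_eq_zero A.isGradedComm H.isInternal (Hom.fn p)
    (fun _ _ => Hom.fn_gr p) ?_ hx
  intro c hc
  by_cases h0 : c = 0
  · rw [h0, map_zero]
  have h1 : Hom.fn p 1 = 0 := by
    rw [Algebra.algebraMap_eq_smul_one, map_smul] at hc
    exact (smul_eq_zero_iff_right h0).1 hc
  obtain ⟨w, -, hw⟩ := hp 1 h1 A.d_one
  have h2 := Grading.proj_of_mem_positivePart A.isInternal (D := AddMonoidHom.id ℤ) (i := 0) le_rfl
    (h.isConnected.positivePart_sq_le A.isGradedComm (h.d_mem w))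
  rw [hw, Grading.proj_same _ A.one_mem] at h2
  rw [Algebra.algebraMap_eq_smul_one, h2, smul_zero]

theorem surjective_of_quasiIso {A H : CDGA.{u} k} (hH : H.d = 0) {p : A ⟶ H}
    (hp : quasiIso k p) : Function.Surjective (Hom.fn p) := fun y => by
  obtain ⟨x, -, z, hz⟩ := (surjective_cohomologyMap_iff p).1 hp.2 y (by rw [hH]; rfl)
  rw [hH] at hz
  exact ⟨x, sub_eq_zero.1 hz.symm⟩

/-- An endomorphism of a minimal cdga over a quasi-isomorphism to a cdga with trivial differential
is surjective. -/
theorem IsMinimal.surjective_of_comp_eq [CharZero k] {A H : CDGA.{u} k} (hA : A.IsMinimal)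
    {p : A ⟶ H} (hp : quasiIso k p) (hH : H.d = 0) {e : A ⟶ A} (he : e ≫ p = p) :
    Function.Surjective (Hom.fn e) := by
  have hK := acyclicKer_of_quasiIso (surjective_of_quasiIso hH hp) hp
  -- A homotopy from the identity to `e` that is constant over H. All its coefficients other than
  -- the constant one lie in the kernel of `p`, hence in positive degrees.
  obtain ⟨h, h0, h1, hc⟩ := hA.exists_homotopy hK (f := 𝟙 A) (g := e)
    (by rw [he, Category.id_comp])
  obtain ⟨W, F, hW⟩ := hA
  have hcon := hW.isConnected
  have hg := A.isGradedComm
  let γ : A.carrier → Grading.PathAlg (fun _ : Unit => A.sign) := fun x => Hom.fn h x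
  have γ0 : ∀ x, coeff (γ x).1 0 = x := fun x => congrArg (fun c : A ⟶ A => Hom.fn c x) h0
  have γ1 : ∀ x, eval 1 (γ x).1 = Hom.fn e x := fun x =>
    congrArg (fun c : A ⟶ A => Hom.fn c x) h1
  have γp : ∀ x, pathMap p |> fun q => Hom.fn q (γ x) = Hom.fn H.pathConst (Hom.fn p x) := fun x =>
    congrArg (fun c : A ⟶ H.path => Hom.fn c x) hc
  have hcst : ∀ x ∈ A.positivePart, ∀ n, coeff (γ x).1 n ∈ A.positivePart := by
    intro x hx n
    cases n with
    | zero => rwa [γ0]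
    | succ n =>
      refine hW.mem_positivePart hK ?_
      have := congrArg
        (fun w : Grading.PathAlg (fun _ : Unit => H.sign) => coeff w.1 (n + 1)) (γp x)
      refine (coeff_coeffMap (Hom.fn p).toLinearMap.toAddMonoidHom _ _).symm.trans (this.trans ?_)
      exact coeff_C_succ
  have hdt : ∀ x n, coeff ((γ x).2 ()) n ∈ A.positivePart := by
    intro x n
    refine hW.mem_positivePart hK ?_
    have := congrArg (fun w : Grading.PathAlg (fun _ : Unit => H.sign) => coeff (w.2 ()) n) (γp x)
    exact (coeff_coeffMap (Hom.fn p).toLinearMap.toAddMonoidHom _ _).symm.trans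
      (this.trans (coeff_zero n))
  have hsign : ∀ x ∈ A.positivePart, A.sign x ∈ A.positivePart := fun x hx =>
    Grading.map_positivePart_le A.sign.toLinearMap.toAddMonoidHom id (fun _ => le_rfl)
      (fun _ _ => hg.sign_mem) hx
  -- In the dt-coefficient of γ(ab), each term is a product of a dt-coefficient with a coefficient
  -- of γ(a) or γ(b); both factors have positive degree.
  have hdec : ∀ y ∈ A.positivePart * A.positivePart,
      ∀ n, coeff ((γ y).2 ()) n ∈ A.positivePart * A.positivePart := by
    intro y hy
    refine Submodule.mul_induction_on hy ?_ ?_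
    · intro a ha b hb n
      have h2 : (γ (a * b)).2 () =
          (γ a).1 * (γ b).2 () + (γ a).2 () * A.polySign (γ b).1 := by
        rw [← mapAlgHom_sign]
        exact congrArg (fun w : Grading.PathAlg (fun _ : Unit => A.sign) => w.2 ())
          (map_mul (Hom.fn h) a b)
      rw [h2, coeff_add]
      refine Submodule.add_mem _ (coeff_mul_mem (hcst a ha) (hdt b) n)
        (coeff_mul_mem (hdt a) (fun n => ?_) n)
      rw [coeff_coeffMap]
      exact hsign _ (hcst b hb n)
    · intro y z hy hz n
      have h2 : (γ (y + z)).2 () = (γ y).2 () + (γ z).2 () :=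
        congrArg (fun w : Grading.PathAlg (fun _ : Unit => A.sign) => w.2 ())
          (map_add (Hom.fn h) y z)
      rw [h2, coeff_add]
      exact Submodule.add_mem _ (hy n) (hz n)
  have hder : ∀ x n, coeff (derivative (γ x).1) n ∈ A.positivePart * A.positivePart := by
    intro x n
    have h2 : (γ (A.d x)).2 () = A.polyD ((γ x).2 ()) + A.polySign (derivative (γ x).1) :=
      congrArg (fun w : Grading.PathAlg (fun _ : Unit => A.sign) => w.2 ()) (Hom.fn_d h x)
    -- Compatibility of γ with d, read at dt and solved for the derivative. One term comes from
    -- γ(dx), where dx is decomposable; the other is a coboundary, hence also decomposable.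
    have h3 : derivative (γ x).1 =
        A.polySign ((γ (A.d x)).2 ()) + A.polyD (A.polySign ((γ x).2 ())) := by
      rw [h2, map_add, polySign_polySign, polySign_polyD]
      abel
    rw [h3, coeff_add, coeff_coeffMap, coeff_coeffMap]
    refine Submodule.add_mem _ ?_ (hW.d_mem _)
    have h4 : A.sign (((γ (A.d x)).2 ()).coeff n) ∈
        (A.positivePart * A.positivePart).map A.sign.toLinearMap :=
      Submodule.mem_map_of_mem (hdec _ (hW.d_mem x) n)
    rw [Submodule.map_mul] at h4
    have h5 : A.positivePart.map A.sign.toLinearMap ≤ A.positivePart := by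
      rintro _ ⟨y, hy, rfl⟩
      exact hsign y hy
    exact (mul_le_mul' h5 h5 : _ ≤ A.positivePart * A.positivePart) h4
  -- Integrating the derivative from 0 to 1 shows that e(x) − x is decomposable, so the image of `e`
  -- is everything modulo decomposables.
  have htop := hcon.eq_top_of_le_sup hg (Hom.fn e).range (by
    rintro i _ ⟨x, rfl⟩
    exact ⟨_, Hom.fn_proj e i x⟩) (fun x hx => by
    refine ⟨_, ⟨x, rfl⟩, ?_⟩
    have h2 := Submodule.neg_mem _ (eval_one_sub_coeff_zero_mem (hder x))
    rw [γ0, γ1, neg_sub] at h2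
    exact h2)
  exact AlgHom.range_eq_top _ |>.1 htop

/-- A morphism between quasi-isomorphisms from a minimal cdga to a cdga with trivial differential is
an isomorphism. -/
theorem IsMinimal.isIso_of_comp_eq [CharZero k] {A H : CDGA.{u} k} (hA : A.IsMinimal)
    {p f : A ⟶ H} (hp : quasiIso k p) (hf : quasiIso k f) (hH : H.d = 0) {b : A ⟶ A}
    (hb : b ≫ p = f) : IsIso b := by
  have hs : ∀ {p : A ⟶ H}, quasiIso k p → Function.Surjective (Hom.fn p) ∧ AcyclicKer p :=
    fun h => ⟨surjective_of_quasiIso hH h, acyclicKer_of_quasiIso (surjective_of_quasiIso hH h) h⟩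
  -- The lift gives an endomorphism of `A` over `p` with last factor `b`, so `b` is onto.
  obtain ⟨s, hs0⟩ := hA.exists_lift f (hs hf).1 (hs hf).2 p
  have hbs : Function.Surjective (Hom.fn b) := by
    have := hA.surjective_of_comp_eq hp hH (e := s ≫ b) (by rw [Category.assoc, hb, hs0])
    exact Function.Surjective.of_comp (g := Hom.fn s) this
  have hbq : quasiIso k b := quasiIso.of_comp_right hp (by rwa [hb])
  -- `b` is now an acyclic surjection, so it has a section `s`. The composite `b ≫ s` is an
  -- endomorphism over `f`, hence onto; thus `s` is onto and `b` is injective.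
  obtain ⟨s, hs0⟩ := hA.exists_lift b hbs (acyclicKer_of_quasiIso hbs hbq) (𝟙 A)
  have hss : Function.Surjective (Hom.fn s) := by
    have := hA.surjective_of_comp_eq hf hH (e := b ≫ s) (by
      rw [← hb, Category.assoc, ← Category.assoc s, hs0, Category.id_comp])
    exact Function.Surjective.of_comp (g := Hom.fn b) this
  have hbsx : ∀ x, Hom.fn b (Hom.fn s x) = x := fun x => congrArg (fun c : A ⟶ A => Hom.fn c x) hs0
  refine isIso_of_bijective b ⟨fun x y hxy => ?_, hbs⟩
  obtain ⟨x, rfl⟩ := hss x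
  obtain ⟨y, rfl⟩ := hss y
  rw [hbsx, hbsx] at hxy
  rw [hxy]

end CDGA

/-! ### Homotopies over an `ℝ`-cbba with trivial differentials -/

namespace RCbba

open Polynomial

/-- Two lifts of the same morphism from a minimal `ℝ`-cbba through a pluripotential
quasi-isomorphism to an `ℝ`-cbba with trivial differentials are homotopic, through a homotopy over
the target. -/
theorem IsMinimal.exists_homotopy {A B H : RCbba.{u}} (hA : A.IsMinimal) {p : B ⟶ H}
    (hp : AcyclicKer p) (hH : H.del = 0) {f g : A ⟶ B} (hfg : f ≫ p = g ≫ p) :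
    ∃ h : A ⟶ B.path, h ≫ B.pathZero = f ∧ h ≫ B.pathOne = g ∧
      h ≫ pathMap p = f ≫ p ≫ H.pathConst := by
  let G := pullback p p
  let T := pullback (pathMap p) H.pathConst
  have hT : ∀ z : T.carrier, (∀ n, Hom.fn p (coeff z.1.1.1 n) = coeff (C z.1.2) n) ∧
      ∀ j n, Hom.fn p (coeff (z.1.1.2 j) n) = 0 := by
    intro z
    have h : Hom.fn (pathMap p) z.1.1 = Hom.fn H.pathConst z.1.2 := z.2
    have key := fun q : B.carrier[X] => coeff_coeffMap (Hom.fn p).toLinearMap.toAddMonoidHom q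
    refine ⟨fun n => ?_, fun j n => ?_⟩
    · have := congrArg (fun w : H.PathCarrier => coeff w.1 n) h
      exact (key _ n).symm.trans this
    · have := congrArg (fun w : H.PathCarrier => coeff (w.2 j) n) h
      match j with
      | 0 => exact (key _ n).symm.trans this
      | 1 => exact (key _ n).symm.trans this
      | 2 => exact (key _ n).symm.trans this
  have hT0 : pullbackFst (pathMap p) H.pathConst ≫ B.pathZero ≫ p = pullbackSnd _ _ :=
    hom_ext fun z => ((hT z).1 0).trans coeff_C_zero
  have hT1 : pullbackFst (pathMap p) H.pathConst ≫ B.pathOne ≫ p = pullbackSnd _ _ :=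
    hom_ext fun z => by
      have h : coeffMap (Hom.fn p).toLinearMap.toAddMonoidHom z.1.1.1 = C z.1.2 := by
        ext n
        rw [coeff_coeffMap]
        exact (hT z).1 n
      have h' := eval_one_coeffMap (Hom.fn p).toLinearMap.toAddMonoidHom z.1.1.1
      rw [h, eval_C] at h'
      exact h'.symm
  let r : T ⟶ G := pullbackLift p p (pullbackFst _ _ ≫ B.pathZero) (pullbackFst _ _ ≫ B.pathOne)
    (by rw [Category.assoc, Category.assoc, hT0, hT1])
  have memT : ∀ (w : B.path.carrier) (c : H.carrier),
      Hom.fn (pathMap p) w = Hom.fn H.pathConst c → ∃ z : T.carrier, z.1.1 = w ∧ z.1.2 = c :=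
    fun w c h => ⟨⟨(w, c), h⟩, rfl, rfl⟩
  have memT' : ∀ (q : B.carrier[X]) (c : H.carrier),
      (∀ n, Hom.fn p (coeff q n) = coeff (C c) n) →
        Hom.fn (pathMap p) (B.pathMk q 0 0 0) = Hom.fn H.pathConst c := by
    intro q c hq
    refine path_ext (Polynomial.ext fun n => ?_) (map_zero (coeffMap _)) (map_zero (coeffMap _))
      (map_zero (coeffMap _))
    exact (coeff_coeffMap (Hom.fn p).toLinearMap.toAddMonoidHom q n).trans (hq n)
  have hr : Function.Surjective (Hom.fn r) := by
    rintro ⟨⟨x, y⟩, hxy⟩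
    have hxy' : Hom.fn p x = Hom.fn p y := hxy
    obtain ⟨z, hz, -⟩ := memT _ _ (memT' (C x + C (y - x) * X) (Hom.fn p x) (fun n => by
        rw [coeff_add, map_add, coeff_C]
        have h0 : Hom.fn p (coeff (C (y - x) * X) n) = 0 := by
          rw [coeff_C_mul, map_mul, map_sub, hxy', sub_self, zero_mul]
        rw [h0, add_zero, coeff_C]
        split_ifs
        exacts [rfl, map_zero _]))
    refine ⟨z, Subtype.ext (Prod.ext ?_ ?_)⟩
    · show coeff (z.1.1 : B.PathCarrier).1 0 = x
      rw [hz]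
      show coeff (C x + C (y - x) * X) 0 = x
      rw [coeff_add, coeff_C_zero, coeff_mul_X_zero, add_zero]
    · show eval 1 (z.1.1 : B.PathCarrier).1 = y
      rw [hz]
      show eval 1 (C x + C (y - x) * X) = y
      rw [eval_add, eval_C, eval_C_mul, eval_X, mul_one, add_sub_cancel]
  have hr' : AcyclicKer r := by
    intro z hz hdz hdz'
    have z0 : coeff z.1.1.1 0 = 0 := congrArg (fun w : G.carrier => w.1.1) hz
    have z1 : eval 1 z.1.1.1 = 0 := congrArg (fun w : G.carrier => w.1.2) hz
    have hz2 : z.1.2 = 0 := by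
      have := (hT z).1 0
      rw [z0, map_zero, coeff_C_zero] at this
      exact this.symm
    let E : B.carrier[X] := integral ℂ (z.1.1.2 2)
    have hE0 : E.coeff 0 = 0 := coeff_integral_zero ℂ _
    have hEp : ∀ n, E.coeff n ∈ LinearMap.ker (Hom.fn p).toLinearMap :=
      coeff_integral_mem fun n => (hT z).2 2 n
    have hEz : B.pathDel (B.pathDelbar (B.pathMk E 0 0 0)) = z.1.1 :=
      B.del_delbar_integral z0 (congrArg (fun w : T.carrier => w.1.1) hdz)
        (congrArg (fun w : T.carrier => w.1.1) hdz')
    have hE : B.polyDel (B.polyDelbar E) = z.1.1.1 :=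
      congrArg (fun w : B.PathCarrier => w.1) hEz
    -- E satisfies ∂∂̄E = z and vanishes at t = 0. Its end value is ∂∂̄-closed in the kernel of `p`,
    -- hence ∂v + ∂̄w since the Aeppli cohomology of the kernel vanishes.
    obtain ⟨v, w, hv, hw, hvw⟩ := hp.aeppli (x := E.eval 1) (eval_one_mem hEp) (by
      have e1 := eval_one_coeffMap B.del.toAddMonoidHom (B.polyDelbar E)
      have e2 := eval_one_coeffMap B.delbar.toAddMonoidHom E
      rw [e2] at e1
      exact e1.symm.trans ((congrArg _ hE).trans z1))
    have memX : ∀ v, Hom.fn p v = 0 → ∃ z : T.carrier, z.1.1 = B.pathMk (C v * X) 0 0 0 ∧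
        z.1.2 = 0 := fun v hv => memT _ _ (memT' _ _ fun n => by
      rw [coeff_C_mul, map_mul, hv, zero_mul, C_0, coeff_zero])
    obtain ⟨e, he, he'⟩ := memT _ _ (memT' E 0 fun n => by
      rw [C_0, coeff_zero]
      exact hEp n)
    obtain ⟨v', hv', hv''⟩ := memX v hv
    obtain ⟨w', hw', hw''⟩ := memX w hw
    have evX : ∀ (S : B.carrier →+ B.carrier) (x : B.carrier), eval 1 (coeffMap S (C x * X)) = S x ∧
        coeff (coeffMap S (C x * X)) 0 = 0 := fun S x => by
      rw [eval_one_coeffMap, eval_C_mul, eval_X, mul_one, coeff_coeffMap, coeff_mul_X_zero,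
        map_zero]
      exact ⟨rfl, rfl⟩
    -- Subtracting ∂(vt) + ∂̄(wt) makes both endpoints zero and does not affect ∂∂̄.
    refine ⟨e - T.del v' - T.delbar w', Subtype.ext (Prod.ext ?_ ?_), ?_⟩
    · show coeff ((e.1.1 : B.PathCarrier).1 - (B.pathDel v'.1.1).1 - (B.pathDelbar w'.1.1).1) 0 = 0
      rw [he, hv', hw']
      show coeff (E - B.polyDel (C v * X) - B.polyDelbar (C w * X)) 0 = 0
      rw [coeff_sub, coeff_sub, (evX _ _).2, (evX _ _).2, hE0, sub_zero, sub_zero]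
    · show eval 1 ((e.1.1 : B.PathCarrier).1 - (B.pathDel v'.1.1).1 - (B.pathDelbar w'.1.1).1) = 0
      rw [he, hv', hw']
      show eval 1 (E - B.polyDel (C v * X) - B.polyDelbar (C w * X)) = 0
      rw [eval_sub, eval_sub, (evX _ _).1, (evX _ _).1, ← hvw]
      show B.del v + B.delbar w - B.del v - B.delbar w = 0
      abel
    · rw [map_sub, map_sub, map_sub, map_sub, T.delbar_delbar, map_zero, sub_zero, T.delbar_del,
        map_neg, T.del_del, neg_zero, sub_zero]
      refine Subtype.ext (Prod.ext ?_ ?_)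
      · show B.pathDel (B.pathDelbar e.1.1) = z.1.1
        rw [he, hEz]
      · show H.del (H.delbar e.1.2) = z.1.2
        rw [hH, hz2]
        rfl
  obtain ⟨h, hh⟩ := hA.exists_lift r hr hr' (pullbackLift p p f g hfg)
  have h0 : (h ≫ pullbackFst (pathMap p) H.pathConst) ≫ B.pathZero = f :=
    congrArg (fun c : A ⟶ G => c ≫ pullbackFst p p) hh
  refine ⟨h ≫ pullbackFst _ _, h0, congrArg (fun c : A ⟶ G => c ≫ pullbackSnd p p) hh, ?_⟩
  have h2 : pullbackFst (pathMap p) H.pathConst ≫ pathMap p =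
      pullbackSnd (pathMap p) H.pathConst ≫ H.pathConst := hom_ext fun z => z.2
  rw [Category.assoc, h2, ← hT0, ← h0]
  rfl

end RCbba

/-! ### Rigidity of minimal `ℝ`-cbba's over their Bott-Chern cohomology -/

namespace RCbba

open Polynomial

/-- The part of positive total degree. -/
abbrev positivePart (A : RCbba.{u}) : Submodule ℂ A.carrier := Grading.positivePart degHom A.gr

theorem IsMinimalOn.isConnected {A : RCbba.{u}} {W F} (h : A.IsMinimalOn W F) :
    Grading.IsConnected degHom A.gr :=
  Grading.IsConnected.of_generators A.isGradedComm h.graded h.free.adjoin_eq_top h.pos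

theorem IsMinimalOn.del_delbar_mem {A : RCbba.{u}} {W F} (h : A.IsMinimalOn W F) (a : A.carrier) :
    A.del (A.delbar a) ∈ A.positivePart * A.positivePart :=
  h.isConnected.decomposable_le A.isGradedComm (Grading.le_positivePart h.graded h.pos)
    (h.del_delbar_decomposable a)

theorem IsMinimalOn.mem_positivePart {A H : RCbba.{u}} {W F} (h : A.IsMinimalOn W F) {p : A ⟶ H}
    (hp : AcyclicKer p) {x : A.carrier} (hx : Hom.fn p x = 0) : x ∈ A.positivePart := by
  refine h.isConnected.mem_positivePart_of_map_eq_zero A.isGradedComm H.isInternal (Hom.fn p)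
    (fun _ _ => Hom.fn_gr p) ?_ hx
  intro c hc
  by_cases h0 : c = 0
  · rw [h0, map_zero]
  have h1 : Hom.fn p 1 = 0 := by
    rw [Algebra.algebraMap_eq_smul_one, map_smul] at hc
    exact (smul_eq_zero_iff_right h0).1 hc
  obtain ⟨w, -, hw⟩ := hp 1 h1 A.del_one A.delbar_one
  have h2 := Grading.proj_of_mem_positivePart A.isInternal (D := degHom) (i := 0) le_rfl
    (h.isConnected.positivePart_sq_le A.isGradedComm (h.del_delbar_mem w))
  rw [hw, Grading.proj_same _ A.isGradedComm.one_mem] at h2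
  rw [Algebra.algebraMap_eq_smul_one, h2, smul_zero]

theorem surjective_of_pluriQuasiIso {A H : RCbba.{u}} (hH : H.del = 0) (hH' : H.delbar = 0)
    {p : A ⟶ H} (hp : PluriQuasiIso p) : Function.Surjective (Hom.fn p) := fun y => by
  obtain ⟨x, -, -, z, hz⟩ := (surjective_bottChernMap_iff p).1 hp.1.2 y (by rw [hH]; rfl)
    (by rw [hH']; rfl)
  rw [hH] at hz
  exact ⟨x, sub_eq_zero.1 hz.symm⟩

/-- A derivation that preserves the positive part preserves its square. -/
theorem map_mul_positivePart_le (A : RCbba.{u}) {d : A.carrier →ₗ[ℂ] A.carrier}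
    (hd : ∀ a b, d (a * b) = d a * b + A.sign a * d b)
    (hd' : ∀ x ∈ A.positivePart, d x ∈ A.positivePart) {x : A.carrier}
    (hx : x ∈ A.positivePart * A.positivePart) : d x ∈ A.positivePart * A.positivePart := by
  refine Submodule.mul_induction_on hx ?_ ?_
  · intro a ha b hb
    rw [hd]
    exact Submodule.add_mem _ (Submodule.mul_mem_mul (hd' a ha) hb)
      (Submodule.mul_mem_mul (Grading.map_positivePart_le A.sign.toLinearMap.toAddMonoidHom id
        (fun _ => le_rfl) (fun _ _ => A.isGradedComm.sign_mem) ha) (hd' b hb))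
  · intro y z hy hz
    rw [map_add]
    exact Submodule.add_mem _ hy hz

/-- An endomorphism of a minimal `ℝ`-cbba over a pluripotential quasi-isomorphism to an `ℝ`-cbba
with trivial differentials is surjective. -/
theorem IsMinimal.surjective_of_comp_eq {A H : RCbba.{u}} (hA : A.IsMinimal)
    {p : A ⟶ H} (hp : PluriQuasiIso p) (hH : H.del = 0) (hH' : H.delbar = 0) {e : A ⟶ A}
    (he : e ≫ p = p) : Function.Surjective (Hom.fn e) := by
  have hK := acyclicKer_of_pluriQuasiIso (surjective_of_pluriQuasiIso hH hH' hp) hp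
  obtain ⟨h, h0, h1, hc⟩ := hA.exists_homotopy hK hH (f := 𝟙 A) (g := e)
    (by rw [he, Category.id_comp])
  obtain ⟨W, F, hW⟩ := hA
  have hcon := hW.isConnected
  have hg := A.isGradedComm
  let γ : A.carrier → A.PathCarrier := fun x => Hom.fn h x
  have γ0 : ∀ x, coeff (γ x).1 0 = x := fun x => congrArg (fun c : A ⟶ A => Hom.fn c x) h0
  have γ1 : ∀ x, eval 1 (γ x).1 = Hom.fn e x := fun x =>
    congrArg (fun c : A ⟶ A => Hom.fn c x) h1
  have γp : ∀ x, Hom.fn (pathMap p) (γ x) = Hom.fn H.pathConst (Hom.fn p x) := fun x =>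
    congrArg (fun c : A ⟶ H.path => Hom.fn c x) hc
  have key := fun q : A.carrier[X] => coeff_coeffMap (Hom.fn p).toLinearMap.toAddMonoidHom q
  have hcst : ∀ x ∈ A.positivePart, ∀ n, coeff (γ x).1 n ∈ A.positivePart := by
    intro x hx n
    cases n with
    | zero => rwa [γ0]
    | succ n =>
      refine hW.mem_positivePart hK ?_
      have := congrArg (fun w : H.PathCarrier => coeff w.1 (n + 1)) (γp x)
      exact (key _ _).symm.trans (this.trans coeff_C_succ)
  have hdt : ∀ j x n, coeff ((γ x).2 j) n ∈ A.positivePart := by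
    intro j x n
    refine hW.mem_positivePart hK ?_
    have := congrArg (fun w : H.PathCarrier => coeff (w.2 j) n) (γp x)
    match j with
    | 0 => exact (key _ _).symm.trans (this.trans (coeff_zero n))
    | 1 => exact (key _ _).symm.trans (this.trans (coeff_zero n))
    | 2 => exact (key _ _).symm.trans (this.trans (coeff_zero n))
  have hdel : ∀ x ∈ A.positivePart, A.del x ∈ A.positivePart := fun x hx =>
    Grading.map_positivePart_le A.del.toAddMonoidHom (fun i => i + (1, 0))
      (fun i => by rw [map_add]; exact le_add_of_nonneg_right zero_le_one)
      (fun _ _ => A.del_mem) hx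
  have hdelbar : ∀ x ∈ A.positivePart, A.delbar x ∈ A.positivePart := fun x hx =>
    Grading.map_positivePart_le A.delbar.toAddMonoidHom (fun i => i + (0, 1))
      (fun i => by rw [map_add]; exact le_add_of_nonneg_right zero_le_one)
      (fun _ _ => A.delbar_mem) hx
  have hsign : ∀ x ∈ A.positivePart, A.sign x ∈ A.positivePart := fun x hx =>
    Grading.map_positivePart_le A.sign.toLinearMap.toAddMonoidHom id (fun _ => le_rfl)
      (fun _ _ => hg.sign_mem) hx
  -- As for cdga's, with the coefficient at ∂∂̄t in the role of the one at dt.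
  have hdec : ∀ y ∈ A.positivePart * A.positivePart,
      ∀ n, coeff ((γ y).2 2) n ∈ A.positivePart * A.positivePart := by
    intro y hy
    refine Submodule.mul_induction_on hy ?_ ?_
    · intro a ha b hb n
      have h2 : (γ (a * b)).2 2 = (γ a).1 * (γ b).2 2 + (γ a).2 2 * (γ b).1 :=
        congrArg (fun w : A.PathCarrier => w.2 2)
          ((map_mul (Hom.fn h) a b).trans (A.path_mul (γ a) (γ b)))
      rw [h2, coeff_add]
      exact Submodule.add_mem _ (coeff_mul_mem (hcst a ha) (hdt 2 b) n)
        (coeff_mul_mem (hdt 2 a) (hcst b hb) n)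
    · intro y z hy hz n
      have h2 : (γ (y + z)).2 2 = (γ y).2 2 + (γ z).2 2 :=
        congrArg (fun w : A.PathCarrier => w.2 2) (map_add (Hom.fn h) y z)
      rw [h2, coeff_add]
      exact Submodule.add_mem _ (hy n) (hz n)
  -- Minimality makes only ∂∂̄ decomposable, not ∂ and ∂̄ separately, so images of ∂ and ∂̄ must be
  -- allowed in the error.
  let N : Submodule ℂ A.carrier := A.positivePart * A.positivePart ⊔
    (A.positivePart.map A.del ⊔ A.positivePart.map A.delbar)
  have hder : ∀ x n, coeff (derivative (γ x).1) n ∈ N := by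
    intro x n
    have h2 : (γ (A.del (A.delbar x))).2 2 =
        A.polyDel (A.polyDelbar ((γ x).2 2) - A.polySign ((γ x).2 0)) +
          A.polySign (A.polyDelbar ((γ x).2 1) + A.polySign (derivative (γ x).1)) := by
      have h3 : γ (A.del (A.delbar x)) = A.pathDel (A.pathDelbar (γ x)) :=
        (Hom.fn_del h _).trans (congrArg _ (Hom.fn_delbar h x))
      exact congrArg (fun w : A.PathCarrier => w.2 2) h3
    -- The ∂∂̄t-coefficient of γ(∂∂̄x) contains the derivative once; every other term is a ∂- or
    -- ∂̄-image. Solving for the derivative leaves a decomposable term and such images.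
    have h3 : derivative (γ x).1 = (γ (A.del (A.delbar x))).2 2 +
        A.polyDel (A.polySign ((γ x).2 0) - A.polyDelbar ((γ x).2 2)) +
        A.polyDelbar (A.polySign ((γ x).2 1)) := by
      rw [h2, map_add, polySign_polySign, polySign_polyDelbar, map_sub, map_sub]
      abel
    rw [h3, coeff_add, coeff_add, coeff_coeffMap, coeff_coeffMap, coeff_sub, coeff_coeffMap,
      coeff_coeffMap, coeff_coeffMap]
    refine Submodule.add_mem _ (Submodule.add_mem _ ?_ ?_) ?_
    · exact Submodule.mem_sup_left (hdec _ (hW.del_delbar_mem x) n)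
    · exact Submodule.mem_sup_right (Submodule.mem_sup_left (Submodule.mem_map_of_mem
        (Submodule.sub_mem _ (hsign _ (hdt 0 x n)) (hdelbar _ (hdt 2 x n)))))
    · exact Submodule.mem_sup_right (Submodule.mem_sup_right (Submodule.mem_map_of_mem
        (hsign _ (hdt 1 x n))))
  have hN : ∀ x, ∃ q ∈ A.positivePart * A.positivePart, ∃ v ∈ A.positivePart,
      ∃ w ∈ A.positivePart, Hom.fn e x = x + q + A.del v + A.delbar w := by
    intro x
    have h2 : Hom.fn e x - x ∈ N := by
      have := eval_one_sub_coeff_zero_mem (hder x)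
      rwa [γ0, γ1] at this
    obtain ⟨q, hq, y, hy, hqy⟩ := Submodule.mem_sup.1 h2
    obtain ⟨_, ⟨v, hv, rfl⟩, _, ⟨w, hw, rfl⟩, rfl⟩ := Submodule.mem_sup.1 hy
    refine ⟨q, hq, v, hv, w, hw, ?_⟩
    rw [sub_eq_iff_eq_add.1 hqy.symm]
    abel
  -- Applying ∂ to e(v) = v + q + ∂v′ + ∂̄w′ kills the third term and makes the last one
  -- decomposable. So e(∂v) and ∂v agree modulo decomposables, and the ∂-error is itself in the
  -- image of `e` up to decomposables.
  have hdel' : ∀ v ∈ A.positivePart, ∃ s, A.del v - Hom.fn e s ∈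
      A.positivePart * A.positivePart := by
    intro v _
    obtain ⟨q, hq, v', -, w', -, h2⟩ := hN v
    refine ⟨A.del v, ?_⟩
    have h3 : A.del v - Hom.fn e (A.del v) = -(A.del q + A.del (A.delbar w')) := by
      rw [Hom.fn_del, h2, map_add, map_add, map_add, A.del_del]
      abel
    rw [h3]
    exact Submodule.neg_mem _ (Submodule.add_mem _
      (A.map_mul_positivePart_le A.del_leibniz_sign hdel hq) (hW.del_delbar_mem w'))
  have hdelbar' : ∀ v ∈ A.positivePart, ∃ s, A.delbar v - Hom.fn e s ∈
      A.positivePart * A.positivePart := by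
    intro v _
    obtain ⟨q, hq, v', -, w', -, h2⟩ := hN v
    refine ⟨A.delbar v, ?_⟩
    have h3 : A.delbar v - Hom.fn e (A.delbar v) = -(A.delbar q - A.del (A.delbar v')) := by
      rw [Hom.fn_delbar, h2, map_add, map_add, map_add, A.delbar_delbar, A.delbar_del]
      abel
    rw [h3]
    exact Submodule.neg_mem _ (Submodule.sub_mem _
      (A.map_mul_positivePart_le A.delbar_leibniz_sign hdelbar hq) (hW.del_delbar_mem v'))
  have htop := hcon.eq_top_of_le_sup hg (Hom.fn e).range (by
    rintro i _ ⟨x, rfl⟩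
    exact ⟨_, Hom.fn_proj e i x⟩) (fun x hx => by
    obtain ⟨q, hq, v, hv, w, hw, h2⟩ := hN x
    obtain ⟨s, hs⟩ := hdel' v hv
    obtain ⟨t, ht⟩ := hdelbar' w hw
    refine ⟨Hom.fn e (x - s - t), ⟨_, rfl⟩, ?_⟩
    have h3 : x - Hom.fn e (x - s - t) =
        -(q + (A.del v - Hom.fn e s) + (A.delbar w - Hom.fn e t)) := by
      rw [map_sub, map_sub, h2]
      abel
    rw [h3]
    exact Submodule.neg_mem _ (Submodule.add_mem _ (Submodule.add_mem _ hq hs) ht))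
  exact AlgHom.range_eq_top _ |>.1 htop

/-- A morphism between pluripotential quasi-isomorphisms from a minimal `ℝ`-cbba to an `ℝ`-cbba with
trivial differentials is an isomorphism. -/
theorem IsMinimal.isIso_of_comp_eq {A H : RCbba.{u}} (hA : A.IsMinimal)
    {p f : A ⟶ H} (hp : PluriQuasiIso p) (hf : PluriQuasiIso f) (hH : H.del = 0)
    (hH' : H.delbar = 0) {b : A ⟶ A} (hb : b ≫ p = f) : IsIso b := by
  have hs : ∀ {p : A ⟶ H}, PluriQuasiIso p → Function.Surjective (Hom.fn p) ∧ AcyclicKer p :=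
    fun h => ⟨surjective_of_pluriQuasiIso hH hH' h,
      acyclicKer_of_pluriQuasiIso (surjective_of_pluriQuasiIso hH hH' h) h⟩
  -- The same two uses of surjectivity as for cdga's: `b` is onto, and so is a section of it.
  obtain ⟨s, hs0⟩ := hA.exists_lift f (hs hf).1 (hs hf).2 p
  have hbs : Function.Surjective (Hom.fn b) := by
    have := hA.surjective_of_comp_eq hp hH hH' (e := s ≫ b) (by rw [Category.assoc, hb, hs0])
    exact Function.Surjective.of_comp (g := Hom.fn s) this
  have hbq : PluriQuasiIso b := PluriQuasiIso.of_comp_right hp (by rwa [hb])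
  obtain ⟨s, hs0⟩ := hA.exists_lift b hbs (acyclicKer_of_pluriQuasiIso hbs hbq) (𝟙 A)
  have hss : Function.Surjective (Hom.fn s) := by
    have := hA.surjective_of_comp_eq hf hH hH' (e := b ≫ s) (by
      rw [← hb, Category.assoc, ← Category.assoc s, hs0, Category.id_comp])
    exact Function.Surjective.of_comp (g := Hom.fn b) this
  have hbsx : ∀ x, Hom.fn b (Hom.fn s x) = x := fun x => congrArg (fun c : A ⟶ A => Hom.fn c x) hs0
  refine isIso_of_bijective b ⟨fun x y hxy => ?_, hbs⟩
  obtain ⟨x, rfl⟩ := hss x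
  obtain ⟨y, rfl⟩ := hss y
  rw [hbsx, hbsx] at hxy
  rw [hxy]

end RCbba

/-! ### Formality of minimal algebras -/

namespace CDGA

variable {k : Type} [Field k]

/-- Quasi-isomorphisms from a minimal cdga lift through quasi-isomorphisms, up to equality in the
homotopy category. -/
theorem IsMinimal.exists_lift_quasiIso [CharZero k] {A X Y : CDGA.{u} k} (hA : A.IsMinimal)
    {f : X ⟶ Y} (hf : quasiIso k f) (g : A ⟶ Y) : ∃ (P : CDGA.{u} k) (s : X ⟶ P) (r : P ⟶ X)
      (f' : P ⟶ Y) (h : A ⟶ P), s ≫ r = 𝟙 X ∧ s ≫ f' = f ∧ h ≫ f' = g ∧ quasiIso k r ∧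
        quasiIso k f' := by
  obtain ⟨P, s, r, f', hsr, rfl, hr, hf'⟩ := exists_factorization f
  have hs : quasiIso k s := quasiIso.of_comp_right hr (by rw [hsr]; exact quasiIso_of_isIso _)
  have hq : quasiIso k f' := quasiIso.of_comp_left hs hf
  obtain ⟨h, hh⟩ := hA.exists_lift f' hf' (acyclicKer_of_quasiIso hf' hq) g
  exact ⟨P, s, r, f', h, hsr, rfl, hh, hr, hq⟩

/-- Admitting a quasi-isomorphism from `A` is invariant along arrows in both directions: forwards by
composition; backwards by lifting to the mapping path object of the arrow, whose map to the target
is an acyclic surjection, and projecting back to its source. -/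
theorem IsMinimal.exists_quasiIso_of_eqvGen [CharZero k] {A : CDGA.{u} k} (hA : A.IsMinimal)
    {B : CDGA.{u} k}
    (h : Relation.EqvGen (fun B C : CDGA.{u} k => ∃ f : B ⟶ C, quasiIso k f) A B) :
    ∃ f : A ⟶ B, quasiIso k f := by
  have key : ∀ X Y : CDGA.{u} k,
      Relation.EqvGen (fun B C : CDGA.{u} k => ∃ f : B ⟶ C, quasiIso k f) X Y →
        ((∃ f : A ⟶ X, quasiIso k f) ↔ ∃ f : A ⟶ Y, quasiIso k f) := by
    intro X Y hXY
    induction hXY with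
    | rel X Y hf =>
      obtain ⟨f, hf⟩ := hf
      refine ⟨fun ⟨g, hg⟩ => ⟨g ≫ f, hg.comp hf⟩, fun ⟨g, hg⟩ => ?_⟩
      obtain ⟨P, s, r, f', h, -, -, rfl, hr, hf'⟩ := hA.exists_lift_quasiIso hf g
      exact ⟨h ≫ r, (quasiIso.of_comp_right hf' hg).comp hr⟩
    | refl X => exact Iff.rfl
    | symm X Y _ ih => exact ih.symm
    | trans X Y Z _ _ ih ih' => exact ih.trans ih'
  exact (key A B h).1 ⟨𝟙 A, quasiIso_of_isIso _⟩

/-- A minimal cdga is formal if and only if it maps quasi-isomorphically to its cohomology. -/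
theorem IsMinimal.formal_iff [CharZero k] {A : CDGA.{u} k} (hA : A.IsMinimal) :
    A.Formal ↔ ∃ q : A ⟶ (H k).obj A, quasiIso k q :=
  ⟨hA.exists_quasiIso_of_eqvGen, fun h => Relation.EqvGen.rel _ _ h⟩

/-! ### Cdga's with trivial differential -/

/-- The isomorphism from a cdga with trivial differential to its cohomology. -/
def toCohomology (X : CDGA.{u} k) (hX : X.d = 0) : X ⟶ (H k).obj X where
  toAlgHom := X.cls.comp ((AlgHom.id k X.carrier).codRestrict X.cocycles fun x =>
    LinearMap.congr_fun hX x)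
  map_gr := fun {_ x} hx => ⟨⟨x, _⟩, hx, rfl⟩
  map_d := fun x => cls_eq_zero.2 ⟨x, rfl⟩

theorem isIso_toCohomology (X : CDGA.{u} k) (hX : X.d = 0) : IsIso (X.toCohomology hX) := by
  refine isIso_of_bijective _ ⟨?_, ?_⟩
  · rw [injective_iff_map_eq_zero]
    intro x hx
    obtain ⟨y, hy⟩ := cls_eq_zero.1 hx
    rw [hX] at hy
    exact hy.symm
  · intro y
    obtain ⟨x, rfl⟩ := X.cls_surjective y
    exact ⟨x, rfl⟩

theorem toCohomology_naturality {X Y : CDGA.{u} k} (hX : X.d = 0) (hY : Y.d = 0) (f : X ⟶ Y) :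
    X.toCohomology hX ≫ (H k).map f = f ≫ Y.toCohomology hY := rfl

/-- Morphisms between cdga's with trivial differential are determined by the induced maps in
cohomology. -/
theorem eq_of_H_map_eq {X Y : CDGA.{u} k} (hX : X.d = 0) (hY : Y.d = 0) {f g : X ⟶ Y}
    (h : (H k).map f = (H k).map g) : f = g := by
  have := isIso_toCohomology Y hY
  rw [← cancel_mono (Y.toCohomology hY), ← toCohomology_naturality hX, h,
    toCohomology_naturality hX hY]

/-- The map in cohomology induced by a quasi-isomorphism to a cdga with trivial differential, with
the cohomology of the target identified with the target. -/
theorem exists_iso_of_quasiIso {A X : CDGA.{u} k} (hX : X.d = 0) {f : A ⟶ X} (hf : quasiIso k f) :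
    ∃ e : (H k).obj A ≅ X, e.hom ≫ X.toCohomology hX = (H k).map f := by
  have := isIso_toCohomology X hX
  have : IsIso ((H k).map f) := isIso_of_bijective _ hf
  exact ⟨asIso ((H k).map f) ≪≫ (asIso (X.toCohomology hX)).symm, by simp⟩

/-! ### The homotopy category and extension of scalars -/

theorem HHo_map_toHo {A B : CDGA.{u} k} (f : A ⟶ B) :
    (HHo k).map ((toHo k).map f) = (H k).map f :=
  Category.id_comp ((H k).map f)

theorem isIso_toHo_map {A B : CDGA.{u} k} {f : A ⟶ B} (hf : quasiIso k f) :
    IsIso ((toHo k).map f) :=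
  Localization.inverts (toHo k) (quasiIso k) f hf

section BaseChange

variable (K : Type) [Field K] [Algebra k K]

theorem baseChange_hom_ext {X : CDGA.{u} k} {Y : CDGA.{u} K} {f g : (baseChange K).obj X ⟶ Y}
    (h : ∀ (r : K) (x : X.carrier), Hom.fn f (r ⊗ₜ[k] x : K ⊗[k] X.carrier) =
      Hom.fn g (r ⊗ₜ[k] x : K ⊗[k] X.carrier)) : f = g :=
  hom_ext fun z => TensorProduct.induction_on (R := k) (M := K) (N := X.carrier)
    (motive := fun z => Hom.fn f z = Hom.fn g z) z
    ((map_zero (Hom.fn f)).trans (map_zero (Hom.fn g)).symm) h fun x y hx hy =>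
      (map_add (Hom.fn f) x y).trans
        ((congrArg₂ (· + ·) hx hy).trans (map_add (Hom.fn g) x y).symm)

theorem cohomologyBaseChange_naturality {A B : CDGA.{u} k} (f : A ⟶ B) :
    (baseChange K).map ((H k).map f) ≫ cohomologyBaseChange K B =
      cohomologyBaseChange K A ≫ (H K).map ((baseChange K).map f) := by
  refine baseChange_hom_ext K fun r x => ?_
  obtain ⟨x, rfl⟩ := A.cls_surjective x
  exact (cohomologyBaseChangeAlgHom_tmul K B r (Hom.onCocycles f x)).trans
    (congrArg (Hom.fn ((H K).map ((baseChange K).map f)))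
      (cohomologyBaseChangeAlgHom_tmul K A r x)).symm

theorem baseChange_d {X : CDGA.{u} k} (hX : X.d = 0) : ((baseChange K).obj X).d = 0 := by
  show X.d.baseChange K = 0
  rw [hX, LinearMap.baseChange_zero]

theorem baseChange_toCohomology (X : CDGA.{u} k) (hX : X.d = 0) :
    (baseChange K).map (X.toCohomology hX) ≫ cohomologyBaseChange K X =
      ((baseChange K).obj X).toCohomology (baseChange_d K hX) :=
  baseChange_hom_ext K fun r _ => cohomologyBaseChangeAlgHom_tmul K X r _

/-- Extension of scalars preserves and reflects quasi-isomorphisms. -/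
theorem quasiIso_baseChange_iff {A B : CDGA.{u} k} (f : A ⟶ B) :
    quasiIso K ((baseChange K).map f) ↔ quasiIso k f := by
  -- Extension of scalars commutes with cohomology, which reduces the claim to faithful flatness of
  -- a field extension.
  have h : (H K).map ((baseChange K).map f) = inv (cohomologyBaseChange K A) ≫
      (baseChange K).map ((H k).map f) ≫ cohomologyBaseChange K B := by
    rw [cohomologyBaseChange_naturality, IsIso.inv_hom_id_assoc]
  have h1 : (Hom.fn ((H K).map ((baseChange K).map f)) : _ → _) =
      Hom.fn (cohomologyBaseChange K B) ∘ Hom.fn ((baseChange K).map ((H k).map f)) ∘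
        Hom.fn (inv (cohomologyBaseChange K A)) := by
    rw [h]
    rfl
  show Function.Bijective (Hom.fn ((H K).map ((baseChange K).map f)) : _ → _) ↔ _
  rw [h1, (bijective_of_isIso (cohomologyBaseChange K B)).of_comp_iff',
    Function.Bijective.of_comp_iff _ (bijective_of_isIso (inv (cohomologyBaseChange K A)))]
  exact Module.FaithfullyFlat.lTensor_bijective_iff_bijective (M := K)
    (f := (Hom.fn ((H k).map f)).toLinearMap)

end BaseChange

end CDGA

/-! ### Strong formality of minimal `ℝ`-cbba's and consequences of the ∂∂̄-property -/

namespace RCbba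

/-- Morphisms from a minimal `ℝ`-cbba lift through pluripotential quasi-isomorphisms, up to equality
in the homotopy category. -/
theorem IsMinimal.exists_lift_pluriQuasiIso {A X Y : RCbba.{u}} (hA : A.IsMinimal)
    {f : X ⟶ Y} (hf : PluriQuasiIso f) (g : A ⟶ Y) : ∃ (P : RCbba.{u}) (s : X ⟶ P) (r : P ⟶ X)
      (f' : P ⟶ Y) (h : A ⟶ P), s ≫ r = 𝟙 X ∧ s ≫ f' = f ∧ h ≫ f' = g ∧ PluriQuasiIso r ∧
        PluriQuasiIso f' := by
  obtain ⟨P, s, r, f', hsr, rfl, hr, hr', hf'⟩ := exists_factorization f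
  have hrq := pluriQuasiIso_of_acyclicKer hr hr'
  have hs : PluriQuasiIso s :=
    PluriQuasiIso.of_comp_right hrq (by rw [hsr]; exact pluriQuasiIso_id _)
  have hq : PluriQuasiIso f' := PluriQuasiIso.of_comp_left hs hf
  obtain ⟨h, hh⟩ := hA.exists_lift f' hf' (acyclicKer_of_pluriQuasiIso hf' hq) g
  exact ⟨P, s, r, f', h, hsr, rfl, hh, hrq, hq⟩

theorem IsMinimal.exists_pluriQuasiIso_of_eqvGen {A : RCbba.{u}} (hA : A.IsMinimal) {B : RCbba.{u}}
    (h : Relation.EqvGen (fun B C : RCbba.{u} => ∃ f : B ⟶ C, PluriQuasiIso f) A B) :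
    ∃ f : A ⟶ B, PluriQuasiIso f := by
  have key : ∀ X Y : RCbba.{u},
      Relation.EqvGen (fun B C : RCbba.{u} => ∃ f : B ⟶ C, PluriQuasiIso f) X Y →
        ((∃ f : A ⟶ X, PluriQuasiIso f) ↔ ∃ f : A ⟶ Y, PluriQuasiIso f) := by
    intro X Y hXY
    induction hXY with
    | rel X Y hf =>
      obtain ⟨f, hf⟩ := hf
      refine ⟨fun ⟨g, hg⟩ => ⟨g ≫ f, hg.comp hf⟩, fun ⟨g, hg⟩ => ?_⟩
      obtain ⟨P, s, r, f', h, -, -, rfl, hr, hf'⟩ := hA.exists_lift_pluriQuasiIso hf g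
      exact ⟨h ≫ r, (PluriQuasiIso.of_comp_right hf' hg).comp hr⟩
    | refl X => exact Iff.rfl
    | symm X Y _ ih => exact ih.symm
    | trans X Y Z _ _ ih ih' => exact ih.trans ih'
  exact (key A B h).1 ⟨𝟙 A, pluriQuasiIso_id _⟩

/-- The isomorphism from an `ℝ`-cbba with trivial differentials to its Bott-Chern cohomology. -/
def toBottChern (X : RCbba.{u}) (hX : X.del = 0) (hX' : X.delbar = 0) : X ⟶ HBC.obj X where
  toAlgHom := X.bcCls.comp ((AlgHom.id ℂ X.carrier).codRestrict X.bcCocycles fun x =>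
    ⟨LinearMap.congr_fun hX x, LinearMap.congr_fun hX' x⟩)
  map_gr := fun {_ x} hx => ⟨⟨x, _⟩, hx, rfl⟩
  map_del := fun x => bcCls_eq_zero.2 ⟨0, by
    rw [map_zero, map_zero]
    exact (LinearMap.congr_fun hX x).symm⟩
  map_delbar := fun x => bcCls_eq_zero.2 ⟨0, by
    rw [map_zero, map_zero]
    exact (LinearMap.congr_fun hX' x).symm⟩
  map_conj := fun _ => rfl

theorem isIso_toBottChern (X : RCbba.{u}) (hX : X.del = 0) (hX' : X.delbar = 0) :
    IsIso (X.toBottChern hX hX') := by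
  refine isIso_of_bijective _ ⟨?_, ?_⟩
  · rw [injective_iff_map_eq_zero]
    intro x hx
    obtain ⟨y, hy⟩ := bcCls_eq_zero.1 hx
    rw [hX] at hy
    exact hy.symm
  · intro y
    obtain ⟨x, rfl⟩ := X.bcCls_surjective y
    exact ⟨x, rfl⟩

theorem toBottChern_naturality {X Y : RCbba.{u}} (hX : X.del = 0) (hX' : X.delbar = 0)
    (hY : Y.del = 0) (hY' : Y.delbar = 0) (f : X ⟶ Y) :
    X.toBottChern hX hX' ≫ HBC.map f = f ≫ Y.toBottChern hY hY' := rfl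

/-- The map in Bott-Chern cohomology induced by a pluripotential quasi-isomorphism to an `ℝ`-cbba
with trivial differentials, with the cohomology of the target identified with the target. -/
theorem exists_iso_of_pluriQuasiIso {A X : RCbba.{u}} (hX : X.del = 0) (hX' : X.delbar = 0)
    {f : A ⟶ X} (hf : PluriQuasiIso f) :
    ∃ e : HBC.obj A ≅ X, e.hom ≫ X.toBottChern hX hX' = HBC.map f := by
  have := isIso_toBottChern X hX hX'
  have : IsIso (HBC.map f) := isIso_of_bijective _ hf.1
  exact ⟨asIso (HBC.map f) ≪≫ (asIso (X.toBottChern hX hX')).symm, by simp⟩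

/-- A minimal `ℝ`-cbba is strongly formal if and only if it maps to its Bott-Chern cohomology by a
pluripotential quasi-isomorphism. -/
theorem IsMinimal.stronglyFormal_iff {A : RCbba.{u}} (hA : A.IsMinimal) :
    A.StronglyFormal ↔ ∃ p : A ⟶ HBC.obj A, PluriQuasiIso p := by
  constructor
  · rintro ⟨B, hB, hB', h⟩
    obtain ⟨f, hf⟩ := hA.exists_pluriQuasiIso_of_eqvGen h
    obtain ⟨e, -⟩ := exists_iso_of_pluriQuasiIso hB hB' hf
    -- The target of `f` has zero differentials, so it can be replaced by the Bott-Chern cohomology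
    -- of `A`.
    exact ⟨f ≫ e.inv, hf.comp (pluriQuasiIso_of_isIso _)⟩
  · intro h
    exact ⟨HBC.obj A, rfl, rfl, Relation.EqvGen.rel _ _ h⟩

/-- The `∂∂̄`-property of an `ℝ`-cbba that maps to one with trivial differentials by a
pluripotential quasi-isomorphism. -/
theorem PluriQuasiIso.ddbar {A X : RCbba.{u}} (hX : X.del = 0) (hX' : X.delbar = 0)
    {f : A ⟶ X} (hf : PluriQuasiIso f) : A.DDbar := by
  refine (injective_iff_map_eq_zero A.bcToDR).2 fun x hx => ?_
  obtain ⟨⟨a, ha, ha'⟩, rfl⟩ := A.bcCls_surjective x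
  obtain ⟨b, hb⟩ := CDGA.cls_eq_zero.1 hx
  change A.carrier at b
  change A.d b = a at hb
  -- The class is d-exact and `X` has no differential, so `f` kills the representative itself and
  -- injectivity on Bott-Chern cohomology applies.
  refine bcCls_eq_zero.2 ((injective_bottChernMap_iff f).1 hf.1.1 a ha ha' ⟨0, ?_⟩)
  rw [← hb, Hom.fn_d, d_apply, hX, hX', map_zero]
  exact (add_zero (0 : X.carrier)).symm

/-- Under the `∂∂̄`-property, a morphism that acts trivially on Bott-Chern cohomology acts trivially
on de Rham cohomology. -/
theorem DDbar.H_tot_map_eq_id {A : RCbba.{u}} (h : A.DDbar) {b : A ⟶ A}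
    (hb : HBC.map b = 𝟙 (HBC.obj A)) :
    (CDGA.H ℂ).map (tot.map b) = 𝟙 ((CDGA.H ℂ).obj (tot.obj A)) := by
  refine CDGA.hom_ext fun x => ?_
  obtain ⟨⟨a, ha⟩, rfl⟩ := CDGA.cls_surjective _ x
  change A.carrier at a
  -- On a representative that is closed for both differentials, `b` changes it only by some ∂∂̄y =
  -- d(∂̄y).
  obtain ⟨c, hc, hc'⟩ := h.exists_representative ha
  have h1 : A.bcCls (Hom.onBcCocycles b ⟨_, hc, hc'⟩) = A.bcCls ⟨_, hc, hc'⟩ :=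
    congrArg (fun g : HBC.obj A ⟶ HBC.obj A => Hom.fn g (A.bcCls ⟨_, hc, hc'⟩)) hb
  obtain ⟨y, hy⟩ := bcCls_eq_bcCls.1 h1
  change A.del (A.delbar y) = Hom.fn b (a + A.d c) - (a + A.d c) at hy
  refine CDGA.cls_eq_cls.2 ⟨A.delbar y + c - Hom.fn b c, ?_⟩
  show A.d (A.delbar y + c - Hom.fn b c) = Hom.fn b a - a
  rw [map_sub, map_add, d_apply A (A.delbar y), A.delbar_delbar, hy, map_add, Hom.fn_d]
  abel

theorem DDbar.exists_realCls_eq {A : RCbba.{u}} (h : A.DDbar)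
    (x : ((CDGA.H ℝ).obj (totReal.obj A)).carrier) :
    ∃ (a : A.bcCocycles) (ha : A.conj a = a), A.realCls a ha = x := by
  obtain ⟨y, rfl⟩ := (bcToDRReal_bijective h).2 x
  exact ⟨A.realRep y, A.conj_realRep y, rfl⟩

/-- Under the `∂∂̄`-property, a morphism that acts trivially on Bott-Chern cohomology acts trivially
on real de Rham cohomology. -/
theorem DDbar.H_totReal_map_eq_id {A : RCbba.{u}} (h : A.DDbar) {b : A ⟶ A}
    (hb : HBC.map b = 𝟙 (HBC.obj A)) :
    (CDGA.H ℝ).map (totReal.map b) = 𝟙 ((CDGA.H ℝ).obj (totReal.obj A)) := by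
  refine CDGA.hom_ext fun x => ?_
  obtain ⟨a, ha, rfl⟩ := h.exists_realCls_eq x
  exact A.realCls_eq (a := Hom.onBcCocycles b a) (b := a)
    (show A.conj (Hom.fn b a) = Hom.fn b a by rw [← Hom.fn_conj, ha]) ha
    (congrArg (fun g : HBC.obj A ⟶ HBC.obj A => Hom.fn g (A.bcCls a)) hb)

/-- The map in real de Rham cohomology induced by a morphism to Bott-Chern cohomology that induces
the canonical map in Bott-Chern cohomology. -/
theorem DDbar.H_map_totReal_comp {A : RCbba.{u}} (h : A.DDbar) {p : A ⟶ HBC.obj A}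
    (hp : HBC.map p = (HBC.obj A).toBottChern rfl rfl) :
    (CDGA.H ℝ).map (totReal.map p ≫ A.bcToDRReal) =
      ((CDGA.H ℝ).obj (totReal.obj A)).toCohomology rfl := by
  refine CDGA.hom_ext fun x => ?_
  obtain ⟨a, ha, rfl⟩ := h.exists_realCls_eq x
  -- With zero differentials on the target, equality of Bott-Chern classes is equality of elements,
  -- so `p` sends a closed element to its class.
  have h1 : Hom.fn p a = A.bcCls a := by
    have h2 : (HBC.obj A).bcCls (Hom.onBcCocycles p a) = _ :=
      congrArg (fun g => Hom.fn g (A.bcCls a)) hp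
    obtain ⟨y, hy⟩ := bcCls_eq_bcCls.1 h2
    exact (sub_eq_zero.1 hy.symm)
  refine congrArg (CDGA.cls ((CDGA.H ℝ).obj (totReal.obj A))) (Subtype.ext ?_)
  refine A.bcToDRRealAlgHom_apply _ a ha ?_
  exact h1.symm

end RCbba

/-! ### Uniqueness of maps to cohomology up to automorphisms -/

namespace CDGA

/-- Two quasi-isomorphisms from a minimal cdga to a cdga with zero differential differ by
automorphisms, the one of the source being trivial in cohomology. -/
theorem IsMinimal.exists_iso_comp_eq {k : Type} [Field k] [CharZero k] {A X : CDGA.{u} k}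
    (hA : A.IsMinimal) (hX : X.d = 0) {p f : A ⟶ X} (hp : quasiIso k p) (hf : quasiIso k f) :
    ∃ (a : A ≅ A) (η : X ≅ X), a.hom ≫ p = f ≫ η.hom ∧ (H k).map a.hom = 𝟙 _ := by
  obtain ⟨ep, hep⟩ := exists_iso_of_quasiIso hX hp
  obtain ⟨ef, hef⟩ := exists_iso_of_quasiIso hX hf
  have hs := surjective_of_quasiIso hX hp
  -- The automorphism `ef.inv ≫ ep.hom` of `X` is H(f)⁻¹ followed by H(p). After it, `f` induces the
  -- same map in cohomology as `p`, so a lift of the composite through `p` is trivial in cohomology.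
  obtain ⟨a, ha⟩ := hA.exists_lift p hs (acyclicKer_of_quasiIso hs hp) (f ≫ (ef.inv ≫ ep.hom))
  have hfη : quasiIso k (f ≫ (ef.inv ≫ ep.hom)) := hf.comp (quasiIso_of_isIso _)
  have hi : IsIso a := hA.isIso_of_comp_eq hp hfη hX ha
  refine ⟨asIso a, ef.symm ≪≫ ep, ha, ?_⟩
  have : IsIso ((H k).map p) := isIso_of_bijective _ hp
  rw [← cancel_mono ((H k).map p), Category.id_comp]
  show (H k).map a ≫ _ = _
  rw [← Functor.map_comp, ha, Functor.map_comp, ← hef, Category.assoc,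
    toCohomology_naturality hX hX, Category.assoc, Iso.hom_inv_id_assoc, hep]

end CDGA

namespace RCbba

/-- Two pluripotential quasi-isomorphisms from a minimal `ℝ`-cbba to an `ℝ`-cbba with zero
differentials differ by automorphisms, the one of the source being trivial in Bott-Chern
cohomology. -/
theorem IsMinimal.exists_iso_comp_eq {A X : RCbba.{u}} (hA : A.IsMinimal) (hX : X.del = 0)
    (hX' : X.delbar = 0) {p f : A ⟶ X} (hp : PluriQuasiIso p) (hf : PluriQuasiIso f) :
    ∃ (b : A ≅ A) (θ : X ≅ X), b.hom ≫ p = f ≫ θ.hom ∧ HBC.map b.hom = 𝟙 _ := by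
  obtain ⟨ep, hep⟩ := exists_iso_of_pluriQuasiIso hX hX' hp
  obtain ⟨ef, hef⟩ := exists_iso_of_pluriQuasiIso hX hX' hf
  have hs := surjective_of_pluriQuasiIso hX hX' hp
  -- The automorphism of `X` is chosen so that `f` followed by it agrees with `p` in Bott-Chern
  -- cohomology.
  obtain ⟨b, hb⟩ := hA.exists_lift p hs (acyclicKer_of_pluriQuasiIso hs hp)
    (f ≫ (ef.inv ≫ ep.hom))
  have hfθ : PluriQuasiIso (f ≫ (ef.inv ≫ ep.hom)) := hf.comp (pluriQuasiIso_of_isIso _)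
  have hi : IsIso b := hA.isIso_of_comp_eq hp hfθ hX hX' hb
  refine ⟨asIso b, ef.symm ≪≫ ep, hb, ?_⟩
  have := isIso_toBottChern X hX hX'
  have : IsIso (HBC.map p) := by
    rw [← hep]
    infer_instance
  rw [← cancel_mono (HBC.map p), Category.id_comp]
  show HBC.map b ≫ _ = _
  rw [← Functor.map_comp, hb, Functor.map_comp, ← hef, Category.assoc,
    toBottChern_naturality hX hX' hX hX', Category.assoc, Iso.hom_inv_id_assoc, hep]

end RCbba

/-! ### Morphisms of triples to their cohomology and the homotopy-commutative square -/

namespace RatCbba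

theorem H_map_φ {A B : RatCbba.{u}} (f : Hom A B) :
    A.Hφ ≫ (CDGA.H ℝ).map (RCbba.totReal.map f.fC) =
      (CDGA.H ℝ).map ((CDGA.baseChange ℝ).map f.fQ) ≫ B.Hφ := by
  have h := congrArg (fun g => (CDGA.HHo ℝ).map g) f.comm
  simp only [Functor.map_comp] at h
  rw [CDGA.HHo_map_toHo, CDGA.HHo_map_toHo] at h
  exact h

/-- A pluripotential quasi-isomorphism is a quasi-isomorphism on real total cdga's. Compatibility
with the isomorphisms φ carries this over to `f.fQ` tensored with ℝ, and extension of scalars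
reflects quasi-isomorphisms. -/
theorem Hom.IsQuasiIso.quasiIso {A B : RatCbba.{u}} {f : Hom A B} (hf : f.IsQuasiIso) :
    CDGA.quasiIso ℚ f.fQ := by
  rw [← CDGA.quasiIso_baseChange_iff ℝ]
  have h1 : IsIso ((CDGA.H ℝ).map (RCbba.totReal.map f.fC)) :=
    CDGA.isIso_of_bijective _ (RCbba.PluriQuasiIso.totReal hf)
  have h2 : IsIso ((CDGA.H ℝ).map ((CDGA.baseChange ℝ).map f.fQ) ≫ B.Hφ) := by
    rw [← H_map_φ]
    infer_instance
  have h3 := IsIso.of_isIso_comp_right ((CDGA.H ℝ).map ((CDGA.baseChange ℝ).map f.fQ)) B.Hφ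
  exact CDGA.bijective_of_isIso _

/-- Quasi-isomorphisms from a minimal cbba with rational structure propagate along chains. -/
theorem IsMinimal.exists_quasiIso_of_eqvGen {A : RatCbba.{u}} (hA : A.IsMinimal) {B : RatCbba.{u}}
    (h : Relation.EqvGen (fun B C : RatCbba.{u} => ∃ f : Hom B C, f.IsQuasiIso) A B) :
    ∃ f : Hom A B, f.IsQuasiIso := by
  have key : ∀ X Y : RatCbba.{u},
      Relation.EqvGen (fun B C : RatCbba.{u} => ∃ f : Hom B C, f.IsQuasiIso) X Y →
        ((∃ f : Hom A X, f.IsQuasiIso) ↔ ∃ f : Hom A Y, f.IsQuasiIso) := by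
    intro X Y hXY
    induction hXY with
    | rel X Y hf =>
      obtain ⟨f, hf⟩ := hf
      constructor
      · rintro ⟨g, hg⟩
        refine ⟨⟨g.fQ ≫ f.fQ, g.fC ≫ f.fC, ?_⟩, RCbba.PluriQuasiIso.comp hg hf⟩
        simp only [Functor.map_comp, Category.assoc]
        rw [← f.comm, reassoc_of% g.comm]
      · rintro ⟨g, hg⟩
        -- The two components are lifted independently through their own factorizations; the
        -- remaining work is the compatibility of the lifts with φ.
        obtain ⟨P, s, r, f', h, hsr, hsf, hhg, hr, hf'⟩ :=
          hA.2.exists_lift_pluriQuasiIso (f := f.fC) hf g.fC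
        obtain ⟨P', s', r', f'', h', hsr', hsf', hhg', hr', hf''⟩ :=
          hA.1.exists_lift_quasiIso hf.quasiIso g.fQ
        -- In general `r` followed by `f` is not equal to `f'`. In the homotopy category it is,
        -- since the section `s` becomes the inverse of `r` there.
        have e1 : (CDGA.toHo ℝ).map (RCbba.totReal.map r) ≫
            (CDGA.toHo ℝ).map (RCbba.totReal.map f.fC) =
              (CDGA.toHo ℝ).map (RCbba.totReal.map f') := by
          have i1 := CDGA.isIso_toHo_map hr.totReal
          have e : inv ((CDGA.toHo ℝ).map (RCbba.totReal.map r)) =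
              (CDGA.toHo ℝ).map (RCbba.totReal.map s) := by
            refine IsIso.inv_eq_of_inv_hom_id ?_
            rw [← Functor.map_comp, ← Functor.map_comp, hsr, CategoryTheory.Functor.map_id,
              CategoryTheory.Functor.map_id]
          rw [← hsf, Functor.map_comp, Functor.map_comp, ← e, IsIso.hom_inv_id_assoc]
        have e2 : (CDGA.toHo ℝ).map ((CDGA.baseChange ℝ).map r') ≫
            (CDGA.toHo ℝ).map ((CDGA.baseChange ℝ).map f.fQ) =
              (CDGA.toHo ℝ).map ((CDGA.baseChange ℝ).map f'') := by
          have i1 := CDGA.isIso_toHo_map ((CDGA.quasiIso_baseChange_iff ℝ r').2 hr')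
          have e : inv ((CDGA.toHo ℝ).map ((CDGA.baseChange ℝ).map r')) =
              (CDGA.toHo ℝ).map ((CDGA.baseChange ℝ).map s') := by
            refine IsIso.inv_eq_of_inv_hom_id ?_
            rw [← Functor.map_comp, ← Functor.map_comp, hsr', CategoryTheory.Functor.map_id,
              CategoryTheory.Functor.map_id]
          rw [← hsf', Functor.map_comp, Functor.map_comp, ← e, IsIso.hom_inv_id_assoc]
        refine ⟨⟨h' ≫ r', h ≫ r, ?_⟩,
          (RCbba.PluriQuasiIso.of_comp_right hf' (by rw [hhg]; exact hg)).comp hr⟩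
        -- The real total map of `f` is invertible in the homotopy category, so the compatibility
        -- may be checked after composing with it, where it becomes that of `g`.
        have i2 := CDGA.isIso_toHo_map (RCbba.PluriQuasiIso.totReal hf)
        rw [← cancel_mono ((CDGA.toHo ℝ).map (RCbba.totReal.map f.fC))]
        simp only [Functor.map_comp, Category.assoc]
        rw [e1, f.comm, reassoc_of% e2, ← Functor.map_comp, ← Functor.map_comp, hhg, g.comm,
          ← hhg']
        simp only [Functor.map_comp, Category.assoc]
    | refl X => exact Iff.rfl
    | symm X Y _ ih => exact ih.symm
    | trans X Y Z _ _ ih ih' => exact ih.trans ih'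
  refine (key A B h).1 ⟨⟨𝟙 _, 𝟙 _, ?_⟩, RCbba.pluriQuasiIso_id _⟩
  simp only [CategoryTheory.Functor.map_id, Category.comp_id, Category.id_comp]

theorem H_map_cohomologyφ (A : RatCbba.{u}) :
    ((CDGA.baseChange ℝ).obj ((CDGA.H ℚ).obj A.Q)).toCohomology (CDGA.baseChange_d ℝ rfl) ≫
      (CDGA.H ℝ).map A.cohomologyφ =
    A.cohomologyφ ≫ ((CDGA.H ℝ).obj (RCbba.totReal.obj A.C)).toCohomology rfl := rfl

/-- Morphisms to cohomology that induce the canonical maps in cohomology are compatible. -/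
theorem compatible_of_canonical {A : RatCbba.{u}} (hA : A.C.DDbar) {p : A.C ⟶ RCbba.HBC.obj A.C}
    {q : A.Q ⟶ (CDGA.H ℚ).obj A.Q} (hp : RCbba.HBC.map p = (RCbba.HBC.obj A.C).toBottChern rfl rfl)
    (hq : (CDGA.H ℚ).map q = ((CDGA.H ℚ).obj A.Q).toCohomology rfl) : A.Compatible p q := by
  unfold Compatible realMap
  -- After precomposition with the isomorphism from ℝ ⊗ H(A_ℚ) to H(A_ℚ ⊗ ℝ), both sides are H(φ)
  -- followed by the identification of an algebra with zero differential with its own cohomology.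
  rw [hA.H_map_totReal_comp hp, ← cancel_epi (CDGA.cohomologyBaseChange ℝ A.Q),
    ← Category.assoc, ← CDGA.cohomologyBaseChange_naturality, hq,
    CDGA.baseChange_toCohomology ℝ _ rfl, H_map_cohomologyφ]
  rfl

/-- A triangle form of the square in `SquareCommutes`. -/
theorem comm_of_squareCommutes {A : RatCbba.{u}} [IsIso A.C.bcToDRReal]
    {p : A.C ⟶ RCbba.HBC.obj A.C} {q : A.Q ⟶ (CDGA.H ℚ).obj A.Q}
    {a : A.Q ≅ A.Q} {b : A.C ⟶ A.C} (h : A.SquareCommutes p q a.hom b) :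
    A.φ.hom ≫ (CDGA.toHo.{u} ℝ).map (RCbba.totReal.map (b ≫ p)) =
      (CDGA.toHo.{u} ℝ).map ((CDGA.baseChange ℝ).map (a.inv ≫ q)) ≫
        (CDGA.toHo.{u} ℝ).map (A.cohomologyφ ≫ inv A.C.bcToDRReal) := by
  have h1 : (CDGA.toHo.{u} ℝ).map ((CDGA.baseChange ℝ).map a.inv) ≫
      (CDGA.toHo.{u} ℝ).map ((CDGA.baseChange ℝ).map a.hom) = 𝟙 _ := by
    rw [← Functor.map_comp, ← Functor.map_comp, Iso.inv_hom_id, CategoryTheory.Functor.map_id,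
      CategoryTheory.Functor.map_id]
  unfold SquareCommutes realMap at h
  rw [← cancel_mono ((CDGA.toHo.{u} ℝ).map A.C.bcToDRReal)]
  rw [Functor.map_comp (RCbba.totReal), Functor.map_comp (CDGA.baseChange ℝ),
    Functor.map_comp (CDGA.toHo.{u} ℝ), Functor.map_comp (CDGA.toHo.{u} ℝ)]
  rw [Category.assoc, Category.assoc, Category.assoc, Category.assoc,
    ← Functor.map_comp (CDGA.toHo.{u} ℝ) (A.cohomologyφ ≫ inv A.C.bcToDRReal),
    Category.assoc, IsIso.inv_hom_id, Category.comp_id, ← h,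
    Functor.map_comp (CDGA.toHo.{u} ℝ) _ A.C.bcToDRReal]
  rw [Category.assoc, Category.assoc, reassoc_of% h1]

/-- The commuting square says exactly that q after a⁻¹ and p after b form a morphism of triples to
the cohomology. It is a quasi-isomorphism because `p` is one and `b` is invertible. -/
theorem stronglyFormalOverQ_of_squareCommutes {A : RatCbba.{u}} (hA : A.C.DDbar)
    {p : A.C ⟶ RCbba.HBC.obj A.C} {q : A.Q ⟶ (CDGA.H ℚ).obj A.Q} (hp : RCbba.PluriQuasiIso p)
    {a : A.Q ≅ A.Q} {b : A.C ≅ A.C} (h : A.SquareCommutes p q a.hom b.hom) :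
    A.StronglyFormalOverQ := by
  have := RCbba.isIso_bcToDRReal hA
  exact ⟨hA, Relation.EqvGen.rel _ _
    ⟨⟨(a.inv ≫ q : A.Q ⟶ (CDGA.H ℚ).obj A.Q), (b.hom ≫ p : A.C ⟶ RCbba.HBC.obj A.C),
      comm_of_squareCommutes h⟩, (RCbba.pluriQuasiIso_of_isIso b.hom).comp hp⟩⟩

/-- A morphism to cohomology, expressed through the map `H(φ)`. -/
theorem comm_cohomology {A : RatCbba.{u}} {hA : A.C.DDbar} (f : Hom A (A.cohomology hA))
    {g : A.Q ⟶ (CDGA.H ℚ).obj A.Q} {p : A.C ⟶ RCbba.HBC.obj A.C} (hg : f.fQ = g) (hp : f.fC = p) :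
    A.φ.hom ≫ (CDGA.toHo.{u} ℝ).map (A.realMap p) =
      (CDGA.toHo.{u} ℝ).map ((CDGA.baseChange ℝ).map g) ≫
        (CDGA.toHo.{u} ℝ).map A.cohomologyφ := by
  have := RCbba.isIso_bcToDRReal hA
  have h : A.φ.hom ≫ (CDGA.toHo.{u} ℝ).map (RCbba.totReal.map p) =
    (CDGA.toHo.{u} ℝ).map ((CDGA.baseChange ℝ).map g) ≫
      (CDGA.toHo.{u} ℝ).map (A.cohomologyφ ≫ inv A.C.bcToDRReal) := by
    subst hg hp
    exact f.comm
  unfold realMap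
  rw [Functor.map_comp (CDGA.toHo.{u} ℝ) _ A.C.bcToDRReal, ← Category.assoc, h, Category.assoc,
    ← Functor.map_comp (CDGA.toHo.{u} ℝ) (A.cohomologyφ ≫ inv A.C.bcToDRReal), Category.assoc,
    IsIso.inv_hom_id, Category.comp_id]

theorem realMap_comp (A : RatCbba.{u}) [IsIso A.C.bcToDRReal] (f : A.C ⟶ RCbba.HBC.obj A.C)
    (θ : RCbba.HBC.obj A.C ⟶ RCbba.HBC.obj A.C) :
    A.realMap (f ≫ θ) =
      A.realMap f ≫ inv A.C.bcToDRReal ≫ RCbba.totReal.map θ ≫ A.C.bcToDRReal := by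
  unfold realMap
  rw [Functor.map_comp, Category.assoc, Category.assoc, IsIso.hom_inv_id_assoc]

theorem totReal_comp_realMap (A : RatCbba.{u}) (b : A.C ⟶ A.C) (p : A.C ⟶ RCbba.HBC.obj A.C) :
    RCbba.totReal.map b ≫ A.realMap p = A.realMap (b ≫ p) := by
  unfold realMap
  rw [Functor.map_comp, Category.assoc]

/-- The given morphism `f` has a commuting square. Passing from it to p and q costs automorphisms of
the minimal algebras, which become a and b, and automorphisms of the two cohomology algebras, which
correspond under H(φ) because p and q are compatible. -/
theorem exists_squareCommutes {A : RatCbba.{u}} (hA : A.IsMinimal) (hD : A.C.DDbar)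
    (f : Hom A (A.cohomology hD)) (hf : f.IsQuasiIso) {p : A.C ⟶ RCbba.HBC.obj A.C}
    {q : A.Q ⟶ (CDGA.H ℚ).obj A.Q} (hp : RCbba.PluriQuasiIso p) (hq : CDGA.quasiIso ℚ q)
    (h : A.Compatible p q) :
    ∃ (a : A.Q ≅ A.Q) (b : A.C ≅ A.C), (CDGA.H ℚ).map a.hom = 𝟙 ((CDGA.H ℚ).obj A.Q) ∧
      (CDGA.H ℂ).map (RCbba.tot.map b.hom) = 𝟙 ((CDGA.H ℂ).obj (RCbba.tot.obj A.C)) ∧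
      A.SquareCommutes p q a.hom b.hom := by
  have := RCbba.isIso_bcToDRReal hD
  obtain ⟨g, hg⟩ : ∃ g : A.Q ⟶ (CDGA.H ℚ).obj A.Q, f.fQ = g := ⟨_, rfl⟩
  obtain ⟨r, hr⟩ : ∃ r : A.C ⟶ RCbba.HBC.obj A.C, f.fC = r := ⟨_, rfl⟩
  have hgq : CDGA.quasiIso ℚ g := hg ▸ hf.quasiIso
  have hrq : RCbba.PluriQuasiIso r := hr ▸ hf
  have hc := comm_cohomology f hg hr
  obtain ⟨b, θ, hb, hb1⟩ := hA.2.exists_iso_comp_eq rfl rfl hp hrq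
  obtain ⟨a, η, ha, ha1⟩ := hA.1.exists_iso_comp_eq rfl hq hgq
  -- The automorphism θ of Bott-Chern cohomology, transported to real de Rham cohomology.
  obtain ⟨T, hT⟩ : ∃ T, T = inv A.C.bcToDRReal ≫ RCbba.totReal.map θ.hom ≫ A.C.bcToDRReal :=
    ⟨_, rfl⟩
  have hT' : RCbba.totReal.map b.hom ≫ A.realMap p = A.realMap r ≫ T := by
    rw [totReal_comp_realMap, hb, realMap_comp, hT]
  have hcH : A.Hφ ≫ (CDGA.H ℝ).map (A.realMap r) =
      (CDGA.H ℝ).map ((CDGA.baseChange ℝ).map g) ≫ (CDGA.H ℝ).map A.cohomologyφ := by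
    have h1 := congrArg (fun z => (CDGA.HHo ℝ).map z) hc
    simp only [Functor.map_comp] at h1
    rw [CDGA.HHo_map_toHo, CDGA.HHo_map_toHo, CDGA.HHo_map_toHo] at h1
    exact h1
  have hab : (CDGA.H ℝ).map ((CDGA.baseChange ℝ).map a.hom) = 𝟙 _ := by
    rw [← cancel_epi (CDGA.cohomologyBaseChange ℝ A.Q), ← CDGA.cohomologyBaseChange_naturality,
      ha1, CategoryTheory.Functor.map_id, Category.id_comp, Category.comp_id]
  -- Both sides are maps between cdga's with zero differential, so it suffices to compare them in
  -- cohomology, and there after the isomorphism induced by `g`. As `a` and `b` act trivially in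
  -- cohomology, the comparison becomes the compatibility of p and q.
  have hη : (CDGA.baseChange ℝ).map η.hom ≫ A.cohomologyφ = A.cohomologyφ ≫ T := by
    refine CDGA.eq_of_H_map_eq (CDGA.baseChange_d ℝ rfl) rfl ?_
    have : IsIso ((CDGA.H ℝ).map ((CDGA.baseChange ℝ).map g)) :=
      CDGA.isIso_of_bijective _ ((CDGA.quasiIso_baseChange_iff ℝ g).2 hgq)
    have hqη : (CDGA.H ℝ).map ((CDGA.baseChange ℝ).map g) ≫
        (CDGA.H ℝ).map ((CDGA.baseChange ℝ).map η.hom) =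
          (CDGA.H ℝ).map ((CDGA.baseChange ℝ).map q) := by
      rw [← Functor.map_comp, ← Functor.map_comp, ← ha, Functor.map_comp, Functor.map_comp, hab,
        Category.id_comp]
    rw [← cancel_epi ((CDGA.H ℝ).map ((CDGA.baseChange ℝ).map g)), Functor.map_comp,
      Functor.map_comp (CDGA.H ℝ) A.cohomologyφ, reassoc_of% hqη, ← Category.assoc, ← hcH, h,
      Category.assoc, ← Functor.map_comp, ← hT', Functor.map_comp, hD.H_totReal_map_eq_id hb1,
      Category.id_comp]
  have hai : (CDGA.toHo.{u} ℝ).map ((CDGA.baseChange ℝ).map a.inv) ≫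
      (CDGA.toHo.{u} ℝ).map ((CDGA.baseChange ℝ).map a.hom) = 𝟙 _ := by
    rw [← Functor.map_comp, ← Functor.map_comp, Iso.inv_hom_id, CategoryTheory.Functor.map_id,
      CategoryTheory.Functor.map_id]
  -- The automorphism `a` satisfies q ∘ a = η ∘ g, whereas the square needs q expressed through g,
  -- hence the inverse.
  refine ⟨a.symm, b, ?_, hD.H_tot_map_eq_id hb1, ?_⟩
  · show (CDGA.H ℚ).map a.inv = _
    rw [← cancel_epi ((CDGA.H ℚ).map a.hom), ← Functor.map_comp, Iso.hom_inv_id, ha1,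
      CategoryTheory.Functor.map_id, Category.comp_id]
  · show ((CDGA.toHo.{u} ℝ).map ((CDGA.baseChange ℝ).map a.inv) ≫ A.φ.hom ≫
      (CDGA.toHo.{u} ℝ).map (RCbba.totReal.map b.hom)) ≫ (CDGA.toHo.{u} ℝ).map (A.realMap p) =
      (CDGA.toHo.{u} ℝ).map ((CDGA.baseChange ℝ).map q) ≫ (CDGA.toHo.{u} ℝ).map A.cohomologyφ
    rw [Category.assoc, Category.assoc, ← Functor.map_comp (CDGA.toHo.{u} ℝ) _ (A.realMap p), hT',
      Functor.map_comp (CDGA.toHo.{u} ℝ) (A.realMap r), reassoc_of% hc,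
      ← Functor.map_comp (CDGA.toHo.{u} ℝ) A.cohomologyφ, ← hη,
      Functor.map_comp (CDGA.toHo.{u} ℝ) _ A.cohomologyφ,
      ← Functor.map_comp_assoc (CDGA.toHo.{u} ℝ) ((CDGA.baseChange ℝ).map g),
      ← Functor.map_comp (CDGA.baseChange ℝ), ← ha, Functor.map_comp (CDGA.baseChange ℝ),
      Functor.map_comp (CDGA.toHo.{u} ℝ), Category.assoc, reassoc_of% hai]

/-- If `A_ℂ` is strongly formal and `A_ℚ` is formal, there are compatible maps to cohomology. -/
theorem exists_compatible {A : RatCbba.{u}} (hA : A.IsMinimal) (hC : A.C.StronglyFormal)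
    (hQ : A.Q.Formal) : A.C.DDbar ∧ ∃ (p : A.C ⟶ RCbba.HBC.obj A.C)
      (q : A.Q ⟶ (CDGA.H ℚ).obj A.Q),
      RCbba.PluriQuasiIso p ∧ CDGA.quasiIso ℚ q ∧ A.Compatible p q := by
  obtain ⟨p, hp⟩ := hA.2.stronglyFormal_iff.1 hC
  obtain ⟨q, hq⟩ := hA.1.formal_iff.1 hQ
  have hD : A.C.DDbar := RCbba.PluriQuasiIso.ddbar rfl rfl hp
  obtain ⟨e, he⟩ := RCbba.exists_iso_of_pluriQuasiIso rfl rfl hp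
  obtain ⟨e', he'⟩ := CDGA.exists_iso_of_quasiIso rfl hq
  -- Dividing p and q by the maps they induce in cohomology normalizes both to the canonical ones,
  -- which are compatible.
  refine ⟨hD, p ≫ e.inv, q ≫ e'.inv, hp.comp (RCbba.pluriQuasiIso_of_isIso _),
    hq.comp (CDGA.quasiIso_of_isIso _), compatible_of_canonical hD ?_ ?_⟩
  · rw [Functor.map_comp, ← he, Category.assoc, RCbba.toBottChern_naturality rfl rfl rfl rfl,
      Iso.hom_inv_id_assoc]
  · rw [Functor.map_comp, ← he', Category.assoc, CDGA.toCohomology_naturality rfl rfl,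
      Iso.hom_inv_id_assoc]

end RatCbba

theorem mainTheorem6 (A : RatCbba.{u}) (hA : A.IsMinimal) :
    (A.C.StronglyFormal ↔ ∃ p : A.C ⟶ RCbba.HBC.obj A.C, RCbba.PluriQuasiIso p) ∧
    (A.Q.Formal ↔ ∃ q : A.Q ⟶ (CDGA.H ℚ).obj A.Q, CDGA.quasiIso ℚ q) ∧
    (A.StronglyFormalOverQ ↔
      A.C.StronglyFormal ∧ A.Q.Formal ∧
        ∀ (p : A.C ⟶ RCbba.HBC.obj A.C) (q : A.Q ⟶ (CDGA.H ℚ).obj A.Q),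
          RCbba.PluriQuasiIso p → CDGA.quasiIso ℚ q → A.Compatible p q →
            ∃ (a : A.Q ≅ A.Q) (b : A.C ≅ A.C),
              (CDGA.H ℚ).map a.hom = 𝟙 ((CDGA.H ℚ).obj A.Q) ∧
              (CDGA.H ℂ).map (RCbba.tot.map b.hom) = 𝟙 ((CDGA.H ℂ).obj (RCbba.tot.obj A.C)) ∧
              A.SquareCommutes p q a.hom b.hom) := by
  refine ⟨hA.2.stronglyFormal_iff, hA.1.formal_iff, ?_, ?_⟩
  · rintro ⟨hD, hchain⟩
    obtain ⟨f, hf⟩ := hA.exists_quasiIso_of_eqvGen hchain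
    exact ⟨hA.2.stronglyFormal_iff.2 ⟨f.fC, hf⟩, hA.1.formal_iff.2 ⟨f.fQ, hf.quasiIso⟩,
      fun p q hp hq h => RatCbba.exists_squareCommutes hA hD f hf hp hq h⟩
  · rintro ⟨hC, hQ, h⟩
    -- Condition 3 is applied to one compatible pair, and this already yields a one-step chain from
    -- A to its cohomology.
    obtain ⟨hD, p, q, hp, hq, hpq⟩ := RatCbba.exists_compatible hA hC hQ
    obtain ⟨a, b, -, -, hs⟩ := h p q hp hq hpq
    exact RatCbba.stronglyFormalOverQ_of_squareCommutes hD hp hs
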